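/- Let $R$ be a discrete valuation ring with fraction field $K$, residue field $k$ and uniformizer $\pi$. A model over $R$ of a proper $K$-scheme is a proper flat $R$-scheme whose generic fibre is isomorphic to it. An $R$-scheme $\mathcal V$ is called strictly semistable if (a) for every closed point $P$ of $\mathcal V$ lying on the special fibre $\mathcal V_k$, the formal completion of $\mathcal V$ at $P$ admits a finite étale $R$-morphism to $\operatorname{Spf} R[[x_1,\dots,x_n]]/(\prod_{i=1}^{r}x_i-\pi)$ for some $1\le r\le n$, and (b) every irreducible component of $\mathcal V_k$, with its reduced structure, is smooth over $k$. Let $C$ be a smooth proper curve and $S$ a smooth proper surface over $K$ (smooth of relative dimension $1$ and $2$), with strictly semistable models $\mathcal C$ and $\mathcal S$ over $R$. Put $\mathcal X_1=\mathcal C\times_R\mathcal S$, and list the irreducible components of its special fibre, each once and in any order, as $C_1^1,\dots,C_1^t$. For $i=1,\dots,t-1$ let $\mathcal X_{i+1}$ be the blow-up of $\mathcal X_i$ along $C_i^i$ (with its reduced structure), and for $j>i$ let $C_{i+1}^j\subset\mathcal X_{i+1}$ be the strict transform of $C_i^j$, that is, the closure of the preimage of $C_i^j\setminus C_i^i$.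 Then $\mathcal X_t$ is a model over $R$ of $X=C\times_K S$, and it is strictly semistable. -/

import Mathlib

universe u

open CategoryTheory CategoryTheory.Limits TopologicalSpace AlgebraicGeometry

namespace SemistableProduct

section Blowup

/-- An ideal sheaf is invertible if it is locally generated by one non-zero-divisor
(that is, if it is the ideal sheaf of an effective Cartier divisor). -/
def IsInvertibleIdeal {X : Scheme.{u}} (I : X.IdealSheafData) : Prop :=
  ∀ x : X, ∃ U : X.affineOpens, x ∈ U.1 ∧
    ∃ a : Γ(X, U.1), a ∈ nonZeroDivisors Γ(X, U.1) ∧ I.ideal U = Ideal.span {a}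

/-- `b : X' ⟶ X` is the blow-up of `X` along the ideal sheaf `I`: the inverse image ideal sheaf
`I · 𝒪_{X'}` is invertible, and `b` is universal for this property. -/
structure IsBlowup {X' X : Scheme.{u}} (b : X' ⟶ X) (I : X.IdealSheafData) : Prop where
  isInvertible_comap : IsInvertibleIdeal (I.comap b)
  existsUnique_lift : ∀ {T : Scheme.{u}} (g : T ⟶ X), IsInvertibleIdeal (I.comap g) →
    ∃! h : T ⟶ X', h ≫ b = g

/-- The blow-up of `X` along a closed subset `W` with its reduced scheme structure. -/
def IsBlowupAlong {X' X : Scheme.{u}} (b : X' ⟶ X) (W : Closeds X) : Prop :=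
  IsBlowup b (Scheme.IdealSheafData.vanishingIdeal W)

/-- The strict transform of a closed subset `Z` of `X` under a blow-up `b : X' ⟶ X` with
centre `W`: the closure in `X'` of the preimage of `Z ∖ W`. -/
def strictTransform {X' X : Scheme.{u}} (b : X' ⟶ X) (W Z : Closeds X) : Closeds X' :=
  Closeds.closure (b ⁻¹' ((Z : Set X) \ (W : Set X)))

/-- A successive blow-up along `t` closed subsets. Indices start at `0`: `X i` is the scheme
`𝒳_{i+1}`, and `comp i j` is the closed subset `C_{i+1}^{j+1}` of it. For `i + 1 < t` the scheme
`X (i + 1)` is the blow-up of `X i` along `comp i i`, and for `j > i` the subset `comp (i + 1) j` is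
the strict transform of `comp i j`. Hence `X (t - 1)` is the scheme `𝒳_t`. The values `X i` with
`i ≥ t`, and the subsets `comp i j` with `j < i`, play no role and are not constrained. -/
structure BlowupSequence (t : ℕ) where
  X : ℕ → Scheme.{u}
  comp : ∀ i, Fin t → Closeds (X i)
  b : ∀ i, X (i + 1) ⟶ X i
  isBlowupAlong : ∀ (i : ℕ) (hi : i + 1 < t),
    IsBlowupAlong (b i) (comp i ⟨i, Nat.lt_of_succ_lt hi⟩)
  comp_succ : ∀ (i : ℕ) (hi : i + 1 < t) (j : Fin t), i < (j : ℕ) →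
    comp (i + 1) j = strictTransform (b i) (comp i ⟨i, Nat.lt_of_succ_lt hi⟩) (comp i j)

/-- The composite `X i ⟶ X (i - 1) ⟶ ⋯ ⟶ X 0` of the blow-ups. -/
noncomputable def BlowupSequence.toBottom {t : ℕ} (T : BlowupSequence.{u} t) :
    ∀ i, T.X i ⟶ T.X 0
  | 0 => 𝟙 _
  | i + 1 => T.b i ≫ T.toBottom i

end Blowup

section Semistable

variable {R : Type u} [CommRing R]

/-- The structure map `R → 𝒪_{V,P}` of an `R`-scheme `V`. -/
noncomputable def toStalk {V : Scheme.{u}} (f : V ⟶ Spec (.of R)) (P : V) :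
    R →+* V.presheaf.stalk P :=
  ((Scheme.ΓSpecIso (.of R)).inv ≫ f.appTop ≫ V.presheaf.germ ⊤ P trivial).hom

/-- The ring `R[[x₁, …, xₙ]] / (x₁ ⋯ x_t - ϖ)`, for `t ≤ n`. -/
abbrev StdRing (ϖ : R) (n t : ℕ) : Type u :=
  MvPowerSeries (Fin n) R ⧸ Ideal.span
    {(∏ i ∈ Finset.univ.filter (fun i : Fin n ↦ (i : ℕ) < t), MvPowerSeries.X (R := R) i) -
      MvPowerSeries.C (σ := Fin n) ϖ}

/-- The completion of the local ring of `V` at `P`. -/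
abbrev CompletedStalk {V : Scheme.{u}} (P : V) : Type u :=
  AdicCompletion (IsLocalRing.maximalIdeal (V.presheaf.stalk P)) (V.presheaf.stalk P)

/-- The formal completion of the `R`-scheme `V` at `P` admits a finite étale `R`-morphism to
`Spf R[[x₁, …, xₙ]] / (x₁ ⋯ x_t - ϖ)` for some `1 ≤ t ≤ n`. -/
def IsSemistableAt (ϖ : R) {V : Scheme.{u}} (f : V ⟶ Spec (.of R)) (P : V) : Prop :=
  ∃ (n t : ℕ) (φ : StdRing ϖ n t →+* CompletedStalk P),
    1 ≤ t ∧ t ≤ n ∧ φ.Finite ∧ φ.Etale ∧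
    ∀ r : R, φ (Ideal.Quotient.mk _ (MvPowerSeries.C r)) =
      algebraMap (V.presheaf.stalk P) (CompletedStalk P) (toStalk f P r)

variable [IsLocalRing R]

/-- The underlying closed subset of the special fibre of an `R`-scheme. -/
def specialFiber {V : Scheme.{u}} (f : V ⟶ Spec (.of R)) : Set V :=
  f ⁻¹' {IsLocalRing.closedPoint R}

/-- The irreducible components of the special fibre, as closed subsets of `V`. -/
def specialComponents {V : Scheme.{u}} (f : V ⟶ Spec (.of R)) : Set (Closeds V) :=
  {Z | Maximal (fun s : Set V ↦ IsIrreducible s ∧ s ⊆ specialFiber f) (Z : Set V)}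

/-- The closed subset `Z` of the special fibre, with its reduced scheme structure, is smooth over
the residue field of `R`. -/
def IsSmoothOverResidueField {V : Scheme.{u}} (f : V ⟶ Spec (.of R)) (Z : Closeds V) : Prop :=
  ∃ g : (Scheme.IdealSheafData.vanishingIdeal Z).subscheme ⟶
      Spec (.of (IsLocalRing.ResidueField R)),
    g ≫ Spec.map (CommRingCat.ofHom (IsLocalRing.residue R)) =
      (Scheme.IdealSheafData.vanishingIdeal Z).subschemeι ≫ f ∧ Smooth g

/-- `V` is strictly semistable over `R`: it is semistable at every closed point of its special
fibre, and every irreducible component of the special fibre is smooth over the residue field. -/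
structure IsStrictlySemistable (ϖ : R) {V : Scheme.{u}} (f : V ⟶ Spec (.of R)) : Prop where
  isSemistableAt : ∀ P : V, IsClosed {P} → P ∈ specialFiber f → IsSemistableAt ϖ f P
  isSmooth_component : ∀ Z ∈ specialComponents f, IsSmoothOverResidueField f Z

end Semistable

/-- `f : V ⟶ Spec R` is a (proper flat) model over `R` of the `K`-scheme `c : C ⟶ Spec K`:
the generic fibre of `V` is isomorphic to `C`. -/
structure IsModel {R K : Type u} [CommRing R] [Field K] [Algebra R K] {V C : Scheme.{u}}
    (f : V ⟶ Spec (.of R)) (c : C ⟶ Spec (.of K)) : Prop where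
  isProper : IsProper f
  flat : Flat f
  exists_isPullback : ∃ j : C ⟶ V,
    IsPullback j c f (Spec.map (CommRingCat.ofHom (algebraMap R K)))

end SemistableProduct

/-! Formal coordinates are replaced by Zariski-local ones, and explicit equations are then followed
through the blow-ups.

From formal to local coordinates (`exists_flat_chart`, `IsSemistableAt.exists_etale_chart`).
Condition (a) provides formal parameters at a closed point, some of which have product `ϖ`.
Condition (b) makes the completed local ring of each component a domain, so that components do not
split formally. Each formal branch therefore comes from one component, and its equation can be
chosen in the local ring, up to a unit. The resulting map to Spec R[x]/(x₁⋯x_t - ϖ) is étale near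
the point. By properness every point specializes to such a closed point, so every point of a model
has a neighbourhood that is smooth over Spec R[w]/(∏ w - ϖ), a standard chart.

Blow-ups. On the product, two standard charts give ∏ u = ∏ v = ϖ, and the components of the special
fibre are locally the loci u_a = v_b = 0. The class of charts that is stable under the process is
that of smooth maps to the scheme ∏ u = ∏ v, ∏ u · ∏ w = ϖ (`ChartRing`, `IsChart`). Blowing up
(u_a, v_b) gives two charts. Where v_b = r u_a, the first relation becomes ∏_{x ≠ a} u_x = r ∏_{y ≠
b} v_y, and u_a joins the w: the shape is the same with one u fewer (`IsChart.blowup`). The other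
chart is symmetric. Strict transforms of components are again loci u_x = v_y = 0, or empty
(`IsAdaptedChart.blowup`). After t - 1 blow-ups at most one component is left to blow up. Then, if
some u_a vanishes at a point, all other u are units there, u_a is determined by the rest, and what
remains is a standard chart ∏ v · ∏ w = ϖ (`IsAdapted.hasStdCharts`). Standard charts give flatness,
condition (a) and condition (b).

The changes of chart are checked by infinitesimal lifting: a chart is smooth when tuples satisfying
the relations lift (`IsChart.of_exists_lift`).

The blow-up is known only through its universal property. From it one shows that the two affine
charts cover it and are locally isomorphic to it (`IsBlowupPair.exists_ringHom`,
`IsBlowupPair.isOpenImmersion_SpecMap`), and the valuative criterion then gives properness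
(`HasBlowupPairs.isProper`). The centres lie in the special fibre, so the generic fibre does not
change.

The residue field k. Condition (a) makes the residue fields of closed points of the special fibre
separable over k. If k were imperfect, the special fibre of the model of the curve would have a
closed point with inseparable residue field, so k is perfect unless there is nothing to prove
(`IsStrictlySemistable.perfectField`). This makes the residue fields at new closed points separable
and the local rings of the loci u_a = v_b = 0 domains. -/

namespace SemistableProduct

/-! ### Completions of rings along an ideal. -/

section Completion

open TensorProduct

/-- Over a noetherian ring the completion of a finite module is its base change to the completed
ring, and here that ring is `D` itself. -/
theorem isAdicComplete_of_finite {D : Type u} [CommRing D] [IsNoetherianRing D] (I : Ideal D)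
    [IsAdicComplete I D] (M : Type u) [AddCommGroup M] [Module D M] [Module.Finite D M] :
    IsAdicComplete I M := by
  rw [← AdicCompletion.of_bijective_iff]
  let e : M ≃ₗ[D] AdicCompletion I D ⊗[D] M :=
    (TensorProduct.lid D M).symm ≪≫ₗ
      TensorProduct.congr (AdicCompletion.ofLinearEquiv I D) (LinearEquiv.refl D M)
  have h : ⇑(AdicCompletion.of I M) = AdicCompletion.ofTensorProduct I M ∘ e := by
    ext1 m
    have := one_smul (AdicCompletion I D) (AdicCompletion.of I M m)
    simp only [Function.comp_apply, e, LinearEquiv.trans_apply, TensorProduct.lid_symm_apply,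
      TensorProduct.congr_tmul, LinearEquiv.refl_apply, AdicCompletion.ofTensorProduct_tmul]
    exact this.symm
  rw [h]
  exact (AdicCompletion.ofTensorProduct_bijective_of_finite_of_isNoetherian I M).comp e.bijective

theorem isAdicComplete_map_of_finite {D S : Type u} [CommRing D] [IsNoetherianRing D] (I : Ideal D)
    [IsAdicComplete I D] [CommRing S] [Algebra D S] [Module.Finite D S] :
    IsAdicComplete (I.map (algebraMap D S)) S := by
  rw [IsAdicComplete.map_algebraMap_iff]
  exact isAdicComplete_of_finite I S

/-- `S` is the `I`-adic completion of `B`. -/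
structure IsCompletion {B : Type*} [CommRing B] (I : Ideal B) (S : Type*) [CommRing S]
    [Algebra B S] : Prop where
  complete : IsAdicComplete (I.map (algebraMap B S)) S
  surj : ∀ s : S, ∃ b : B, s - algebraMap B S b ∈ I.map (algebraMap B S)
  inj : ∀ (n : ℕ) (b : B), algebraMap B S b ∈ I.map (algebraMap B S) ^ n → b ∈ I ^ n

namespace IsCompletion

variable {B : Type u} [CommRing B] {I : Ideal B} {S : Type u} [CommRing S] [Algebra B S]

/-- Successive approximation: an element of IⁿS is a combination of elements of Iⁿ with coefficients
in `S`, and approximating the coefficients modulo IS gains one power. -/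
theorem surj_pow (h : IsCompletion I S) (n : ℕ) (s : S) :
    ∃ b : B, s - algebraMap B S b ∈ I.map (algebraMap B S) ^ n := by
  induction n generalizing s with
  | zero => exact ⟨0, by simp⟩
  | succ n ih =>
    obtain ⟨b, hb⟩ := ih s
    suffices H : ∀ x ∈ I.map (algebraMap B S) ^ n, ∃ b : B,
        x - algebraMap B S b ∈ I.map (algebraMap B S) ^ (n + 1) by
      obtain ⟨b', hb'⟩ := H _ hb
      exact ⟨b + b', by simpa [sub_sub] using hb'⟩
    intro x hx
    rw [← Ideal.map_pow, Ideal.map] at hx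
    induction hx using Submodule.span_induction with
    | mem x hx =>
      obtain ⟨b, -, rfl⟩ := hx
      exact ⟨b, by simp⟩
    | zero => exact ⟨0, by simp⟩
    | add x y hx hy h1 h2 =>
      obtain ⟨b, hb⟩ := h1
      obtain ⟨c, hc⟩ := h2
      refine ⟨b + c, ?_⟩
      have := add_mem hb hc
      rw [map_add]; convert this using 1; ring
    | smul a x hx h1 =>
      obtain ⟨b, hb⟩ := h1
      obtain ⟨c, hc⟩ := h.surj a
      refine ⟨c * b, ?_⟩
      have hx' : x ∈ I.map (algebraMap B S) ^ n := by
        rwa [← Ideal.map_pow]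
      have h2 := Ideal.mul_mem_mul hx' hc
      rw [← pow_succ] at h2
      have h3 := Ideal.mul_mem_left _ (algebraMap B S c) hb
      have := add_mem h2 h3
      rw [map_mul, smul_eq_mul]; convert this using 1; ring

theorem of_ringEquiv (h : IsCompletion I S) {S' : Type u} [CommRing S'] [Algebra B S']
    (e : S ≃+* S') (he : ∀ b, e (algebraMap B S b) = algebraMap B S' b) : IsCompletion I S' := by
  have hm : (I.map (algebraMap B S)).map e = I.map (algebraMap B S') := by
    have : algebraMap B S' = (e : S →+* S').comp (algebraMap B S) := by ext b; simp [he]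
    rw [this, ← Ideal.map_map]; rfl
  refine ⟨?_, fun s ↦ ?_, fun n b hb ↦ h.inj n b ?_⟩
  · rw [← hm, IsAdicComplete.congr_ringEquiv]
    exact h.complete
  · obtain ⟨b, hb⟩ := h.surj (e.symm s)
    refine ⟨b, ?_⟩
    rw [← hm]
    have := Ideal.mem_map_of_mem e hb
    simpa [he] using this
  · rw [← hm, ← Ideal.map_pow, ← he] at hb
    rw [← Ideal.comap_symm, Ideal.mem_comap] at hb
    simpa using hb

theorem adicCompletion (I : Ideal B) (hI : I.FG) : IsCompletion I (AdicCompletion I B) := by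
  refine ⟨?_, fun s ↦ ?_, fun n b hb ↦ ?_⟩
  · rw [IsAdicComplete.map_algebraMap_iff]
    exact AdicCompletion.isAdicComplete hI
  · obtain ⟨b, hb⟩ := Ideal.Quotient.mk_surjective (AdicCompletion.evalOneₐ I s)
    refine ⟨b, ?_⟩
    rw [← AdicCompletion.ker_evalOneₐ_eq_map _ hI]
    change AdicCompletion.evalOneₐ I (s - algebraMap B _ b) = 0
    rw [map_sub, AlgHom.commutes, ← hb]
    simp
  · rw [← Ideal.map_pow] at hb
    have hle : (I ^ n).map (algebraMap B (AdicCompletion I B)) ≤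
        RingHom.ker (AdicCompletion.evalₐ I n) := by
      rw [Ideal.map_le_iff_le_comap]
      intro x hx
      simp only [Ideal.mem_comap, RingHom.mem_ker, AlgHom.commutes]
      exact Ideal.Quotient.eq_zero_iff_mem.mpr hx
    have := hle hb
    simp only [RingHom.mem_ker, AlgHom.commutes] at this
    exact Ideal.Quotient.eq_zero_iff_mem.mp this

theorem quotient [IsNoetherianRing S] (h : IsCompletion I S) (J : Ideal B) :
    IsCompletion (I.map (Ideal.Quotient.mk J)) (S ⧸ J.map (algebraMap B S)) := by
  have := h.complete
  have hmap : (I.map (Ideal.Quotient.mk J)).map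
      (algebraMap (B ⧸ J) (S ⧸ J.map (algebraMap B S))) =
      (I.map (algebraMap B S)).map (algebraMap S (S ⧸ J.map (algebraMap B S))) := by
    rw [Ideal.map_map, Ideal.map_map]; rfl
  refine ⟨?_, fun s ↦ ?_, fun n b hb ↦ ?_⟩
  · rw [hmap]
    exact isAdicComplete_map_of_finite _
  · obtain ⟨s, rfl⟩ := Ideal.Quotient.mk_surjective s
    obtain ⟨b, hb⟩ := h.surj s
    refine ⟨Ideal.Quotient.mk J b, ?_⟩
    rw [hmap]
    exact Ideal.mem_map_of_mem (algebraMap S _) hb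
  · obtain ⟨b, rfl⟩ := Ideal.Quotient.mk_surjective b
    rw [hmap, ← Ideal.map_pow] at hb
    have hb' : algebraMap B S b ∈ (I.map (algebraMap B S)) ^ n ⊔ J.map (algebraMap B S) := by
      change (Ideal.Quotient.mk _ (algebraMap B S b)) ∈ Ideal.map (Ideal.Quotient.mk _) _ at hb
      rw [← Ideal.mem_comap, Ideal.comap_map_of_surjective _ Ideal.Quotient.mk_surjective] at hb
      simpa [← RingHom.ker_eq_comap_bot] using hb
    obtain ⟨x, hx, y, hy, hxy⟩ := Submodule.mem_sup.mp hb'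
    -- Approximating the coefficients of an element of JS modulo IⁿS replaces it by an element of
    -- `J`, so the question moves back to `B`.
    have key : ∀ y ∈ J.map (algebraMap B S), ∃ c ∈ J, y - algebraMap B S c ∈
        I.map (algebraMap B S) ^ n := by
      intro y hy
      rw [Ideal.map] at hy
      induction hy using Submodule.span_induction with
      | mem x hx =>
        obtain ⟨b, hb, rfl⟩ := hx
        exact ⟨b, hb, by simp⟩
      | zero => exact ⟨0, by simp, by simp⟩
      | add x y hx hy h1 h2 =>
        obtain ⟨b, hb, hb'⟩ := h1
        obtain ⟨c, hc, hc'⟩ := h2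
        refine ⟨b + c, add_mem hb hc, ?_⟩
        have := add_mem hb' hc'
        rw [map_add]; convert this using 1; ring
      | smul a x hx h1 =>
        obtain ⟨b, hb, hb'⟩ := h1
        obtain ⟨c, hc⟩ := h.surj_pow n a
        refine ⟨c * b, Ideal.mul_mem_left _ _ hb, ?_⟩
        have := add_mem (Ideal.mul_mem_left _ a hb') (Ideal.mul_mem_right (algebraMap B S b) _ hc)
        rw [map_mul, smul_eq_mul]; convert this using 1; ring
    obtain ⟨c, hc, hc'⟩ := key y hy
    have h3 : b - c ∈ I ^ n := by
      refine h.inj n _ ?_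
      have := add_mem hx hc'
      rw [map_sub]; convert this using 1; rw [← hxy]; ring
    rw [← Ideal.map_pow]
    have : Ideal.Quotient.mk J b = Ideal.Quotient.mk J (b - c) := by
      rw [map_sub, Ideal.Quotient.eq_zero_iff_mem.mpr hc, sub_zero]
    rw [this]
    exact Ideal.mem_map_of_mem _ h3

theorem smul_top_eq (n : ℕ) : ((I ^ n • ⊤ : Submodule B S) : Set S) =
    (I.map (algebraMap B S) ^ n : Ideal S) := by
  rw [Ideal.smul_top_eq_map, ← Ideal.map_pow]; rfl

/-- Since `S` is complete it is the limit of the S/IⁿS, which are the B/Iⁿ; hence `S` is the adic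
completion of `B` as a module, and that is flat for noetherian `B`. -/
theorem flat [IsNoetherianRing B] (h : IsCompletion I S) : Module.Flat B S := by
  have h1 : IsAdicComplete I S := by
    have := h.complete
    rwa [IsAdicComplete.map_algebraMap_iff] at this
  let f := AdicCompletion.map I (Algebra.linearMap B S)
  have hf : Function.Bijective f := by
    constructor
    · rw [injective_iff_map_eq_zero]
      intro x hx
      ext n
      obtain ⟨b, hb⟩ := Submodule.Quotient.mk_surjective _ (x.val n)
      have hx' := congr_arg (fun y ↦ y.val n) hx
      simp only [f, AdicCompletion.map_val_apply, ← hb] at hx'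
      rw [LinearMap.reduceModIdeal_apply] at hx'
      change _ = (0 : _ ⧸ _) at hx'
      rw [Submodule.Quotient.mk_eq_zero] at hx'
      have h3 : algebraMap B S b ∈ I.map (algebraMap B S) ^ n := by
        have : algebraMap B S b ∈ ((I ^ n • ⊤ : Submodule B S) : Set S) := hx'
        rwa [smul_top_eq] at this
      have h4 := h.inj n b h3
      rw [← hb]
      change _ = (0 : _ ⧸ _)
      rw [Submodule.Quotient.mk_eq_zero]
      simpa using h4
    · refine AdicCompletion.map_surjective_of_mkQ_comp_surjective ?_
      intro y
      obtain ⟨s, rfl⟩ := Submodule.Quotient.mk_surjective _ y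
      obtain ⟨b, hb⟩ := h.surj s
      refine ⟨b, ?_⟩
      have h5 : s - algebraMap B S b ∈ ((I ^ 1 • ⊤ : Submodule B S) : Set S) := by
        rw [smul_top_eq, pow_one]; exact hb
      rw [pow_one] at h5
      symm
      change Submodule.Quotient.mk s = Submodule.Quotient.mk (algebraMap B S b)
      rw [Submodule.Quotient.eq]
      exact h5
  have e : S ≃ₗ[B] AdicCompletion I B := (AdicCompletion.ofLinearEquiv I S).trans
    (LinearEquiv.ofBijective (f.restrictScalars B) hf).symm
  exact Module.Flat.of_linearEquiv e

theorem bijective_quotient (h : IsCompletion I S) (n : ℕ) : Function.Bijective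
    (Ideal.quotientMap (I.map (algebraMap B S) ^ n) (algebraMap B S)
      (by rw [← Ideal.map_pow]; exact Ideal.le_comap_map) : B ⧸ I ^ n →+* _) := by
  constructor
  · apply Ideal.quotientMap_injective'
    intro b hb
    exact h.inj n b hb
  · intro s
    obtain ⟨s, rfl⟩ := Ideal.Quotient.mk_surjective s
    obtain ⟨b, hb⟩ := h.surj_pow n s
    refine ⟨Ideal.Quotient.mk _ b, ?_⟩
    rw [Ideal.quotientMap_mk, eq_comm, Ideal.Quotient.eq]
    exact hb

/-- The universal property of the completion. -/
theorem exists_lift (h : IsCompletion I S) {T : Type u} [CommRing T] (J : Ideal T)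
    [IsAdicComplete J T] (g : B →+* T) (hg : I ≤ J.comap g) :
    ∃ φ : S →+* T, ∀ b, φ (algebraMap B S b) = g b := by
  have hn : ∀ n, I ^ n ≤ (J ^ n).comap g := fun n ↦ by
    refine le_trans ?_ (Ideal.le_comap_pow g n)
    exact Ideal.pow_right_mono hg n
  -- The map is the limit of S → S/IⁿS ≅ B/Iⁿ → T/Jⁿ.
  let e (n : ℕ) := RingEquiv.ofBijective _ (h.bijective_quotient n)
  let f (n : ℕ) : S →+* T ⧸ J ^ n :=
    ((Ideal.quotientMap (J ^ n) g (hn n)).comp ((e n).symm : _ ≃+* _).toRingHom).comp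
      (Ideal.Quotient.mk _)
  have hf : ∀ n s b, s - algebraMap B S b ∈ I.map (algebraMap B S) ^ n →
      f n s = Ideal.Quotient.mk _ (g b) := by
    intro n s b hb
    have : (e n).symm (Ideal.Quotient.mk _ s) = Ideal.Quotient.mk _ b := by
      rw [RingEquiv.symm_apply_eq]
      exact (Ideal.Quotient.eq.mpr hb)
    simp [f, this]
  have hfc : ∀ {m n : ℕ} (hle : m ≤ n),
      (Ideal.Quotient.factorPow J hle).comp (f n) = f m := by
    intro m n hle
    ext s
    obtain ⟨b, hb⟩ := h.surj_pow n s
    rw [RingHom.comp_apply, hf n s b hb, hf m s b (Ideal.pow_le_pow_right hle hb)]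
    rfl
  refine ⟨IsAdicComplete.liftRingHom J f hfc, fun b ↦ ?_⟩
  refine IsHausdorff.eq_iff_smodEq (I := J).mpr fun n ↦ ?_
  rw [SModEq.sub_mem, smul_eq_mul, Ideal.mul_top, ← Ideal.Quotient.eq,
    IsAdicComplete.mk_liftRingHom, hf n _ b (by simp)]

end IsCompletion

theorem isCompletion_mvPowerSeries (σ : Type) (R : Type u) [CommRing R] [Finite σ] :
    letI : Algebra (MvPolynomial σ R) (MvPowerSeries σ R) := inferInstance
    IsCompletion (MvPolynomial.idealOfVars σ R) (MvPowerSeries σ R) :=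
  (IsCompletion.adicCompletion _ (MvPolynomial.idealOfVars_fg σ R)).of_ringEquiv
    (MvPowerSeries.toAdicCompletionAlgEquiv σ R).toRingEquiv.symm
    (fun b ↦ (MvPowerSeries.toAdicCompletionAlgEquiv σ R).symm.commutes b)

end Completion

end SemistableProduct

namespace SemistableProduct

/-! ### The polynomial model of the standard semistable ring. -/

section StdPoly

variable {R : Type u} [CommRing R]

/-- The ring `R[x₁, …, xₙ] / (x₁ ⋯ x_t - ϖ)`, for `t ≤ n`. -/
abbrev StdPoly (ϖ : R) (n t : ℕ) : Type u :=
  MvPolynomial (Fin n) R ⧸ Ideal.span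
    {(∏ i ∈ Finset.univ.filter (fun i : Fin n ↦ (i : ℕ) < t), MvPolynomial.X (R := R) i) -
      MvPolynomial.C (σ := Fin n) ϖ}

/-- The coordinates on `Spec (StdPoly ϖ n t)`. -/
noncomputable def StdPoly.x (ϖ : R) (n t : ℕ) (i : Fin n) : StdPoly ϖ n t :=
  Ideal.Quotient.mk _ (MvPolynomial.X i)

/-- The ideal of the origin. -/
noncomputable def StdPoly.origin (ϖ : R) (n t : ℕ) : Ideal (StdPoly ϖ n t) :=
  (MvPolynomial.idealOfVars (Fin n) R).map (Ideal.Quotient.mk _)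

theorem map_span_relation (ϖ : R) (n t : ℕ) :
    (Ideal.span {(∏ i ∈ Finset.univ.filter (fun i : Fin n ↦ (i : ℕ) < t),
      MvPolynomial.X (R := R) i) - MvPolynomial.C (σ := Fin n) ϖ}).map
        (algebraMap (MvPolynomial (Fin n) R) (MvPowerSeries (Fin n) R)) =
    Ideal.span {(∏ i ∈ Finset.univ.filter (fun i : Fin n ↦ (i : ℕ) < t),
      MvPowerSeries.X (R := R) i) - MvPowerSeries.C (σ := Fin n) ϖ} := by
  rw [Ideal.map_span, Set.image_singleton]
  congr 2
  rw [map_sub, map_prod]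
  have hX : ∀ i : Fin n, algebraMap (MvPolynomial (Fin n) R) (MvPowerSeries (Fin n) R)
      (MvPolynomial.X i) = MvPowerSeries.X i := fun i ↦ MvPolynomial.coe_X i
  have hC : algebraMap (MvPolynomial (Fin n) R) (MvPowerSeries (Fin n) R)
      (MvPolynomial.C ϖ) = MvPowerSeries.C ϖ := MvPolynomial.coe_C ϖ
  simp only [hX, hC]

noncomputable instance StdPoly.algebraStdRing (ϖ : R) (n t : ℕ) :
    Algebra (StdPoly ϖ n t) (StdRing ϖ n t) :=
  (Ideal.quotientMap _ (algebraMap (MvPolynomial (Fin n) R) (MvPowerSeries (Fin n) R))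
    (by rw [← map_span_relation]; exact Ideal.le_comap_map)).toAlgebra

theorem StdPoly.algebraMap_mk (ϖ : R) (n t : ℕ) (p : MvPolynomial (Fin n) R) :
    algebraMap (StdPoly ϖ n t) (StdRing ϖ n t) (Ideal.Quotient.mk _ p) =
      Ideal.Quotient.mk _ (p : MvPowerSeries (Fin n) R) := rfl

/-- Ties the power series ring in the definition of semistability to an algebra of finite type, over
which étale neighbourhoods can be taken. -/
theorem isCompletion_stdRing [IsNoetherianRing R] (ϖ : R) (n t : ℕ) :
    IsCompletion (StdPoly.origin ϖ n t) (StdRing ϖ n t) := by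
  refine ((isCompletion_mvPowerSeries (Fin n) R).quotient _).of_ringEquiv
    (Ideal.quotEquivOfEq (map_span_relation ϖ n t)) ?_
  intro b
  obtain ⟨b, rfl⟩ := Ideal.Quotient.mk_surjective b
  rfl

theorem StdPoly.origin_eq_span (ϖ : R) (n t : ℕ) :
    StdPoly.origin ϖ n t = Ideal.span (Set.range (StdPoly.x ϖ n t)) := by
  rw [origin, MvPolynomial.idealOfVars, Ideal.map_span, ← Set.range_comp]
  rfl

theorem StdPoly.prod_x (ϖ : R) (n t : ℕ) :
    ∏ i ∈ Finset.univ.filter (fun i : Fin n ↦ (i : ℕ) < t), StdPoly.x ϖ n t i =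
      algebraMap R _ ϖ := by
  have : (∏ i ∈ Finset.univ.filter (fun i : Fin n ↦ (i : ℕ) < t), StdPoly.x ϖ n t i) =
      Ideal.Quotient.mk _ (∏ i ∈ Finset.univ.filter (fun i : Fin n ↦ (i : ℕ) < t),
        MvPolynomial.X (R := R) i) := by
    rw [map_prod]; rfl
  rw [this]
  refine (Ideal.Quotient.eq (I := _) (y := MvPolynomial.C ϖ)).mpr ?_
  exact Ideal.subset_span rfl

theorem StdPoly.sub_algebraMap_mem (ϖ : R) (n t : ℕ) (p : StdPoly ϖ n t) :
    ∃ r : R, p - algebraMap R _ r ∈ StdPoly.origin ϖ n t := by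
  obtain ⟨p, rfl⟩ := Ideal.Quotient.mk_surjective p
  refine ⟨MvPolynomial.constantCoeff p, ?_⟩
  induction p using MvPolynomial.induction_on with
  | C a =>
    rw [MvPolynomial.constantCoeff_C]
    have : (algebraMap R (StdPoly ϖ n t)) a = Ideal.Quotient.mk _ (MvPolynomial.C a) := rfl
    rw [this, sub_self]
    exact zero_mem _
  | add p q hp hq =>
    rw [map_add, map_add, map_add]
    convert add_mem hp hq using 1
    ring
  | mul_X p i hp =>
    rw [map_mul, map_mul, MvPolynomial.constantCoeff_X, mul_zero, map_zero, sub_zero]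
    refine Ideal.mul_mem_left _ _ ?_
    rw [origin_eq_span]
    exact Ideal.subset_span ⟨i, rfl⟩

/-- As 1 ≤ t, the element `ϖ` is a non-empty product of coordinates and vanishes at the origin, so
the quotient by this ideal is the residue field of `R`. -/
theorem StdPoly.isMaximal_origin [IsLocalRing R] (ϖ : R) (n t : ℕ)
    (hϖ : IsLocalRing.maximalIdeal R = Ideal.span {ϖ}) (ht : 1 ≤ t) (htn : t ≤ n) :
    (StdPoly.origin ϖ n t).IsMaximal := by
  have hϖ' : ϖ ∈ IsLocalRing.maximalIdeal R := hϖ ▸ Ideal.mem_span_singleton_self ϖ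
  let ev : StdPoly ϖ n t →+* IsLocalRing.ResidueField R := Ideal.Quotient.lift _
    (MvPolynomial.eval₂Hom (IsLocalRing.residue R) (fun _ ↦ 0)) (by
      intro a ha
      rw [Ideal.mem_span_singleton] at ha
      obtain ⟨b, rfl⟩ := ha
      have : (∏ i ∈ Finset.univ.filter (fun i : Fin n ↦ (i : ℕ) < t),
          (0 : IsLocalRing.ResidueField R)) = 0 := by
        refine Finset.prod_eq_zero (i := ⟨0, by omega⟩) ?_ rfl
        simp; omega
      rw [map_mul, map_sub, map_prod]
      simp only [MvPolynomial.coe_eval₂Hom, MvPolynomial.eval₂_X, MvPolynomial.eval₂_C]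
      rw [this, (IsLocalRing.residue_eq_zero_iff ϖ).mpr hϖ']
      simp)
  have hev : Function.Surjective ev := by
    intro y
    obtain ⟨r, rfl⟩ := IsLocalRing.residue_surjective y
    exact ⟨Ideal.Quotient.mk _ (MvPolynomial.C r), by simp [ev]⟩
  have hr : ∀ r : R, ev (algebraMap R _ r) = IsLocalRing.residue R r := by
    intro r
    change ev (Ideal.Quotient.mk _ (MvPolynomial.C r)) = _
    simp [ev]
  have hle : StdPoly.origin ϖ n t ≤ RingHom.ker ev := by
    rw [origin_eq_span, Ideal.span_le]
    rintro _ ⟨i, rfl⟩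
    simp [ev, StdPoly.x]
  have : StdPoly.origin ϖ n t = RingHom.ker ev := by
    refine le_antisymm hle fun p hp ↦ ?_
    obtain ⟨r, hr'⟩ := StdPoly.sub_algebraMap_mem ϖ n t p
    have h1 : ev (algebraMap R _ r) = 0 := by
      have := hle hr'
      rw [RingHom.mem_ker] at this hp
      rw [map_sub, hp, zero_sub, neg_eq_zero] at this
      exact this
    rw [hr, IsLocalRing.residue_eq_zero_iff, hϖ, Ideal.mem_span_singleton] at h1
    obtain ⟨c, rfl⟩ := h1
    have h2 : algebraMap R (StdPoly ϖ n t) (ϖ * c) ∈ StdPoly.origin ϖ n t := by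
      rw [map_mul, ← StdPoly.prod_x]
      refine Ideal.mul_mem_right _ _ ?_
      rw [origin_eq_span]
      refine Ideal.mem_of_dvd _ (Finset.dvd_prod_of_mem _ (a := ⟨0, by omega⟩) ?_)
        (Ideal.subset_span ⟨_, rfl⟩)
      simp; omega
    have := add_mem hr' h2
    rwa [sub_add_cancel] at this
  rw [this]
  exact RingHom.ker_isMaximal_of_surjective ev hev

end StdPoly

/-! ### Separability of residue fields over a base ring. -/

section Separable

open Polynomial

/-- Every element of `K` is a simple root of a polynomial with coefficients in `F`. -/
def HasSimpleRoots (F K : Type*) [CommRing F] [CommRing K] [Algebra F K] : Prop :=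
  ∀ y : K, ∃ f : F[X], aeval y f = 0 ∧ aeval y (derivative f) ≠ 0

theorem HasSimpleRoots.isSeparable {k K : Type*} [Field k] [Field K] [Algebra k K]
    (h : HasSimpleRoots k K) : Algebra.IsSeparable k K := by
  refine ⟨fun y ↦ ?_⟩
  obtain ⟨f, hf, hf'⟩ := h y
  have hf0 : f ≠ 0 := by rintro rfl; simp at hf'
  have hint : IsIntegral k y := (isAlgebraic_iff_isIntegral).mp ⟨f, hf0, hf⟩
  have hirr := minpoly.irreducible hint
  refine (separable_iff_derivative_ne_zero hirr).mpr fun h0 ↦ ?_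
  obtain ⟨g, hg⟩ := minpoly.dvd k y hf
  apply hf'
  rw [hg, derivative_mul, h0]
  simp

theorem hasSimpleRoots_of_isSeparable {k K : Type*} [Field k] [Field K] [Algebra k K]
    [Algebra.IsSeparable k K] : HasSimpleRoots k K := by
  intro y
  refine ⟨minpoly k y, minpoly.aeval k y, ?_⟩
  exact (Algebra.IsSeparable.isSeparable k y).aeval_derivative_ne_zero (minpoly.aeval k y)

/-- Having simple roots makes sense over a base that is not a field, so the same hypothesis can be
moved between `R`, polynomial rings and residue fields. -/
theorem HasSimpleRoots.of_ringHom {F K F' K' : Type*} [CommRing F] [CommRing K] [Algebra F K]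
    [CommRing F'] [CommRing K'] [Algebra F' K'] (h : HasSimpleRoots F K) (a : F →+* F')
    (b : K →+* K') (hb : Function.Bijective b)
    (hab : ∀ x, b (algebraMap F K x) = algebraMap F' K' (a x)) : HasSimpleRoots F' K' := by
  intro y
  obtain ⟨y, rfl⟩ := hb.2 y
  obtain ⟨f, hf, hf'⟩ := h y
  have key : ∀ g : F[X], aeval (b y) (g.map a) = b (aeval y g) := by
    intro g
    rw [aeval_def, eval₂_map, aeval_def, hom_eval₂]
    congr 1
    ext x
    exact (hab x).symm
  refine ⟨f.map a, by rw [key, hf, map_zero], ?_⟩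
  rw [derivative_map, key]
  intro h0
  exact hf' (hb.1 (by rw [h0, map_zero]))

theorem HasSimpleRoots.of_surjective {F K F' : Type*} [CommRing F] [CommRing K] [CommRing F']
    [Algebra F' K] (h : HasSimpleRoots F' K) [Algebra F K] (a : F →+* F')
    (ha : Function.Surjective a)
    (hab : ∀ x, algebraMap F K x = algebraMap F' K (a x)) : HasSimpleRoots F K := by
  intro y
  obtain ⟨f, hf, hf'⟩ := h y
  obtain ⟨g, rfl⟩ := Polynomial.map_surjective a ha f
  have key : ∀ g : F[X], aeval y (g.map a) = aeval y g := by
    intro g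
    rw [aeval_def, eval₂_map, aeval_def]
    congr 1
    ext x
    exact (hab x).symm
  rw [derivative_map] at hf'
  rw [key] at hf hf'
  exact ⟨g, hf, hf'⟩

end Separable

end SemistableProduct

namespace SemistableProduct

open IsLocalRing TensorProduct

/-! ### Finite étale maps between completions. -/

section FiniteEtale

theorem IsCompletion.isMaximal {B S : Type u} [CommRing B] [CommRing S] [Algebra B S] {I : Ideal B}
    (h : IsCompletion I S) [hI : I.IsMaximal] : (I.map (algebraMap B S)).IsMaximal := by
  have h1 := h.bijective_quotient 1
  let e := RingEquiv.ofBijective _ h1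
  have h2 : (I ^ 1).IsMaximal := by rwa [pow_one]
  have h3 : (I.map (algebraMap B S) ^ 1).IsMaximal := by
    rw [Ideal.Quotient.maximal_ideal_iff_isField_quotient] at h2 ⊢
    exact MulEquiv.isField h2 e.symm.toMulEquiv
  rwa [pow_one] at h3

theorem IsCompletion.isLocalRing {B S : Type u} [CommRing B] [CommRing S] [Algebra B S]
    {I : Ideal B} (h : IsCompletion I S) [hI : I.IsMaximal] : IsLocalRing S :=
  have := h.isMaximal
  have := h.complete
  isLocalRing_of_isAdicComplete_maximal (I.map (algebraMap B S))

theorem IsCompletion.maximalIdeal_eq {B S : Type u} [CommRing B] [CommRing S] [Algebra B S]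
    {I : Ideal B} (h : IsCompletion I S) [hI : I.IsMaximal] [IsLocalRing S] :
    maximalIdeal S = I.map (algebraMap B S) :=
  (IsLocalRing.eq_maximalIdeal h.isMaximal).symm

/-- Elements that are independent over F/Q after passing to `K` stay independent over the local ring
F/Qⁿ in B/QⁿB, because `B` is flat. This gives injectivity in the next theorem. -/
theorem mem_pow_of_sum_mem {F B : Type u} [CommRing F] [CommRing B] [Algebra F B]
    [Module.Flat F B] (Q : Ideal F) [Q.IsMaximal] {K : Type u} [Field K] [Algebra B K]
    [Algebra F K] [IsScalarTower F B K] {d : ℕ} (v : Fin d → B)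
    (hQ : ∀ q ∈ Q, algebraMap F K q = 0)
    (hv : ∀ f : Fin d → F, ∑ i, algebraMap F K (f i) * algebraMap B K (v i) = 0 → ∀ i, f i ∈ Q)
    (n : ℕ) (f : Fin d → F)
    (hf : ∑ i, algebraMap F B (f i) * v i ∈ (Q.map (algebraMap F B)) ^ n) (i : Fin d) :
    f i ∈ Q ^ n := by
  rcases Nat.eq_zero_or_pos n with rfl | hn
  · simp
  let Fn := F ⧸ Q ^ n
  -- `Q` is the only prime ideal above Qⁿ.
  have hlocal : IsLocalRing Fn := by
    have hmax : ∀ M : Ideal Fn, M.IsMaximal → M = Q.map (Ideal.Quotient.mk (Q ^ n)) := by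
      intro M hM
      have hp : (M.comap (Ideal.Quotient.mk (Q ^ n))).IsPrime := Ideal.IsPrime.comap _
      have h1 : Q ^ n ≤ M.comap (Ideal.Quotient.mk (Q ^ n)) := by
        intro x hx
        rw [Ideal.mem_comap, Ideal.Quotient.eq_zero_iff_mem.mpr hx]; exact zero_mem _
      have h2 : Q ≤ M.comap (Ideal.Quotient.mk (Q ^ n)) := hp.le_of_pow_le h1
      have h3 := (‹Q.IsMaximal›).eq_of_le hp.ne_top h2
      calc M = (M.comap (Ideal.Quotient.mk (Q ^ n))).map (Ideal.Quotient.mk (Q ^ n)) :=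
            (Ideal.map_comap_of_surjective _ Ideal.Quotient.mk_surjective M).symm
        _ = _ := by rw [← h3]
    have hnt : Nontrivial Fn := Ideal.Quotient.nontrivial_iff.mpr (by
      intro htop
      exact (‹Q.IsMaximal›).ne_top (top_le_iff.mp (htop ▸ Ideal.pow_le_self hn.ne')))
    refine IsLocalRing.of_unique_max_ideal ?_
    obtain ⟨M, hM⟩ := Ideal.exists_maximal Fn
    exact ⟨M, hM, fun N hN ↦ by rw [hmax M hM, hmax N hN]⟩
  have hmaxF : ∀ x : F, x ∈ Q → Ideal.Quotient.mk (Q ^ n) x ∈ maximalIdeal Fn := by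
    intro x hx
    rw [mem_maximalIdeal, mem_nonunits_iff]
    intro hu
    have hnil : IsNilpotent (Ideal.Quotient.mk (Q ^ n) x) :=
      ⟨n, by rw [← map_pow]; exact Ideal.Quotient.eq_zero_iff_mem.mpr (Ideal.pow_mem_pow hx n)⟩
    exact hnil.not_isUnit hu
  let algFnK : Algebra Fn K := (Ideal.Quotient.lift (Q ^ n) (algebraMap F K)
    (fun a ha ↦ hQ a (Ideal.pow_le_self hn.ne' ha))).toAlgebra
  have tow1 : IsScalarTower F Fn K := IsScalarTower.of_algebraMap_eq (fun x ↦ rfl)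
  have hker : ∀ x : Fn, x ∈ maximalIdeal Fn → algebraMap Fn K x = 0 := by
    intro x hx
    obtain ⟨x, rfl⟩ := Ideal.Quotient.mk_surjective x
    change algebraMap F K x = 0
    refine hQ x ?_
    by_contra hxQ
    obtain ⟨y, hy⟩ := (‹Q.IsMaximal›).exists_inv hxQ
    obtain ⟨q, hq, hy⟩ := hy
    have h1 := hmaxF q hq
    have h2 : (1 : Fn) ∈ maximalIdeal Fn := by
      have : (1 : Fn) = Ideal.Quotient.mk (Q ^ n) y * Ideal.Quotient.mk (Q ^ n) x +
          Ideal.Quotient.mk (Q ^ n) q := by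
        rw [← map_mul, ← map_add, hy, map_one]
      rw [this]
      exact add_mem (Ideal.mul_mem_left _ _ hx) h1
    exact (Ideal.ne_top_iff_one _).mp (maximalIdeal.isMaximal Fn).ne_top h2
  let k := ResidueField Fn
  have hlh : IsLocalHom (algebraMap Fn K) := ⟨fun a ha ↦ by
    by_contra h
    exact ha.ne_zero (hker a ((mem_maximalIdeal _).mpr h))⟩
  let algkK : Algebra k K := (ResidueField.lift (algebraMap Fn K)).toAlgebra
  have tow2 : IsScalarTower Fn k K := IsScalarTower.of_algebraMap_eq (fun x ↦ by
    exact (ResidueField.lift_residue_apply _ _).symm)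
  let M := Fn ⊗[F] B
  let w : Fin d → M := fun i ↦ 1 ⊗ₜ v i
  let l : M →ₗ[Fn] K := LinearMap.liftBaseChange Fn ((Algebra.ofId B K).toLinearMap.restrictScalars F)
  let l' : k ⊗[Fn] M →ₗ[k] K := LinearMap.liftBaseChange k l
  have hl' : ∀ i, l' (TensorProduct.mk Fn k M 1 (w i)) = algebraMap B K (v i) := by
    intro i
    simp only [l', l, w, TensorProduct.mk_apply, LinearMap.liftBaseChange_tmul, one_smul]
    exact (LinearMap.liftBaseChange_tmul Fn _ _ _).trans (one_smul _ _)
  have hLI : LinearIndependent k (TensorProduct.mk Fn k M 1 ∘ w) := by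
    refine LinearIndependent.of_comp l' ?_
    rw [Fintype.linearIndependent_iff]
    intro g hg i
    have hsurj : ∀ x : k, ∃ y : F, algebraMap Fn k (Ideal.Quotient.mk (Q ^ n) y) = x := by
      intro x
      obtain ⟨x, rfl⟩ := residue_surjective x
      obtain ⟨x, rfl⟩ := Ideal.Quotient.mk_surjective x
      exact ⟨x, rfl⟩
    choose r hr using hsurj
    have h1 : ∀ x, algebraMap k K x = algebraMap F K (r x) := by
      intro x
      conv_lhs => rw [← hr x]
      rw [← IsScalarTower.algebraMap_apply Fn k K]
      rfl
    have h2 := hv (fun i ↦ r (g i)) (by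
      rw [← hg]
      refine Finset.sum_congr rfl fun i _ ↦ ?_
      rw [Function.comp_apply, Function.comp_apply, hl', Algebra.smul_def, h1]) i
    rw [← hr (g i)]
    exact (residue_eq_zero_iff _).mpr (hmaxF _ h2)
  -- In a flat module over a local ring, independence modulo the maximal ideal lifts.
  have hLI2 : LinearIndependent Fn w := Module.IsLocalRing.linearIndependent_of_flat w hLI
  rw [Fintype.linearIndependent_iff] at hLI2
  have h0 := hLI2 (fun i ↦ Ideal.Quotient.mk (Q ^ n) (f i)) (by
    have h1 : ∀ x ∈ (Q.map (algebraMap F B)) ^ n, (1 : Fn) ⊗ₜ[F] x = 0 := by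
      intro x hx
      rw [← Ideal.map_pow, Ideal.map] at hx
      induction hx using Submodule.span_induction with
      | mem x hx =>
        obtain ⟨q, hq, rfl⟩ := hx
        have : (1 : Fn) ⊗ₜ[F] (algebraMap F B q) = (q • (1 : Fn)) ⊗ₜ[F] (1 : B) := by
          rw [TensorProduct.smul_tmul, Algebra.smul_def, mul_one]
        rw [this, Algebra.smul_def, mul_one]
        change (Ideal.Quotient.mk (Q ^ n) q) ⊗ₜ[F] (1 : B) = 0
        rw [Ideal.Quotient.eq_zero_iff_mem.mpr hq, TensorProduct.zero_tmul]
      | zero => exact TensorProduct.tmul_zero _ _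
      | add x y _ _ h1 h2 => rw [TensorProduct.tmul_add, h1, h2, add_zero]
      | smul a x _ h1 =>
        have : (1 : Fn) ⊗ₜ[F] (a • x) = ((1 : Fn) ⊗ₜ[F] a) * ((1 : Fn) ⊗ₜ[F] x) := by
          rw [Algebra.TensorProduct.tmul_mul_tmul, one_mul, smul_eq_mul]
        rw [this, h1, mul_zero]
    rw [← h1 _ hf, TensorProduct.tmul_sum]
    refine Finset.sum_congr rfl fun i _ ↦ ?_
    rw [TensorProduct.smul_tmul', ← Algebra.smul_def, ← TensorProduct.smul_tmul]
    congr 1) i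
  exact Ideal.Quotient.eq_zero_iff_mem.mp h0

/-- `S` is free over `D` on lifts of a basis of the residue field of `B` over F/Q: the lifts
generate by completeness, and by `mem_pow_of_sum_mem` the coefficients of a relation lie in every
power of QD. The map is unramified because `Q` generates the maximal ideal and the residue extension
is separable; unramified and flat is étale. -/
theorem exists_finite_etale_of_isCompletion {F D B S : Type u} [CommRing F] [CommRing D]
    [Algebra F D] [IsNoetherianRing D] [CommRing B] [IsLocalRing B] [CommRing S]
    [Algebra B S] [Algebra F B] (Q : Ideal F) [Q.IsMaximal] (hD : IsCompletion Q D)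
    (hS : IsCompletion (maximalIdeal B) S) [Module.Flat F B]
    (hQ : Q.map (algebraMap F B) = maximalIdeal B) [Module.Finite F (ResidueField B)]
    (hsep : HasSimpleRoots F (ResidueField B)) :
    ∃ φ : D →+* S, (∀ x : F, φ (algebraMap F D x) = algebraMap B S (algebraMap F B x)) ∧
      φ.Finite ∧ φ.Etale := by
  have hDc := hD.complete
  have hSc := hS.complete
  have hDmax := hD.isMaximal
  have hSmax := hS.isMaximal
  have hDloc := hD.isLocalRing
  have hSloc := hS.isLocalRing
  have hDm := hD.maximalIdeal_eq
  have hSm := hS.maximalIdeal_eq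
  obtain ⟨φ, hφ⟩ := hD.exists_lift ((maximalIdeal B).map (algebraMap B S))
    ((algebraMap B S).comp (algebraMap F B)) (by
      rw [← Ideal.map_le_iff_le_comap, ← Ideal.map_map, hQ])
  refine ⟨φ, hφ, ?_⟩
  let : Algebra D S := φ.toAlgebra
  have hmapDS : (Q.map (algebraMap F D)).map (algebraMap D S) =
      (maximalIdeal B).map (algebraMap B S) := by
    rw [Ideal.map_map, ← hQ, Ideal.map_map]
    congr 1
    ext x
    exact hφ x
  let K := ResidueField B
  let : Field (F ⧸ Q) := Ideal.Quotient.field Q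
  have hQK : ∀ q ∈ Q, algebraMap F K q = 0 := by
    intro q hq
    rw [IsScalarTower.algebraMap_apply F B K]
    refine (residue_eq_zero_iff _).mpr ?_
    rw [← hQ]; exact Ideal.mem_map_of_mem _ hq
  let algQK : Algebra (F ⧸ Q) K := (Ideal.Quotient.lift Q (algebraMap F K) hQK).toAlgebra
  have : IsScalarTower F (F ⧸ Q) K := IsScalarTower.of_algebraMap_eq (fun x ↦ rfl)
  have : Module.Finite (F ⧸ Q) K := Module.Finite.of_restrictScalars_finite F (F ⧸ Q) K
  let bas := Module.finBasis (F ⧸ Q) K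
  let d := Module.finrank (F ⧸ Q) K
  choose v hv using fun i : Fin d ↦ residue_surjective (bas i)
  have hvLI : ∀ f : Fin d → F, ∑ i, algebraMap F K (f i) * algebraMap B K (v i) = 0 →
      ∀ i, f i ∈ Q := by
    intro f hf i
    have := (Fintype.linearIndependent_iff.mp bas.linearIndependent)
      (fun i ↦ Ideal.Quotient.mk Q (f i)) (by
        rw [← hf]
        refine Finset.sum_congr rfl fun i _ ↦ ?_
        rw [Algebra.smul_def, ← hv i]; rfl) i
    exact Ideal.Quotient.eq_zero_iff_mem.mp this
  have hspan : ∀ b : B, ∃ f : Fin d → F, b - ∑ i, algebraMap F B (f i) * v i ∈ maximalIdeal B := by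
    intro b
    choose f hf using fun i : Fin d ↦ Ideal.Quotient.mk_surjective (bas.repr (residue B b) i)
    refine ⟨f, ?_⟩
    rw [← residue_eq_zero_iff, map_sub, sub_eq_zero]
    conv_lhs => rw [← bas.sum_repr (residue B b)]
    rw [map_sum]
    refine Finset.sum_congr rfl fun i _ ↦ ?_
    rw [map_mul, hv, ← hf i, Algebra.smul_def]
    rfl
  let Ψ : (Fin d → D) →ₗ[D] S := Fintype.linearCombination D (fun i ↦ algebraMap B S (v i))
  have hΨ : ∀ x, Ψ x = ∑ i, φ (x i) * algebraMap B S (v i) := by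
    intro x
    simp only [Ψ, Fintype.linearCombination_apply, Algebra.smul_def]
    rfl
  have hHaus : IsHausdorff (Q.map (algebraMap F D)) S := by
    rw [← IsHausdorff.map_algebraMap_iff (S := S), hmapDS]
    infer_instance
  have : IsAdicComplete (Q.map (algebraMap F D)) (Fin d → D) := isAdicComplete_of_finite _ _
  have hΨsurj : Function.Surjective Ψ := by
    refine surjective_of_mkQ_comp_surjective (I := Q.map (algebraMap F D)) ?_
    intro y
    obtain ⟨s, rfl⟩ := Submodule.Quotient.mk_surjective _ y
    obtain ⟨b, hb⟩ := hS.surj s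
    obtain ⟨f, hf⟩ := hspan b
    refine ⟨fun i ↦ algebraMap F D (f i), ?_⟩
    symm
    change Submodule.Quotient.mk s = Submodule.Quotient.mk (Ψ _)
    rw [Submodule.Quotient.eq, Ideal.smul_top_eq_map, hmapDS]
    change s - Ψ _ ∈ Ideal.map _ _
    have h1 := add_mem hb (Ideal.mem_map_of_mem (algebraMap B S) hf)
    convert h1 using 1
    rw [hΨ, map_sub, map_sum]
    simp only [hφ, map_mul, RingHom.comp_apply]
    ring
  have hΨinj : Function.Injective Ψ := by
    rw [injective_iff_map_eq_zero]
    intro x hx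
    ext i
    refine (IsHausdorff.eq_iff_smodEq (I := Q.map (algebraMap F D))).mpr fun n ↦ ?_
    rw [SModEq.sub_mem, smul_eq_mul, Ideal.mul_top, Pi.zero_apply, sub_zero]
    choose f hf using fun i ↦ hD.surj_pow n (x i)
    have h1 : ∑ i, algebraMap F B (f i) * v i ∈ (Q.map (algebraMap F B)) ^ n := by
      rw [hQ]
      refine hS.inj n _ ?_
      have h2 : algebraMap B S (∑ i, algebraMap F B (f i) * v i) =
          - ∑ i, φ (x i - algebraMap F D (f i)) * algebraMap B S (v i) := by
        rw [eq_neg_iff_add_eq_zero, map_sum, ← Finset.sum_add_distrib, ← hx, hΨ]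
        refine Finset.sum_congr rfl fun i _ ↦ ?_
        rw [map_sub, hφ, map_mul, RingHom.comp_apply]
        ring
      rw [h2, neg_mem_iff]
      refine Ideal.sum_mem _ fun i _ ↦ Ideal.mul_mem_right _ _ ?_
      rw [← hmapDS, ← Ideal.map_pow]
      exact Ideal.mem_map_of_mem φ (hf i)
    have h2 := mem_pow_of_sum_mem Q v hQK hvLI n f h1 i
    have h3 := Ideal.mem_map_of_mem (algebraMap F D) h2
    rw [Ideal.map_pow] at h3
    have := add_mem (hf i) h3
    rwa [sub_add_cancel] at this
  let e : (Fin d → D) ≃ₗ[D] S := LinearEquiv.ofBijective Ψ ⟨hΨinj, hΨsurj⟩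
  have hfin : Module.Finite D S := Module.Finite.equiv e
  have hflat : Module.Flat D S := Module.Flat.of_linearEquiv e.symm
  have hlocal : IsLocalHom (algebraMap D S) := by
    refine ((local_hom_TFAE (algebraMap D S)).out 0 2).mpr ?_
    rw [hDm, hmapDS, hSm]
  have : Algebra.IsSeparable (ResidueField D) (ResidueField S) := by
    refine HasSimpleRoots.isSeparable ?_
    let a : F →+* ResidueField D := (residue D).comp (algebraMap F D)
    let b₀ : B →+* ResidueField S := (residue S).comp (algebraMap B S)
    have hb₀ : ∀ x ∈ maximalIdeal B, b₀ x = 0 := by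
      intro x hx
      refine (residue_eq_zero_iff _).mpr ?_
      rw [hSm]; exact Ideal.mem_map_of_mem _ hx
    let b : K →+* ResidueField S := Ideal.Quotient.lift _ b₀ hb₀
    refine hsep.of_ringHom a b ⟨b.injective, ?_⟩ ?_
    · intro y
      obtain ⟨s, rfl⟩ := residue_surjective y
      obtain ⟨x, hx⟩ := hS.surj s
      refine ⟨residue B x, ?_⟩
      change residue S (algebraMap B S x) = _
      symm
      rw [← sub_eq_zero, ← map_sub, residue_eq_zero_iff, hSm]
      exact hx
    · intro x
      change residue S (algebraMap B S (algebraMap F B x)) = residue S (φ (algebraMap F D x))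
      rw [hφ]; rfl
  have : Algebra.FormallyUnramified D S :=
    Algebra.FormallyUnramified.of_map_maximalIdeal (by rw [hDm, hmapDS, hSm])
  have : Algebra.FinitePresentation D S := Algebra.FinitePresentation.of_finiteType.mp inferInstance
  exact ⟨hfin, Algebra.Etale.of_formallyUnramified_of_flat⟩

end FiniteEtale

end SemistableProduct

namespace SemistableProduct

open IsLocalRing TensorProduct

/-! ### Embedding finite étale local algebras in power series rings. -/

section EtaleOverPowerSeries

theorem MvPowerSeries_span_X_le_ker {σ : Type} {κ : Type u} [Field κ] :
    Ideal.span (Set.range (MvPowerSeries.X (σ := σ) (R := κ))) ≤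
      RingHom.ker (MvPowerSeries.constantCoeff (σ := σ) (R := κ)) := by
  rw [Ideal.span_le]
  rintro _ ⟨i, rfl⟩
  exact MvPowerSeries.constantCoeff_X i

theorem MvPowerSeries_sub_C_mem {σ : Type} [Finite σ] {κ : Type u} [Field κ]
    (x : MvPowerSeries σ κ) : x - MvPowerSeries.C (MvPowerSeries.constantCoeff x) ∈
      Ideal.span (Set.range (MvPowerSeries.X (σ := σ) (R := κ))) := by
  set J := Ideal.span (Set.range (MvPowerSeries.X (σ := σ) (R := κ))) with hJ
  obtain ⟨p, hp⟩ := (isCompletion_mvPowerSeries σ κ).surj x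
  have hmap : (MvPolynomial.idealOfVars σ κ).map (algebraMap _ (MvPowerSeries σ κ)) = J := by
    rw [MvPolynomial.idealOfVars, Ideal.map_span, ← Set.range_comp]
    congr 2
    ext i : 1
    exact MvPolynomial.coe_X i
  rw [hmap] at hp
  have h3 := MvPowerSeries_span_X_le_ker hp
  rw [RingHom.mem_ker, map_sub, sub_eq_zero] at h3
  rw [h3]
  have h5 : p - MvPolynomial.C (MvPolynomial.constantCoeff p) ∈ MvPolynomial.idealOfVars σ κ := by
    rw [MvPolynomial.idealOfVars]
    have := MvPolynomial.mem_ideal_span_X_image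
      (x := p - MvPolynomial.C (MvPolynomial.constantCoeff p)) (s := Set.univ)
    rw [Set.image_univ] at this
    rw [this]
    intro m hm
    by_contra hcon
    push Not at hcon
    have : m = 0 := by ext i; exact hcon i trivial
    subst this
    rw [MvPolynomial.mem_support_iff] at hm
    exact hm (by simp [MvPolynomial.constantCoeff_eq])
  have h6 := Ideal.mem_map_of_mem (algebraMap _ (MvPowerSeries σ κ)) h5
  rw [hmap, map_sub] at h6
  have h7 : algebraMap (MvPolynomial σ κ) (MvPowerSeries σ κ)
      (MvPolynomial.C (MvPolynomial.constantCoeff p)) =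
      MvPowerSeries.C (MvPowerSeries.constantCoeff
        (algebraMap (MvPolynomial σ κ) (MvPowerSeries σ κ) p)) := by
    change ((MvPolynomial.C (MvPolynomial.constantCoeff p) : MvPolynomial σ κ) :
      MvPowerSeries σ κ) = _
    rw [MvPolynomial.coe_C]
    rfl
  have h8 := add_mem hp h6
  rw [sub_add_sub_cancel, h7] at h8
  exact h8

/-- A finite étale local algebra over a complete local ring `D` embeds in a power series ring over
its residue field, provided that `D` maps to it. -/
theorem exists_injective_mvPowerSeries {D S : Type u} {σ : Type} [Finite σ] [CommRing D]
    [IsLocalRing D] [IsNoetherianRing D] [CommRing S] [IsLocalRing S] [Algebra D S]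
    [Module.Finite D S] [Algebra.Etale D S] (x : σ → D)
    (hx : maximalIdeal D = Ideal.span (Set.range x)) (τ : D →+* MvPowerSeries σ (ResidueField S))
    (hτ : ∀ i, τ (x i) = MvPowerSeries.X i)
    (hτ0 : ∀ d, MvPowerSeries.constantCoeff (τ d) = residue S (algebraMap D S d)) :
    ∃ ψ : S →+* MvPowerSeries σ (ResidueField S), Function.Injective ψ ∧
      ∀ d, ψ (algebraMap D S d) = τ d := by
  let κ := ResidueField S
  let T := MvPowerSeries σ κ
  let J : Ideal T := Ideal.span (Set.range (MvPowerSeries.X (R := κ)))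
  let algDT : Algebra D T := τ.toAlgebra
  have hnoeth : IsNoetherianRing S := IsNoetherianRing.of_finite D S
  have hint : Algebra.IsIntegral D S := inferInstance
  have hlocal : IsLocalHom (algebraMap D S) := by
    refine ((local_hom_TFAE (algebraMap D S)).out 0 4).mpr ?_
    have h1 : ((maximalIdeal S).comap (algebraMap D S)).IsMaximal :=
      Ideal.isMaximal_comap_of_isIntegral_of_isMaximal (R := D) (maximalIdeal S)
    exact eq_maximalIdeal h1
  have hmS : maximalIdeal S = Ideal.span (Set.range fun i ↦ algebraMap D S (x i)) := by
    rw [← Algebra.FormallyUnramified.map_maximalIdeal (R := D) (S := S), hx, Ideal.map_span,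
      ← Set.range_comp]
    rfl
  let r₀ : S →+* T ⧸ J := (Ideal.Quotient.mk J).comp ((MvPowerSeries.C).comp (residue S))
  let r : S →ₐ[D] T ⧸ J := AlgHom.mk r₀ (by
    intro d
    change Ideal.Quotient.mk J (MvPowerSeries.C (residue S (algebraMap D S d))) =
      Ideal.Quotient.mk J (τ d)
    rw [← hτ0, eq_comm, Ideal.Quotient.eq]
    exact MvPowerSeries_sub_C_mem _)
  -- Formal smoothness lifts the residue map of `S`, viewed with values in T/J, to the complete ring
  -- `T`.
  obtain ⟨ψ, hψ⟩ := Algebra.FormallySmooth.exists_mkₐ_comp_eq_of_isAdicComplete r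
  have hψ0 : ∀ s, MvPowerSeries.constantCoeff (ψ s) = residue S s := by
    intro s
    have h1 : Ideal.Quotient.mk J (ψ s) = Ideal.Quotient.mk J (MvPowerSeries.C (residue S s)) :=
      DFunLike.congr_fun hψ s
    rw [Ideal.Quotient.eq] at h1
    have h2 := MvPowerSeries_span_X_le_ker h1
    rw [RingHom.mem_ker, map_sub, sub_eq_zero] at h2
    rw [h2, MvPowerSeries.constantCoeff_C]
  have hψX : ∀ i, ψ (algebraMap D S (x i)) = MvPowerSeries.X i := by
    intro i
    rw [ψ.commutes]
    exact hτ i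
  have hinj : Function.Injective ψ := by
    rw [injective_iff_map_eq_zero]
    intro s hs
    -- Comparison of initial forms: write an element of the kernel as a form of degree n in the
    -- parameters. The degree n part of its image has the residues of the coefficients as
    -- coefficients, so these residues vanish and the element lies in the next power.
    have hmem : ∀ n, s ∈ maximalIdeal S ^ n := by
      intro n
      induction n with
      | zero => simp
      | succ n ih =>
        rw [hmS, Ideal.mem_span_pow_iff_exists_isHomogeneous] at ih
        obtain ⟨p, hp, rfl⟩ := ih
        have h1 : ∀ m ∈ p.support, p.coeff m ∈ maximalIdeal S := by
          intro m hm
          rw [← residue_eq_zero_iff, ← hψ0]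
          have h2 : ∀ q : MvPolynomial σ S, ψ (MvPolynomial.eval
              (fun i ↦ algebraMap D S (x i)) q) =
              ∑ m ∈ q.support, ψ (q.coeff m) * MvPowerSeries.monomial m 1 := by
            intro q
            rw [MvPolynomial.eval_eq, map_sum]
            refine Finset.sum_congr rfl fun m _ ↦ ?_
            rw [map_mul, map_prod]
            simp only [map_pow, hψX]
            congr 1
            rw [MvPowerSeries.monomial_eq']
            simp [Finsupp.prod]
          rw [h2] at hs
          have h3 := congr_arg (MvPowerSeries.coeff m) hs
          rw [map_sum, map_zero, Finset.sum_eq_single m] at h3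
          · rw [MvPowerSeries.coeff_mul_monomial] at h3
            simpa using h3
          · intro m' hm' hne
            rw [MvPowerSeries.coeff_mul_monomial, if_neg]
            intro hle
            apply hne
            have hd := hp (MvPolynomial.mem_support_iff.mp hm)
            have hd' := hp (MvPolynomial.mem_support_iff.mp hm')
            obtain ⟨c, rfl⟩ := le_iff_exists_add.mp hle
            rw [map_add, hd'] at hd
            have hc : Finsupp.weight 1 c = 0 := by omega
            have : c = 0 := by
              change Finsupp.weight (fun _ ↦ 1) c = 0 at hc
              rw [← Finsupp.degree_eq_weight_one] at hc
              exact (Finsupp.degree_eq_zero_iff c).mp hc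
            rw [this, add_zero]
          · intro h; exact absurd hm h
        rw [MvPolynomial.eval_eq, pow_succ']
        refine Ideal.sum_mem _ fun m hm ↦ Ideal.mul_mem_mul (h1 m hm) ?_
        have hd := hp (MvPolynomial.mem_support_iff.mp hm)
        have hd2 : ∑ i ∈ m.support, m i = n := by
          rw [← hd]
          change _ = Finsupp.weight (fun _ ↦ 1) m
          rw [← Finsupp.degree_eq_weight_one]; rfl
        rw [← hd2, ← Finset.prod_pow_eq_pow_sum]
        refine Ideal.prod_mem_prod fun i _ ↦ Ideal.pow_mem_pow ?_ _
        rw [hmS]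
        exact Ideal.subset_span ⟨i, rfl⟩
    have h0 := Ideal.iInf_pow_eq_bot_of_isLocalRing (maximalIdeal S) (Ideal.IsPrime.ne_top')
    have : s ∈ ⨅ n, maximalIdeal S ^ n := by
      rw [Ideal.mem_iInf]; exact hmem
    rw [h0] at this
    exact this
  exact ⟨ψ.toRingHom, hinj, fun d ↦ ψ.commutes d⟩

/-- The map out of `D` needed above is produced from a map out of `F` by the universal property of
the completion, so it suffices to prescribe it on uncompleted coordinates. -/
theorem exists_injective_mvPowerSeries_of_isCompletion {F D S : Type u} {σ : Type} [Finite σ]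
    [CommRing F] [CommRing D] [Algebra F D] [IsNoetherianRing D] [CommRing S] [IsLocalRing S]
    [Algebra D S] [Module.Finite D S] [Algebra.Etale D S] (Q : Ideal F) [Q.IsMaximal]
    (hD : IsCompletion Q D) (x : σ → F) (hx : Q = Ideal.span (Set.range x))
    (g : F →+* MvPowerSeries σ (ResidueField S)) (hg : ∀ i, g (x i) = MvPowerSeries.X i)
    (hg0 : ∀ a, MvPowerSeries.constantCoeff (g a) = residue S (algebraMap D S (algebraMap F D a))) :
    ∃ ψ : S →+* MvPowerSeries σ (ResidueField S), Function.Injective ψ ∧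
      ∀ a, ψ (algebraMap D S (algebraMap F D a)) = g a := by
  have hDloc := hD.isLocalRing
  have hDm : maximalIdeal D = Ideal.span (Set.range fun i ↦ algebraMap F D (x i)) := by
    rw [hD.maximalIdeal_eq, hx, Ideal.map_span, ← Set.range_comp]
    rfl
  have hcomp : IsAdicComplete (Ideal.span (Set.range
      (MvPowerSeries.X (σ := σ) (R := ResidueField S)))) (MvPowerSeries σ (ResidueField S)) :=
    inferInstance
  obtain ⟨τ, hτ⟩ := hD.exists_lift (Ideal.span (Set.range
      (MvPowerSeries.X (σ := σ) (R := ResidueField S)))) g (by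
    rw [hx, Ideal.span_le]
    rintro _ ⟨i, rfl⟩
    rw [SetLike.mem_coe, Ideal.mem_comap, hg]
    exact Ideal.subset_span ⟨i, rfl⟩)
  have hint : Algebra.IsIntegral D S := inferInstance
  have hlocal : IsLocalHom (algebraMap D S) := by
    refine ((local_hom_TFAE (algebraMap D S)).out 0 4).mpr ?_
    have h1 : ((maximalIdeal S).comap (algebraMap D S)).IsMaximal :=
      Ideal.isMaximal_comap_of_isIntegral_of_isMaximal (R := D) (maximalIdeal S)
    exact eq_maximalIdeal h1
  obtain ⟨ψ, hψ, hψ'⟩ := exists_injective_mvPowerSeries (S := S) (fun i ↦ algebraMap F D (x i)) hDm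
    τ (fun i ↦ by rw [hτ, hg]) (by
    intro d
    obtain ⟨f, hf⟩ := hD.surj d
    rw [← hD.maximalIdeal_eq] at hf
    have h1 : residue S (algebraMap D S (d - algebraMap F D f)) = 0 := by
      rw [residue_eq_zero_iff, mem_maximalIdeal, mem_nonunits_iff]
      intro hu
      exact hf (isUnit_of_map_unit (algebraMap D S) _ hu)
    have h2 : MvPowerSeries.constantCoeff (τ (d - algebraMap F D f)) = 0 := by
      have h3 : (maximalIdeal D).map τ ≤ RingHom.ker MvPowerSeries.constantCoeff := by
        rw [hDm, Ideal.map_span, Ideal.span_le]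
        rintro _ ⟨_, ⟨i, rfl⟩, rfl⟩
        rw [hτ, hg]
        exact MvPowerSeries.constantCoeff_X i
      exact h3 (Ideal.mem_map_of_mem τ hf)
    rw [map_sub, map_sub, sub_eq_zero] at h1
    rw [map_sub, map_sub, sub_eq_zero] at h2
    rw [h1, h2, hτ, hg0])
  exact ⟨ψ, hψ, fun a ↦ by rw [hψ', hτ]⟩

end EtaleOverPowerSeries

/-! ### Étale coordinates at a point of a smooth algebra. -/

section EtaleCoordinates

open KaehlerDifferential

/-- The Jacobi–Zariski sequence of E → F → B: surjectivity kills the differentials of `B` over `F`,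
and injectivity, together with the vanishing of H₁ of the cotangent complex of `B` over `E`, kills
H₁ over `F`. -/
theorem formallyEtale_of_bijective_mapBaseChange {E F B : Type u} [CommRing E] [CommRing F]
    [CommRing B] [Algebra E F] [Algebra F B] [Algebra E B] [IsScalarTower E F B]
    [Algebra.FormallySmooth E B] (h : Function.Bijective (mapBaseChange E F B)) :
    Algebra.FormallyEtale F B := by
  constructor
  · refine ⟨fun x y ↦ ?_⟩
    have : ∀ x : Ω[B⁄F], x = 0 := by
      intro x
      obtain ⟨y, rfl⟩ := KaehlerDifferential.map_surjective_of_surjective E F B B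
        (Function.surjective_id) x
      obtain ⟨z, rfl⟩ := h.2 y
      exact (exact_mapBaseChange_map E F B).apply_apply_eq_zero z
    rw [this x, this y]
  · refine ⟨fun x y ↦ ?_⟩
    have : ∀ x : Algebra.H1Cotangent F B, x = 0 := by
      intro x
      have h1 : Algebra.H1Cotangent.δ E F B x = 0 := by
        apply h.1
        rw [map_zero]
        exact (Algebra.H1Cotangent.exact_δ_mapBaseChange E F B).apply_apply_eq_zero x
      obtain ⟨y, rfl⟩ := (Algebra.H1Cotangent.exact_map_δ E F B x).mp h1
      rw [Subsingleton.elim y 0, map_zero]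
    rw [this x, this y]

-- If f(a) ∈ P and f'(a) ∉ P, then d(f(a)) = f'(a) da with f'(a) invertible at `P`, so da is a
-- multiple of the differential of an element of `P`. Separability thus allows all parameters to be
-- taken inside `P`.
open Polynomial in
theorem span_D_eq_top {E A B : Type u} [CommRing E] [CommRing A] [CommRing B] [Algebra E A]
    [Algebra A B] [Algebra E B] [IsScalarTower E A B] (P : Ideal A) [P.IsPrime]
    [IsLocalization.AtPrime B P] (hsep : HasSimpleRoots E (A ⧸ P)) :
    Submodule.span B (Set.range fun p : P ↦ D E B (algebraMap A B p)) = ⊤ := by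
  rw [eq_top_iff, ← span_range_map_derivation_of_isLocalization E A B P.primeCompl,
    Submodule.span_le]
  rintro _ ⟨a, rfl⟩
  obtain ⟨f, hf, hf'⟩ := hsep (Ideal.Quotient.mk P a)
  have key : ∀ g : E[X], aeval (Ideal.Quotient.mk P a) g = Ideal.Quotient.mk P (aeval a g) := by
    intro g
    exact aeval_algHom_apply (Ideal.Quotient.mkₐ E P) a g
  rw [key] at hf hf'
  have h1 : aeval a f ∈ P := Ideal.Quotient.eq_zero_iff_mem.mp hf
  have h2 : aeval a (derivative f) ∉ P := fun h ↦ hf' (Ideal.Quotient.eq_zero_iff_mem.mpr h)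
  have hu : IsUnit (algebraMap A B (aeval a (derivative f))) :=
    IsLocalization.map_units B (⟨_, h2⟩ : P.primeCompl)
  have h3 : D E B (algebraMap A B (aeval a f)) =
      algebraMap A B (aeval a (derivative f)) • D E B (algebraMap A B a) := by
    rw [← aeval_algebraMap_apply, Derivation.map_aeval, aeval_algebraMap_apply]
  rw [Function.comp_apply, map_D]
  have h4 : D E B (algebraMap A B a) = hu.unit⁻¹.val • D E B (algebraMap A B (aeval a f)) := by
    rw [h3, ← mul_smul, IsUnit.val_inv_mul, one_smul]
  rw [h4]
  exact Submodule.smul_mem _ _ (Submodule.subset_span ⟨⟨_, h1⟩, rfl⟩)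

/-- Elements of `P` whose differentials form a basis of the differentials at `P` define a map from a
polynomial ring that is étale at `P`. Flatness and the equality of ideals are the two consequences
of étaleness that are used later. -/
theorem exists_etale_coordinates {E A B : Type u} [CommRing E] [CommRing A] [CommRing B]
    [Algebra E A] [Algebra A B] [Algebra.Smooth E A] (P : Ideal A) [P.IsPrime]
    [IsLocalization.AtPrime B P] (hsep : HasSimpleRoots E (A ⧸ P)) :
    ∃ (d : ℕ) (s : Fin d → A), (∀ i, s i ∈ P) ∧
      (((algebraMap A B).comp (MvPolynomial.aeval (R := E) s).toRingHom).Flat) ∧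
      (P.comap (MvPolynomial.aeval (R := E) s).toRingHom).map
        ((algebraMap A B).comp (MvPolynomial.aeval (R := E) s).toRingHom) =
        P.map (algebraMap A B) := by
  let B₀ := Localization.AtPrime P
  have hsm : Algebra.FormallySmooth E B₀ := Algebra.FormallySmooth.comp E A B₀
  have hess : Algebra.EssFiniteType E B₀ := Algebra.EssFiniteType.comp E A B₀
  have hfp : Module.FinitePresentation B₀ Ω[B₀⁄E] := Module.finitePresentation_of_projective _ _
  -- Over a local ring a generating family of a finite free module contains a basis.
  obtain ⟨κ, a, b, hb⟩ := Module.exists_basis_of_span_of_flat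
    (fun p : P ↦ D E B₀ (algebraMap A B₀ p)) (span_D_eq_top P hsep)
  have hκ : Finite κ := Module.Finite.finite_basis b
  obtain ⟨d, ⟨e⟩⟩ := Finite.exists_equiv_fin κ
  let s : Fin d → A := fun i ↦ a (e.symm i)
  refine ⟨d, s, fun i ↦ (a (e.symm i)).2, ?_⟩
  let F := MvPolynomial (Fin d) E
  let algFA : Algebra F A := (MvPolynomial.aeval (R := E) s).toRingHom.toAlgebra
  have tow1 : IsScalarTower E F A := IsScalarTower.of_algebraMap_eq (fun x ↦ by
    exact ((MvPolynomial.aeval (R := E) s).commutes x).symm)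
  have tow2 : IsScalarTower F A B₀ := inferInstance
  have tow3 : IsScalarTower E F B₀ := IsScalarTower.of_algebraMap_eq (fun x ↦ by
    rw [IsScalarTower.algebraMap_apply F A B₀, ← IsScalarTower.algebraMap_apply E F A,
      ← IsScalarTower.algebraMap_apply E A B₀])
  have hX : ∀ i, algebraMap F A (MvPolynomial.X i) = s i := fun i ↦ MvPolynomial.aeval_X s i
  have het : Algebra.FormallyEtale F B₀ := by
    refine formallyEtale_of_bijective_mapBaseChange (E := E) ?_
    let b₁ := (mvPolynomialBasis E (Fin d)).baseChange B₀
    let b₂ := b.reindex e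
    have : (mapBaseChange E F B₀) = (b₁.equiv b₂ (Equiv.refl _)).toLinearMap := by
      refine b₁.ext fun i ↦ ?_
      rw [LinearEquiv.coe_coe, Module.Basis.equiv_apply]
      simp only [b₁, b₂, Module.Basis.baseChange_apply, mvPolynomialBasis_apply,
        Module.Basis.reindex_apply, hb, Equiv.refl_apply]
      refine (mapBaseChange_tmul E F B₀ _ _).trans ?_
      rw [one_smul]
      refine (map_D E E F B₀ _).trans ?_
      rw [IsScalarTower.algebraMap_apply F A B₀, hX]
    rw [this]
    exact (b₁.equiv b₂ (Equiv.refl _)).bijective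
  have hfin : Algebra.FinitePresentation F A :=
    Algebra.FinitePresentation.of_restrict_scalars_finitePresentation E F A
  have hat : Algebra.IsEtaleAt F P := het
  have hBB : Algebra.FormallyUnramified F B₀ := inferInstance
  let σ : B₀ ≃ₐ[A] B := IsLocalization.algEquiv P.primeCompl B₀ B
  have hcompσ : (algebraMap A B).comp (algebraMap F A) =
      (σ : B₀ →+* B).comp (algebraMap F B₀) := by
    ext x
    · simp only [RingHom.comp_apply]; exact (σ.commutes _).symm
    · simp only [RingHom.comp_apply]; exact (σ.commutes _).symm
  constructor
  · obtain ⟨f, hf, hf'⟩ := Algebra.exists_etale_of_isEtaleAt (R := F) P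
    have h1 : Module.Flat F (Localization.Away f) := inferInstance
    have hunit : IsUnit (algebraMap A B f) := IsLocalization.map_units B (⟨f, hf⟩ : P.primeCompl)
    let alg : Algebra (Localization.Away f) B := (IsLocalization.Away.lift f hunit).toAlgebra
    have tow4 : IsScalarTower A (Localization.Away f) B :=
      IsScalarTower.of_algebraMap_eq (fun x ↦ (IsLocalization.Away.lift_eq f hunit x).symm)
    have hle : Submonoid.powers f ≤ P.primeCompl := by
      rw [Submonoid.powers_le]; exact hf
    have hloc := IsLocalization.isLocalization_of_submonoid_le (Localization.Away f) B
      (Submonoid.powers f) P.primeCompl hle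
    have h2 : Module.Flat (Localization.Away f) B := IsLocalization.flat B
      (P.primeCompl.map (algebraMap A (Localization.Away f)))
    have h3 : (algebraMap F (Localization.Away f)).Flat := by
      rw [RingHom.flat_algebraMap_iff]; exact h1
    have h4 : (algebraMap (Localization.Away f) B).Flat := by
      rw [RingHom.flat_algebraMap_iff]; exact h2
    have h5 := RingHom.Flat.comp h3 h4
    convert h5 using 1
    rw [IsScalarTower.algebraMap_eq F A (Localization.Away f), ← RingHom.comp_assoc,
      ← IsScalarTower.algebraMap_eq A]
    rfl
  · let p := P.comap (algebraMap F A)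
    have hp : p.IsPrime := Ideal.IsPrime.comap _
    have hlies : P.LiesOver p := ⟨rfl⟩
    let algpP := Localization.AtPrime.algebraOfLiesOver p P
    have h6 := ((Algebra.isUnramifiedAt_iff_map_eq F p P).mp (show Algebra.IsUnramifiedAt F P from hBB)).2
    change p.map ((algebraMap A B).comp (algebraMap F A)) = _
    rw [hcompσ, ← Ideal.map_map, h6, ← Localization.AtPrime.map_eq_maximalIdeal, Ideal.map_map]
    congr 1
    ext x
    exact σ.commutes x

end EtaleCoordinates

end SemistableProduct

namespace SemistableProduct

open IsLocalRing TensorProduct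

/-! ### Completed local rings of smooth algebras. -/

section SmoothCompletion

theorem residueField_quotient_bijective {A B : Type u} [CommRing A] [CommRing B] [IsLocalRing B]
    [Algebra A B] (P : Ideal A) [P.IsMaximal] [IsLocalization.AtPrime B P] :
    ∃ b : A ⧸ P →+* ResidueField B, Function.Bijective b ∧
      ∀ a, b (Ideal.Quotient.mk P a) = residue B (algebraMap A B a) := by
  let e := IsLocalization.AtPrime.equivQuotMaximalIdeal P B
  exact ⟨(e : A ⧸ P →+* B ⧸ maximalIdeal B), e.bijective, fun a ↦ IsLocalization.AtPrime.equivQuotMaximalIdeal_apply_mk P B a⟩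

/-- Completes the étale coordinates. The completion `D` of the polynomial ring is left arbitrary
because it is realized once as a power series ring over a field and once as `StdRing`. -/
theorem exists_finite_etale_of_smooth {E A B S : Type u} [CommRing E] [CommRing A] [CommRing B]
    [CommRing S] [Algebra E A] [Algebra A B] [Algebra B S] [Algebra.Smooth E A] (P : Ideal A)
    [P.IsMaximal] [IsLocalization.AtPrime B P] [IsLocalRing B] [Module.Finite E (A ⧸ P)]
    (hsep : HasSimpleRoots E (A ⧸ P)) (hS : IsCompletion (maximalIdeal B) S) :
    ∃ (d : ℕ) (s : Fin d → A), (∀ i, s i ∈ P) ∧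
      (P.comap (MvPolynomial.aeval (R := E) s).toRingHom).IsMaximal ∧
      ∀ (D : Type u) [CommRing D] [IsNoetherianRing D] [Algebra (MvPolynomial (Fin d) E) D],
        IsCompletion (P.comap (MvPolynomial.aeval (R := E) s).toRingHom) D →
        ∃ φ : D →+* S, (∀ x : MvPolynomial (Fin d) E, φ (algebraMap _ D x) =
          algebraMap B S (algebraMap A B (MvPolynomial.aeval s x))) ∧ φ.Finite ∧ φ.Etale := by
  obtain ⟨d, s, hs, hflat, hmap⟩ := exists_etale_coordinates (B := B) P hsep
  let F := MvPolynomial (Fin d) E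
  let h : F →+* A := (MvPolynomial.aeval (R := E) s).toRingHom
  obtain ⟨b, hb, hb'⟩ := residueField_quotient_bijective (B := B) P
  let algFA : Algebra F A := h.toAlgebra
  let algFB : Algebra F B := ((algebraMap A B).comp h).toAlgebra
  have tow : IsScalarTower E F A := IsScalarTower.of_algebraMap_eq (fun x ↦ by
    exact ((MvPolynomial.aeval (R := E) s).commutes x).symm)
  have tow' : IsScalarTower E F (A ⧸ P) := IsScalarTower.of_algebraMap_eq (fun x ↦ by
    rw [IsScalarTower.algebraMap_apply E A (A ⧸ P), IsScalarTower.algebraMap_apply E F A]; rfl)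
  have hfin : Module.Finite F (A ⧸ P) := Module.Finite.of_restrictScalars_finite E F (A ⧸ P)
  have hmax : (P.comap h).IsMaximal := by
    have hinj : Function.Injective (Ideal.quotientMap P h le_rfl) := Ideal.quotientMap_injective
    have hfin2 : (Ideal.quotientMap P h le_rfl : F ⧸ P.comap h →+* A ⧸ P).Finite := by
      refine RingHom.Finite.of_comp_finite (f := Ideal.Quotient.mk (P.comap h)) ?_
      have : (algebraMap F (A ⧸ P)).Finite := RingHom.finite_algebraMap.mpr hfin
      exact this
    have hint : (Ideal.quotientMap P h le_rfl : F ⧸ P.comap h →+* A ⧸ P).IsIntegral :=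
      hfin2.to_isIntegral
    rw [Ideal.Quotient.maximal_ideal_iff_isField_quotient]
    letI : Field (A ⧸ P) := Ideal.Quotient.field P
    algebraize [(Ideal.quotientMap P h le_rfl : F ⧸ P.comap h →+* A ⧸ P)]
    exact isField_of_isIntegral_of_isField hinj (Field.toIsField (A ⧸ P))
  have hcompat : ∀ x : F, b (algebraMap F (A ⧸ P) x) = algebraMap F (ResidueField B) x :=
    fun x ↦ hb' (h x)
  have hfinK : Module.Finite F (ResidueField B) := by
    rw [← RingHom.finite_algebraMap]
    have h1 : (b.comp (algebraMap F (A ⧸ P))).Finite :=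
      RingHom.Finite.comp (RingHom.Finite.of_surjective b hb.2) (RingHom.finite_algebraMap.mpr hfin)
    convert h1
    ext x
    · exact (hcompat _).symm
    · exact (hcompat _).symm
  have hflat' : Module.Flat F B := hflat
  have hsep' : HasSimpleRoots F (ResidueField B) := by
    refine hsep.of_ringHom (algebraMap E F) b hb fun x ↦ ?_
    rw [IsScalarTower.algebraMap_apply E F (A ⧸ P), hcompat]
  have hQ : (P.comap h).map (algebraMap F B) = maximalIdeal B := by
    change (P.comap h).map ((algebraMap A B).comp h) = _
    rw [hmap, IsLocalization.AtPrime.map_eq_maximalIdeal P B]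
  refine ⟨d, s, hs, hmax, fun D _ _ _ hD ↦ ?_⟩
  exact exists_finite_etale_of_isCompletion (P.comap h) hD hS hQ hsep'

/-- The coordinates lie in `P`, so `P` contracts to the ideal of the variables and `S` is finite
étale over a power series ring over `k`. It then embeds in a power series ring over its own residue
field. -/
theorem isDomain_of_smooth_of_isCompletion {k A B S : Type u} [Field k] [CommRing A] [CommRing B]
    [CommRing S] [Algebra k A] [Algebra A B] [Algebra B S] [Algebra.Smooth k A] (P : Ideal A)
    [P.IsMaximal] [IsLocalization.AtPrime B P] [IsLocalRing B] [Module.Finite k (A ⧸ P)]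
    (hsep : HasSimpleRoots k (A ⧸ P)) (hS : IsCompletion (maximalIdeal B) S) : IsDomain S := by
  obtain ⟨d, s, hs, hmax, H⟩ := exists_finite_etale_of_smooth (B := B) P hsep hS
  have hle : MvPolynomial.idealOfVars (Fin d) k ≤
      P.comap (MvPolynomial.aeval (R := k) s).toRingHom := by
    rw [MvPolynomial.idealOfVars, Ideal.span_le]
    rintro _ ⟨i, rfl⟩
    rw [SetLike.mem_coe, Ideal.mem_comap]
    change MvPolynomial.aeval s (MvPolynomial.X i) ∈ P
    rw [MvPolynomial.aeval_X]
    exact hs i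
  have hvars : MvPolynomial.idealOfVars (Fin d) k =
      RingHom.ker (MvPolynomial.constantCoeff (σ := Fin d) (R := k)) := by
    refine le_antisymm ?_ fun p hp ↦ ?_
    · rw [MvPolynomial.idealOfVars, Ideal.span_le]
      rintro _ ⟨i, rfl⟩
      exact MvPolynomial.constantCoeff_X _ i
    · rw [MvPolynomial.idealOfVars]
      have := MvPolynomial.mem_ideal_span_X_image (x := p) (s := Set.univ)
      rw [Set.image_univ] at this
      rw [this]
      intro m hm
      by_contra hcon
      push Not at hcon
      have : m = 0 := by ext i; exact hcon i trivial
      subst this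
      rw [MvPolynomial.mem_support_iff] at hm
      exact hm hp
  have hvmax : (MvPolynomial.idealOfVars (Fin d) k).IsMaximal := by
    rw [hvars]
    exact RingHom.ker_isMaximal_of_surjective _
      (fun y ↦ ⟨MvPolynomial.C y, MvPolynomial.constantCoeff_C _ y⟩)
  have heq := hvmax.eq_of_le hmax.ne_top hle
  have hD := isCompletion_mvPowerSeries (Fin d) k
  obtain ⟨φ, hφ, hfin, het⟩ := H (MvPowerSeries (Fin d) k) (heq ▸ hD)
  letI : Algebra (MvPowerSeries (Fin d) k) S := φ.toAlgebra
  have : Module.Finite (MvPowerSeries (Fin d) k) S := hfin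
  have : Algebra.Etale (MvPowerSeries (Fin d) k) S := het
  have hloc := hS.isLocalRing
  let ι : k →+* ResidueField S :=
    (residue S).comp ((algebraMap B S).comp ((algebraMap A B).comp (algebraMap k A)))
  obtain ⟨ψ, hψ, -⟩ := exists_injective_mvPowerSeries_of_isCompletion (S := S) _ hD
    MvPolynomial.X rfl (MvPolynomial.eval₂Hom ((MvPowerSeries.C).comp ι) MvPowerSeries.X)
    (fun i ↦ MvPolynomial.eval₂Hom_X' _ _ i) (by
    have h1 : ((MvPowerSeries.constantCoeff (σ := Fin d)).comp
        (MvPolynomial.eval₂Hom ((MvPowerSeries.C).comp ι) MvPowerSeries.X)) =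
        ((residue S).comp (algebraMap (MvPowerSeries (Fin d) k) S)).comp
          (algebraMap (MvPolynomial (Fin d) k) _) := by
      refine MvPolynomial.ringHom_ext (fun r ↦ ?_) (fun i ↦ ?_)
      · simp only [RingHom.comp_apply, MvPolynomial.coe_eval₂Hom, MvPolynomial.eval₂_C,
          MvPowerSeries.constantCoeff_C]
        change _ = residue S (φ (algebraMap _ _ _))
        rw [hφ, MvPolynomial.aeval_C]
        rfl
      · simp only [RingHom.comp_apply, MvPolynomial.coe_eval₂Hom, MvPolynomial.eval₂_X,
          MvPowerSeries.constantCoeff_X]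
        change _ = residue S (φ (algebraMap _ _ _))
        rw [hφ, MvPolynomial.aeval_X, eq_comm, residue_eq_zero_iff, hS.maximalIdeal_eq]
        refine Ideal.mem_map_of_mem _ ?_
        rw [← IsLocalization.AtPrime.map_eq_maximalIdeal P B]
        exact Ideal.mem_map_of_mem _ (hs i)
    exact fun a ↦ DFunLike.congr_fun h1 a)
  have hT : NoZeroDivisors (MvPowerSeries (Fin d) (ResidueField S)) := inferInstance
  have hT' : IsDomain (MvPowerSeries (Fin d) (ResidueField S)) := NoZeroDivisors.to_isDomain _
  exact hψ.isDomain ψ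

end SmoothCompletion

/-! ### Contraction of ideals from the completion. -/

section Contraction

theorem IsCompletion.injective {B S : Type u} [CommRing B] [CommRing S] [Algebra B S]
    [IsNoetherianRing B] {I : Ideal B} (h : IsCompletion I S) (hI : I ≤ Ideal.jacobson ⊥) :
    Function.Injective (algebraMap B S) := by
  rw [injective_iff_map_eq_zero]
  intro b hb
  have h1 := Ideal.iInf_pow_smul_eq_bot_of_le_jacobson (M := B) I hI
  have h2 : b ∈ (⨅ i : ℕ, I ^ i • (⊤ : Submodule B B)) := by
    rw [Submodule.mem_iInf]
    intro n
    rw [smul_eq_mul, Ideal.mul_top]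
    exact h.inj n b (by rw [hb]; exact zero_mem _)
  rw [h1] at h2
  exact h2

/-- Krull's intersection theorem in B/J, whose completion is S/JS. -/
theorem IsCompletion.comap_map {B S : Type u} [CommRing B] [IsLocalRing B] [CommRing S]
    [Algebra B S] [IsNoetherianRing B] [IsNoetherianRing S] (h : IsCompletion (maximalIdeal B) S)
    (J : Ideal B) : (J.map (algebraMap B S)).comap (algebraMap B S) = J := by
  refine le_antisymm (fun b hb ↦ ?_) Ideal.le_comap_map
  rcases eq_or_ne J ⊤ with rfl | hJ
  · trivial
  have h1 := h.quotient J
  have h2 : Nontrivial (B ⧸ J) := Ideal.Quotient.nontrivial_iff.mpr hJ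
  have h3 : IsLocalRing (B ⧸ J) := IsLocalRing.of_surjective' _ Ideal.Quotient.mk_surjective
  have h4 := h1.injective (by
    refine le_trans ?_ (IsLocalRing.maximalIdeal_le_jacobson _)
    refine IsLocalRing.le_maximalIdeal ?_
    intro htop
    have h5 : (1 : B ⧸ J) ∈ (maximalIdeal B).map (Ideal.Quotient.mk J) := htop ▸ trivial
    rw [← map_one (Ideal.Quotient.mk J), ← Ideal.mem_comap, Ideal.comap_map_of_surjective _
      Ideal.Quotient.mk_surjective, ← RingHom.ker_eq_comap_bot, Ideal.mk_ker,
      sup_eq_left.mpr (IsLocalRing.le_maximalIdeal hJ)] at h5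
    exact (Ideal.ne_top_iff_one _).mp (maximalIdeal.isMaximal B).ne_top h5)
  rw [Ideal.mem_comap] at hb
  have h6 : algebraMap (B ⧸ J) (S ⧸ J.map (algebraMap B S)) (Ideal.Quotient.mk J b) = 0 :=
    Ideal.Quotient.eq_zero_iff_mem.mpr hb
  rw [← map_zero (algebraMap (B ⧸ J) (S ⧸ J.map (algebraMap B S)))] at h6
  exact Ideal.Quotient.eq_zero_iff_mem.mp (h4 h6)

end Contraction

/-! ### Descent of flatness and étaleness. -/

section Descent

theorem flat_of_flat_of_faithfullyFlat (F B S : Type u) [CommRing F] [CommRing B] [CommRing S]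
    [Algebra F B] [Algebra B S] [Algebra F S] [IsScalarTower F B S] [Module.FaithfullyFlat B S]
    [Module.Flat F S] : Module.Flat F B := by
  rw [Module.Flat.iff_lTensor_preserves_injective_linearMap]
  intro N N' _ _ _ _ f hf
  have h1 : Function.Injective (LinearMap.lTensor S f) :=
    Module.Flat.lTensor_preserves_injective_linearMap f hf
  have h2 : Function.Injective (LinearMap.lTensor S (TensorProduct.AlgebraTensorModule.lTensor B B f)) := by
    have e1 := AlgebraTensorModule.cancelBaseChange F B B S N
    have e2 := AlgebraTensorModule.cancelBaseChange F B B S N'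
    have hcomm : ∀ x, (AlgebraTensorModule.cancelBaseChange F B B S N')
        (LinearMap.lTensor S (TensorProduct.AlgebraTensorModule.lTensor B B f) x) =
        LinearMap.lTensor S f (AlgebraTensorModule.cancelBaseChange F B B S N x) := by
      intro x
      induction x with
      | zero => simp
      | add x y hx hy => simp only [map_add, hx, hy]
      | tmul s y =>
        induction y with
        | zero => simp
        | add x y hx hy => simp only [TensorProduct.tmul_add, map_add, hx, hy]
        | tmul b n => simp
    intro x y hxy
    apply (AlgebraTensorModule.cancelBaseChange F B B S N).injective
    apply h1
    rw [← hcomm, ← hcomm, hxy]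
  have h3 := (Module.FaithfullyFlat.lTensor_injective_iff_injective B S _).mp h2
  exact h3

open Algebra in
attribute [local instance] FormallyEtale.of_formallyUnramified_of_field in
/-- Étaleness at a prime can be checked on the local ring. -/
theorem isEtaleAt_of_flat {F A : Type u} [CommRing F] [CommRing A] [Algebra F A]
    [Algebra.FinitePresentation F A] (q : Ideal A) [q.IsPrime]
    [Module.Flat F (Localization.AtPrime q)] (p : Ideal F) [p.IsPrime] [q.LiesOver p]
    (hmap : p.map (algebraMap F (Localization.AtPrime q)) = maximalIdeal _)
    (hsep : HasSimpleRoots F (ResidueField (Localization.AtPrime q))) : Algebra.IsEtaleAt F q := by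
  let Rp := Localization.AtPrime p
  let Sp := Localization (algebraMapSubmonoid A p.primeCompl)
  let Sq := Localization.AtPrime q
  let := Localization.AtPrime.algebraOfLiesOver p q
  let f : Sp →ₐ[A] Sq := IsLocalization.liftAlgHom (M := algebraMapSubmonoid A p.primeCompl)
        (f := Algebra.ofId _ _) (by
      rintro ⟨_, x, hx, rfl⟩
      simpa using! IsLocalization.map_units (M := q.primeCompl) Sq ⟨algebraMap _ _ x,
        by simp_all [q.over_def p]⟩)
  algebraize [f.toRingHom]
  have : IsScalarTower F Sp Sq := .to₁₃₄ _ A _ _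
  have : IsScalarTower Rp Sp Sq := .of_algebraMap_eq' <| by
    apply IsLocalization.ringHom_ext p.primeCompl
    simp only [RingHom.comp_assoc, ← IsScalarTower.algebraMap_eq]
  have : IsLocalization (algebraMapSubmonoid Sp q.primeCompl) Sq :=
    .isLocalization_of_submonoid_le _ _ (algebraMapSubmonoid A p.primeCompl) _
    (by rintro _ ⟨x, hx, rfl⟩; simp_all [q.over_def p])
  have : FinitePresentation Rp Sp := by
    have : Algebra.IsPushout F Rp A Sp :=
      .symm <| Algebra.isPushout_of_isLocalization p.primeCompl _ _ _
    exact .equiv (Algebra.IsPushout.equiv F Rp A Sp)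
  have : Module.Flat Rp Sq := (Module.flat_iff_of_isLocalization Rp p.primeCompl Sq).mpr inferInstance
  have : EssFiniteType Rp Sq := .of_comp F _ _
  have : IsLocalHom (algebraMap Rp Sq) := inferInstance
  have : Algebra.IsSeparable (ResidueField Rp) (ResidueField Sq) := by
    refine HasSimpleRoots.isSeparable (hsep.of_ringHom ((residue Rp).comp (algebraMap F Rp))
      (RingHom.id _) Function.bijective_id fun x ↦ ?_)
    change residue Sq (algebraMap F Sq x) = residue Sq (algebraMap Rp Sq (algebraMap F Rp x))
    rw [← IsScalarTower.algebraMap_apply F Rp Sq]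
  have : Algebra.FormallyUnramified Rp Sq := by
    refine FormallyUnramified.of_map_maximalIdeal ?_
    rw [← Localization.AtPrime.map_eq_maximalIdeal, Ideal.map_map,
      ← IsScalarTower.algebraMap_eq F Rp Sq]
    exact hmap
  -- For a flat map smoothness can be tested on the closed fibre, and this fibre is étale because it
  -- is unramified and essentially of finite type over a field.
  have : FormallySmooth (ResidueField Rp) (ResidueField Rp ⊗[Rp] Sq) := by
    have h1 : Algebra.FormallyUnramified (ResidueField Rp) (ResidueField Rp ⊗[Rp] Sq) := inferInstance
    have h2 : EssFiniteType (ResidueField Rp) (ResidueField Rp ⊗[Rp] Sq) := inferInstance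
    have h3 : Algebra.FormallyEtale (ResidueField Rp) (ResidueField Rp ⊗[Rp] Sq) := inferInstance
    infer_instance
  have hsm := FormallySmooth.of_formallySmooth_residueField_tensor
    (R := Rp) (S := Sq) (P := Sp) (algebraMapSubmonoid _ q.primeCompl)
  have : FormallyEtale Rp Sq := FormallyEtale.iff_formallyUnramified_and_formallySmooth.mpr
    ⟨inferInstance, inferInstance⟩
  exact FormallyEtale.comp F Rp Sq

end Descent

end SemistableProduct

namespace SemistableProduct

open IsLocalRing TensorProduct

/-! ### Residue fields and branches of a formal chart. -/

section FormalChart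

theorem isLocalHom_of_finite {D S : Type u} [CommRing D] [IsLocalRing D] [CommRing S]
    [IsLocalRing S] [Algebra D S] [Module.Finite D S] : IsLocalHom (algebraMap D S) := by
  refine ((local_hom_TFAE (algebraMap D S)).out 0 4).mpr ?_
  have h1 : ((maximalIdeal S).comap (algebraMap D S)).IsMaximal :=
    Ideal.isMaximal_comap_of_isIntegral_of_isMaximal (R := D) (maximalIdeal S)
  exact eq_maximalIdeal h1

theorem IsCompletion.residueField_bijective {B S : Type u} [CommRing B] [CommRing S] [Algebra B S]
    [IsLocalRing B] [IsLocalRing S] (hS : IsCompletion (maximalIdeal B) S) :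
    ∃ b : ResidueField B →+* ResidueField S, Function.Bijective b ∧
      ∀ x, b (residue B x) = residue S (algebraMap B S x) := by
  let b₀ : B →+* ResidueField S := (residue S).comp (algebraMap B S)
  have hSm := hS.maximalIdeal_eq
  have hb₀ : ∀ x ∈ maximalIdeal B, b₀ x = 0 := by
    intro x hx
    refine (residue_eq_zero_iff _).mpr ?_
    rw [hSm]; exact Ideal.mem_map_of_mem _ hx
  let b : ResidueField B →+* ResidueField S := Ideal.Quotient.lift _ b₀ hb₀
  refine ⟨b, ⟨b.injective, fun y ↦ ?_⟩, fun x ↦ rfl⟩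
  obtain ⟨s, rfl⟩ := residue_surjective y
  obtain ⟨x, hx⟩ := hS.surj s
  refine ⟨residue B x, ?_⟩
  change residue S (algebraMap B S x) = _
  symm
  rw [← sub_eq_zero, ← map_sub, residue_eq_zero_iff, hSm]
  exact hx

/-- The increasing chain of kernels of the iterates stabilizes. -/
theorem injective_of_surjective_ringHom {S : Type*} [CommRing S] [IsNoetherianRing S] (f : S →+* S)
    (hf : Function.Surjective f) : Function.Injective f := by
  let c : ℕ →o Ideal S := ⟨fun n ↦ RingHom.ker (f ^ n), monotone_nat_of_le_succ fun n x hx ↦ by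
    rw [RingHom.mem_ker] at hx ⊢
    rw [pow_succ', RingHom.mul_def, RingHom.comp_apply, hx, map_zero]⟩
  obtain ⟨n, hn⟩ := monotone_stabilizes_iff_noetherian.mpr ‹IsNoetherianRing S› c
  rw [injective_iff_map_eq_zero]
  intro x hx
  have hsurj : Function.Surjective (f ^ n) := by
    rw [RingHom.coe_pow]
    exact hf.iterate n
  obtain ⟨y, rfl⟩ := hsurj x
  have h1 : y ∈ c (n + 1) := by
    change (f ^ (n + 1)) y = 0
    rw [pow_succ', RingHom.mul_def, RingHom.comp_apply, hx]
  rw [← hn (n + 1) n.le_succ] at h1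
  exact h1

theorem finite_etale_quotient {D S : Type u} [CommRing D] [CommRing S] [Algebra D S]
    [Module.Finite D S] [Algebra.Etale D S] (J : Ideal D) :
    Module.Finite (D ⧸ J) (S ⧸ J.map (algebraMap D S)) ∧
      Algebra.Etale (D ⧸ J) (S ⧸ J.map (algebraMap D S)) :=
  ⟨Module.Finite.of_restrictScalars_finite D _ _,
    .of_equiv (Algebra.TensorProduct.quotIdealMapEquivQuotTensor S J).symm⟩

/-- A perturbation lemma: a map D → S' that agrees on residues with a finite étale one, and under
which the maximal ideal of `D` generates that of `S'`, is itself finite étale. Formal smoothness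
lifts the residue map to a `D`-algebra map S → S' congruent to `θ`. It is onto by completeness, and
one-to-one because followed by the inverse of `θ` it is a surjective endomorphism of a noetherian
ring. -/
theorem finite_etale_of_residue_eq {D S S' : Type u} [CommRing D] [IsLocalRing D]
    [IsNoetherianRing D] [IsAdicComplete (maximalIdeal D) D] [CommRing S] [CommRing S']
    [IsLocalRing S'] [Algebra D S] [Algebra D S'] [Module.Finite D S] [Algebra.Etale D S]
    (θ : S ≃+* S') [IsAdicComplete (maximalIdeal S') S']
    (hm : (maximalIdeal D).map (algebraMap D S') = maximalIdeal S')
    (hmod : ∀ d, residue S' (θ (algebraMap D S d)) = residue S' (algebraMap D S' d)) :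
    Module.Finite D S' ∧ Algebra.Etale D S' := by
  have hN : IsNoetherianRing S := IsNoetherianRing.of_finite D S
  let r : S →ₐ[D] S' ⧸ maximalIdeal S' :=
    AlgHom.mk ((Ideal.Quotient.mk (maximalIdeal S')).comp (θ : S →+* S')) (fun d ↦ hmod d)
  obtain ⟨e, he⟩ := Algebra.FormallySmooth.exists_mkₐ_comp_eq_of_isAdicComplete r
  have he' : ∀ s, e s - θ s ∈ maximalIdeal S' := by
    intro s
    rw [← Ideal.Quotient.eq]
    exact DFunLike.congr_fun he s
  have : IsAdicComplete (maximalIdeal D) S := isAdicComplete_of_finite _ _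
  have : IsHausdorff (maximalIdeal D) S' := by
    rw [← IsHausdorff.map_algebraMap_iff (S := S'), hm]
    infer_instance
  have hsurj : Function.Surjective e.toLinearMap := by
    refine surjective_of_mkQ_comp_surjective (I := maximalIdeal D) ?_
    intro y
    obtain ⟨s, rfl⟩ := Submodule.Quotient.mk_surjective _ y
    refine ⟨θ.symm s, ?_⟩
    change Submodule.Quotient.mk (e _) = Submodule.Quotient.mk s
    rw [Submodule.Quotient.eq, Ideal.smul_top_eq_map, hm]
    have := he' (θ.symm s)
    rwa [θ.apply_symm_apply] at this
  have hinj : Function.Injective e := by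
    have hs : Function.Surjective ((θ.symm : S' →+* S).comp e.toRingHom) :=
      θ.symm.surjective.comp hsurj
    have := injective_of_surjective_ringHom _ hs
    exact Function.Injective.of_comp this
  let E : S ≃ₐ[D] S' := AlgEquiv.ofBijective e ⟨hinj, hsurj⟩
  exact ⟨Module.Finite.equiv E.toLinearEquiv, Algebra.Etale.of_equiv E⟩

variable {R : Type u} [CommRing R] [IsLocalRing R] [IsNoetherianRing R] {ϖ : R} {n t : ℕ}
  {B S : Type u} [CommRing B] [IsLocalRing B] [CommRing S] [Algebra B S]

/-- `StdRing` has the residue field of `R`, and a finite étale map of local rings has a finite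
separable residue extension. -/
theorem residueField_of_formalChart [Algebra R B] [Algebra (StdRing ϖ n t) S]
    (hϖ : maximalIdeal R = Ideal.span {ϖ}) (ht : 1 ≤ t)
    (htn : t ≤ n) (hS : IsCompletion (maximalIdeal B) S) [Module.Finite (StdRing ϖ n t) S]
    [Algebra.Etale (StdRing ϖ n t) S]
    (hR : ∀ r : R, algebraMap (StdRing ϖ n t) S (Ideal.Quotient.mk _ (MvPowerSeries.C r)) =
      algebraMap B S (algebraMap R B r)) :
    HasSimpleRoots R (ResidueField B) ∧ Module.Finite R (ResidueField B) := by
  let D := StdRing ϖ n t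
  have hD := isCompletion_stdRing ϖ n t
  have hmax := StdPoly.isMaximal_origin ϖ n t hϖ ht htn
  have hDloc : IsLocalRing D := hD.isLocalRing
  have hSloc := hS.isLocalRing
  have hlocal : IsLocalHom (algebraMap D S) := isLocalHom_of_finite
  obtain ⟨b, hb, hb'⟩ := hS.residueField_bijective
  let be := RingEquiv.ofBijective b hb
  have hRD : Function.Surjective ((residue D).comp ((algebraMap (StdPoly ϖ n t) D).comp
      (algebraMap R (StdPoly ϖ n t)))) := by
    intro y
    obtain ⟨d, rfl⟩ := residue_surjective y
    obtain ⟨f, hf⟩ := hD.surj d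
    obtain ⟨r, hr⟩ := StdPoly.sub_algebraMap_mem ϖ n t f
    refine ⟨r, ?_⟩
    simp only [RingHom.comp_apply]
    symm
    rw [← sub_eq_zero, ← map_sub, residue_eq_zero_iff, hD.maximalIdeal_eq]
    have := add_mem hf (Ideal.mem_map_of_mem (algebraMap _ D) hr)
    rwa [map_sub, sub_add_sub_cancel] at this
  have hcompat : ∀ r, be.symm (algebraMap (ResidueField D) (ResidueField S)
      (residue D (algebraMap (StdPoly ϖ n t) D (algebraMap R (StdPoly ϖ n t) r)))) =
      algebraMap R (ResidueField B) r := by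
    intro r
    rw [RingEquiv.symm_apply_eq]
    change residue S (algebraMap D S _) = b (residue B (algebraMap R B r))
    rw [hb', ← hR]
    congr 2
    change algebraMap (StdPoly ϖ n t) D (Ideal.Quotient.mk _ (MvPolynomial.C r)) = _
    rw [StdPoly.algebraMap_mk, MvPolynomial.coe_C]
  constructor
  · have h1 : HasSimpleRoots (ResidueField D) (ResidueField S) := hasSimpleRoots_of_isSeparable
    have h2 : letI : Algebra (ResidueField D) (ResidueField B) :=
        ((be.symm : ResidueField S →+* ResidueField B).comp
          (algebraMap (ResidueField D) (ResidueField S))).toAlgebra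
        HasSimpleRoots (ResidueField D) (ResidueField B) := by
      letI : Algebra (ResidueField D) (ResidueField B) :=
        ((be.symm : ResidueField S →+* ResidueField B).comp
          (algebraMap (ResidueField D) (ResidueField S))).toAlgebra
      exact h1.of_ringHom (RingHom.id _) (be.symm : ResidueField S →+* ResidueField B)
        be.symm.bijective (fun x ↦ rfl)
    letI : Algebra (ResidueField D) (ResidueField B) :=
        ((be.symm : ResidueField S →+* ResidueField B).comp
          (algebraMap (ResidueField D) (ResidueField S))).toAlgebra
    exact h2.of_surjective _ hRD (fun r ↦ (hcompat r).symm)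
  · rw [← RingHom.finite_algebraMap]
    have h3 : ((be.symm : ResidueField S →+* ResidueField B).comp
        ((algebraMap (ResidueField D) (ResidueField S)).comp
        ((residue D).comp ((algebraMap (StdPoly ϖ n t) D).comp
          (algebraMap R (StdPoly ϖ n t)))))).Finite := by
      refine RingHom.Finite.comp (RingHom.Finite.of_surjective _ be.symm.surjective)
        (RingHom.Finite.comp ?_ (RingHom.Finite.of_surjective _ hRD))
      rw [RingHom.finite_algebraMap]
      infer_instance
    convert h3 using 1
    ext r
    exact (hcompat r).symm

/-- Modulo the `s`-th coordinate of a formal chart, the completed local ring embeds in a power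
series ring in the remaining coordinates. -/
theorem exists_ker_eq_span_of_formalChart (hϖ : maximalIdeal R = Ideal.span {ϖ}) (ht : 1 ≤ t)
    (htn : t ≤ n) {D : Type u} [CommRing D] [IsNoetherianRing D] [Algebra (StdPoly ϖ n t) D]
    (hD : IsCompletion (StdPoly.origin ϖ n t) D) [IsLocalRing S] [Algebra D S] [Module.Finite D S]
    [Algebra.Etale D S] (s : Fin n) (hs : (s : ℕ) < t) :
    ∃ (κ : Type u) (_ : Field κ) (ψ : S →+* MvPowerSeries {j : Fin n // j ≠ s} κ),
      RingHom.ker ψ = Ideal.span {algebraMap D S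
        (algebraMap (StdPoly ϖ n t) _ (StdPoly.x ϖ n t s))} ∧
      ∀ (j : Fin n) (hj : j ≠ s), ψ (algebraMap D S
        (algebraMap (StdPoly ϖ n t) _ (StdPoly.x ϖ n t j))) = MvPowerSeries.X ⟨j, hj⟩ := by
  let F := StdPoly ϖ n t
  have hϖ' : ϖ ∈ maximalIdeal R := hϖ ▸ Ideal.mem_span_singleton_self ϖ
  have hmax := StdPoly.isMaximal_origin ϖ n t hϖ ht htn
  have hDloc : IsLocalRing D := hD.isLocalRing
  have hlocal : IsLocalHom (algebraMap D S) := isLocalHom_of_finite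
  have hmem : ∀ j, StdPoly.x ϖ n t j ∈ StdPoly.origin ϖ n t := fun j ↦ by
    rw [StdPoly.origin_eq_span]; exact Ideal.subset_span ⟨j, rfl⟩
  let J : Ideal F := Ideal.span {StdPoly.x ϖ n t s}
  let JD : Ideal D := J.map (algebraMap F D)
  let JS : Ideal S := JD.map (algebraMap D S)
  have hJS : JS = Ideal.span {algebraMap D S (algebraMap F D (StdPoly.x ϖ n t s))} := by
    simp only [JS, JD, J, Ideal.map_span, Set.image_singleton]
  have hJle : J ≤ StdPoly.origin ϖ n t := by
    rw [Ideal.span_le, Set.singleton_subset_iff]; exact hmem s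
  have hJDm : JD ≤ maximalIdeal D := by
    rw [hD.maximalIdeal_eq]; exact Ideal.map_mono hJle
  have hJSm : JS ≤ maximalIdeal S :=
    (Ideal.map_mono hJDm).trans (((local_hom_TFAE (algebraMap D S)).out 0 2).mp hlocal)
  have hD' := hD.quotient J
  let F' := F ⧸ J
  let D' := D ⧸ JD
  let S' := S ⧸ JS
  have hnt : Nontrivial S' := Ideal.Quotient.nontrivial_iff.mpr
    (fun h ↦ (maximalIdeal.isMaximal S).ne_top (top_le_iff.mp (h ▸ hJSm)))
  have hS'loc : IsLocalRing S' := IsLocalRing.of_surjective' _ Ideal.Quotient.mk_surjective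
  have hfin : Module.Finite D' S' := (finite_etale_quotient JD).1
  have het : Algebra.Etale D' S' := (finite_etale_quotient JD).2
  let Q' : Ideal F' := (StdPoly.origin ϖ n t).map (Ideal.Quotient.mk J)
  have hQ'max : Q'.IsMaximal := by
    refine Ideal.IsMaximal.map_of_surjective_of_ker_le Ideal.Quotient.mk_surjective ?_
    rw [Ideal.mk_ker]; exact hJle
  let κ := ResidueField S'
  let σ := {j : Fin n // j ≠ s}
  let ι : R →+* κ := (residue S').comp ((Ideal.Quotient.mk JS).comp ((algebraMap D S).comp
    ((algebraMap F D).comp (algebraMap R F))))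
  have hmem0 : ∀ j, residue S' (Ideal.Quotient.mk JS (algebraMap D S (algebraMap F D
      (StdPoly.x ϖ n t j)))) = 0 := by
    intro j
    have h1 : algebraMap F D (StdPoly.x ϖ n t j) ∈ maximalIdeal D := by
      rw [hD.maximalIdeal_eq]; exact Ideal.mem_map_of_mem _ (hmem j)
    have h0 : (maximalIdeal D).map (algebraMap D S) ≤ maximalIdeal S :=
      ((local_hom_TFAE (algebraMap D S)).out 0 2).mp hlocal
    have h2 : algebraMap D S (algebraMap F D (StdPoly.x ϖ n t j)) ∈ maximalIdeal S :=
      h0 (Ideal.mem_map_of_mem _ h1)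
    have hloc' : IsLocalHom (Ideal.Quotient.mk JS) :=
      IsLocalHom.of_surjective _ Ideal.Quotient.mk_surjective
    rw [residue_eq_zero_iff, mem_maximalIdeal, mem_nonunits_iff]
    intro hu
    exact h2 (isUnit_of_map_unit (Ideal.Quotient.mk JS) _ hu)
  have hιϖ : ι ϖ = 0 := by
    have h1 := StdPoly.prod_x ϖ n t
    change residue S' (Ideal.Quotient.mk JS (algebraMap D S (algebraMap F D (algebraMap R F ϖ)))) = 0
    rw [← h1, map_prod, map_prod, map_prod, map_prod]
    exact Finset.prod_eq_zero (i := s) (by simpa using hs) (hmem0 s)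
  classical
  let g₀ : MvPolynomial (Fin n) R →+* MvPowerSeries σ κ := MvPolynomial.eval₂Hom
    ((MvPowerSeries.C).comp ι) (fun j ↦ if h : j = s then 0 else MvPowerSeries.X ⟨j, h⟩)
  -- Putting x_s = 0 kills the product of the coordinates, and `ϖ` vanishes in `κ`, so the relation
  -- is respected.
  let g₁ : F →+* MvPowerSeries σ κ := Ideal.Quotient.lift _ g₀ (by
    intro a ha
    have : Ideal.span {(∏ i ∈ Finset.univ.filter (fun i : Fin n ↦ (i : ℕ) < t),
        MvPolynomial.X (R := R) i) - MvPolynomial.C (σ := Fin n) ϖ} ≤ RingHom.ker g₀ := by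
      rw [Ideal.span_le, Set.singleton_subset_iff, SetLike.mem_coe, RingHom.mem_ker, map_sub,
        map_prod, Finset.prod_eq_zero (i := s) (by simpa using hs) (by simp [g₀])]
      simp [g₀, hιϖ]
    exact this ha)
  have hg₁x : ∀ j, g₁ (StdPoly.x ϖ n t j) = if h : j = s then 0 else MvPowerSeries.X ⟨j, h⟩ := by
    intro j
    exact MvPolynomial.eval₂Hom_X' _ _ j
  have hg₁C : ∀ r, g₁ (algebraMap R F r) = MvPowerSeries.C (ι r) := by
    intro r
    exact MvPolynomial.eval₂Hom_C _ _ r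
  let g : F' →+* MvPowerSeries σ κ := Ideal.Quotient.lift J g₁ (by
    intro a ha
    have : J ≤ RingHom.ker g₁ := by
      rw [Ideal.span_le, Set.singleton_subset_iff, SetLike.mem_coe, RingHom.mem_ker, hg₁x, dif_pos rfl]
    exact this ha)
  -- The embedding is applied to `S` modulo x_s, whose parameters are the remaining coordinates.
  obtain ⟨ψ, hψ, hψ'⟩ := exists_injective_mvPowerSeries_of_isCompletion (S := S') (D := D') Q' hD'
    (fun j : σ ↦ Ideal.Quotient.mk J (StdPoly.x ϖ n t j)) (by
      simp only [Q', StdPoly.origin_eq_span, Ideal.map_span, ← Set.range_comp]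
      refine le_antisymm ?_ ?_
      · rw [Ideal.span_le]
        rintro _ ⟨j, rfl⟩
        by_cases hj : j = s
        · subst hj
          have : Ideal.Quotient.mk J (StdPoly.x ϖ n t j) = 0 :=
            Ideal.Quotient.eq_zero_iff_mem.mpr (Ideal.mem_span_singleton_self _)
          rw [Function.comp_apply, this]
          exact zero_mem _
        · exact Ideal.subset_span ⟨⟨j, hj⟩, rfl⟩
      · refine Ideal.span_mono ?_
        rintro _ ⟨j, rfl⟩
        exact ⟨j, rfl⟩) g
    (fun j ↦ by
      change g₁ (StdPoly.x ϖ n t j) = _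
      rw [hg₁x, dif_neg j.2]) (by
    have h1 : ((MvPowerSeries.constantCoeff (σ := σ)).comp g₁) = (residue S').comp
        ((Ideal.Quotient.mk JS).comp ((algebraMap D S).comp (algebraMap F D))) := by
      refine Ideal.Quotient.ringHom_ext (MvPolynomial.ringHom_ext (fun r ↦ ?_) (fun j ↦ ?_))
      · change MvPowerSeries.constantCoeff (g₁ (algebraMap R F r)) = ι r
        rw [hg₁C, MvPowerSeries.constantCoeff_C]
      · change MvPowerSeries.constantCoeff (g₁ (StdPoly.x ϖ n t j)) = residue S'
          (Ideal.Quotient.mk JS (algebraMap D S (algebraMap F D (StdPoly.x ϖ n t j))))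
        rw [hg₁x, hmem0]
        split_ifs with h
        · exact map_zero _
        · exact MvPowerSeries.constantCoeff_X _
    intro a
    obtain ⟨a, rfl⟩ := Ideal.Quotient.mk_surjective a
    exact DFunLike.congr_fun h1 a)
  refine ⟨κ, inferInstance, ψ.comp (Ideal.Quotient.mk JS), ?_, fun j hj ↦ ?_⟩
  · rw [← hJS]
    ext x
    rw [RingHom.mem_ker, RingHom.comp_apply]
    rw [← Ideal.Quotient.eq_zero_iff_mem (I := JS)]
    exact map_eq_zero_iff ψ hψ
  · have h2 := hψ' (Ideal.Quotient.mk J (StdPoly.x ϖ n t j))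
    have h3 : g (Ideal.Quotient.mk J (StdPoly.x ϖ n t j)) = MvPowerSeries.X ⟨j, hj⟩ := by
      change g₁ (StdPoly.x ϖ n t j) = _
      rw [hg₁x, dif_neg hj]
    rw [h3] at h2
    exact h2

end FormalChart

end SemistableProduct

namespace SemistableProduct

open IsLocalRing TensorProduct

/-! ### From formal coordinates to coordinates in the local ring. -/

section LocalChart

/-- The homomorphism from `StdPoly ϖ n t` with given values on the coordinates. -/
noncomputable def StdPoly.lift {R A : Type u} [CommRing R] [CommRing A] [Algebra R A] {ϖ : R}
    {n t : ℕ} (z : Fin n → A)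
    (hz : ∏ i ∈ Finset.univ.filter (fun i : Fin n ↦ (i : ℕ) < t), z i = algebraMap R A ϖ) :
    StdPoly ϖ n t →ₐ[R] A :=
  Ideal.Quotient.liftₐ _ (MvPolynomial.aeval z) (by
    intro a ha
    have : Ideal.span {(∏ i ∈ Finset.univ.filter (fun i : Fin n ↦ (i : ℕ) < t),
        MvPolynomial.X (R := R) i) - MvPolynomial.C (σ := Fin n) ϖ} ≤
        RingHom.ker (MvPolynomial.aeval (R := R) z) := by
      rw [Ideal.span_le, Set.singleton_subset_iff, SetLike.mem_coe, RingHom.mem_ker, map_sub,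
        map_prod, MvPolynomial.aeval_C, ← hz]
      simp
    exact this ha)

theorem StdPoly.lift_x {R A : Type u} [CommRing R] [CommRing A] [Algebra R A] {ϖ : R}
    {n t : ℕ} (z : Fin n → A)
    (hz : ∏ i ∈ Finset.univ.filter (fun i : Fin n ↦ (i : ℕ) < t), z i = algebraMap R A ϖ)
    (i : Fin n) : StdPoly.lift z hz (StdPoly.x ϖ n t i) = z i :=
  MvPolynomial.aeval_X z i

theorem StdPoly.map_origin {R A : Type u} [CommRing R] [CommRing A] {ϖ : R}
    {n t : ℕ} (h : StdPoly ϖ n t →+* A) :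
    (StdPoly.origin ϖ n t).map h = Ideal.span (Set.range fun i ↦ h (StdPoly.x ϖ n t i)) := by
  rw [StdPoly.origin_eq_span, Ideal.map_span, ← Set.range_comp]
  rfl

/-- Otherwise all of `p` lands in (y) times the maximal ideal, so y = 0 by Nakayama's lemma, and
then z = 0 works after all. -/
theorem exists_associated_of_map_eq_span {B S : Type u} [CommRing B] [CommRing S] [IsLocalRing S]
    [Algebra B S] (p : Ideal B) (y : S) (h : p.map (algebraMap B S) = Ideal.span {y}) :
    ∃ (z : B) (c : S), IsUnit c ∧ algebraMap B S z = y * c := by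
  by_contra hcon
  push Not at hcon
  have h1 : ∀ b ∈ p, algebraMap B S b ∈ Ideal.span {y} * maximalIdeal S := by
    intro b hb
    have h2 : algebraMap B S b ∈ Ideal.span {y} := h ▸ Ideal.mem_map_of_mem _ hb
    obtain ⟨c, hc⟩ := Ideal.mem_span_singleton'.mp h2
    rw [← hc, mul_comm c y]
    refine Ideal.mul_mem_mul (Ideal.mem_span_singleton_self y) ?_
    rw [mem_maximalIdeal, mem_nonunits_iff]
    intro hu
    exact hcon b c hu (by rw [← hc, mul_comm])
  have h3 : Ideal.span {y} ≤ Ideal.span {y} * maximalIdeal S := by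
    conv_lhs => rw [← h]
    rw [Ideal.map_le_iff_le_comap]
    exact h1
  have h4 : Ideal.span {y} ≤ (⊥ : Ideal S) := by
    refine Submodule.le_of_le_smul_of_le_jacobson_bot (I := maximalIdeal S) (N := ⊥)
      (Submodule.fg_span_singleton y) (IsLocalRing.maximalIdeal_le_jacobson _) ?_
    rw [bot_sup_eq, smul_eq_mul, mul_comm]
    exact h3
  have hy : y = 0 := by
    have := h4 (Ideal.mem_span_singleton_self y)
    simpa using this
  exact hcon 0 1 isUnit_one (by rw [hy, map_zero, zero_mul])

/-- `H` says that the components of the special fibre do not split in the completion. Hence each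
formal branch (y_s) is extended from a minimal prime of (ϖ) in `B`, and y_s is a unit times an
element of `B`; the other parameters are approximated modulo the square of the maximal ideal. The
map to `B` so obtained need not induce the given D → S, but the two agree on residues, so
`finite_etale_of_residue_eq` makes it étale after completion, and flatness descends along the
faithfully flat B → S. -/
theorem exists_flat_chart {R B S D : Type u} [CommRing R] [IsLocalRing R] [IsNoetherianRing R]
    {ϖ : R} {n t : ℕ} [CommRing B] [IsLocalRing B] [IsNoetherianRing B] [CommRing S] [CommRing D]
    [IsNoetherianRing D] [Algebra R B] [Algebra B S] [Algebra D S] [Algebra (StdPoly ϖ n t) D]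
    (hϖ : maximalIdeal R = Ideal.span {ϖ}) (ht : 1 ≤ t) (htn : t ≤ n)
    (hD : IsCompletion (StdPoly.origin ϖ n t) D) (hS : IsCompletion (maximalIdeal B) S)
    [Module.Finite D S] [Algebra.Etale D S]
    (hR : ∀ r : R, algebraMap D S (algebraMap _ D (algebraMap R (StdPoly ϖ n t) r)) =
      algebraMap B S (algebraMap R B r))
    (H : ∀ p ∈ (Ideal.span {algebraMap R B ϖ}).minimalPrimes, (p.map (algebraMap B S)).IsPrime) :
    ∃ h : StdPoly ϖ n t →ₐ[R] B, h.toRingHom.Flat ∧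
      (StdPoly.origin ϖ n t).map h.toRingHom = maximalIdeal B := by
  classical
  let F := StdPoly ϖ n t
  have hmax := StdPoly.isMaximal_origin ϖ n t hϖ ht htn
  have hDloc : IsLocalRing D := hD.isLocalRing
  have hSloc := hS.isLocalRing
  have hlocal : IsLocalHom (algebraMap D S) := isLocalHom_of_finite
  have hSN : IsNoetherianRing S := IsNoetherianRing.of_finite D S
  have hFN : IsNoetherianRing F := inferInstance
  have hDm := hD.maximalIdeal_eq
  have hSm := hS.maximalIdeal_eq
  have hϖ' : ϖ ∈ maximalIdeal R := hϖ ▸ Ideal.mem_span_singleton_self ϖ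
  let y : Fin n → S := fun i ↦ algebraMap D S (algebraMap F D (StdPoly.x ϖ n t i))
  have hDx : maximalIdeal D = Ideal.span (Set.range fun i ↦ algebraMap F D (StdPoly.x ϖ n t i)) := by
    rw [hDm]; exact StdPoly.map_origin _
  have hy : maximalIdeal S = Ideal.span (Set.range y) := by
    rw [← Algebra.FormallyUnramified.map_maximalIdeal (R := D) (S := S), hDx, Ideal.map_span,
      ← Set.range_comp]
    rfl
  have hymem : ∀ i, y i ∈ maximalIdeal S := fun i ↦ hy ▸ Ideal.subset_span ⟨i, rfl⟩
  have hyprod : ∏ i ∈ Finset.univ.filter (fun i : Fin n ↦ (i : ℕ) < t), y i =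
      algebraMap B S (algebraMap R B ϖ) := by
    rw [← hR, ← StdPoly.prod_x, map_prod, map_prod]
  -- the coordinates `y s` for `s < t` generate distinct prime ideals
  have hprime : ∀ s : Fin n, (s : ℕ) < t → (Ideal.span {y s}).IsPrime := by
    intro s hs
    obtain ⟨κ, _, ψ, hψ, -⟩ := exists_ker_eq_span_of_formalChart hϖ ht htn hD (S := S) s hs
    rw [← hψ]
    have hT : NoZeroDivisors (MvPowerSeries {j : Fin n // j ≠ s} κ) := inferInstance
    have hT' : IsDomain (MvPowerSeries {j : Fin n // j ≠ s} κ) := NoZeroDivisors.to_isDomain _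
    exact RingHom.ker_isPrime ψ
  have hdist : ∀ s : Fin n, (s : ℕ) < t → ∀ j, y j ∈ Ideal.span {y s} → j = s := by
    intro s hs j hj
    obtain ⟨κ, _, ψ, hψ, hψ'⟩ := exists_ker_eq_span_of_formalChart hϖ ht htn hD (S := S) s hs
    by_contra hne
    rw [← hψ, RingHom.mem_ker, hψ' j hne] at hj
    have h1 := congr_arg (MvPowerSeries.coeff (Finsupp.single (⟨j, hne⟩ : {j : Fin n // j ≠ s}) 1)) hj
    rw [MvPowerSeries.coeff_index_single_self_X, map_zero] at h1
    exact one_ne_zero h1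
  have hfac : ∀ q : Ideal S, q.IsPrime → algebraMap B S (algebraMap R B ϖ) ∈ q →
      ∃ s : Fin n, (s : ℕ) < t ∧ Ideal.span {y s} ≤ q := by
    intro q hq hmem
    rw [← hyprod, hq.prod_mem_iff] at hmem
    obtain ⟨s, hs, hsq⟩ := hmem
    exact ⟨s, by simpa using hs, by rwa [Ideal.span_le, Set.singleton_subset_iff]⟩
  have hmin : ∀ s : Fin n, (s : ℕ) < t → ∃ p : Ideal B, p.map (algebraMap B S) = Ideal.span {y s} := by
    intro s hs
    have hps := hprime s hs
    have hle : Ideal.span {algebraMap R B ϖ} ≤ (Ideal.span {y s}).comap (algebraMap B S) := by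
      rw [Ideal.span_le, Set.singleton_subset_iff, SetLike.mem_coe, Ideal.mem_comap, ← hyprod,
        Ideal.mem_span_singleton]
      exact Finset.dvd_prod_of_mem _ (by simpa using hs)
    have hpc : ((Ideal.span {y s}).comap (algebraMap B S)).IsPrime := Ideal.IsPrime.comap _
    obtain ⟨p, hp, hple⟩ := Ideal.exists_minimalPrimes_le hle
    have hpS := H p hp
    have hpϖ : algebraMap B S (algebraMap R B ϖ) ∈ p.map (algebraMap B S) :=
      Ideal.mem_map_of_mem _ (hp.1.2 (Ideal.mem_span_singleton_self _))
    obtain ⟨s', hs', hs'p⟩ := hfac _ hpS hpϖ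
    -- The prime pS contains `ϖ`, hence some y_{s'}, and it is contained in (y_s).
    have h1 : s' = s := by
      refine hdist s hs s' ?_
      have h2 : p.map (algebraMap B S) ≤ Ideal.span {y s} := Ideal.map_le_iff_le_comap.mpr hple
      exact h2 (hs'p (Ideal.mem_span_singleton_self _))
    subst h1
    exact ⟨p, le_antisymm (Ideal.map_le_iff_le_comap.mpr hple) hs'p⟩
  -- generators in `B`
  have hgen : ∀ i : Fin n, ∃ (z : B) (c : S), ((i : ℕ) < t → IsUnit c ∧ algebraMap B S z = y i * c) ∧
      (¬ (i : ℕ) < t → y i - algebraMap B S z ∈ maximalIdeal S ^ 2) := by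
    intro i
    by_cases hi : (i : ℕ) < t
    · obtain ⟨p, hp⟩ := hmin i hi
      obtain ⟨z, c, hc, hz⟩ := exists_associated_of_map_eq_span p (y i) hp
      exact ⟨z, c, fun _ ↦ ⟨hc, hz⟩, fun h ↦ absurd hi h⟩
    · obtain ⟨z, hz⟩ := hS.surj_pow 2 (y i)
      exact ⟨z, 0, fun h ↦ absurd h hi, fun _ ↦ by rwa [hSm]⟩
  choose z₀ c hc hz₀ using hgen
  -- adjust by a unit
  have hunit : ∃ u : B, IsUnit u ∧
      (∏ i ∈ Finset.univ.filter (fun i : Fin n ↦ (i : ℕ) < t), z₀ i) * u = algebraMap R B ϖ := by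
    set Z := ∏ i ∈ Finset.univ.filter (fun i : Fin n ↦ (i : ℕ) < t), z₀ i with hZ
    set Cu := ∏ i ∈ Finset.univ.filter (fun i : Fin n ↦ (i : ℕ) < t), c i with hCu
    have hCunit : IsUnit Cu := by
      rw [hCu, IsUnit.prod_iff]
      intro i hi
      exact (hc i (by simpa using hi)).1
    have hZC : algebraMap B S Z = algebraMap B S (algebraMap R B ϖ) * Cu := by
      rw [hZ, map_prod, ← hyprod, hCu, ← Finset.prod_mul_distrib]
      exact Finset.prod_congr rfl fun i hi ↦ (hc i (by simpa using hi)).2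
    have h1 : Z ∈ Ideal.span {algebraMap R B ϖ} := by
      rw [← hS.comap_map (Ideal.span {algebraMap R B ϖ}), Ideal.mem_comap, hZC, Ideal.map_span,
        Set.image_singleton]
      exact Ideal.mul_mem_right _ _ (Ideal.mem_span_singleton_self _)
    have h2 : algebraMap R B ϖ ∈ Ideal.span {Z} := by
      rw [← hS.comap_map (Ideal.span {Z}), Ideal.mem_comap, Ideal.map_span,
        Set.image_singleton, hZC]
      obtain ⟨v, hv⟩ := hCunit
      have : algebraMap B S (algebraMap R B ϖ) =
          algebraMap B S (algebraMap R B ϖ) * Cu * (v⁻¹ : Sˣ) := by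
        rw [← hv, mul_assoc, Units.mul_inv, mul_one]
      rw [Ideal.mem_span_singleton]
      exact ⟨_, this⟩
    obtain ⟨b, hb⟩ := Ideal.mem_span_singleton'.mp h1
    obtain ⟨b', hb'⟩ := Ideal.mem_span_singleton'.mp h2
    -- If b' is not a unit then 1 - b'b is one, which forces ϖ = 0 in `B`; then both sides are zero
    -- and any unit serves.
    by_cases hu : IsUnit b'
    · exact ⟨b', hu, by rw [mul_comm]; exact hb'⟩
    · have h3 : IsUnit (1 - b' * b) := by
        by_contra h4
        have h5 : b' * b ∈ maximalIdeal B := Ideal.mul_mem_right _ _ hu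
        exact (Ideal.ne_top_iff_one _).mp (maximalIdeal.isMaximal B).ne_top
          (by have := add_mem (show (1 - b' * b) ∈ maximalIdeal B from h4) h5
              rwa [sub_add_cancel] at this)
      have h4 : algebraMap R B ϖ = 0 := by
        have h5 : (1 - b' * b) * algebraMap R B ϖ = 0 := by
          rw [sub_mul, one_mul, mul_assoc, hb, hb', sub_self]
        exact (h3.mul_right_eq_zero).mp h5
      refine ⟨1, isUnit_one, ?_⟩
      rw [mul_one, ← hb, h4, mul_zero]
  obtain ⟨u, hu, hZu⟩ := hunit
  -- The unit is absorbed into the coordinate of index 0, which occurs in the product because 1 ≤ t.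
  let i₀ : Fin n := ⟨0, by omega⟩
  have hi₀ : i₀ ∈ Finset.univ.filter (fun i : Fin n ↦ (i : ℕ) < t) := by
    simp [i₀]; omega
  let z : Fin n → B := fun i ↦ if i = i₀ then z₀ i * u else z₀ i
  have hzprod : ∏ i ∈ Finset.univ.filter (fun i : Fin n ↦ (i : ℕ) < t), z i = algebraMap R B ϖ := by
    rw [← hZu, ← Finset.mul_prod_erase _ _ hi₀, ← Finset.mul_prod_erase _ z₀ hi₀]
    have h1 : z i₀ = z₀ i₀ * u := if_pos rfl
    have h2 : ∏ i ∈ (Finset.univ.filter (fun i : Fin n ↦ (i : ℕ) < t)).erase i₀, z i =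
        ∏ i ∈ (Finset.univ.filter (fun i : Fin n ↦ (i : ℕ) < t)).erase i₀, z₀ i :=
      Finset.prod_congr rfl fun i hi ↦ if_neg (Finset.ne_of_mem_erase hi)
    rw [h1, h2]
    ring
  have hz1 : ∀ i : Fin n, (i : ℕ) < t → ∃ c' : S, IsUnit c' ∧ algebraMap B S (z i) = y i * c' := by
    intro i hi
    obtain ⟨h1, h2⟩ := hc i hi
    by_cases hii : i = i₀
    · refine ⟨c i * algebraMap B S u, h1.mul (hu.map _), ?_⟩
      have : z i = z₀ i * u := if_pos hii
      rw [this, map_mul, h2, mul_assoc]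
    · refine ⟨c i, h1, ?_⟩
      have : z i = z₀ i := if_neg hii
      rw [this, h2]
  have hz2 : ∀ i : Fin n, ¬ (i : ℕ) < t → y i - algebraMap B S (z i) ∈ maximalIdeal S ^ 2 := by
    intro i hi
    have hii : i ≠ i₀ := by rintro rfl; exact hi (by simpa using hi₀)
    have : z i = z₀ i := if_neg hii
    rw [this]
    exact hz₀ i hi
  have hwmem : ∀ i, algebraMap B S (z i) ∈ maximalIdeal S := by
    intro i
    by_cases hi : (i : ℕ) < t
    · obtain ⟨c', -, h⟩ := hz1 i hi
      rw [h]
      exact Ideal.mul_mem_right _ _ (hymem i)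
    · have h1 := Ideal.pow_le_self two_ne_zero (hz2 i hi)
      have := sub_mem (hymem i) h1
      rwa [sub_sub_cancel] at this
  -- Nakayama's lemma: the z_i and the y_i agree up to units or modulo the square of the maximal
  -- ideal.
  have hw : maximalIdeal S = Ideal.span (Set.range fun i ↦ algebraMap B S (z i)) := by
    refine le_antisymm ?_ ?_
    · refine Submodule.le_of_le_smul_of_le_jacobson_bot (I := maximalIdeal S)
        (IsNoetherian.noetherian _) (IsLocalRing.maximalIdeal_le_jacobson _) ?_
      conv_lhs => rw [hy]
      rw [Ideal.span_le]
      rintro _ ⟨i, rfl⟩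
      by_cases hi : (i : ℕ) < t
      · obtain ⟨c', ⟨v, rfl⟩, h⟩ := hz1 i hi
        refine Submodule.mem_sup_left ?_
        have h2 : y i = algebraMap B S (z i) * (v⁻¹ : Sˣ) := by
          rw [h, mul_assoc, Units.mul_inv, mul_one]
        rw [h2]
        exact Ideal.mul_mem_right _ _ (Ideal.subset_span ⟨i, rfl⟩)
      · have h1 := hz2 i hi
        rw [pow_two] at h1
        have h2 := Submodule.add_mem_sup (S := Ideal.span (Set.range fun i ↦ algebraMap B S (z i)))
          (Ideal.subset_span ⟨i, rfl⟩) h1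
        rwa [add_sub_cancel] at h2
    · rw [Ideal.span_le]
      rintro _ ⟨i, rfl⟩
      exact hwmem i
  let h : F →ₐ[R] B := StdPoly.lift z hzprod
  have hx : ∀ i, h (StdPoly.x ϖ n t i) = z i := StdPoly.lift_x z hzprod
  have hmapS : ((StdPoly.origin ϖ n t).map h.toRingHom).map (algebraMap B S) = maximalIdeal S := by
    rw [Ideal.map_map, StdPoly.map_origin, hw]
    congr 2
    ext i : 1
    exact congr_arg _ (hx i)
  have hmapB : (StdPoly.origin ϖ n t).map h.toRingHom = maximalIdeal B := by
    rw [← hS.comap_map ((StdPoly.origin ϖ n t).map h.toRingHom), hmapS, hSm, hS.comap_map]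
  refine ⟨h, ?_, hmapB⟩
  have hSc : IsAdicComplete (maximalIdeal S) S := by rw [hSm]; exact hS.complete
  have hDc : IsAdicComplete (maximalIdeal D) D := by rw [hDm]; exact hD.complete
  obtain ⟨φ, hφ⟩ := hD.exists_lift (maximalIdeal S) ((algebraMap B S).comp h.toRingHom) (by
    rw [← Ideal.map_le_iff_le_comap, ← Ideal.map_map, hmapS])
  have hmapφ : (maximalIdeal D).map φ = maximalIdeal S := by
    rw [hDm, Ideal.map_map, ← hmapS, Ideal.map_map]
    congr 1
    exact RingHom.ext hφ
  have hres : ∀ d, residue S (algebraMap D S d) = residue S (φ d) := by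
    have h1 : ((residue S).comp ((algebraMap D S).comp (algebraMap F D))) =
        (residue S).comp (φ.comp (algebraMap F D)) := by
      refine Ideal.Quotient.ringHom_ext (MvPolynomial.ringHom_ext (fun r ↦ ?_) (fun j ↦ ?_))
      · change residue S (algebraMap D S (algebraMap F D (algebraMap R F r))) =
          residue S (φ (algebraMap F D (algebraMap R F r)))
        rw [hR, hφ]
        change _ = residue S (algebraMap B S (h (algebraMap R F r)))
        rw [h.commutes]
      · change residue S (y j) = residue S (φ (algebraMap F D (StdPoly.x ϖ n t j)))
        rw [hφ]
        change _ = residue S (algebraMap B S (h (StdPoly.x ϖ n t j)))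
        rw [hx, (residue_eq_zero_iff _).mpr (hymem j), (residue_eq_zero_iff _).mpr (hwmem j)]
    intro d
    obtain ⟨f, hf⟩ := hD.surj d
    rw [← hDm] at hf
    have h2 : residue S (algebraMap D S (d - algebraMap F D f)) = 0 := by
      rw [residue_eq_zero_iff, ← Algebra.FormallyUnramified.map_maximalIdeal (R := D) (S := S)]
      exact Ideal.mem_map_of_mem _ hf
    have h3 : residue S (φ (d - algebraMap F D f)) = 0 := by
      rw [residue_eq_zero_iff, ← hmapφ]
      exact Ideal.mem_map_of_mem _ hf
    rw [map_sub, map_sub, sub_eq_zero] at h2 h3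
    rw [h2, h3]
    exact DFunLike.congr_fun h1 f
  -- Two `D`-algebra structures on the same ring `S` are compared: the given one, which is finite
  -- étale, and the one through `φ`.
  have hfe := @finite_etale_of_residue_eq D S S _ _ _ _ _ _ _ _ φ.toAlgebra _ _ (RingEquiv.refl S) _
    hmapφ hres
  have hflatφ : φ.Flat := by
    letI := φ.toAlgebra
    have := hfe.2
    have h1 : Module.Flat D S := inferInstance
    exact h1
  have hflatD : (algebraMap F D).Flat := by
    rw [RingHom.flat_algebraMap_iff]; exact hD.flat
  have hflatFS : ((algebraMap B S).comp h.toRingHom).Flat := by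
    have h1 : (algebraMap B S).comp h.toRingHom = φ.comp (algebraMap F D) := by
      exact RingHom.ext fun x ↦ (hφ x).symm
    rw [h1]
    exact RingHom.Flat.comp hflatD hflatφ
  have hlocBS : IsLocalHom (algebraMap B S) := by
    refine ((local_hom_TFAE (algebraMap B S)).out 0 2).mpr ?_
    rw [hSm]
  have hflatBS : Module.Flat B S := hS.flat
  have hff : Module.FaithfullyFlat B S := Module.FaithfullyFlat.of_flat_of_isLocalHom
  letI algFB : Algebra F B := h.toRingHom.toAlgebra
  letI algFS : Algebra F S := ((algebraMap B S).comp h.toRingHom).toAlgebra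
  have : IsScalarTower F B S := IsScalarTower.of_algebraMap_eq (fun x ↦ rfl)
  have : Module.Flat F S := hflatFS
  exact flat_of_flat_of_faithfullyFlat F B S

end LocalChart

end SemistableProduct

namespace SemistableProduct

open IsLocalRing TensorProduct

theorem mem_of_forall_ringHom {T : Type u} [CommRing T] (J : Ideal T) (p : T)
    (h : ∀ (B : Type u) [CommRing B] (q : T →+* B), (∀ x ∈ J, q x = 0) → q p = 0) : p ∈ J :=
  Ideal.Quotient.eq_zero_iff_mem.mp
    (h (T ⧸ J) (Ideal.Quotient.mk J) fun _ hx ↦ Ideal.Quotient.eq_zero_iff_mem.mpr hx)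

/-! ### The model ring of a chart. -/

section ChartRing

variable {R : Type u} [CommRing R]

/-- The relations `∏ u = ∏ v` and `∏ u * ∏ w = ϖ` in variables `u`, `v`, `w` indexed by
`α`, `β`, `γ`. -/
noncomputable def chartRel (ϖ : R) (α β γ : Type) [Fintype α] [Fintype β] [Fintype γ] :
    Ideal (MvPolynomial (α ⊕ β ⊕ γ) R) :=
  Ideal.span {(∏ a : α, MvPolynomial.X (Sum.inl a)) - ∏ b : β, MvPolynomial.X (Sum.inr (Sum.inl b)),
    (∏ a : α, MvPolynomial.X (Sum.inl a)) * (∏ c : γ, MvPolynomial.X (Sum.inr (Sum.inr c))) -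
      MvPolynomial.C ϖ}

/-- The ring `R[u, v, w] / (∏ u - ∏ v, ∏ u * ∏ w - ϖ)`. -/
abbrev ChartRing (ϖ : R) (α β γ : Type) [Fintype α] [Fintype β] [Fintype γ] : Type u :=
  MvPolynomial (α ⊕ β ⊕ γ) R ⧸ chartRel ϖ α β γ

namespace ChartRing

variable (ϖ : R) {α β γ : Type} [Fintype α] [Fintype β] [Fintype γ]

noncomputable def var (x : α ⊕ β ⊕ γ) : ChartRing ϖ α β γ :=
  Ideal.Quotient.mk _ (MvPolynomial.X x)

theorem prod_eq : ∏ a : α, var ϖ (β := β) (γ := γ) (Sum.inl a) =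
    ∏ b : β, var ϖ (α := α) (γ := γ) (Sum.inr (Sum.inl b)) := by
  simp only [var, ← map_prod]
  rw [Ideal.Quotient.eq]
  exact Ideal.subset_span (Or.inl rfl)

theorem prod_mul : (∏ a : α, var ϖ (β := β) (γ := γ) (Sum.inl a)) *
    (∏ c : γ, var ϖ (α := α) (β := β) (Sum.inr (Sum.inr c))) = algebraMap R _ ϖ := by
  simp only [var, ← map_prod, ← map_mul]
  refine (Ideal.Quotient.eq (y := MvPolynomial.C ϖ)).mpr ?_
  exact Ideal.subset_span (Or.inr rfl)

variable {ϖ}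

theorem hom_ext {A : Type*} [CommRing A] {f g : ChartRing ϖ α β γ →+* A}
    (h : ∀ r, f (algebraMap R _ r) = g (algebraMap R _ r)) (h' : ∀ x, f (var ϖ x) = g (var ϖ x)) :
    f = g :=
  Ideal.Quotient.ringHom_ext (MvPolynomial.ringHom_ext h h')

/-- The homomorphism from the chart ring with given values on the variables. -/
noncomputable def lift {A : Type*} [CommRing A] (ρ : R →+* A) (u : α → A) (v : β → A) (w : γ → A)
    (h : ∏ a, u a = ∏ b, v b) (h' : (∏ a, u a) * ∏ c, w c = ρ ϖ) : ChartRing ϖ α β γ →+* A :=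
  Ideal.Quotient.lift _ (MvPolynomial.eval₂Hom ρ (Sum.elim u (Sum.elim v w))) (by
    intro a ha
    have : chartRel ϖ α β γ ≤
        RingHom.ker (MvPolynomial.eval₂Hom ρ (Sum.elim u (Sum.elim v w))) := by
      rw [chartRel, Ideal.span_le]
      rintro _ (rfl | rfl)
      · simp [RingHom.mem_ker, h]
      · simp [RingHom.mem_ker, h']
    exact this ha)

section

variable {A : Type*} [CommRing A] (ρ : R →+* A) (u : α → A) (v : β → A) (w : γ → A)
    (h : ∏ a, u a = ∏ b, v b) (h' : (∏ a, u a) * ∏ c, w c = ρ ϖ)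

theorem lift_var (x : α ⊕ β ⊕ γ) :
    lift ρ u v w h h' (var ϖ x) = Sum.elim u (Sum.elim v w) x :=
  MvPolynomial.eval₂Hom_X' _ _ _

theorem lift_algebraMap (r : R) : lift ρ u v w h h' (algebraMap R _ r) = ρ r :=
  MvPolynomial.eval₂Hom_C _ _ _

end

theorem map_algebraMap_eq_zero {B : Type*} [CommRing B] (q : ChartRing ϖ α β γ →+* B)
    {Δ : Set (α ⊕ β ⊕ γ)}
    (h : ((∃ a, Sum.inl a ∈ Δ) ∧ ∃ b, Sum.inr (Sum.inl b) ∈ Δ) ∨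
      (IsEmpty α ∧ IsEmpty β ∧ ∃ c, Sum.inr (Sum.inr c) ∈ Δ))
    (hq : ∀ x ∈ Δ, q (var ϖ x) = 0) : q (algebraMap R _ ϖ) = 0 := by
  rw [← prod_mul, map_mul, map_prod, map_prod]
  rcases h with ⟨⟨a, ha⟩, b, hb⟩ | ⟨_, _, c, hc⟩
  · rw [Finset.prod_eq_zero (Finset.mem_univ a) (hq _ ha), zero_mul]
  · rw [Finset.prod_eq_zero (Finset.mem_univ c) (hq _ hc), mul_zero]

/-- A homomorphism that kills the variables in `Δ` also kills `ϖ`, so it factors through the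
polynomial ring over the residue field in the other variables. -/
theorem map_eq_zero_of_mem_ker [IsLocalRing R] (hϖ : maximalIdeal R = Ideal.span {ϖ})
    {Δ : Set (α ⊕ β ⊕ γ)}
    (h : ((∃ a, Sum.inl a ∈ Δ) ∧ ∃ b, Sum.inr (Sum.inl b) ∈ Δ) ∨
      (IsEmpty α ∧ IsEmpty β ∧ ∃ c, Sum.inr (Sum.inr c) ∈ Δ))
    (π : ChartRing ϖ α β γ →+* MvPolynomial {x // x ∉ Δ} (ResidueField R))
    (hπ0 : ∀ x ∈ Δ, π (var ϖ x) = 0)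
    (hπR : ∀ r, π (algebraMap R _ r) = MvPolynomial.C (residue R r))
    (hπX : ∀ (x) (hx : x ∉ Δ), π (var ϖ x) = MvPolynomial.X ⟨x, hx⟩)
    {B : Type*} [CommRing B] (q : ChartRing ϖ α β γ →+* B) (hq : ∀ x ∈ Δ, q (var ϖ x) = 0)
    {p : ChartRing ϖ α β γ} (hp : π p = 0) : q p = 0 := by
  let κ : ResidueField R →+* B := Ideal.Quotient.lift _ (q.comp (algebraMap R _)) (by
    intro r hr
    rw [hϖ, Ideal.mem_span_singleton] at hr
    obtain ⟨c, rfl⟩ := hr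
    rw [RingHom.comp_apply, map_mul, map_mul, map_algebraMap_eq_zero q h hq, zero_mul])
  let θ : MvPolynomial {x // x ∉ Δ} (ResidueField R) →+* B :=
    MvPolynomial.eval₂Hom κ (fun x ↦ q (var ϖ x.1))
  have hθ : θ.comp π = q := by
    refine hom_ext (fun r ↦ ?_) (fun x ↦ ?_)
    · rw [RingHom.comp_apply, hπR]
      simp only [θ, MvPolynomial.coe_eval₂Hom, MvPolynomial.eval₂_C]
      rfl
    · by_cases hx : x ∈ Δ
      · rw [RingHom.comp_apply, hπ0 x hx, map_zero, hq x hx]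
      · rw [RingHom.comp_apply, hπX x hx]
        simp only [θ, MvPolynomial.coe_eval₂Hom, MvPolynomial.eval₂_X]
  rw [← hθ, RingHom.comp_apply, hp, map_zero]

/-- If a set `Δ` of variables is such that the relations hold modulo `Δ`, then the quotient by `Δ`
is a polynomial ring over the residue field. -/
theorem exists_ker_eq_span [IsLocalRing R] (hϖ : maximalIdeal R = Ideal.span {ϖ})
    (Δ : Set (α ⊕ β ⊕ γ))
    (h : ((∃ a, Sum.inl a ∈ Δ) ∧ ∃ b, Sum.inr (Sum.inl b) ∈ Δ) ∨
      (IsEmpty α ∧ IsEmpty β ∧ ∃ c, Sum.inr (Sum.inr c) ∈ Δ)) :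
    ∃ π : ChartRing ϖ α β γ →+* MvPolynomial {x // x ∉ Δ} (ResidueField R),
      Function.Surjective π ∧ RingHom.ker π = Ideal.span (var ϖ '' Δ) ∧
      (∀ r, π (algebraMap R _ r) = MvPolynomial.C (residue R r)) ∧
      ∀ (x) (hx : x ∉ Δ), π (var ϖ x) = MvPolynomial.X ⟨x, hx⟩ := by
  classical
  have hϖ' : residue R ϖ = 0 :=
    (residue_eq_zero_iff _).mpr (hϖ ▸ Ideal.mem_span_singleton_self ϖ)
  let ρ : R →+* MvPolynomial {x // x ∉ Δ} (ResidueField R) := MvPolynomial.C.comp (residue R)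
  have hρ : ρ ϖ = 0 := by simp [ρ, hϖ']
  let val : α ⊕ β ⊕ γ → MvPolynomial {x // x ∉ Δ} (ResidueField R) := fun x ↦
    if hx : x ∈ Δ then 0 else MvPolynomial.X ⟨x, hx⟩
  have hval : ∀ x ∈ Δ, val x = 0 := fun x hx ↦ dif_pos hx
  have h1 : ∏ a : α, val (Sum.inl a) = ∏ b : β, val (Sum.inr (Sum.inl b)) := by
    rcases h with ⟨⟨a, ha⟩, b, hb⟩ | ⟨_, _, -⟩
    · rw [Finset.prod_eq_zero (Finset.mem_univ a) (hval _ ha),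
        Finset.prod_eq_zero (Finset.mem_univ b) (hval _ hb)]
    · simp
  have h2 : (∏ a : α, val (Sum.inl a)) * ∏ c : γ, val (Sum.inr (Sum.inr c)) = ρ ϖ := by
    rw [hρ]
    rcases h with ⟨⟨a, ha⟩, b, hb⟩ | ⟨_, _, c, hc⟩
    · rw [Finset.prod_eq_zero (Finset.mem_univ a) (hval _ ha), zero_mul]
    · rw [Finset.prod_eq_zero (Finset.mem_univ c) (hval _ hc), mul_zero]
  let π := lift (ϖ := ϖ) ρ (fun a : α ↦ val (Sum.inl a)) (fun b : β ↦ val (Sum.inr (Sum.inl b)))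
    (fun c : γ ↦ val (Sum.inr (Sum.inr c))) h1 h2
  have hπvar : ∀ x, π (var ϖ x) = val x := by
    intro x
    rw [lift_var]
    rcases x with a | b | c <;> rfl
  have hπR : ∀ r, π (algebraMap R _ r) = MvPolynomial.C (residue R r) := fun r ↦
    lift_algebraMap _ _ _ _ _ _ r
  have hπX : ∀ (x) (hx : x ∉ Δ), π (var ϖ x) = MvPolynomial.X ⟨x, hx⟩ := fun x hx ↦ by
    rw [hπvar]; exact dif_neg hx
  refine ⟨π, fun p ↦ ?_, ?_, hπR, hπX⟩
  · induction p using MvPolynomial.induction_on with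
    | C a =>
      obtain ⟨r, rfl⟩ := residue_surjective a
      exact ⟨_, hπR r⟩
    | add p q hp hq =>
      obtain ⟨p, rfl⟩ := hp
      obtain ⟨q, rfl⟩ := hq
      exact ⟨p + q, map_add _ _ _⟩
    | mul_X p x hp =>
      obtain ⟨p, rfl⟩ := hp
      exact ⟨p * var ϖ x.1, by rw [map_mul, hπX x.1 x.2]⟩
  · refine le_antisymm (fun p hp ↦ mem_of_forall_ringHom _ p fun B _ q hq ↦ ?_) ?_
    · exact map_eq_zero_of_mem_ker hϖ h π (fun x hx ↦ by rw [hπvar, hval x hx]) hπR hπX q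
        (fun x hx ↦ hq _ (Ideal.subset_span ⟨x, hx, rfl⟩)) hp
    · rw [Ideal.span_le]
      rintro _ ⟨x, hx, rfl⟩
      rw [SetLike.mem_coe, RingHom.mem_ker, hπvar, hval x hx]

theorem dvd_of_dvd_mul_X {k : Type*} [CommRing k] [IsDomain k] {σ : Type*} (x : σ)
    (f b : MvPolynomial σ k) (hf : ¬ MvPolynomial.X x ∣ f) (h : f ∣ b * MvPolynomial.X x) :
    f ∣ b := by
  obtain ⟨c, hc⟩ := h
  have h1 : (MvPolynomial.X x : MvPolynomial σ k) ∣ f * c := ⟨b, by rw [← hc, mul_comm]⟩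
  obtain ⟨d, rfl⟩ := ((MvPolynomial.X_prime (i := x)).dvd_or_dvd h1).resolve_left hf
  refine ⟨d, ?_⟩
  have h2 := MvPolynomial.X_ne_zero (R := k) x
  apply mul_right_cancel₀ h2
  rw [hc]; ring

theorem dvd_of_dvd_mul_prod_X {k : Type*} [CommRing k] [IsDomain k] {σ ι : Type*} (s : Finset ι)
    (x : ι → σ) (f b : MvPolynomial σ k) (hf : ∀ i ∈ s, ¬ MvPolynomial.X (x i) ∣ f)
    (h : f ∣ b * ∏ i ∈ s, MvPolynomial.X (x i)) : f ∣ b := by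
  classical
  induction s using Finset.induction_on generalizing b with
  | empty => simpa using h
  | insert i s hi ih =>
    rw [Finset.prod_insert hi, ← mul_assoc] at h
    have h1 := ih _ (fun j hj ↦ hf j (Finset.mem_insert_of_mem hj)) h
    exact dvd_of_dvd_mul_X _ _ _ (hf i (Finset.mem_insert_self _ _)) h1

/-- This is flatness of the model over `R`. Modulo `ϖ` the relations become U - V and UW. If there
is a u or a v, no u and no w divides U - V, as evaluation at suitable 0-1 points shows, so all
syzygies between the two are trivial, and trivial syzygies lift. -/
theorem mem_chartRel_of_C_mul_mem [IsDomain R] [IsLocalRing R] (hϖ0 : ϖ ≠ 0)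
    (hϖ : maximalIdeal R = Ideal.span {ϖ}) (g : MvPolynomial (α ⊕ β ⊕ γ) R)
    (hg : MvPolynomial.C ϖ * g ∈ chartRel ϖ α β γ) : g ∈ chartRel ϖ α β γ := by
  let k := ResidueField R
  let red : MvPolynomial (α ⊕ β ⊕ γ) R →+* MvPolynomial (α ⊕ β ⊕ γ) k :=
    MvPolynomial.map (residue R)
  have hred : Function.Surjective red := MvPolynomial.map_surjective _ residue_surjective
  have hker : ∀ p, red p = 0 → ∃ q, p = MvPolynomial.C ϖ * q := by
    intro p hp
    have : MvPolynomial.C ϖ ∣ p := by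
      rw [MvPolynomial.C_dvd_iff_dvd_coeff]
      intro m
      have h1 : residue R (p.coeff m) = 0 := by
        rw [← MvPolynomial.coeff_map]
        change MvPolynomial.coeff m (red p) = 0
        rw [hp, MvPolynomial.coeff_zero]
      rwa [residue_eq_zero_iff, hϖ, Ideal.mem_span_singleton] at h1
    exact this
  have hϖ' : residue R ϖ = 0 :=
    (residue_eq_zero_iff _).mpr (hϖ ▸ Ideal.mem_span_singleton_self ϖ)
  set U : MvPolynomial (α ⊕ β ⊕ γ) R := ∏ a : α, MvPolynomial.X (Sum.inl a) with hU
  set V : MvPolynomial (α ⊕ β ⊕ γ) R := ∏ b : β, MvPolynomial.X (Sum.inr (Sum.inl b)) with hV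
  set W : MvPolynomial (α ⊕ β ⊕ γ) R := ∏ c : γ, MvPolynomial.X (Sum.inr (Sum.inr c)) with hW
  have hspan : chartRel ϖ α β γ = Ideal.span {U - V, U * W - MvPolynomial.C ϖ} := rfl
  rw [hspan, Ideal.mem_span_pair] at hg
  obtain ⟨p, q, hpq⟩ := hg
  have hredU : red U = ∏ a : α, MvPolynomial.X (Sum.inl a) := by simp [red, hU]
  have hredV : red V = ∏ b : β, MvPolynomial.X (Sum.inr (Sum.inl b)) := by simp [red, hV]
  have hredW : red W = ∏ c : γ, MvPolynomial.X (Sum.inr (Sum.inr c)) := by simp [red, hW]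
  have hredϖ : red (MvPolynomial.C ϖ) = 0 := by simp [red, hϖ']
  have h1 : red p * (red U - red V) + red q * (red U * red W) = 0 := by
    have := congr_arg red hpq
    rw [map_add, map_mul, map_mul, map_sub, map_sub, map_mul, hredϖ, sub_zero, map_mul, hredϖ,
      zero_mul] at this
    exact this
  have hUW0 : red U * red W ≠ 0 := by
    rw [hredU, hredW]
    refine mul_ne_zero ?_ ?_ <;>
    exact Finset.prod_ne_zero_iff.mpr fun _ _ ↦ MvPolynomial.X_ne_zero _
  -- the reduction of `q` is a multiple of that of `U - V`
  have h2 : ∃ c, red q = c * (red U - red V) := by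
    -- Without any u or v one has U = V = 1 and the first relation is void.
    by_cases hempty : IsEmpty α ∧ IsEmpty β
    · obtain ⟨_, _⟩ := hempty
      have h3 : red U - red V = 0 := by rw [hredU, hredV]; simp
      rw [h3, mul_zero, zero_add] at h1
      exact ⟨0, by rw [zero_mul]; exact (mul_eq_zero.mp h1).resolve_right hUW0⟩
    · have hdvd : (red U - red V) ∣ red q * red U * red W :=
        ⟨-red p, by linear_combination h1⟩
      have hev : ∀ (δ : α ⊕ β ⊕ γ → k) (x), δ x = 0 →
          MvPolynomial.eval δ (red U - red V) ≠ 0 → ¬ MvPolynomial.X x ∣ (red U - red V) := by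
        rintro δ x hx hne ⟨d, hd⟩
        apply hne
        rw [hd, map_mul, MvPolynomial.eval_X, hx, zero_mul]
      have hevU : ∀ δ : α ⊕ β ⊕ γ → k, MvPolynomial.eval δ (red U - red V) =
          (∏ a : α, δ (Sum.inl a)) - ∏ b : β, δ (Sum.inr (Sum.inl b)) := by
        intro δ
        rw [map_sub, hredU, hredV, map_prod, map_prod]
        simp
      classical
      have hne : (red U - red V) ∣ red q := by
        refine dvd_of_dvd_mul_prod_X Finset.univ (fun a : α ↦ Sum.inl a) _ _ (fun a _ ↦ ?_) ?_
        · refine hev (fun x ↦ if x = Sum.inl a then 0 else 1) _ (if_pos rfl) ?_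
          rw [hevU, Finset.prod_eq_zero (Finset.mem_univ a) (by simp)]
          simp
        · rw [← hredU]
          refine dvd_of_dvd_mul_prod_X Finset.univ (fun c : γ ↦ Sum.inr (Sum.inr c)) _ _
            (fun c _ ↦ ?_) ?_
          · rw [not_and_or, not_isEmpty_iff, not_isEmpty_iff] at hempty
            rcases hempty with ⟨⟨a⟩⟩ | ⟨⟨b⟩⟩
            · refine hev (fun x ↦ if x = Sum.inl a ∨ x = Sum.inr (Sum.inr c) then 0 else 1) _
                (by simp) ?_
              rw [hevU, Finset.prod_eq_zero (Finset.mem_univ a) (by simp)]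
              simp
            · refine hev (fun x ↦ if x = Sum.inr (Sum.inl b) ∨ x = Sum.inr (Sum.inr c)
                then 0 else 1) _ (by simp) ?_
              rw [hevU, Finset.prod_eq_zero (s := Finset.univ)
                (f := fun b' : β ↦ (if (Sum.inr (Sum.inl b') : α ⊕ β ⊕ γ) = Sum.inr (Sum.inl b) ∨
                (Sum.inr (Sum.inl b') : α ⊕ β ⊕ γ) = Sum.inr (Sum.inr c) then (0 : k) else 1))
                (Finset.mem_univ b) (by simp)]
              simp
          · rw [← hredW]
            exact hdvd
      obtain ⟨c, hc⟩ := hne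
      exact ⟨c, by rw [hc, mul_comm]⟩
  obtain ⟨c, hc⟩ := h2
  obtain ⟨c, rfl⟩ := hred c
  have h3 : ∃ p', p = -c * U * W + MvPolynomial.C ϖ * p' ∨ red U - red V = 0 := by
    by_cases h0 : red U - red V = 0
    · exact ⟨0, Or.inr h0⟩
    · have : red (p + c * U * W) = 0 := by
        rw [map_add, map_mul, map_mul]
        have h4 : (red p + red c * red U * red W) * (red U - red V) = 0 := by
          rw [hc] at h1
          linear_combination h1
        exact (mul_eq_zero.mp h4).resolve_right h0
      obtain ⟨p', hp'⟩ := hker _ this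
      exact ⟨p', Or.inl (by linear_combination hp')⟩
  obtain ⟨q', hq'⟩ := hker (q - c * (U - V)) (by rw [map_sub, map_mul, map_sub, hc, sub_self])
  have hC0 : (MvPolynomial.C ϖ : MvPolynomial (α ⊕ β ⊕ γ) R) ≠ 0 := by
    rwa [Ne, MvPolynomial.C_eq_zero]
  rw [hspan, Ideal.mem_span_pair]
  obtain ⟨p', hp' | hp'⟩ := h3
  -- Substituting p = -cUW + ϖp' and q = c(U - V) + ϖq', the trivial syzygy leaves the term -cϖ(U -
  -- V), whence the coefficient p' - c.
  · refine ⟨p' - c, q', ?_⟩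
    apply mul_left_cancel₀ hC0
    rw [← hpq]
    linear_combination (-1 : MvPolynomial (α ⊕ β ⊕ γ) R) * (U - V) * hp' -
      (U * W - MvPolynomial.C ϖ) * hq'
  · have hUV : U = V := by
      by_cases hempty : IsEmpty α ∧ IsEmpty β
      · obtain ⟨_, _⟩ := hempty
        simp [hU, hV]
      · exfalso
        classical
        rw [not_and_or, not_isEmpty_iff, not_isEmpty_iff] at hempty
        have hev : ∀ δ : α ⊕ β ⊕ γ → k,
            (∏ a : α, δ (Sum.inl a)) - ∏ b : β, δ (Sum.inr (Sum.inl b)) = 0 := by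
          intro δ
          have := congr_arg (MvPolynomial.eval δ) hp'
          rw [map_sub, hredU, hredV, map_prod, map_prod, map_zero] at this
          simpa using this
        rcases hempty with ⟨⟨a⟩⟩ | ⟨⟨b⟩⟩
        · have := hev (fun x ↦ if x = Sum.inl a then 0 else 1)
          rw [Finset.prod_eq_zero (Finset.mem_univ a) (by simp)] at this
          simp at this
        · have := hev (fun x ↦ if x = Sum.inr (Sum.inl b) then 0 else 1)
          rw [Finset.prod_eq_zero (s := Finset.univ)
            (f := fun b' : β ↦ (if (Sum.inr (Sum.inl b') : α ⊕ β ⊕ γ) = Sum.inr (Sum.inl b)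
              then (0 : k) else 1)) (Finset.mem_univ b) (by simp)] at this
          simp at this
    have h5 : red q = 0 := by rw [hc, hp', mul_zero]
    obtain ⟨q'', hq''⟩ := hker _ h5
    refine ⟨0, q'', ?_⟩
    apply mul_left_cancel₀ hC0
    rw [← hpq, hUV]
    linear_combination (-(V * W - MvPolynomial.C ϖ)) * hq''

theorem algebraMap_mem_nonZeroDivisors [IsDomain R] [IsLocalRing R] (hϖ0 : ϖ ≠ 0)
    (hϖ : maximalIdeal R = Ideal.span {ϖ}) :
    algebraMap R (ChartRing ϖ α β γ) ϖ ∈ nonZeroDivisors (ChartRing ϖ α β γ) := by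
  rw [mem_nonZeroDivisors_iff_right]
  intro x hx
  obtain ⟨g, rfl⟩ := Ideal.Quotient.mk_surjective x
  refine Ideal.Quotient.eq_zero_iff_mem.mpr (mem_chartRel_of_C_mul_mem hϖ0 hϖ g ?_)
  rw [mul_comm]
  exact Ideal.Quotient.eq_zero_iff_mem.mp hx

end ChartRing

end ChartRing

end SemistableProduct

namespace SemistableProduct

open IsLocalRing TensorProduct

/-! ### Smoothness as an infinitesimal lifting property. -/

section SmoothHom

theorem smooth_exists_lift {T A B : Type*} [CommRing T] [CommRing A] [CommRing B] {f : T →+* A}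
    (hf : f.Smooth) (J : Ideal B) (hJ : J ^ 2 = ⊥) (τ : T →+* B) (g : A →+* B ⧸ J)
    (hg : ∀ x, g (f x) = Ideal.Quotient.mk J (τ x)) :
    ∃ h : A →+* B, (∀ x, h (f x) = τ x) ∧ ∀ a, Ideal.Quotient.mk J (h a) = g a := by
  letI := f.toAlgebra
  letI := τ.toAlgebra
  have hf' : Algebra.Smooth T A := hf
  have := hf'.formallySmooth
  let g' : A →ₐ[T] B ⧸ J := { g with commutes' := fun x ↦ hg x }
  obtain ⟨h, hh⟩ := Algebra.FormallySmooth.comp_surjective T A J hJ g'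
  exact ⟨h.toRingHom, fun x ↦ h.commutes x, fun a ↦ DFunLike.congr_fun hh a⟩

theorem smooth_of_exists_lift {T A : Type u} [CommRing T] [CommRing A] {f : T →+* A}
    (hf : f.FinitePresentation)
    (H : ∀ (B : Type u) [CommRing B] (J : Ideal B), J ^ 2 = ⊥ → ∀ (τ : T →+* B) (g : A →+* B ⧸ J),
      (∀ x, g (f x) = Ideal.Quotient.mk J (τ x)) →
      ∃ h : A →+* B, (∀ x, h (f x) = τ x) ∧ ∀ a, Ideal.Quotient.mk J (h a) = g a) : f.Smooth := by
  letI := f.toAlgebra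
  refine @Algebra.Smooth.mk _ _ _ _ _ ?_ hf
  refine Algebra.FormallySmooth.of_comp_surjective fun B _ _ J hJ g ↦ ?_
  obtain ⟨h, h1, h2⟩ := H B J hJ (algebraMap T B) g.toRingHom (fun x ↦ g.commutes x)
  exact ⟨{ h with commutes' := h1 }, AlgHom.ext h2⟩

theorem finitePresentation_of_smooth {T A : Type*} [CommRing T] [CommRing A] {f : T →+* A}
    (hf : f.Smooth) : f.FinitePresentation := by
  letI := f.toAlgebra
  exact Algebra.Smooth.finitePresentation (self := hf)

/-- Smoothness descends to the quotient by an ideal of the base. -/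
theorem exists_smooth_of_surjective {T P A D : Type u} [CommRing T] [CommRing P] [CommRing A]
    [CommRing D] {f : T →+* A} (hf : f.Smooth) {π : T →+* P} (hπ : Function.Surjective π)
    (hπ' : (RingHom.ker π).FG)
    {δ : A →+* D} (hδ : Function.Surjective δ) (hker : RingHom.ker δ = (RingHom.ker π).map f) :
    ∃ κ : P →+* D, (∀ x, κ (π x) = δ (f x)) ∧ κ.Smooth := by
  let κ : P →+* D := RingHom.liftOfSurjective π hπ ⟨δ.comp f, fun x hx ↦ by
    have : f x ∈ RingHom.ker δ := hker ▸ Ideal.mem_map_of_mem f hx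
    exact this⟩
  have hκ : ∀ x, κ (π x) = δ (f x) := fun x ↦ RingHom.liftOfRightInverse_comp_apply _ _ _ _ x
  refine ⟨κ, hκ, smooth_of_exists_lift ?_ ?_⟩
  · refine RingHom.FinitePresentation.of_comp_finiteType π (g := κ) ?_
      (RingHom.FiniteType.of_surjective π hπ)
    have : κ.comp π = δ.comp f := RingHom.ext hκ
    rw [this]
    refine RingHom.FinitePresentation.comp ?_ (finitePresentation_of_smooth hf)
    exact RingHom.FinitePresentation.of_surjective δ hδ (hker ▸ hπ'.map f)
  · intro B _ J hJ τ g hg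
    obtain ⟨h, h1, h2⟩ := smooth_exists_lift hf J hJ (τ.comp π) (g.comp δ)
      (fun x ↦ by simp only [RingHom.comp_apply, ← hκ, hg])
    have hk : ∀ x ∈ RingHom.ker δ, h x = 0 := by
      intro x hx
      have : (RingHom.ker π).map f ≤ RingHom.ker h := by
        rw [Ideal.map_le_iff_le_comap]
        intro y hy
        change h (f y) = 0
        rw [h1, RingHom.comp_apply, RingHom.mem_ker.mp hy, map_zero]
      exact this (hker ▸ hx)
    let h' : D →+* B := RingHom.liftOfSurjective δ hδ ⟨h, hk⟩
    have hh' : ∀ x, h' (δ x) = h x := fun x ↦ RingHom.liftOfRightInverse_comp_apply _ _ _ _ x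
    refine ⟨h', fun x ↦ ?_, fun x ↦ ?_⟩
    · obtain ⟨y, rfl⟩ := hπ x
      rw [hκ, hh', h1, RingHom.comp_apply]
    · obtain ⟨y, rfl⟩ := hδ x
      rw [hh', h2, RingHom.comp_apply]

theorem flat_of_smooth {T A : Type u} [CommRing T] [CommRing A] {f : T →+* A}
    (hf : f.Smooth) : f.Flat := by
  letI := f.toAlgebra
  have hf' : Algebra.Smooth T A := hf
  exact RingHom.flat_algebraMap_iff.mpr (Algebra.Smooth.flat T A)

theorem map_mem_nonZeroDivisors_of_flat {T A : Type*} [CommRing T] [CommRing A] {f : T →+* A}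
    (hf : f.Flat) {x : T} (hx : x ∈ nonZeroDivisors T) : f x ∈ nonZeroDivisors A := by
  letI := f.toAlgebra
  have : Module.Flat T A := hf
  have h := Module.Flat.isSMulRegular_of_nonZeroDivisors (M := A) hx
  rw [mem_nonZeroDivisors_iff_right]
  intro y hy
  refine h ?_
  simp only [Algebra.smul_def, mul_zero]
  rw [mul_comm]
  exact hy

end SmoothHom

/-! ### Charts: smooth maps to the model. -/

section IsChart

variable {R : Type u} [CommRing R] (ϖ : R) {A : Type u} [CommRing A] (ρ : R →+* A)
  {α β γ : Type} [Fintype α] [Fintype β] [Fintype γ]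

/-- The elements `u`, `v`, `w` of `A` define a smooth homomorphism from
`R[u, v, w] / (∏ u - ∏ v, ∏ u * ∏ w - ϖ)` to `A`. -/
structure IsChart (u : α → A) (v : β → A) (w : γ → A) : Prop where
  prod_eq : ∏ a, u a = ∏ b, v b
  prod_mul : (∏ a, u a) * ∏ c, w c = ρ ϖ
  smooth : (ChartRing.lift ρ u v w prod_eq prod_mul).Smooth

/-- The elements `w` of `A` define a smooth homomorphism from `R[w] / (∏ w - ϖ)` to `A`. -/
abbrev IsStdChart (w : γ → A) : Prop :=
  IsChart ϖ ρ (Empty.elim : Empty → A) (Empty.elim : Empty → A) w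

variable {ϖ ρ} {u : α → A} {v : β → A} {w : γ → A}

namespace IsChart

theorem exists_lift (H : IsChart ϖ ρ u v w) {B : Type*} [CommRing B] (J : Ideal B) (hJ : J ^ 2 = ⊥)
    (σ : R →+* B) (u' : α → B) (v' : β → B) (w' : γ → B) (h : ∏ a, u' a = ∏ b, v' b)
    (h' : (∏ a, u' a) * ∏ c, w' c = σ ϖ) (g : A →+* B ⧸ J)
    (hσ : ∀ r, g (ρ r) = Ideal.Quotient.mk J (σ r)) (hu : ∀ a, g (u a) = Ideal.Quotient.mk J (u' a))
    (hv : ∀ b, g (v b) = Ideal.Quotient.mk J (v' b))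
    (hw : ∀ c, g (w c) = Ideal.Quotient.mk J (w' c)) :
    ∃ φ : A →+* B, (∀ r, φ (ρ r) = σ r) ∧ (∀ a, φ (u a) = u' a) ∧ (∀ b, φ (v b) = v' b) ∧
      (∀ c, φ (w c) = w' c) ∧ ∀ x, Ideal.Quotient.mk J (φ x) = g x := by
  obtain ⟨φ, h1, h2⟩ := smooth_exists_lift H.smooth J hJ (ChartRing.lift σ u' v' w' h h') g (by
    refine RingHom.congr_fun (f := g.comp _) (g := (Ideal.Quotient.mk J).comp _)
      (ChartRing.hom_ext (fun r ↦ ?_) (fun x ↦ ?_))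
    · simp only [RingHom.comp_apply, ChartRing.lift_algebraMap, hσ]
    · simp only [RingHom.comp_apply, ChartRing.lift_var]
      rcases x with a | b | c
      · exact hu a
      · exact hv b
      · exact hw c)
  refine ⟨φ, fun r ↦ ?_, fun a ↦ ?_, fun b ↦ ?_, fun c ↦ ?_, h2⟩
  · have := h1 (algebraMap R _ r)
    rwa [ChartRing.lift_algebraMap, ChartRing.lift_algebraMap] at this
  · have := h1 (ChartRing.var ϖ (Sum.inl a))
    rwa [ChartRing.lift_var, ChartRing.lift_var] at this
  · have := h1 (ChartRing.var ϖ (Sum.inr (Sum.inl b)))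
    rwa [ChartRing.lift_var, ChartRing.lift_var] at this
  · have := h1 (ChartRing.var ϖ (Sum.inr (Sum.inr c)))
    rwa [ChartRing.lift_var, ChartRing.lift_var] at this

theorem finiteType_algebraMap : (algebraMap R (ChartRing ϖ α β γ)).FiniteType := by
  rw [RingHom.finiteType_algebraMap]
  infer_instance

theorem finitePresentation_algebraMap :
    (algebraMap R (ChartRing ϖ α β γ)).FinitePresentation := by
  rw [RingHom.finitePresentation_algebraMap]
  refine Algebra.FinitePresentation.quotient ?_
  exact Submodule.fg_span (Set.toFinite _)

/-- Together with `exists_lift` this turns smoothness over the chart ring into the lifting of tuples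
that satisfy the two relations, so that a change of coordinates only has to be checked on such
tuples. -/
theorem of_exists_lift (h : ∏ a, u a = ∏ b, v b) (h' : (∏ a, u a) * ∏ c, w c = ρ ϖ)
    (hρ : ρ.FinitePresentation)
    (H : ∀ (B : Type u) [CommRing B] (J : Ideal B), J ^ 2 = ⊥ →
      ∀ (σ : R →+* B) (u' : α → B) (v' : β → B) (w' : γ → B), ∏ a, u' a = ∏ b, v' b →
      (∏ a, u' a) * ∏ c, w' c = σ ϖ → ∀ (g : A →+* B ⧸ J),
      (∀ r, g (ρ r) = Ideal.Quotient.mk J (σ r)) → (∀ a, g (u a) = Ideal.Quotient.mk J (u' a)) →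
      (∀ b, g (v b) = Ideal.Quotient.mk J (v' b)) →
      (∀ c, g (w c) = Ideal.Quotient.mk J (w' c)) →
      ∃ φ : A →+* B, (∀ r, φ (ρ r) = σ r) ∧ (∀ a, φ (u a) = u' a) ∧ (∀ b, φ (v b) = v' b) ∧
        (∀ c, φ (w c) = w' c) ∧ ∀ x, Ideal.Quotient.mk J (φ x) = g x) : IsChart ϖ ρ u v w := by
  refine ⟨h, h', smooth_of_exists_lift ?_ ?_⟩
  · refine RingHom.FinitePresentation.of_comp_finiteType (algebraMap R _) ?_ finiteType_algebraMap
    have : (ChartRing.lift ρ u v w h h').comp (algebraMap R _) = ρ :=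
      RingHom.ext fun r ↦ ChartRing.lift_algebraMap ρ u v w h h' r
    rwa [this]
  · intro B _ J hJ τ g hg
    obtain ⟨φ, h1, h2, h3, h4, h5⟩ := H B J hJ (τ.comp (algebraMap R _))
      (fun a ↦ τ (ChartRing.var ϖ (Sum.inl a)))
      (fun b ↦ τ (ChartRing.var ϖ (Sum.inr (Sum.inl b))))
      (fun c ↦ τ (ChartRing.var ϖ (Sum.inr (Sum.inr c))))
      (by rw [← map_prod, ← map_prod, ChartRing.prod_eq])
      (by rw [← map_prod, ← map_prod, ← map_mul, ChartRing.prod_mul]; rfl) g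
      (fun r ↦ by rw [RingHom.comp_apply, ← hg, ChartRing.lift_algebraMap])
      (fun a ↦ by rw [← hg, ChartRing.lift_var]; rfl)
      (fun a ↦ by rw [← hg, ChartRing.lift_var]; rfl)
      (fun a ↦ by rw [← hg, ChartRing.lift_var]; rfl)
    refine ⟨φ, fun x ↦ ?_, h5⟩
    refine RingHom.congr_fun (f := φ.comp _) (g := τ)
      (ChartRing.hom_ext (fun r ↦ ?_) (fun x ↦ ?_)) x
    · simp only [RingHom.comp_apply, ChartRing.lift_algebraMap, h1]
    · simp only [RingHom.comp_apply, ChartRing.lift_var]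
      rcases x with a | b | c
      · exact h2 a
      · exact h3 b
      · exact h4 c

theorem finitePresentation (H : IsChart ϖ ρ u v w) : ρ.FinitePresentation := by
  have : (ChartRing.lift ρ u v w H.prod_eq H.prod_mul).comp (algebraMap R _) = ρ :=
    RingHom.ext fun r ↦
      ChartRing.lift_algebraMap ρ u v w H.prod_eq H.prod_mul r
  rw [← this]
  exact (finitePresentation_of_smooth H.smooth).comp finitePresentation_algebraMap

theorem map (H : IsChart ϖ ρ u v w) {A' : Type u} [CommRing A'] {φ : A →+* A'} (hφ : φ.Smooth) :
    IsChart ϖ (φ.comp ρ) (φ ∘ u) (φ ∘ v) (φ ∘ w) := by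
  refine ⟨?_, ?_, ?_⟩
  · simp only [Function.comp_apply, ← map_prod, H.prod_eq]
  · simp only [Function.comp_apply, ← map_prod, ← map_mul, H.prod_mul, RingHom.comp_apply]
  · convert H.smooth.comp hφ
    refine ChartRing.hom_ext (fun r ↦ ?_) (fun x ↦ ?_)
    · simp only [RingHom.comp_apply, ChartRing.lift_algebraMap]
    · simp only [RingHom.comp_apply, ChartRing.lift_var]
      rcases x with a | b | c <;> rfl

theorem swap (H : IsChart ϖ ρ u v w) : IsChart ϖ ρ v u w := by
  refine of_exists_lift H.prod_eq.symm (H.prod_eq ▸ H.prod_mul) H.finitePresentation ?_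
  intro B _ J hJ σ u' v' w' h h' g hσ hu hv hw
  obtain ⟨φ, h1, h2, h3, h4⟩ := H.exists_lift J hJ σ v' u' w' h.symm (h ▸ h') g hσ hv hu hw
  exact ⟨φ, h1, h3, h2, h4⟩

section DVR

variable [IsDomain R] [IsLocalRing R]

theorem map_mem_nonZeroDivisors (H : IsChart ϖ ρ u v w) (hϖ0 : ϖ ≠ 0)
    (hϖ : maximalIdeal R = Ideal.span {ϖ}) : ρ ϖ ∈ nonZeroDivisors A := by
  rw [← ChartRing.lift_algebraMap ρ u v w H.prod_eq H.prod_mul]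
  exact map_mem_nonZeroDivisors_of_flat (flat_of_smooth H.smooth)
    (ChartRing.algebraMap_mem_nonZeroDivisors hϖ0 hϖ)

theorem right_mem_nonZeroDivisors (H : IsChart ϖ ρ u v w) (hϖ0 : ϖ ≠ 0)
    (hϖ : maximalIdeal R = Ideal.span {ϖ}) (c : γ) : w c ∈ nonZeroDivisors A := by
  have h := H.map_mem_nonZeroDivisors hϖ0 hϖ
  rw [← H.prod_mul, mul_mem_nonZeroDivisors] at h
  classical
  have h1 := h.2
  rw [← Finset.mul_prod_erase _ _ (Finset.mem_univ c), mul_mem_nonZeroDivisors] at h1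
  exact h1.1

/-- Over a discrete valuation ring flat means torsion-free, and it is enough that the uniformizer be
a non-zero-divisor. -/
theorem flat (H : IsChart ϖ ρ u v w) [IsDiscreteValuationRing R] (hϖ : Irreducible ϖ) :
    ρ.Flat := by
  letI := ρ.toAlgebra
  have h := H.map_mem_nonZeroDivisors hϖ.ne_zero hϖ.maximalIdeal_eq
  change Module.Flat R A
  have : Module.IsTorsionFree R A := by
    refine ⟨fun r hr ↦ ?_⟩
    obtain ⟨n, x, rfl⟩ := IsDiscreteValuationRing.eq_unit_mul_pow_irreducible hr.ne_zero hϖ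
    intro y z hyz
    simp only [Algebra.smul_def] at hyz
    have h2 : ρ (x * ϖ ^ n) ∈ nonZeroDivisors A := by
      rw [map_mul, map_pow]
      exact mul_mem ((x.isUnit.map ρ).mem_nonZeroDivisors) (pow_mem h n)
    exact (mul_cancel_left_mem_nonZeroDivisors h2).mp hyz
  infer_instance

end DVR

end IsChart

end IsChart

end SemistableProduct

namespace SemistableProduct

open IsLocalRing TensorProduct

/-! ### The coordinate ring of a chart of the blow-up. -/

section BlowupRing

variable {A : Type u} [CommRing A]

/-- The ring `A[t] / (u t - v, p - t q)`. For `u p = v q` it is, under suitable assumptions, the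
chart `u ≠ 0` of the blow-up of `(u, v)`. -/
abbrev BlowupRing (u v p q : A) : Type u :=
  Polynomial A ⧸ Ideal.span {Polynomial.C u * Polynomial.X - Polynomial.C v,
    Polynomial.C p - Polynomial.X * Polynomial.C q}

namespace BlowupRing

variable (u v p q : A)

/-- The structure map of the blow-up chart. -/
noncomputable def of : A →+* BlowupRing u v p q := (Ideal.Quotient.mk _).comp Polynomial.C

/-- The quotient `v / u` in the blow-up chart. -/
noncomputable def ratio : BlowupRing u v p q := Ideal.Quotient.mk _ Polynomial.X

theorem of_mul_ratio : of u v p q u * ratio u v p q = of u v p q v :=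
  Ideal.Quotient.eq.mpr (Ideal.subset_span (Or.inl rfl))

theorem of_eq_ratio_mul : of u v p q p = ratio u v p q * of u v p q q :=
  Ideal.Quotient.eq.mpr (Ideal.subset_span (Or.inr rfl))

variable {u v p q}

theorem hom_ext {B : Type*} [CommRing B] {f g : BlowupRing u v p q →+* B}
    (h : ∀ a, f (of u v p q a) = g (of u v p q a))
    (h' : f (ratio u v p q) = g (ratio u v p q)) : f = g :=
  Ideal.Quotient.ringHom_ext (Polynomial.ringHom_ext h h')

theorem exists_lift {B : Type*} [CommRing B] (g : A →+* B) (t : B) (h : g u * t = g v)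
    (h' : g p = t * g q) : ∃ φ : BlowupRing u v p q →+* B,
      (∀ a, φ (of u v p q a) = g a) ∧ φ (ratio u v p q) = t := by
  have hk : Ideal.span {Polynomial.C u * Polynomial.X - Polynomial.C v,
      Polynomial.C p - Polynomial.X * Polynomial.C q} ≤
      RingHom.ker (Polynomial.eval₂RingHom g t) := by
    rw [Ideal.span_le]
    rintro _ (rfl | rfl)
    · simp [RingHom.mem_ker, h]
    · simp [RingHom.mem_ker, h', mul_comm (g q)]
  refine ⟨Ideal.Quotient.lift _ (Polynomial.eval₂RingHom g t) fun a ha ↦ hk ha, fun a ↦ ?_, ?_⟩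
  · exact Polynomial.eval₂_C g t
  · exact Polynomial.eval₂_X g t

theorem finitePresentation_of : (of u v p q).FinitePresentation := by
  refine RingHom.FinitePresentation.comp (RingHom.FinitePresentation.of_surjective _
    Ideal.Quotient.mk_surjective ?_) ?_
  · rw [Ideal.mk_ker]
    exact Submodule.fg_span (Set.toFinite _)
  · rw [← Polynomial.algebraMap_eq, RingHom.finitePresentation_algebraMap]
    exact Algebra.FinitePresentation.polynomial A A

end BlowupRing

end BlowupRing

section

variable {R : Type u} [CommRing R] {ϖ : R} {A : Type u} [CommRing A] {ρ : R →+* A}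
  {α β γ : Type} [Fintype α] [Fintype β] [Fintype γ] {u : α → A} {v : β → A} {w : γ → A}

namespace IsChart

theorem blowup_relation [DecidableEq α] [DecidableEq β] (H : IsChart ϖ ρ u v w) (a : α) (b : β) :
    u a * ∏ x : {x // x ≠ a}, u x = v b * ∏ y : {y // y ≠ b}, v y := by
  rw [← Fintype.prod_eq_mul_prod_subtype_ne, H.prod_eq, Fintype.prod_eq_mul_prod_subtype_ne _ b]

/-- A chart of the blow-up of `(u a, v b)`. -/
theorem blowup [DecidableEq α] [DecidableEq β] (H : IsChart ϖ ρ u v w) (a : α) (b : β)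
    {A' : Type u} [CommRing A'] (f : A →+* A') (r : A')
    (e : BlowupRing (u a) (v b) (∏ x : {x // x ≠ a}, u x) (∏ y : {y // y ≠ b}, v y) →+* A')
    (he : e.Smooth) (hef : ∀ x, e (BlowupRing.of _ _ _ _ x) = f x)
    (her : e (BlowupRing.ratio _ _ _ _) = r) :
    IsChart ϖ (f.comp ρ) (fun x : {x // x ≠ a} ↦ f (u x)) (Function.update (f ∘ v) b r)
      (fun c : Option γ ↦ c.elim (f (u a)) (f ∘ w)) := by
  have hfr : f (u a) * r = f (v b) := by
    rw [← her, ← hef, ← hef, ← map_mul, BlowupRing.of_mul_ratio]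
  have hfp : f (∏ x : {x // x ≠ a}, u x) = r * f (∏ y : {y // y ≠ b}, v y) := by
    rw [← her, ← hef, ← hef, ← map_mul, BlowupRing.of_eq_ratio_mul]
  have hupd : ∀ {B : Type u} [CommRing B] (v' : β → B),
      ∏ y, v' y = v' b * ∏ y : {y // y ≠ b}, v' y :=
    fun v' ↦ Fintype.prod_eq_mul_prod_subtype_ne v' b
  refine of_exists_lift ?_ ?_ ?_ ?_
  · rw [hupd, Function.update_self, ← map_prod, hfp, map_prod]
    congr 1
    refine Finset.prod_congr rfl fun y _ ↦ ?_
    rw [Function.update_of_ne y.2]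
    rfl
  · rw [Fintype.prod_option]
    simp only [Option.elim, Function.comp_apply, ← map_prod, ← map_mul, RingHom.comp_apply]
    rw [← H.prod_mul, Fintype.prod_eq_mul_prod_subtype_ne _ a]
    congr 1
    ring
  · have : f = e.comp (BlowupRing.of _ _ _ _) := RingHom.ext fun x ↦ (hef x).symm
    rw [this]
    exact ((finitePresentation_of_smooth he).comp BlowupRing.finitePresentation_of).comp
      H.finitePresentation
  · intro B _ J hJ σ u' v' w' h h' g hσ hu hv hw
    -- Old coordinates are recovered from new ones by u_a = w_none and v_b = u_a r, where r is the
    -- new coordinate of index `b`.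
    let U' : α → B := fun x ↦ if hx : x = a then w' none else u' ⟨x, hx⟩
    let V' : β → B := Function.update v' b (w' none * v' b)
    have hU'a : U' a = w' none := dif_pos rfl
    have hU' : ∀ x : {x // x ≠ a}, U' x = u' x := fun x ↦ dif_neg x.2
    have hV'b : V' b = w' none * v' b := Function.update_self _ _ _
    have hV' : ∀ y : {y // y ≠ b}, V' y = v' y := fun y ↦ Function.update_of_ne y.2 _ _
    have hgv : ∀ y : {y // y ≠ b}, g (f (v y)) = Ideal.Quotient.mk J (v' y) := fun y ↦ by
      rw [← hv, Function.update_of_ne y.2]; rfl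
    have hgr : g r = Ideal.Quotient.mk J (v' b) := by rw [← hv, Function.update_self]
    have hg0 : g (f (u a)) = Ideal.Quotient.mk J (w' none) := hw none
    obtain ⟨φ, h1, h2, h3, h4, h5⟩ := H.exists_lift J hJ σ U' V' (fun c ↦ w' (some c))
      (by
        rw [Fintype.prod_eq_mul_prod_subtype_ne _ a, Fintype.prod_eq_mul_prod_subtype_ne _ b,
          hU'a, hV'b, Finset.prod_congr rfl fun x _ ↦ hU' x,
          Finset.prod_congr rfl fun y _ ↦ hV' y, h, hupd, mul_assoc])
      (by
        rw [Fintype.prod_eq_mul_prod_subtype_ne _ a, hU'a, Finset.prod_congr rfl fun x _ ↦ hU' x,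
          ← h', Fintype.prod_option]
        ring)
      (g.comp f) hσ
      (fun x ↦ by
        by_cases hx : x = a
        · subst hx
          rw [hU'a]
          exact hg0
        · rw [hU' ⟨x, hx⟩]
          exact hu ⟨x, hx⟩)
      (fun y ↦ by
        by_cases hy : y = b
        · subst hy
          rw [hV'b, map_mul, ← hg0, ← hgr, ← map_mul, hfr]
          rfl
        · rw [hV' ⟨y, hy⟩]
          exact hgv ⟨y, hy⟩)
      (fun c ↦ hw (some c))
    -- The lift on `A` extends to the blow-up ring by choosing v'_b as the ratio; smoothness of `e`
    -- then lifts to `A'`.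
    obtain ⟨φ', h6, h7⟩ := BlowupRing.exists_lift (u := u a) (v := v b)
      (p := ∏ x : {x // x ≠ a}, u x) (q := ∏ y : {y // y ≠ b}, v y) φ (v' b)
      (by rw [h2, h3, hU'a, hV'b])
      (by
        rw [map_prod, map_prod, Finset.prod_congr rfl fun x _ ↦ h2 _,
          Finset.prod_congr rfl fun y _ ↦ h3 _, Finset.prod_congr rfl fun x _ ↦ hU' x,
          Finset.prod_congr rfl fun y _ ↦ hV' y, h, hupd])
    obtain ⟨ψ, h8, h9⟩ := smooth_exists_lift he J hJ φ' g (fun x ↦ by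
      refine RingHom.congr_fun (f := g.comp e) (g := (Ideal.Quotient.mk J).comp φ')
        (BlowupRing.hom_ext (fun x ↦ ?_) ?_) x
      · simp only [RingHom.comp_apply, h6, h5, hef]
      · simp only [RingHom.comp_apply, h7, her, hgr])
    have hψf : ∀ x, ψ (f x) = φ x := fun x ↦ by rw [← hef, h8, h6]
    refine ⟨ψ, fun x ↦ ?_, fun x ↦ ?_, fun y ↦ ?_, fun c ↦ ?_, h9⟩
    · rw [RingHom.comp_apply, hψf, h1]
    · rw [hψf, h2, hU']
    · by_cases hy : y = b
      · subst hy
        rw [Function.update_self, ← her, h8, h7]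
      · rw [Function.update_of_ne hy, Function.comp_apply, hψf, h3]
        exact hV' ⟨y, hy⟩
    · cases c with
      | none => exact (hψf _).trans ((h2 a).trans hU'a)
      | some c => exact (hψf _).trans (h4 c)

/-- If all but one of the `u` are units, the chart is a standard one. -/
theorem of_isUnit_left (H : IsChart ϖ ρ u v w) (a : α) (ha : ∀ x, x ≠ a → IsUnit (u x)) :
    IsStdChart ϖ ρ (Sum.elim v w) := by
  classical
  refine of_exists_lift (by simp) ?_ H.finitePresentation ?_
  · rw [Fintype.prod_sum_type]
    simp [← H.prod_mul, H.prod_eq]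
  · intro B _ J hJ σ u' v' w' h h' g hσ hu hv hw
    choose U₀ hU₀ using fun x ↦ Ideal.Quotient.mk_surjective (I := J) (g (u x))
    have hunit : ∀ x, x ≠ a → IsUnit (U₀ x) := fun x hx ↦ by
      refine (IsNilpotent.isUnit_quotient_mk_iff (I := J) ⟨2, hJ⟩).mp ?_
      rw [hU₀]
      exact (ha x hx).map g
    have hunit' : IsUnit (∏ x : {x // x ≠ a}, U₀ x) :=
      IsUnit.prod_univ_iff.mpr fun x ↦ hunit x x.2
    obtain ⟨d, hd⟩ := hunit'
    -- The u of index other than `a` are units and may be lifted arbitrarily; the relation ∏ u = ∏ v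
    -- then determines u_a.
    let U' : α → B := fun x ↦ if x = a then (∏ y, w' (Sum.inl y)) * ↑d⁻¹ else U₀ x
    have hU'a : U' a = (∏ y, w' (Sum.inl y)) * ↑d⁻¹ := if_pos rfl
    have hU' : ∀ x : {x // x ≠ a}, U' x = U₀ x := fun x ↦ if_neg x.2
    have hprod : ∏ x, U' x = ∏ y, w' (Sum.inl y) := by
      rw [Fintype.prod_eq_mul_prod_subtype_ne _ a, hU'a, Finset.prod_congr rfl fun x _ ↦ hU' x,
        ← hd, mul_assoc, Units.inv_mul, mul_one]
    obtain ⟨φ, h1, h2, h3, h4, h5⟩ := H.exists_lift J hJ σ U' (fun y ↦ w' (Sum.inl y))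
      (fun c ↦ w' (Sum.inr c)) hprod
      (by
        rw [hprod, ← h', Fintype.prod_sum_type]
        simp)
      g hσ
      (fun x ↦ by
        by_cases hx : x = a
        · subst hx
          have hm : IsUnit (Ideal.Quotient.mk J (d : B)) := d.isUnit.map _
          refine hm.mul_right_cancel ?_
          rw [hU'a, ← map_mul, mul_assoc, Units.inv_mul, mul_one, hd, map_prod, map_prod,
            Finset.prod_congr rfl fun x _ ↦ hU₀ _, ← map_prod, ← map_mul,
            ← Fintype.prod_eq_mul_prod_subtype_ne, H.prod_eq, map_prod]
          exact Finset.prod_congr rfl fun y _ ↦ hw (Sum.inl y)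
        · rw [hU' ⟨x, hx⟩, hU₀])
      (fun y ↦ hw (Sum.inl y)) (fun c ↦ hw (Sum.inr c))
    refine ⟨φ, h1, fun x ↦ x.elim, fun x ↦ x.elim, fun c ↦ ?_, h5⟩
    rcases c with y | c
    · exact h3 y
    · exact h4 c

end IsChart

namespace IsStdChart

theorem prod_eq (H : IsStdChart ϖ ρ w) : ∏ c, w c = ρ ϖ := by
  simpa using H.prod_mul

/-- In a standard chart, variables that are units can be absorbed into another variable. -/
theorem of_isUnit [DecidableEq γ] (H : IsStdChart ϖ ρ w) (I : γ → Prop) [DecidablePred I]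
    (c₀ : {c // I c}) (hI : ∀ c, ¬ I c → IsUnit (w c)) :
    IsStdChart ϖ ρ (fun c : {c // I c} ↦
      if c = c₀ then w c * ∏ d : {d // ¬ I d}, w d else w c) := by
  have key : ∀ {B : Type u} [CommRing B] (x : {c // I c} → B) (y : B),
      ∏ c, (if c = c₀ then x c * y else x c) = (∏ c, x c) * y := by
    intro B _ x y
    rw [Fintype.prod_eq_mul_prod_subtype_ne _ c₀, if_pos rfl,
      Fintype.prod_eq_mul_prod_subtype_ne x c₀, Finset.prod_congr rfl fun c _ ↦ if_neg c.2]
    ring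
  refine IsChart.of_exists_lift (by simp) ?_ H.finitePresentation ?_
  · have := key (fun c ↦ w c) (∏ d : {d // ¬ I d}, w d)
    rw [this, Fintype.prod_subtype_mul_prod_subtype, prod_eq H]
    simp
  · intro B _ J hJ σ u' v' w' h h' g hσ hu hv hw
    choose W₀ hW₀ using fun x ↦ Ideal.Quotient.mk_surjective (I := J) (g (w x))
    have hunit : ∀ x, ¬ I x → IsUnit (W₀ x) := fun x hx ↦ by
      refine (IsNilpotent.isUnit_quotient_mk_iff (I := J) ⟨2, hJ⟩).mp ?_
      rw [hW₀]
      exact (hI x hx).map g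
    have hunit' : IsUnit (∏ x : {x // ¬ I x}, W₀ x) :=
      IsUnit.prod_univ_iff.mpr fun x ↦ hunit x x.2
    obtain ⟨d, hd⟩ := hunit'
    -- The new coordinate at `c₀` is the old one times the units, so dividing by lifts of the units
    -- recovers the old one.
    let W' : γ → B := fun x ↦ if hx : I x then
      (if (⟨x, hx⟩ : {c // I c}) = c₀ then w' ⟨x, hx⟩ * ↑d⁻¹ else w' ⟨x, hx⟩) else W₀ x
    have hW'1 : ∀ x : {c // I c}, W' x = if x = c₀ then w' x * ↑d⁻¹ else w' x :=
      fun x ↦ dif_pos x.2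
    have hW'2 : ∀ x : {c // ¬ I c}, W' x = W₀ x := fun x ↦ dif_neg x.2
    have hprod : ∏ x, W' x = σ ϖ := by
      rw [← Fintype.prod_subtype_mul_prod_subtype I, Finset.prod_congr rfl fun x _ ↦ hW'1 x,
        key, Finset.prod_congr rfl fun x _ ↦ hW'2 x, ← hd, mul_assoc, Units.inv_mul, mul_one]
      simpa using h'
    obtain ⟨φ, h1, h2, h3, h4, h5⟩ := H.exists_lift J hJ σ u' v' W' h
      (by rw [hprod]; simp) g hσ hu hv
      (fun x ↦ by
        by_cases hx : I x
        · rw [hW'1 ⟨x, hx⟩]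
          have hwx := hw ⟨x, hx⟩
          split_ifs with hc
          · rw [if_pos hc, map_mul, map_prod] at hwx
            have hm : IsUnit (Ideal.Quotient.mk J (d : B)) := d.isUnit.map _
            refine hm.mul_right_cancel ?_
            rw [← map_mul, mul_assoc, Units.inv_mul, mul_one, hd, map_prod, ← hwx]
            congr 1
            exact Finset.prod_congr rfl fun x _ ↦ hW₀ _
          · rwa [if_neg hc] at hwx
        · rw [hW'2 ⟨x, hx⟩, hW₀])
    refine ⟨φ, h1, h2, h3, fun c ↦ ?_, h5⟩
    split_ifs with hc
    · rw [map_mul, h4, map_prod, hW'1, if_pos hc, Finset.prod_congr rfl fun x _ ↦ h4 _,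
        Finset.prod_congr rfl fun x _ ↦ hW'2 x, ← hd, mul_assoc, Units.inv_mul, mul_one]
    · rw [h4, hW'1, if_neg hc]

/-- The product of two standard charts over `R`. -/
theorem prod {A₁ A₂ : Type u} [CommRing A₁] [CommRing A₂] {ρ₁ : R →+* A₁} {ρ₂ : R →+* A₂}
    {u : α → A₁} {v : β → A₂} (H₁ : IsStdChart ϖ ρ₁ u) (H₂ : IsStdChart ϖ ρ₂ v)
    (i₁ : A₁ →+* A) (i₂ : A₂ →+* A) (hρ : ρ.FinitePresentation)
    (h₁ : ∀ r, i₁ (ρ₁ r) = ρ r) (h₂ : ∀ r, i₂ (ρ₂ r) = ρ r)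
    (hext : ∀ (B : Type u) [CommRing B] (f g : A →+* B), f.comp i₁ = g.comp i₁ →
      f.comp i₂ = g.comp i₂ → f = g)
    (hlift : ∀ (B : Type u) [CommRing B] (f : A₁ →+* B) (g : A₂ →+* B), f.comp ρ₁ = g.comp ρ₂ →
      ∃ φ : A →+* B, φ.comp i₁ = f ∧ φ.comp i₂ = g) :
    IsChart ϖ ρ (i₁ ∘ u) (i₂ ∘ v) (Empty.elim : Empty → A) := by
  refine IsChart.of_exists_lift ?_ ?_ hρ ?_
  · simp only [Function.comp_apply, ← map_prod, prod_eq H₁, prod_eq H₂, h₁, h₂]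
  · simp only [Function.comp_apply, ← map_prod, prod_eq H₁, h₁]
    simp
  · intro B _ J hJ σ u' v' w' h h' g hσ hu hv hw
    have hu' : ∏ c, u' c = σ ϖ := by simpa using h'
    obtain ⟨φ₁, a1, -, -, a4, a5⟩ := H₁.exists_lift J hJ σ Empty.elim Empty.elim u' (by simp)
      (by simpa using hu') (g.comp i₁) (fun r ↦ by rw [RingHom.comp_apply, h₁, hσ])
      (fun x ↦ x.elim) (fun x ↦ x.elim) hu
    obtain ⟨φ₂, b1, -, -, b4, b5⟩ := H₂.exists_lift J hJ σ Empty.elim Empty.elim v' (by simp)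
      (by simpa [← h] using hu') (g.comp i₂) (fun r ↦ by rw [RingHom.comp_apply, h₂, hσ])
      (fun x ↦ x.elim) (fun x ↦ x.elim) hv
    obtain ⟨φ, c1, c2⟩ := hlift B φ₁ φ₂ (RingHom.ext fun r ↦ by
      rw [RingHom.comp_apply, RingHom.comp_apply, a1, b1])
    have c1' : ∀ x, φ (i₁ x) = φ₁ x := RingHom.congr_fun c1
    have c2' : ∀ x, φ (i₂ x) = φ₂ x := RingHom.congr_fun c2
    refine ⟨φ, fun r ↦ by rw [← h₁, c1', a1], fun a ↦ ?_, fun b ↦ ?_, fun x ↦ x.elim, fun x ↦ ?_⟩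
    · rw [Function.comp_apply, c1', a4]
    · rw [Function.comp_apply, c2', b4]
    · refine RingHom.congr_fun (f := (Ideal.Quotient.mk J).comp φ) (hext _ _ _ ?_ ?_) x
      · exact RingHom.ext fun x ↦ by
          rw [RingHom.comp_apply, RingHom.comp_apply, c1', a5]
      · exact RingHom.ext fun x ↦ by
          rw [RingHom.comp_apply, RingHom.comp_apply, c2', b5]

end IsStdChart

end

end SemistableProduct

namespace SemistableProduct

open IsLocalRing TensorProduct

theorem smooth_mvPolynomial_C (k : Type u) [CommRing k] (σ : Type) [Finite σ] :
    (MvPolynomial.C : k →+* MvPolynomial σ k).Smooth := by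
  rw [← MvPolynomial.algebraMap_eq, RingHom.smooth_algebraMap]
  have : Algebra.FormallySmooth k (MvPolynomial σ k) := inferInstance
  exact ⟨inferInstance, inferInstance⟩

/-! ### Smooth algebras over a perfect field. -/

section Domain

/-- The local rings of a smooth algebra over a perfect field are domains. -/
theorem exists_mul_eq_zero_of_smooth {k D : Type u} [Field k] [PerfectField k] [CommRing D]
    [Algebra k D] [Algebra.Smooth k D] (P : Ideal D) [hP : P.IsPrime] {x y : D} (hxy : x * y = 0) :
    ∃ s ∉ P, s * x = 0 ∨ s * y = 0 := by
  obtain ⟨m, hm, hPm⟩ := Ideal.exists_le_maximal P hP.ne_top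
  have : IsNoetherianRing D := Algebra.FiniteType.isNoetherianRing k D
  have hft : Algebra.FiniteType k (D ⧸ m) :=
    Algebra.FiniteType.of_surjective (Ideal.Quotient.mkₐ k m) (Ideal.Quotient.mkₐ_surjective k m)
  letI := Ideal.Quotient.field m
  have hfin : Module.Finite k (D ⧸ m) := finite_of_finite_type_of_isJacobsonRing k (D ⧸ m)
  have hsep : HasSimpleRoots k (D ⧸ m) := hasSimpleRoots_of_isSeparable
  let B := Localization.AtPrime m
  let S := AdicCompletion (maximalIdeal B) B
  have hS : IsCompletion (maximalIdeal B) S :=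
    IsCompletion.adicCompletion _ (Ideal.fg_of_isNoetherianRing _)
  have hdom : IsDomain S := isDomain_of_smooth_of_isCompletion (A := D) (k := k) m hsep hS
  have hinj := hS.injective (maximalIdeal_le_jacobson _)
  have h0 : algebraMap B S (algebraMap D B x) * algebraMap B S (algebraMap D B y) = 0 := by
    rw [← map_mul, ← map_mul, hxy, map_zero, map_zero]
  have hz : ∀ z : D, algebraMap B S (algebraMap D B z) = 0 → ∃ s ∉ P, s * z = 0 := by
    intro z hz
    have h1 : algebraMap D B z = 0 := hinj (by rw [hz, map_zero])
    obtain ⟨s, hs⟩ := (IsLocalization.map_eq_zero_iff m.primeCompl B z).mp h1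
    exact ⟨s, fun h ↦ s.2 (hPm h), hs⟩
  rcases mul_eq_zero.mp h0 with h | h
  · obtain ⟨s, hs, hs'⟩ := hz x h
    exact ⟨s, hs, Or.inl hs'⟩
  · obtain ⟨s, hs, hs'⟩ := hz y h
    exact ⟨s, hs, Or.inr hs'⟩

theorem isReduced_of_smooth {k D : Type u} [Field k] [PerfectField k] [CommRing D]
    [Algebra k D] [Algebra.Smooth k D] : IsReduced D := by
  rw [isReduced_iff_pow_one_lt 2 one_lt_two]
  intro x hx
  by_contra hx0
  have hne : Ideal.span {x} ≠ ⊥ := by simpa using hx0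
  let I : Ideal D := LinearMap.ker (LinearMap.toSpanSingleton D D x)
  have hmem : ∀ s, s ∈ I ↔ s * x = 0 := fun s ↦ by
    simp [I, LinearMap.mem_ker]
  have hI : I ≠ ⊤ := by
    rw [Ne, Ideal.eq_top_iff_one, hmem, one_mul]
    exact hx0
  obtain ⟨m, hm, hIm⟩ := Ideal.exists_le_maximal I hI
  obtain ⟨s, hs, h⟩ := exists_mul_eq_zero_of_smooth (k := k) m (x := x) (y := x) (by rw [← sq, hx])
  exact hs (hIm ((hmem s).mpr (h.elim id id)))

theorem isRadical_of_smooth_quotient {k A : Type u} [Field k] [PerfectField k] [CommRing A]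
    {J : Ideal A} {κ : k →+* A ⧸ J} (hκ : κ.Smooth) : J.IsRadical := by
  letI := κ.toAlgebra
  have h' : Algebra.Smooth k (A ⧸ J) := hκ
  rw [Ideal.isRadical_iff_quotient_reduced]
  exact isReduced_of_smooth (k := k)

theorem exists_mul_mem_of_smooth_quotient {k A : Type u} [Field k] [PerfectField k] [CommRing A]
    {J : Ideal A} {κ : k →+* A ⧸ J} (hκ : κ.Smooth) (P : Ideal A) [P.IsPrime] (hP : J ≤ P)
    (x y : A) (hxy : x * y ∈ J) : ∃ s ∉ P, s * x ∈ J ∨ s * y ∈ J := by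
  letI := κ.toAlgebra
  have h' : Algebra.Smooth k (A ⧸ J) := hκ
  have hprime : (P.map (Ideal.Quotient.mk J)).IsPrime :=
    Ideal.map_isPrime_of_surjective Ideal.Quotient.mk_surjective (by rwa [Ideal.mk_ker])
  obtain ⟨s, hs, h⟩ := exists_mul_eq_zero_of_smooth (k := k) (P.map (Ideal.Quotient.mk J))
    (x := Ideal.Quotient.mk J x) (y := Ideal.Quotient.mk J y)
    (by rw [← map_mul]; exact Ideal.Quotient.eq_zero_iff_mem.mpr hxy)
  obtain ⟨s, rfl⟩ := Ideal.Quotient.mk_surjective s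
  refine ⟨s, fun h ↦ hs (Ideal.mem_map_of_mem _ h), ?_⟩
  rwa [← map_mul, ← map_mul, Ideal.Quotient.eq_zero_iff_mem, Ideal.Quotient.eq_zero_iff_mem] at h

end Domain

/-! ### Spreading primality from a point to a neighbourhood. -/

section Spreading

/-- The hypothesis says that `J` becomes prime, or trivial, in the local ring at `P`. The
contraction of that ideal is finitely generated, so a single f outside `P` multiplies it into `J`.
Allowing every multiple g of f lets one g serve finitely many ideals. -/
theorem exists_isPrime_map_or_eq_top {A : Type u} [CommRing A] [IsNoetherianRing A] (J P : Ideal A)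
    [P.IsPrime]
    (H : J ≤ P → ∀ x y, x * y ∈ J → ∃ s ∉ P, s * x ∈ J ∨ s * y ∈ J) :
    ∃ f ∉ P, ∀ g, f ∣ g → g ∉ P → ∀ (A' : Type u) [CommRing A'] [Algebra A A']
      [IsLocalization.Away g A'],
      (J.map (algebraMap A A')).IsPrime ∨ J.map (algebraMap A A') = ⊤ := by
  by_cases hJP : J ≤ P
  swap
  · obtain ⟨f, hfJ, hfP⟩ := SetLike.not_le_iff_exists.mp hJP
    refine ⟨f, hfP, fun g hg hgP A' _ _ _ ↦ Or.inr ?_⟩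
    exact Ideal.eq_top_of_isUnit_mem _ (Ideal.mem_map_of_mem _ (J.mem_of_dvd hg hfJ))
      (IsLocalization.Away.algebraMap_isUnit g)
  let J' : Ideal A := (J.map (algebraMap A (Localization.AtPrime P))).comap (algebraMap A _)
  have hJ' : ∀ x, x ∈ J' ↔ ∃ s ∉ P, s * x ∈ J := fun x ↦
    IsLocalization.algebraMap_mem_map_algebraMap_iff P.primeCompl (Localization.AtPrime P) J x
  have hJ'P : J' ≤ P := by
    intro x hx
    obtain ⟨s, hs, hsx⟩ := (hJ' x).mp hx
    exact ((‹P.IsPrime›.mem_or_mem (hJP hsx))).resolve_left hs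
  have hprime : J'.IsPrime := by
    refine ⟨fun h ↦ ‹P.IsPrime›.ne_top (top_le_iff.mp (h ▸ hJ'P)), fun {x y} hxy ↦ ?_⟩
    obtain ⟨s, hs, hsxy⟩ := (hJ' _).mp hxy
    obtain ⟨s', hs', h⟩ := H hJP (s * x) y (by rwa [mul_assoc])
    rcases h with h | h
    · exact Or.inl ((hJ' x).mpr ⟨s' * s, fun h' ↦ (‹P.IsPrime›.mem_or_mem h').elim hs' hs,
        by rwa [mul_assoc]⟩)
    · exact Or.inr ((hJ' y).mpr ⟨s', hs', h⟩)
  obtain ⟨S, hS⟩ := (isNoetherianRing_iff_ideal_fg A).mp ‹_› J'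
  have hf : ∃ f ∉ P, ∀ x ∈ S, f * x ∈ J := by
    have hS' : ∀ x ∈ S, x ∈ J' := fun x hx ↦ hS ▸ Ideal.subset_span hx
    clear hS
    classical
    induction S using Finset.induction_on with
    | empty => exact ⟨1, fun h ↦ ‹P.IsPrime›.ne_top ((Ideal.eq_top_iff_one _).mpr h), by simp⟩
    | insert a S ha ih =>
      obtain ⟨f, hf, hfS⟩ := ih fun x hx ↦ hS' x (Finset.mem_insert_of_mem hx)
      obtain ⟨s, hs, hsa⟩ := (hJ' a).mp (hS' a (Finset.mem_insert_self _ _))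
      refine ⟨f * s, fun h' ↦ (‹P.IsPrime›.mem_or_mem h').elim hf hs, fun x hx ↦ ?_⟩
      rcases Finset.mem_insert.mp hx with rfl | hx
      · rw [mul_assoc]; exact J.mul_mem_left _ hsa
      · rw [mul_comm f, mul_assoc]; exact J.mul_mem_left _ (hfS x hx)
  obtain ⟨f, hfP, hfS⟩ := hf
  refine ⟨f, hfP, fun g hg hgP A' _ _ _ ↦ Or.inl ?_⟩
  have heq : J.map (algebraMap A A') = J'.map (algebraMap A A') := by
    refine le_antisymm (Ideal.map_mono fun x hx ↦ (hJ' x).mpr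
      ⟨1, fun h ↦ ‹P.IsPrime›.ne_top ((Ideal.eq_top_iff_one _).mpr h), by rwa [one_mul]⟩) ?_
    have : J' = Ideal.span S := hS.symm
    rw [this, Ideal.map_span, Ideal.span_le]
    rintro _ ⟨x, hx, rfl⟩
    have hu : IsUnit (algebraMap A A' f) :=
      isUnit_of_dvd_unit (map_dvd _ hg) (IsLocalization.Away.algebraMap_isUnit g)
    rw [SetLike.mem_coe, ← Ideal.unit_mul_mem_iff_mem _ hu, ← map_mul]
    exact Ideal.mem_map_of_mem _ (hfS x hx)
  rw [heq]
  exact IsLocalization.isPrime_of_isPrime_disjoint (Submonoid.powers g) A' J' hprime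
    ((Ideal.disjoint_powers_iff_notMem _ hprime.isRadical).mpr fun h ↦ hgP (hJ'P h))

theorem exists_forall_isPrime_map_or_eq_top {A : Type u} [CommRing A] [IsNoetherianRing A]
    {ι : Type*} [Finite ι] (J : ι → Ideal A) (P : Ideal A) [P.IsPrime]
    (H : ∀ i, J i ≤ P → ∀ x y, x * y ∈ J i → ∃ s ∉ P, s * x ∈ J i ∨ s * y ∈ J i) :
    ∃ f ∉ P, ∀ g, f ∣ g → g ∉ P → ∀ (A' : Type u) [CommRing A'] [Algebra A A']
      [IsLocalization.Away g A'],
      ∀ i, ((J i).map (algebraMap A A')).IsPrime ∨ (J i).map (algebraMap A A') = ⊤ := by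
  cases nonempty_fintype ι
  choose f hf hf' using fun i ↦ exists_isPrime_map_or_eq_top (J i) P (H i)
  refine ⟨∏ i, f i, fun h ↦ ?_, fun g hg hgP A' _ _ _ i ↦ ?_⟩
  · obtain ⟨i, -, hi⟩ := (Ideal.IsPrime.prod_mem_iff (p := P)).mp h
    exact hf i hi
  · exact hf' i g ((Finset.dvd_prod_of_mem f (Finset.mem_univ i)).trans hg) hgP A'

end Spreading

/-! ### Quotients of charts by coordinates. -/

section

variable {R : Type u} [CommRing R] {ϖ : R} {A : Type u} [CommRing A] {ρ : R →+* A}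
  {α β γ : Type} [Fintype α] [Fintype β] [Fintype γ] {u : α → A} {v : β → A} {w : γ → A}

namespace IsChart

/-- Base change of the chart along the quotient of the model computed in
`ChartRing.exists_ker_eq_span`. That quotient is a polynomial ring, in which the remaining variables
are non-zero-divisors, and flatness carries this over. -/
theorem exists_smooth_quotient [IsLocalRing R] (H : IsChart ϖ ρ u v w)
    (hϖ : maximalIdeal R = Ideal.span {ϖ}) (Δ : Set (α ⊕ β ⊕ γ))
    (h : ((∃ a, Sum.inl a ∈ Δ) ∧ ∃ b, Sum.inr (Sum.inl b) ∈ Δ) ∨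
      (IsEmpty α ∧ IsEmpty β ∧ ∃ c, Sum.inr (Sum.inr c) ∈ Δ))
    {D : Type u} [CommRing D] {δ : A →+* D} (hδ : Function.Surjective δ)
    (hker : RingHom.ker δ = Ideal.span (Sum.elim u (Sum.elim v w) '' Δ)) :
    ∃ κ : MvPolynomial {x // x ∉ Δ} (ResidueField R) →+* D, κ.Smooth ∧
      (∀ r, κ (MvPolynomial.C (residue R r)) = δ (ρ r)) ∧
      ∀ (x) (hx : x ∉ Δ), κ (MvPolynomial.X ⟨x, hx⟩) = δ (Sum.elim u (Sum.elim v w) x) := by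
  obtain ⟨π, hπ, hπker, hπR, hπX⟩ := ChartRing.exists_ker_eq_span (ϖ := ϖ) hϖ Δ h
  obtain ⟨κ, h1, h2⟩ := exists_smooth_of_surjective H.smooth hπ
    (by rw [hπker]; exact Submodule.fg_span (Set.toFinite _)) hδ
    (by
      rw [hker, hπker, Ideal.map_span, ← Set.image_comp]
      congr 1
      exact Set.image_congr fun x _ ↦ (ChartRing.lift_var ρ u v w H.prod_eq H.prod_mul x).symm)
  refine ⟨κ, h2, fun r ↦ ?_, fun x hx ↦ ?_⟩
  · rw [← hπR, h1, ChartRing.lift_algebraMap]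
  · rw [← hπX, h1, ChartRing.lift_var]

/-- The quotient of a chart by one of the `u` and one of the `v`. -/
theorem exists_smooth_quotient_pair [IsLocalRing R] (H : IsChart ϖ ρ u v w)
    (hϖ : maximalIdeal R = Ideal.span {ϖ}) (a : α) (b : β)
    {D : Type u} [CommRing D] {δ : A →+* D} (hδ : Function.Surjective δ)
    (hker : RingHom.ker δ = Ideal.span {u a, v b}) :
    ∃ κ : ResidueField R →+* D, κ.Smooth ∧ (∀ r, κ (residue R r) = δ (ρ r)) ∧
      (∀ a', a' ≠ a → δ (u a') ∈ nonZeroDivisors D) ∧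
      (∀ b', b' ≠ b → δ (v b') ∈ nonZeroDivisors D) ∧ ∀ c, δ (w c) ∈ nonZeroDivisors D := by
  let Δ : Set (α ⊕ β ⊕ γ) := {Sum.inl a, Sum.inr (Sum.inl b)}
  obtain ⟨κ, h1, h2, h3⟩ := H.exists_smooth_quotient hϖ Δ
    (Or.inl ⟨⟨a, Or.inl rfl⟩, b, Or.inr rfl⟩) hδ (by rw [hker, Set.image_pair]; rfl)
  have hnzd : ∀ x, x ∉ Δ → δ (Sum.elim u (Sum.elim v w) x) ∈ nonZeroDivisors D := fun x hx ↦ by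
    rw [← h3 x hx]
    exact map_mem_nonZeroDivisors_of_flat (flat_of_smooth h1)
      (mem_nonZeroDivisors_of_ne_zero (MvPolynomial.X_ne_zero _))
  refine ⟨κ.comp MvPolynomial.C, (smooth_mvPolynomial_C _ _).comp h1, h2, fun a' ha ↦ ?_,
    fun b' hb ↦ ?_, fun c ↦ ?_⟩
  · exact hnzd (Sum.inl a') (by simpa [Δ] using ha)
  · exact hnzd (Sum.inr (Sum.inl b')) (by simpa [Δ] using hb)
  · exact hnzd (Sum.inr (Sum.inr c)) (by simp [Δ])

/-- The quotient of a standard chart by one of the variables. -/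
theorem _root_.SemistableProduct.IsStdChart.exists_smooth_quotient_single [IsLocalRing R]
    (H : IsStdChart ϖ ρ w) (hϖ : maximalIdeal R = Ideal.span {ϖ}) (c : γ)
    {D : Type u} [CommRing D] {δ : A →+* D} (hδ : Function.Surjective δ)
    (hker : RingHom.ker δ = Ideal.span {w c}) :
    ∃ κ : ResidueField R →+* D, κ.Smooth ∧ (∀ r, κ (residue R r) = δ (ρ r)) ∧
      ∀ c', c' ≠ c → δ (w c') ∈ nonZeroDivisors D := by
  let Δ : Set (Empty ⊕ Empty ⊕ γ) := {Sum.inr (Sum.inr c)}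
  obtain ⟨κ, h1, h2, h3⟩ := IsChart.exists_smooth_quotient H hϖ Δ
    (Or.inr ⟨inferInstance, inferInstance, c, rfl⟩) hδ (by rw [hker, Set.image_singleton]; rfl)
  refine ⟨κ.comp MvPolynomial.C, (smooth_mvPolynomial_C _ _).comp h1, h2, fun c' hc ↦ ?_⟩
  have := h3 (Sum.inr (Sum.inr c')) (by simpa [Δ] using hc)
  rw [Sum.elim_inr, Sum.elim_inr] at this
  rw [← this]
  exact map_mem_nonZeroDivisors_of_flat (flat_of_smooth h1)
    (mem_nonZeroDivisors_of_ne_zero (MvPolynomial.X_ne_zero _))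

end IsChart

end

end SemistableProduct

namespace SemistableProduct

open IsLocalRing TensorProduct

theorem IsCompletion.comap_ringEquiv {B S E : Type u} [CommRing B] [CommRing S] [CommRing E]
    [Algebra B S] {I : Ideal B} (h : IsCompletion I S) (e : E ≃+* B) [Algebra E S]
    (he : ∀ x, algebraMap E S x = algebraMap B S (e x)) :
    IsCompletion (I.comap e) S := by
  have hcomp : algebraMap E S = (algebraMap B S).comp (e : E →+* B) := RingHom.ext he
  have hm : (I.comap e).map (algebraMap E S) = I.map (algebraMap B S) := by
    rw [hcomp, ← Ideal.map_map]
    congr 1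
    exact Ideal.map_comap_of_surjective (e : E →+* B) e.surjective I
  refine ⟨?_, fun s ↦ ?_, fun n b hb ↦ ?_⟩
  · rw [hm]; exact h.complete
  · obtain ⟨b, hb⟩ := h.surj s
    refine ⟨e.symm b, ?_⟩
    rw [hm, he, e.apply_symm_apply]
    exact hb
  · rw [hm, he] at hb
    have := h.inj n _ hb
    have h2 : I.comap e = I.map (e.symm : B ≃+* E) := (Ideal.map_symm e).symm
    rw [h2, ← Ideal.map_pow, ← e.symm_apply_apply b]
    exact Ideal.mem_map_of_mem _ this

/-- The polynomial ring is replaced by an isomorphic ring `T`, later `StdPoly`. It is enough that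
`I` lies over `P`, because both ideals of the polynomial ring are maximal. -/
theorem exists_finite_etale_of_smooth_of_ringEquiv {E A B S : Type u} [CommRing E] [CommRing A]
    [CommRing B] [CommRing S] [Algebra E A] [Algebra A B] [Algebra B S] [Algebra.Smooth E A]
    (P : Ideal A) [P.IsMaximal] [IsLocalization.AtPrime B P] [IsLocalRing B]
    [Module.Finite E (A ⧸ P)] (hsep : HasSimpleRoots E (A ⧸ P))
    (hS : IsCompletion (maximalIdeal B) S) :
    ∃ (d : ℕ) (s : Fin d → A), (∀ i, s i ∈ P) ∧
      ∀ (T D : Type u) [CommRing T] [CommRing D] [IsNoetherianRing D] [Algebra T D] (I : Ideal T)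
        [I.IsMaximal] (Φ : MvPolynomial (Fin d) E ≃+* T),
        (∀ x ∈ I, MvPolynomial.aeval s (Φ.symm x) ∈ P) → IsCompletion I D →
        ∃ φ : D →+* S, (∀ x, φ (algebraMap T D (Φ x)) =
          algebraMap B S (algebraMap A B (MvPolynomial.aeval s x))) ∧ φ.Finite ∧ φ.Etale := by
  obtain ⟨d, s, hs, hmax, h⟩ := exists_finite_etale_of_smooth (E := E) P hsep hS
  refine ⟨d, s, hs, fun T D _ _ _ _ I _ Φ hI hD ↦ ?_⟩
  letI : Algebra (MvPolynomial (Fin d) E) D :=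
    ((algebraMap T D).comp (Φ : MvPolynomial (Fin d) E →+* T)).toAlgebra
  have hcomap : I.comap Φ = P.comap (MvPolynomial.aeval (R := E) s).toRingHom := by
    have hm : (I.comap Φ).IsMaximal := Ideal.comap_isMaximal_of_equiv Φ
    refine hm.eq_of_le hmax.ne_top fun x hx ↦ ?_
    have := hI (Φ x) hx
    rwa [Φ.symm_apply_apply] at this
  have hcompl : IsCompletion (P.comap (MvPolynomial.aeval (R := E) s).toRingHom) D := by
    rw [← hcomap]
    exact hD.comap_ringEquiv Φ fun x ↦ rfl
  exact h D hcompl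

/-! ### Standard charts and formal charts. -/

section

variable {R : Type u} [CommRing R] {ϖ : R}

theorem prod_filter_lt_add {M : Type*} [CommMonoid M] (t d : ℕ) (f : Fin (t + d) → M) :
    ∏ i ∈ Finset.univ.filter (fun i : Fin (t + d) ↦ (i : ℕ) < t), f i =
      ∏ i : Fin t, f (Fin.castAdd d i) := by
  rw [Finset.prod_filter, Fin.prod_univ_add]
  simp

/-- Polynomial rings over a standard chart ring. -/
theorem exists_ringEquiv_stdPoly (ϖ : R) {γ : Type} [Fintype γ] (t d : ℕ) (e : γ ≃ Fin t) :
    ∃ Φ : MvPolynomial (Fin d) (ChartRing ϖ Empty Empty γ) ≃+* StdPoly ϖ (t + d) t,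
      (∀ r, Φ (MvPolynomial.C (algebraMap R _ r)) = algebraMap R _ r) ∧
      (∀ i, Φ.symm (StdPoly.x ϖ (t + d) t (Fin.castAdd d i)) =
        MvPolynomial.C (ChartRing.var ϖ (Sum.inr (Sum.inr (e.symm i))))) ∧
      ∀ j, Φ.symm (StdPoly.x ϖ (t + d) t (Fin.natAdd t j)) = MvPolynomial.X j := by
  have hrel : ∏ c : γ, StdPoly.x ϖ (t + d) t (Fin.castAdd d (e c)) = algebraMap R _ ϖ := by
    refine Eq.trans ?_ (StdPoly.prod_x ϖ (t + d) t)
    exact (Fintype.prod_equiv e _ (fun i ↦ StdPoly.x ϖ (t + d) t (Fin.castAdd d i))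
      fun _ ↦ rfl).trans (prod_filter_lt_add t d _).symm
  let F₀ : ChartRing ϖ Empty Empty γ →+* StdPoly ϖ (t + d) t :=
    ChartRing.lift (algebraMap R _) Empty.elim Empty.elim
      (fun c ↦ StdPoly.x ϖ (t + d) t (Fin.castAdd d (e c))) (by simp) (by simpa using hrel)
  let F : MvPolynomial (Fin d) (ChartRing ϖ Empty Empty γ) →+* StdPoly ϖ (t + d) t :=
    MvPolynomial.eval₂Hom F₀ fun j ↦ StdPoly.x ϖ (t + d) t (Fin.natAdd t j)
  let z : Fin (t + d) → MvPolynomial (Fin d) (ChartRing ϖ Empty Empty γ) := fun i ↦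
    Fin.addCases (motive := fun _ ↦ MvPolynomial (Fin d) (ChartRing ϖ Empty Empty γ))
      (fun i ↦ MvPolynomial.C (ChartRing.var ϖ (Sum.inr (Sum.inr (e.symm i)))))
      (fun j ↦ MvPolynomial.X j) i
  have hz1 : ∀ i, z (Fin.castAdd d i) =
      MvPolynomial.C (ChartRing.var ϖ (Sum.inr (Sum.inr (e.symm i)))) := fun i ↦
    Fin.addCases_left i
  have hz2 : ∀ j, z (Fin.natAdd t j) = MvPolynomial.X j := fun j ↦ Fin.addCases_right j
  have hz : ∏ i ∈ Finset.univ.filter (fun i : Fin (t + d) ↦ (i : ℕ) < t), z i =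
      algebraMap R _ ϖ := by
    change _ = MvPolynomial.C (algebraMap R _ ϖ)
    rw [prod_filter_lt_add, Finset.prod_congr rfl fun i _ ↦ hz1 i, ← map_prod,
      ← ChartRing.prod_mul, Fintype.prod_equiv e.symm _
        (fun c ↦ ChartRing.var ϖ (α := Empty) (β := Empty) (Sum.inr (Sum.inr c))) fun _ ↦ rfl]
    simp
  let G : StdPoly ϖ (t + d) t →ₐ[R] MvPolynomial (Fin d) (ChartRing ϖ Empty Empty γ) :=
    StdPoly.lift z hz
  have hG : ∀ i, G (StdPoly.x ϖ (t + d) t i) = z i := fun i ↦ StdPoly.lift_x z hz i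
  have hGR : ∀ r, G (algebraMap R _ r) = MvPolynomial.C (algebraMap R _ r) := fun r ↦ G.commutes r
  have hFC : ∀ x, F (MvPolynomial.C x) = F₀ x := fun x ↦ MvPolynomial.eval₂Hom_C _ _ _
  have hFX : ∀ j, F (MvPolynomial.X j) = StdPoly.x ϖ (t + d) t (Fin.natAdd t j) := fun j ↦
    MvPolynomial.eval₂Hom_X' _ _ _
  have hF₀R : ∀ r, F₀ (algebraMap R _ r) = algebraMap R _ r := fun r ↦
    ChartRing.lift_algebraMap _ _ _ _ _ _ r
  have hF₀v : ∀ c, F₀ (ChartRing.var ϖ (Sum.inr (Sum.inr c))) =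
      StdPoly.x ϖ (t + d) t (Fin.castAdd d (e c)) := fun c ↦
    ChartRing.lift_var _ _ _ _ _ _ (Sum.inr (Sum.inr c))
  have hFz : ∀ i, F (z i) = StdPoly.x ϖ (t + d) t i := by
    intro i
    refine Fin.addCases (fun i ↦ ?_) (fun j ↦ ?_) i
    · rw [hz1, hFC, hF₀v, e.apply_symm_apply]
    · rw [hz2, hFX]
  have h1 : F.comp G.toRingHom = RingHom.id _ := by
    refine Ideal.Quotient.ringHom_ext (MvPolynomial.ringHom_ext (fun r ↦ ?_) fun i ↦ ?_)
    · have : F (G (algebraMap R _ r)) = algebraMap R _ r := by rw [hGR, hFC, hF₀R]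
      exact this
    · have : F (G (StdPoly.x ϖ (t + d) t i)) = StdPoly.x ϖ (t + d) t i := by rw [hG, hFz]
      exact this
  have h2 : (G.toRingHom.comp F) = RingHom.id _ := by
    refine MvPolynomial.ringHom_ext (fun x ↦ ?_) fun j ↦ ?_
    · revert x
      refine RingHom.congr_fun (?_ : (G.toRingHom.comp F).comp MvPolynomial.C = MvPolynomial.C)
      refine ChartRing.hom_ext (ϖ := ϖ) (A := MvPolynomial (Fin d) (ChartRing ϖ Empty Empty γ))
        (f := (G.toRingHom.comp F).comp MvPolynomial.C) (g := MvPolynomial.C)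
        (fun r ↦ ?_) fun x ↦ ?_
      · change G (F (MvPolynomial.C _)) = _
        rw [hFC, hF₀R, hGR]
      · change G (F (MvPolynomial.C _)) = _
        rcases x with x | x | c
        · exact x.elim
        · exact x.elim
        · rw [hFC, hF₀v, hG, hz1, e.symm_apply_apply]
    · change G (F (MvPolynomial.X j)) = MvPolynomial.X j
      rw [hFX, hG, hz2]
  refine ⟨RingEquiv.ofRingHom F G.toRingHom h1 h2, fun r ↦ ?_, fun i ↦ ?_, fun j ↦ ?_⟩
  · exact (hFC _).trans (hF₀R r)
  · exact (hG _).trans (hz1 i)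
  · exact (hG _).trans (hz2 j)

/-- An algebra that is étale over `R[x₁, …, xₙ] / (x₁ ⋯ x_t - ϖ)` has a standard chart. -/
theorem IsStdChart.of_etale {A : Type u} [CommRing A] {n t : ℕ} (htn : t ≤ n)
    (h : StdPoly ϖ n t →+* A) (hh : h.Etale) :
    IsStdChart ϖ (h.comp (algebraMap R _))
      (fun i : Fin t ↦ h (StdPoly.x ϖ n t (Fin.castLE htn i))) := by
  have hprod : ∀ {M : Type u} [CommRing M] (f : Fin n → M),
      ∏ i ∈ Finset.univ.filter (fun i : Fin n ↦ (i : ℕ) < t), f i =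
        ∏ i : Fin t, f (Fin.castLE htn i) := by
    intro M _ f
    obtain ⟨d, rfl⟩ := Nat.exists_eq_add_of_le htn
    exact prod_filter_lt_add t d f
  have hsm : h.Smooth := by
    letI := h.toAlgebra
    have : Algebra.Etale (StdPoly ϖ n t) A := hh
    exact (inferInstance : Algebra.Smooth (StdPoly ϖ n t) A)
  refine IsChart.of_exists_lift (by simp) ?_ ?_ ?_
  · rw [← map_prod, ← hprod, StdPoly.prod_x]
    simp
  · refine (finitePresentation_of_smooth hsm).comp ?_
    rw [RingHom.finitePresentation_algebraMap]
    exact Algebra.FinitePresentation.quotient (Submodule.fg_span (Set.toFinite _))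
  · intro B _ J hJ σ u' v' w' h1 h2 g hσ hu hv hw
    choose z₀ hz₀ using fun i ↦ Ideal.Quotient.mk_surjective (I := J) (g (h (StdPoly.x ϖ n t i)))
    -- Only the first t coordinates are prescribed; the relation does not involve the others, which
    -- are lifted arbitrarily.
    let z : Fin n → B := fun i ↦ if hi : (i : ℕ) < t then w' ⟨i, hi⟩ else z₀ i
    have hz1 : ∀ i : Fin t, z (Fin.castLE htn i) = w' i := fun i ↦ dif_pos i.2
    letI := σ.toAlgebra
    have hz : ∏ i ∈ Finset.univ.filter (fun i : Fin n ↦ (i : ℕ) < t), z i = algebraMap R B ϖ := by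
      rw [hprod, Finset.prod_congr rfl fun i _ ↦ hz1 i]
      refine Eq.trans ?_ h2
      simp
    let τ : StdPoly ϖ n t →ₐ[R] B := StdPoly.lift z hz
    have hτ : ∀ i, τ (StdPoly.x ϖ n t i) = z i := fun i ↦ StdPoly.lift_x z hz i
    obtain ⟨φ, a1, a2⟩ := smooth_exists_lift hsm J hJ τ.toRingHom g (fun x ↦ by
      refine RingHom.congr_fun (f := g.comp h) (g := (Ideal.Quotient.mk J).comp τ.toRingHom)
        (Ideal.Quotient.ringHom_ext (MvPolynomial.ringHom_ext (fun r ↦ ?_) fun i ↦ ?_)) x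
      · exact (hσ r).trans (congr_arg _ (τ.commutes r).symm)
      · have : g (h (StdPoly.x ϖ n t i)) = Ideal.Quotient.mk J (τ (StdPoly.x ϖ n t i)) := by
          rw [hτ]
          by_cases hi : (i : ℕ) < t
          · have := hw ⟨i, hi⟩
            have hzi : z i = w' ⟨i, hi⟩ := dif_pos hi
            rw [hzi]
            exact this
          · have hzi : z i = z₀ i := dif_neg hi
            rw [hzi, hz₀]
        exact this)
    refine ⟨φ, fun r ↦ ?_, fun x ↦ x.elim, fun x ↦ x.elim, fun i ↦ ?_, a2⟩
    · exact (a1 _).trans (τ.commutes r)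
    · rw [a1]
      exact (hτ _).trans (hz1 i)

/-- A standard chart at a point where all the variables vanish gives a finite étale homomorphism
from a standard ring to the completed local ring. -/
theorem IsStdChart.exists_finite_etale_stdRing [IsLocalRing R] [IsNoetherianRing R]
    [PerfectField (ResidueField R)] (hϖ : maximalIdeal R = Ideal.span {ϖ}) {A B S : Type u}
    [CommRing A] [CommRing B] [CommRing S] [Algebra A B] [Algebra B S] {ρ : R →+* A}
    {γ : Type} [Fintype γ] [Nonempty γ] {w : γ → A} (H : IsStdChart ϖ ρ w) (P : Ideal A)
    [P.IsMaximal] (hw : ∀ c, w c ∈ P) [IsLocalization.AtPrime B P] [IsLocalRing B]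
    (hS : IsCompletion (maximalIdeal B) S) :
    ∃ (n t : ℕ) (φ : StdRing ϖ n t →+* S), 1 ≤ t ∧ t ≤ n ∧ φ.Finite ∧ φ.Etale ∧
      ∀ r : R, φ (Ideal.Quotient.mk _ (MvPowerSeries.C r)) =
        algebraMap B S (algebraMap A B (ρ r)) := by
  let E := ChartRing ϖ Empty Empty γ
  let τ : E →+* A := ChartRing.lift ρ Empty.elim Empty.elim w H.1 H.2
  have hτR : ∀ r, τ (algebraMap R _ r) = ρ r := fun r ↦ ChartRing.lift_algebraMap _ _ _ _ _ _ r
  have hτv : ∀ c, τ (ChartRing.var ϖ (Sum.inr (Sum.inr c))) = w c := fun c ↦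
    ChartRing.lift_var _ _ _ _ _ _ (Sum.inr (Sum.inr c))
  letI : Algebra E A := τ.toAlgebra
  have hsm : Algebra.Smooth E A := H.smooth
  letI := Ideal.Quotient.field P
  have hϖP : ρ ϖ ∈ P := by
    obtain ⟨c⟩ := ‹Nonempty γ›
    classical
    rw [← IsStdChart.prod_eq H, ← Finset.mul_prod_erase _ _ (Finset.mem_univ c)]
    exact P.mul_mem_right _ (hw c)
  let κ : ResidueField R →+* A ⧸ P := Ideal.Quotient.lift _ ((Ideal.Quotient.mk P).comp ρ) (by
    intro r hr
    rw [hϖ, Ideal.mem_span_singleton] at hr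
    obtain ⟨c, rfl⟩ := hr
    rw [RingHom.comp_apply, map_mul]
    exact Ideal.Quotient.eq_zero_iff_mem.mpr (P.mul_mem_right _ hϖP))
  have hκ : ∀ r, κ (residue R r) = Ideal.Quotient.mk P (ρ r) := fun r ↦ rfl
  let π : E →+* ResidueField R := ChartRing.lift (residue R) Empty.elim Empty.elim (fun _ ↦ 0)
    (by simp) (by
      have : residue R ϖ = 0 :=
        (residue_eq_zero_iff _).mpr (hϖ ▸ Ideal.mem_span_singleton_self ϖ)
      rw [this]
      simp)
  have hπR : ∀ r, π (algebraMap R _ r) = residue R r := fun r ↦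
    ChartRing.lift_algebraMap _ _ _ _ _ _ r
  have hπv : ∀ c, π (ChartRing.var ϖ (Sum.inr (Sum.inr c))) = 0 := fun c ↦
    ChartRing.lift_var _ _ _ _ _ _ (Sum.inr (Sum.inr c))
  have hκπ : κ.comp π = (Ideal.Quotient.mk P).comp τ := by
    refine ChartRing.hom_ext (fun r ↦ ?_) fun x ↦ ?_
    · rw [RingHom.comp_apply, hπR, hκ, RingHom.comp_apply, hτR]
    · rcases x with x | x | c
      · exact x.elim
      · exact x.elim
      · rw [RingHom.comp_apply, hπv, map_zero, RingHom.comp_apply, hτv]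
        exact (Ideal.Quotient.eq_zero_iff_mem.mpr (hw c)).symm
  letI : Algebra (ResidueField R) (A ⧸ P) := κ.toAlgebra
  have hπ : Function.Surjective π := fun x ↦ by
    obtain ⟨r, rfl⟩ := residue_surjective x
    exact ⟨_, hπR r⟩
  letI : Algebra E (ResidueField R) := π.toAlgebra
  have : IsScalarTower E (ResidueField R) (A ⧸ P) :=
    IsScalarTower.of_algebraMap_eq fun x ↦ (RingHom.congr_fun hκπ x).symm
  have hft : Algebra.FiniteType E (A ⧸ P) :=
    Algebra.FiniteType.of_surjective (Ideal.Quotient.mkₐ E P) (Ideal.Quotient.mkₐ_surjective E P)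
  have hft' : Algebra.FiniteType (ResidueField R) (A ⧸ P) :=
    Algebra.FiniteType.of_restrictScalars_finiteType E (ResidueField R) (A ⧸ P)
  have hfin : Module.Finite (ResidueField R) (A ⧸ P) :=
    finite_of_finite_type_of_isJacobsonRing _ _
  have hfin1 : Module.Finite E (ResidueField R) :=
    Module.Finite.of_surjective (Algebra.linearMap E (ResidueField R)) hπ
  have hfin2 : Module.Finite E (A ⧸ P) := Module.Finite.trans (ResidueField R) _
  -- The residue field at `P` is finite over the perfect residue field of `R`, hence separable.
  have hsep : HasSimpleRoots E (A ⧸ P) := by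
    have h1 : HasSimpleRoots (ResidueField R) (A ⧸ P) := hasSimpleRoots_of_isSeparable
    exact h1.of_surjective π hπ fun x ↦ (RingHom.congr_fun hκπ x).symm
  -- The polynomial ring over `E` in the d parameters is `StdPoly ϖ (t + d) t` with t the number of
  -- the w, and all its coordinates vanish at `P`.
  obtain ⟨d, s, hs, h⟩ := exists_finite_etale_of_smooth_of_ringEquiv (E := E) P hsep hS
  let t := Fintype.card γ
  have ht : 1 ≤ t := Fintype.card_pos
  obtain ⟨Φ, hΦR, hΦ1, hΦ2⟩ := exists_ringEquiv_stdPoly ϖ t d (Fintype.equivFin γ)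
  have hmax := StdPoly.isMaximal_origin ϖ (t + d) t hϖ ht (Nat.le_add_right _ _)
  obtain ⟨φ, h1, h2, h3⟩ := h (StdPoly ϖ (t + d) t) (StdRing ϖ (t + d) t)
    (StdPoly.origin ϖ (t + d) t) Φ (by
      have : StdPoly.origin ϖ (t + d) t ≤
          P.comap ((MvPolynomial.aeval (R := E) s : MvPolynomial (Fin d) E →+* A).comp
            (Φ.symm : StdPoly ϖ (t + d) t →+* MvPolynomial (Fin d) E)) := by
        rw [StdPoly.origin_eq_span, Ideal.span_le]
        rintro _ ⟨i, rfl⟩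
        rw [SetLike.mem_coe, Ideal.mem_comap]
        change MvPolynomial.aeval (R := E) s (Φ.symm (StdPoly.x ϖ (t + d) t i)) ∈ P
        refine Fin.addCases (fun i ↦ ?_) (fun j ↦ ?_) i
        · rw [hΦ1 i, MvPolynomial.aeval_C]
          change τ _ ∈ P
          rw [hτv]
          exact hw _
        · rw [hΦ2 j, MvPolynomial.aeval_X]
          exact hs j
      exact fun x hx ↦ this hx) (isCompletion_stdRing ϖ (t + d) t)
  refine ⟨t + d, t, φ, ht, Nat.le_add_right _ _, h2, h3, fun r ↦ ?_⟩
  have h4 := h1 (MvPolynomial.C (algebraMap R _ r))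
  rw [MvPolynomial.aeval_C, hΦR] at h4
  have h5 : algebraMap E A (algebraMap R _ r) = ρ r := hτR r
  rw [h5] at h4
  rw [← h4]
  congr 1
  have h7 : algebraMap R (StdPoly ϖ (t + d) t) r = Ideal.Quotient.mk _ (MvPolynomial.C r) := rfl
  rw [h7, StdPoly.algebraMap_mk, MvPolynomial.coe_C]

end

end SemistableProduct

namespace SemistableProduct

/-! ### Inverse images of ideal sheaves. -/

section IdealSheaf

/-- The inverse image is left adjoint to the direct image, and the latter is contraction of ideals
on affine schemes. -/
theorem ideal_comap_top_of_isAffine {X Y : Scheme.{u}} [IsAffine X] [IsAffine Y] (f : X ⟶ Y)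
    (I : Y.IdealSheafData) :
    (I.comap f).ideal ⟨⊤, isAffineOpen_top X⟩ =
      (I.ideal ⟨⊤, isAffineOpen_top Y⟩).map f.appTop.hom := by
  have key : ∀ K : X.IdealSheafData, (K.map f).ideal ⟨⊤, isAffineOpen_top Y⟩ =
      (K.ideal ⟨⊤, isAffineOpen_top X⟩).comap f.appTop.hom := fun K ↦
    Scheme.IdealSheafData.ideal_map_of_isAffineHom K f ⟨⊤, isAffineOpen_top Y⟩
  apply le_antisymm
  · let K : X.IdealSheafData := Scheme.IdealSheafData.ofIdealTop
      ((I.ideal ⟨⊤, isAffineOpen_top Y⟩).map f.appTop.hom)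
    have hK : K.ideal ⟨⊤, isAffineOpen_top X⟩ =
        (I.ideal ⟨⊤, isAffineOpen_top Y⟩).map f.appTop.hom :=
      Scheme.IdealSheafData.equivOfIsAffine.apply_symm_apply _
    rw [← hK]
    refine Scheme.IdealSheafData.le_map_iff_comap_le.mp ?_ _
    refine Scheme.IdealSheafData.le_of_isAffine ?_
    rw [key, hK]
    exact Ideal.le_comap_map
  · rw [Ideal.map_le_iff_le_comap, ← key]
    exact Scheme.IdealSheafData.le_map_iff_comap_le.mpr le_rfl _

theorem ideal_comap_isOpenImmersion {X Y : Scheme.{u}} (f : X ⟶ Y) [IsOpenImmersion f]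
    (I : Y.IdealSheafData) (U : Y.affineOpens) (V : X.affineOpens) (e : V.1 ≤ f ⁻¹ᵁ U.1) :
    (I.comap f).ideal V = (I.ideal U).map (f.appLE U V e).hom := by
  have hle : f ''ᵁ V.1 ≤ U.1 := by
    rintro _ ⟨x, hx, rfl⟩
    exact e hx
  let W : Y.affineOpens := ⟨f ''ᵁ V.1, V.2.image_of_isOpenImmersion f⟩
  have hW : W ≤ U := hle
  rw [Scheme.IdealSheafData.ideal_comap_of_isOpenImmersion, ← I.map_ideal hW]
  have h1 : f.appLE U V e = Y.presheaf.map (homOfLE hle).op ≫ (f.appIso V).hom := by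
    rw [Scheme.Hom.appIso_hom', Scheme.Hom.map_appLE]
  rw [h1, CommRingCat.hom_comp, ← Ideal.map_map]
  exact (Ideal.map_comap_of_equiv (f.appIso V.1).commRingCatIsoToRingEquiv).symm

/-- The inverse image of an ideal sheaf on affine opens. -/
theorem ideal_comap {X Y : Scheme.{u}} (f : X ⟶ Y) (I : Y.IdealSheafData) (U : Y.affineOpens)
    (V : X.affineOpens) (e : V.1 ≤ f ⁻¹ᵁ U.1) :
    (I.comap f).ideal V = (I.ideal U).map (f.appLE U V e).hom := by
  have : IsAffine U.1 := U.2
  have : IsAffine V.1 := V.2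
  let r := f.resLE U V e
  have hr : r ≫ U.1.ι = V.1.ι ≫ f := Scheme.Hom.resLE_comp_ι f e
  have hU : (⊤ : U.1.toScheme.Opens) ≤ U.1.ι ⁻¹ᵁ U.1 := by simp
  have hV : (⊤ : V.1.toScheme.Opens) ≤ V.1.ι ⁻¹ᵁ V.1 := by simp
  have hr' : (⊤ : V.1.toScheme.Opens) ≤ r ⁻¹ᵁ ⊤ := le_top
  have h1 : ((I.comap f).comap V.1.ι).ideal ⟨⊤, isAffineOpen_top _⟩ =
      ((I.comap U.1.ι).comap r).ideal ⟨⊤, isAffineOpen_top _⟩ := by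
    rw [← Scheme.IdealSheafData.comap_comp, ← Scheme.IdealSheafData.comap_comp, hr]
  rw [ideal_comap_isOpenImmersion V.1.ι (I.comap f) V ⟨⊤, isAffineOpen_top _⟩ hV,
    ideal_comap_top_of_isAffine r, ideal_comap_isOpenImmersion U.1.ι I U ⟨⊤, isAffineOpen_top _⟩ hU, Ideal.map_map,
    ← CommRingCat.hom_comp] at h1
  have h2 : U.1.ι.appLE U ⊤ hU ≫ r.appTop = f.appLE U V e ≫ V.1.ι.appLE V ⊤ hV := by
    have h3 : r.appTop = r.appLE ⊤ ⊤ hr' := (Scheme.Hom.app_eq_appLE r)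
    rw [h3, Scheme.Hom.appLE_comp_appLE, Scheme.Hom.appLE_comp_appLE]
    simp only [hr]
  rw [h2, CommRingCat.hom_comp, ← Ideal.map_map] at h1
  have hiso : IsIso (V.1.ι.appLE V ⊤ hV) := by
    have : V.1.ι.appLE V ⊤ hV = V.1.topIso.inv := by
      simp only [Scheme.Hom.appLE, Scheme.Opens.ι_app, Scheme.Opens.toScheme_presheaf_map]
      exact (X.presheaf.map_comp _ _).symm.trans rfl
    rw [this]
    infer_instance
  have hbij : Function.Bijective (V.1.ι.appLE V ⊤ hV).hom := ConcreteCategory.bijective_of_isIso _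
  have := congr_arg (Ideal.comap (V.1.ι.appLE V ⊤ hV).hom) h1
  rwa [Ideal.comap_map_of_bijective _ hbij, Ideal.comap_map_of_bijective _ hbij] at this

theorem appLE_fromSpec {X : Scheme.{u}} {U : X.Opens} (hU : IsAffineOpen U) {B : CommRingCat.{u}}
    (α : Γ(X, U) ⟶ B) (e) :
    (Spec.map α ≫ hU.fromSpec).appLE U ⊤ e = α ≫ (Scheme.ΓSpecIso B).inv := by
  have h : (Spec.map α).appTop = (Scheme.ΓSpecIso _).hom ≫ α ≫ (Scheme.ΓSpecIso B).inv := by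
    rw [← Category.assoc, ← Scheme.ΓSpecIso_naturality]
    simp
  have e' : (⊤ : (Spec B).Opens) ≤ Spec.map α ⁻¹ᵁ hU.fromSpec ⁻¹ᵁ U := e
  rw [Scheme.Hom.comp_appLE, IsAffineOpen.fromSpec_app_self, Category.assoc]
  have h2 : (Spec.map α).appLE ⊤ ⊤ le_rfl = (Spec.map α).appTop :=
    (Scheme.Hom.app_eq_appLE _).symm
  have h3 : (Spec Γ(X, U)).presheaf.map (eqToHom hU.fromSpec_preimage_self).op ≫
      (Spec.map α).appLE (hU.fromSpec ⁻¹ᵁ U) ⊤ e' = (Spec.map α).appLE ⊤ ⊤ le_rfl :=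
    Scheme.Hom.map_appLE (Spec.map α) e' (eqToHom hU.fromSpec_preimage_self).op
  refine (congr_arg ((Scheme.ΓSpecIso Γ(X, U)).inv ≫ ·) h3).trans ?_
  rw [h2, h]
  simp

theorem isInvertibleIdeal_comap_of_flat {X Y : Scheme.{u}} (f : X ⟶ Y) [Flat f]
    {I : Y.IdealSheafData} (hI : IsInvertibleIdeal I) : IsInvertibleIdeal (I.comap f) := by
  intro x
  obtain ⟨U, hxU, a, ha, haI⟩ := hI (f x)
  obtain ⟨V, hV, hxV, hVU⟩ := exists_isAffineOpen_mem_and_subset (U := f ⁻¹ᵁ U.1) hxU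
  refine ⟨⟨V, hV⟩, hxV, (f.appLE U V hVU).hom a, ?_, ?_⟩
  · exact map_mem_nonZeroDivisors_of_flat
      (HasRingHomProperty.appLE @Flat f inferInstance U ⟨V, hV⟩ hVU) ha
  · rw [ideal_comap f I U ⟨V, hV⟩ hVU, haI, Ideal.map_span, Set.image_singleton]

theorem isInvertibleIdeal_comap_Spec {X : Scheme.{u}} {I : X.IdealSheafData} {U : X.Opens}
    (hU : IsAffineOpen U)
    {B : Type u} [CommRing B] (α : Γ(X, U) →+* B) (b : B) (hb : b ∈ nonZeroDivisors B)
    (h : (I.ideal ⟨U, hU⟩).map α = Ideal.span {b}) :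
    IsInvertibleIdeal (I.comap (Spec.map (CommRingCat.ofHom α) ≫ hU.fromSpec)) := by
  have e : (⊤ : (Spec (.of B)).Opens) ≤
      (Spec.map (CommRingCat.ofHom α) ≫ hU.fromSpec) ⁻¹ᵁ U := by
    rw [Scheme.Hom.comp_preimage, IsAffineOpen.fromSpec_preimage_self]; exact le_rfl
  intro x
  have hbij : Function.Bijective (Scheme.ΓSpecIso (.of B)).inv.hom :=
    ConcreteCategory.bijective_of_isIso _
  refine ⟨⟨⊤, isAffineOpen_top _⟩, trivial, (Scheme.ΓSpecIso (.of B)).inv.hom b, ?_, ?_⟩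
  · rw [mem_nonZeroDivisors_iff_right] at hb ⊢
    intro y hy
    obtain ⟨y, rfl⟩ := hbij.2 y
    rw [← map_mul, ← map_zero (Scheme.ΓSpecIso (.of B)).inv.hom] at hy
    have := hb y (hbij.1 hy)
    rw [this, map_zero]
  · rw [ideal_comap _ I ⟨U, hU⟩ _ e, appLE_fromSpec, CommRingCat.hom_comp, ← Ideal.map_map,
      CommRingCat.hom_ofHom, h, Ideal.map_span, Set.image_singleton]

end IdealSheaf

section SpecLocal

theorem exists_eq_SpecMap_fromSpec {X : Scheme.{u}} {U : X.Opens} (hU : IsAffineOpen U) {B : Type u}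
    [CommRing B] (g : Spec (.of B) ⟶ X) (hg : Set.range g ⊆ U) :
    ∃ α : Γ(X, U) →+* B, g = Spec.map (CommRingCat.ofHom α) ≫ hU.fromSpec := by
  refine ⟨(Spec.preimage (IsOpenImmersion.lift hU.fromSpec g (by rwa [hU.range_fromSpec]))).hom, ?_⟩
  rw [CommRingCat.ofHom_hom, Spec.map_preimage, IsOpenImmersion.lift_fac]

theorem range_subset_of_closedPoint_mem {X : Scheme.{u}} (U : X.Opens) {B : Type u}
    [CommRing B] [IsLocalRing B] (g : Spec (.of B) ⟶ X)
    (hg : g (IsLocalRing.closedPoint B) ∈ U) : Set.range g ⊆ U := by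
  have : g ⁻¹ᵁ U = ⊤ := (IsLocalRing.closed_point_mem_iff (U := g ⁻¹ᵁ U)).mp hg
  rintro _ ⟨x, rfl⟩
  have hx : x ∈ g ⁻¹ᵁ U := this ▸ trivial
  exact hx

end SpecLocal

end SemistableProduct

namespace SemistableProduct

/-! ### Charts of a blow-up from its universal property. -/

section BlowupPair

variable {X : Scheme.{u}}

/-- On the affine open `U` the ideal sheaf `I` is generated by `u` and `v`, and `BlowupRing u v p q`
and `BlowupRing v u q p` are the coordinate rings of the charts of its blow-up. -/
structure IsBlowupPair (I : X.IdealSheafData) {U : X.Opens} (hU : IsAffineOpen U)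
    (u v p q : Γ(X, U)) : Prop where
  ideal_eq : I.ideal ⟨U, hU⟩ = Ideal.span {u, v}
  rel : u * p = v * q
  left : BlowupRing.of u v p q u ∈ nonZeroDivisors (BlowupRing u v p q)
  right : BlowupRing.of v u q p v ∈ nonZeroDivisors (BlowupRing v u q p)

/-- The morphism from a chart of the blow-up to the base. -/
noncomputable def blowupChart {U : X.Opens} (hU : IsAffineOpen U) (u v p q : Γ(X, U)) :
    Spec (.of (BlowupRing u v p q)) ⟶ X :=
  Spec.map (CommRingCat.ofHom (BlowupRing.of u v p q)) ≫ hU.fromSpec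

theorem flat_presheaf_map {Y : Scheme.{u}} {U V : Y.Opens} (hU : IsAffineOpen U)
    (hV : IsAffineOpen V) (h : V ≤ U) : (Y.presheaf.map (homOfLE h).op).hom.Flat := by
  have e : V ≤ (𝟙 Y : Y ⟶ Y) ⁻¹ᵁ U := h
  have h1 := HasRingHomProperty.appLE @Flat (𝟙 Y) inferInstance ⟨U, hU⟩ ⟨V, hV⟩ e
  have h2 : (𝟙 Y : Y ⟶ Y).appLE U V e = Y.presheaf.map (homOfLE h).op := by
    change (𝟙 Y : Y ⟶ Y).app U ≫ Y.presheaf.map _ = _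
    rw [Scheme.Hom.id_app]
    exact Category.id_comp _
  rwa [h2] at h1

theorem exists_fromSpec_comp_eq {A : Type u} [CommRing A] {W : Scheme.{u}} (y : W ⟶ Spec (.of A))
    {V : W.Opens} (hV : IsAffineOpen V) :
    ∃ φ : A →+* Γ(W, V), hV.fromSpec ≫ y = Spec.map (CommRingCat.ofHom φ) := by
  refine ⟨(Spec.preimage (hV.fromSpec ≫ y)).hom, ?_⟩
  rw [CommRingCat.ofHom_hom, Spec.map_preimage]

theorem exists_isAffineOpen_of_isInvertibleIdeal {Y : Scheme.{u}} {J : Y.IdealSheafData}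
    (hJ : IsInvertibleIdeal J) (y : Y) (W : Y.Opens) (hy : y ∈ W) :
    ∃ (V : Y.Opens) (hV : IsAffineOpen V), y ∈ V ∧ V ≤ W ∧
      ∃ a ∈ nonZeroDivisors Γ(Y, V), J.ideal ⟨V, hV⟩ = Ideal.span {a} := by
  obtain ⟨U, hyU, a, ha, haJ⟩ := hJ y
  obtain ⟨V, hV, hyV, hVU⟩ := exists_isAffineOpen_mem_and_subset (U := U.1 ⊓ W) ⟨hyU, hy⟩
  have hVU' : V ≤ U.1 := hVU.trans inf_le_left
  refine ⟨V, hV, hyV, hVU.trans inf_le_right, (Y.presheaf.map (homOfLE hVU').op).hom a,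
    map_mem_nonZeroDivisors_of_flat (flat_presheaf_map U.2 hV hVU') ha, ?_⟩
  have := J.map_ideal (U := ⟨V, hV⟩) (V := U) hVU'
  rw [← this, haJ, Ideal.map_span, Set.image_singleton]
  rfl

theorem mem_nonZeroDivisors_of_span_eq {B : Type*} [CommRing B] {a b : B}
    (ha : a ∈ nonZeroDivisors B) (h : Ideal.span {b} = Ideal.span {a}) :
    b ∈ nonZeroDivisors B := by
  obtain ⟨c, rfl⟩ := Ideal.mem_span_singleton'.mp (h ▸ Ideal.mem_span_singleton_self a)
  exact (mul_mem_nonZeroDivisors.mp ha).2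

namespace IsBlowupPair

variable {I : X.IdealSheafData} {U : X.Opens} {hU : IsAffineOpen U} {u v p q : Γ(X, U)}

theorem swap (H : IsBlowupPair I hU u v p q) : IsBlowupPair I hU v u q p :=
  ⟨by rw [H.ideal_eq, Set.pair_comm], H.rel.symm, H.right, H.left⟩

theorem map_ideal (H : IsBlowupPair I hU u v p q) {B : Type u} [CommRing B]
    (e : BlowupRing u v p q →+* B) : (I.ideal ⟨U, hU⟩).map (e.comp (BlowupRing.of u v p q)) =
      Ideal.span {e (BlowupRing.of u v p q u)} := by
  rw [H.ideal_eq, Ideal.map_span, Set.image_pair]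
  refine le_antisymm ?_ (Ideal.span_mono (by simp))
  rw [Ideal.span_le]
  rintro _ (rfl | rfl)
  · exact Ideal.subset_span rfl
  · rw [SetLike.mem_coe, RingHom.comp_apply, ← BlowupRing.of_mul_ratio, map_mul]
    exact Ideal.mul_mem_right _ _ (Ideal.subset_span rfl)

theorem isInvertibleIdeal_comap (H : IsBlowupPair I hU u v p q) {B : Type u} [CommRing B]
    (e : BlowupRing u v p q →+* B) (he : e (BlowupRing.of u v p q u) ∈ nonZeroDivisors B) :
    IsInvertibleIdeal (I.comap (Spec.map (CommRingCat.ofHom (e.comp (BlowupRing.of u v p q))) ≫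
      hU.fromSpec)) :=
  isInvertibleIdeal_comap_Spec hU _ _ he (H.map_ideal e)

theorem isInvertibleIdeal_comap_blowupChart (H : IsBlowupPair I hU u v p q) :
    IsInvertibleIdeal (I.comap (blowupChart hU u v p q)) := by
  have := H.isInvertibleIdeal_comap (RingHom.id _) (by simpa using H.left)
  rwa [RingHom.id_comp] at this

/-- The ratio is determined as v/u as soon as u becomes a non-zero-divisor. -/
theorem ringHom_ext {B : Type u} [CommRing B] {e e' : BlowupRing u v p q →+* B}
    (h : ∀ a, e (BlowupRing.of u v p q a) = e' (BlowupRing.of u v p q a))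
    (hu : e (BlowupRing.of u v p q u) ∈ nonZeroDivisors B) : e = e' := by
  refine BlowupRing.hom_ext h ?_
  have h1 := congr_arg e (BlowupRing.of_mul_ratio u v p q)
  have h2 := congr_arg e' (BlowupRing.of_mul_ratio u v p q)
  rw [map_mul] at h1 h2
  rw [← h, ← h] at h2
  exact (mul_cancel_left_mem_nonZeroDivisors hu).mp (h1.trans h2.symm)

theorem SpecMap_comp_blowupChart {B : Type u} [CommRing B] (e : BlowupRing u v p q →+* B) :
    Spec.map (CommRingCat.ofHom e) ≫ blowupChart hU u v p q =
      Spec.map (CommRingCat.ofHom (e.comp (BlowupRing.of u v p q))) ≫ hU.fromSpec := by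
  rw [blowupChart, CommRingCat.ofHom_comp, Spec.map_comp, Category.assoc]

theorem eq_of_SpecMap_comp_fromSpec {B : Type u} [CommRing B] {e e' : Γ(X, U) →+* B}
    (h : Spec.map (CommRingCat.ofHom e) ≫ hU.fromSpec =
      Spec.map (CommRingCat.ofHom e') ≫ hU.fromSpec) : e = e' := by
  rw [cancel_mono] at h
  have := Spec.map_injective h
  exact congr_arg CommRingCat.Hom.hom this

theorem comp_of_eq {B : Type u} [CommRing B] {e : BlowupRing u v p q →+* B} {a : Γ(X, U) →+* B}
    (h : Spec.map (CommRingCat.ofHom e) ≫ blowupChart hU u v p q =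
      Spec.map (CommRingCat.ofHom a) ≫ hU.fromSpec) (x : Γ(X, U)) :
    e (BlowupRing.of u v p q x) = a x := by
  rw [SpecMap_comp_blowupChart] at h
  exact RingHom.congr_fun (eq_of_SpecMap_comp_fromSpec h) x

theorem range_blowupChart_subset : Set.range (blowupChart hU u v p q) ⊆ U := by
  rintro _ ⟨x, rfl⟩
  rw [← hU.range_fromSpec]
  exact ⟨_, rfl⟩

/-- On an affine open `V` of a scheme `W` over a chart of the blow-up. -/
theorem mem_nonZeroDivisors_appLE (H : IsBlowupPair I hU u v p q) {W : Scheme.{u}} (g : W ⟶ X)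
    {V : W.Opens} (hV : IsAffineOpen V) (e : V ≤ g ⁻¹ᵁ U) {a : Γ(W, V)}
    (ha : a ∈ nonZeroDivisors Γ(W, V)) (haI : (I.comap g).ideal ⟨V, hV⟩ = Ideal.span {a})
    (φ : BlowupRing u v p q →+* Γ(W, V))
    (hφ : ∀ x, φ (BlowupRing.of u v p q x) = (g.appLE U V e).hom x) :
    φ (BlowupRing.of u v p q u) ∈ nonZeroDivisors Γ(W, V) := by
  refine mem_nonZeroDivisors_of_span_eq ha ?_
  rw [← H.map_ideal φ, ← haI, ideal_comap g I ⟨U, hU⟩ ⟨V, hV⟩ e]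
  congr 1
  exact RingHom.ext hφ

theorem preimage_eq_top {W : Scheme.{u}} {y : W ⟶ Spec (.of (BlowupRing u v p q))} {g : W ⟶ X}
    (h : y ≫ blowupChart hU u v p q = g) : g ⁻¹ᵁ U = ⊤ := by
  rw [← h, blowupChart, Scheme.Hom.comp_preimage, Scheme.Hom.comp_preimage,
    hU.fromSpec_preimage_self, Scheme.Hom.preimage_top, Scheme.Hom.preimage_top]

theorem exists_ringHom_of_comp_eq {W : Scheme.{u}} {y : W ⟶ Spec (.of (BlowupRing u v p q))}
    {g : W ⟶ X} (h : y ≫ blowupChart hU u v p q = g) {V : W.Opens} (hV : IsAffineOpen V)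
    (e : V ≤ g ⁻¹ᵁ U) : ∃ φ : BlowupRing u v p q →+* Γ(W, V),
      hV.fromSpec ≫ y = Spec.map (CommRingCat.ofHom φ) ∧
        ∀ x, φ (BlowupRing.of u v p q x) = (g.appLE U V e).hom x := by
  obtain ⟨φ, hφ⟩ := exists_fromSpec_comp_eq y hV
  refine ⟨φ, hφ, comp_of_eq (hU := hU) (B := Γ(W, V)) ?_⟩
  rw [← hφ, Category.assoc, h]
  exact (IsAffineOpen.SpecMap_appLE_fromSpec _ hU hV e).symm

theorem ι_comp_eq_of_fromSpec_comp_eq {W Z : Scheme.{u}} {V : W.Opens} (hV : IsAffineOpen V)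
    {y z : W ⟶ Z} (h : hV.fromSpec ≫ y = hV.fromSpec ≫ z) : V.ι ≫ y = V.ι ≫ z := by
  have h6 : hV.isoSpec.hom ≫ hV.fromSpec = V.ι := hV.isoSpec_hom_fromSpec
  rw [← h6, Category.assoc, Category.assoc, h]

/-- The charts of the blow-up are monomorphisms as far as they can be tested by the universal
property. -/
theorem hom_ext (H : IsBlowupPair I hU u v p q) {W : Scheme.{u}}
    {y z : W ⟶ Spec (.of (BlowupRing u v p q))} {g : W ⟶ X}
    (hy : y ≫ blowupChart hU u v p q = g) (hz : z ≫ blowupChart hU u v p q = g)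
    (hI : IsInvertibleIdeal (I.comap g)) : y = z := by
  refine Scheme.hom_ext_of_forall _ _ fun w ↦ ?_
  obtain ⟨V, hV, hwV, -, a, ha, haI⟩ := exists_isAffineOpen_of_isInvertibleIdeal hI w ⊤ trivial
  have e : V ≤ g ⁻¹ᵁ U := le_top.trans (preimage_eq_top hy).ge
  obtain ⟨φ, h1, h2⟩ := exists_ringHom_of_comp_eq hy hV e
  obtain ⟨ψ, h3, h4⟩ := exists_ringHom_of_comp_eq hz hV e
  have hφψ : φ = ψ := ringHom_ext (fun x ↦ by rw [h2, h4])
    (H.mem_nonZeroDivisors_appLE _ hV e ha haI φ h2)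
  exact ⟨V, hwV, ι_comp_eq_of_fromSpec_comp_eq hV (by rw [h1, h3, hφψ])⟩

variable {X' : Scheme.{u}} {b : X' ⟶ X}

theorem existsUnique_lift (H : IsBlowupPair I hU u v p q) (hb : IsBlowup b I) :
    ∃! h : Spec (.of (BlowupRing u v p q)) ⟶ X', h ≫ b = blowupChart hU u v p q :=
  hb.existsUnique_lift _ H.isInvertibleIdeal_comap_blowupChart

/-- Locally u = αa and v = βa, where a generates the inverse image ideal. As a is a non-zero-divisor
and a combination of u and v, the elements α and β generate the unit ideal, and one of them is
invertible at x. Then β/α or α/β is a regular function near x, which is a map to one of the charts.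
-/
theorem exists_ringHom (H : IsBlowupPair I hU u v p q) (hb : IsBlowup b I) (x : X')
    (hx : b x ∈ U) : ∃ (V : X'.Opens) (_ : IsAffineOpen V) (e : V ≤ b ⁻¹ᵁ U), x ∈ V ∧
      ((∃ φ : BlowupRing u v p q →+* Γ(X', V), ∀ a, φ (BlowupRing.of u v p q a) =
        (b.appLE U V e).hom a) ∨
      (∃ φ : BlowupRing v u q p →+* Γ(X', V), ∀ a, φ (BlowupRing.of v u q p a) =
        (b.appLE U V e).hom a)) := by
  obtain ⟨V, hV, hxV, e, a, ha, haI⟩ :=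
    exists_isAffineOpen_of_isInvertibleIdeal hb.isInvertible_comap x (b ⁻¹ᵁ U) hx
  rw [ideal_comap b I ⟨U, hU⟩ ⟨V, hV⟩ e, H.ideal_eq, Ideal.map_span, Set.image_pair] at haI
  have hu : (b.appLE U V e).hom u ∈ Ideal.span {a} := haI ▸ Ideal.subset_span (Or.inl rfl)
  have hv : (b.appLE U V e).hom v ∈ Ideal.span {a} := haI ▸ Ideal.subset_span (Or.inr rfl)
  have ha' := haI.ge (Ideal.mem_span_singleton_self a)
  obtain ⟨α, hα⟩ := Ideal.mem_span_singleton'.mp hu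
  obtain ⟨β, hβ⟩ := Ideal.mem_span_singleton'.mp hv
  obtain ⟨c, d, hcd⟩ := Ideal.mem_span_pair.mp ha'
  have hone : c * α + d * β = 1 := by
    refine (mul_cancel_right_mem_nonZeroDivisors ha).mp ?_
    rw [one_mul]
    linear_combination hcd + c * hα + d * hβ
  have hgerm : IsUnit (X'.presheaf.germ V x hxV α) ∨ IsUnit (X'.presheaf.germ V x hxV β) := by
    have h1 := congr_arg (X'.presheaf.germ V x hxV).hom hone
    rw [map_add, map_mul, map_mul, map_one] at h1
    rcases IsLocalRing.isUnit_or_isUnit_of_add_one h1 with h | h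
    · exact Or.inl (isUnit_of_mul_isUnit_right h)
    · exact Or.inr (isUnit_of_mul_isUnit_right h)
  have key : ∀ (u v p q : Γ(X, U)) (α β : Γ(X', V)), u * p = v * q →
      α * a = (b.appLE U V e).hom u → β * a = (b.appLE U V e).hom v →
      ∃ φ : BlowupRing u v p q →+* Γ(X', X'.basicOpen α), ∀ x, φ (BlowupRing.of u v p q x) =
        (b.appLE U (X'.basicOpen α) ((X'.basicOpen_le α).trans e)).hom x := by
    intro u v p q α β hrel hα hβ
    let r : Γ(X', V) →+* Γ(X', X'.basicOpen α) :=
      (X'.presheaf.map (homOfLE (X'.basicOpen_le α)).op).hom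
    have hr : ∀ x, (b.appLE U (X'.basicOpen α) ((X'.basicOpen_le α).trans e)).hom x =
        r ((b.appLE U V e).hom x) := by
      intro x
      have := Scheme.Hom.appLE_map b e (homOfLE (X'.basicOpen_le α)).op
      rw [← this]
      rfl
    have hrf : r.Flat := flat_presheaf_map hV (hV.basicOpen α) (X'.basicOpen_le α)
    have hra := map_mem_nonZeroDivisors_of_flat hrf ha
    have hunit : IsUnit (r α) := RingedSpace.isUnit_res_basicOpen _ α
    obtain ⟨ε, hε⟩ := hunit
    have h1 : r ((b.appLE U V e).hom u) * (↑ε⁻¹ * r β) = r ((b.appLE U V e).hom v) := by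
      rw [← hα, ← hβ, map_mul, map_mul, ← hε]
      calc (ε : Γ(X', X'.basicOpen α)) * r a * (↑ε⁻¹ * r β) = (ε * ↑ε⁻¹) * (r β * r a) := by ring
        _ = _ := by rw [Units.mul_inv, one_mul]
    have hu' : r ((b.appLE U V e).hom u) ∈ nonZeroDivisors Γ(X', X'.basicOpen α) := by
      rw [← hα, map_mul]
      exact mul_mem (by rw [← hε]; exact ε.isUnit.mem_nonZeroDivisors) hra
    obtain ⟨φ, h2, -⟩ := BlowupRing.exists_lift (u := u) (v := v) (p := p) (q := q)
      (b.appLE U (X'.basicOpen α) ((X'.basicOpen_le α).trans e)).hom (↑ε⁻¹ * r β)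
      (by rw [hr, hr, h1])
      (by
        rw [hr, hr]
        -- The second relation of the chart is u p = v q with u cancelled.
        refine (mul_cancel_left_mem_nonZeroDivisors hu').mp ?_
        rw [← mul_assoc, h1, ← map_mul, ← map_mul, ← map_mul, ← map_mul, hrel])
    exact ⟨φ, h2⟩
  rcases hgerm with h | h
  · obtain ⟨φ, hφ⟩ := key u v p q α β H.rel hα hβ
    exact ⟨_, hV.basicOpen α, _, (X'.mem_basicOpen α x hxV).mpr h, Or.inl ⟨φ, hφ⟩⟩
  · obtain ⟨φ, hφ⟩ := key v u q p β α H.rel.symm hβ hα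
    exact ⟨_, hV.basicOpen β, _, (X'.mem_basicOpen β x hxV).mpr h, Or.inr ⟨φ, hφ⟩⟩

section Lift

variable (H : IsBlowupPair I hU u v p q) (hb : IsBlowup b I)
  {h : Spec (.of (BlowupRing u v p q)) ⟶ X'} (hh : h ≫ b = blowupChart hU u v p q)
  {V : X'.Opens} (hV : IsAffineOpen V) (e : V ≤ b ⁻¹ᵁ U)
  (φ : BlowupRing u v p q →+* Γ(X', V))
  (hφ : ∀ a, φ (BlowupRing.of u v p q a) = (b.appLE U V e).hom a)

include hφ in
theorem SpecMap_comp_blowupChart_eq : Spec.map (CommRingCat.ofHom φ) ≫ blowupChart hU u v p q =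
    hV.fromSpec ≫ b := by
  rw [← IsAffineOpen.SpecMap_appLE_fromSpec b hU hV e]
  have := SpecMap_comp_blowupChart (hU := hU) (B := Γ(X', V)) φ
  have h2 : φ.comp (BlowupRing.of u v p q) = (b.appLE U V e).hom := RingHom.ext hφ
  rw [h2] at this
  exact this

-- Both sides lift the same morphism to `X`, and lifts are unique.
include hb hh hφ in
theorem SpecMap_comp_lift : Spec.map (CommRingCat.ofHom φ) ≫ h = hV.fromSpec := by
  refine (hb.existsUnique_lift (hV.fromSpec ≫ b) ?_).unique ?_ rfl
  · rw [Scheme.IdealSheafData.comap_comp]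
    exact isInvertibleIdeal_comap_of_flat _ hb.isInvertible_comap
  · rw [Category.assoc, hh, SpecMap_comp_blowupChart_eq hV e φ hφ]

-- The section inverts the map from `V` to the open subset over it in the chart. That the composite
-- on the chart is the inclusion follows from `hom_ext`, as the inverse image ideal is invertible on
-- the chart and on its open subsets.
include H hb hh hφ in
theorem exists_section : ∃ s : (h ⁻¹ᵁ V).toScheme ⟶ Spec Γ(X', V),
    s ≫ hV.fromSpec = (h ⁻¹ᵁ V).ι ≫ h ∧ s ≫ Spec.map (CommRingCat.ofHom φ) = (h ⁻¹ᵁ V).ι := by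
  let s : (h ⁻¹ᵁ V).toScheme ⟶ Spec Γ(X', V) :=
    IsOpenImmersion.lift hV.fromSpec ((h ⁻¹ᵁ V).ι ≫ h) (by
      rw [hV.range_fromSpec]
      rintro _ ⟨x, rfl⟩
      exact x.2)
  have hs : s ≫ hV.fromSpec = (h ⁻¹ᵁ V).ι ≫ h := IsOpenImmersion.lift_fac _ _ _
  refine ⟨s, hs, H.hom_ext (g := (h ⁻¹ᵁ V).ι ≫ blowupChart hU u v p q) ?_ rfl ?_⟩
  · rw [Category.assoc, SpecMap_comp_blowupChart_eq hV e φ hφ, ← Category.assoc, hs,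
      Category.assoc, hh]
  · rw [Scheme.IdealSheafData.comap_comp]
    exact isInvertibleIdeal_comap_of_flat _ H.isInvertibleIdeal_comap_blowupChart

include H hb hh hφ in
theorem comp_SpecMap_eq {W : Scheme.{u}} (y : W ⟶ Spec (.of (BlowupRing u v p q)))
    (z : W ⟶ Spec Γ(X', V)) (hyz : y ≫ h = z ≫ hV.fromSpec) :
    z ≫ Spec.map (CommRingCat.ofHom φ) = y := by
  obtain ⟨s, hs1, hs2⟩ := exists_section H hb hh hV e φ hφ
  let y' : W ⟶ (h ⁻¹ᵁ V).toScheme := IsOpenImmersion.lift (h ⁻¹ᵁ V).ι y (by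
    rw [Scheme.Opens.range_ι]
    rintro _ ⟨w, rfl⟩
    have : (y ≫ h) w ∈ V := by
      rw [hyz]
      have : hV.fromSpec (z w) ∈ Set.range hV.fromSpec := ⟨_, rfl⟩
      rwa [hV.range_fromSpec] at this
    exact this)
  have hy' : y' ≫ (h ⁻¹ᵁ V).ι = y := IsOpenImmersion.lift_fac _ _ _
  have hz : z = y' ≫ s := by
    rw [← cancel_mono hV.fromSpec, Category.assoc, hs1, ← Category.assoc, hy', hyz]
  rw [hz, Category.assoc, hs2, hy']

-- The section and the map from `V` are mutually inverse, so `V` is identified with an open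
-- subscheme of the chart.
include H hb hh hV hφ in
theorem isOpenImmersion_SpecMap : IsOpenImmersion (Spec.map (CommRingCat.ofHom φ)) := by
  obtain ⟨s, hs1, hs2⟩ := exists_section H hb hh hV e φ hφ
  have hl := SpecMap_comp_lift hb hh hV e φ hφ
  let r : Spec Γ(X', V) ⟶ (h ⁻¹ᵁ V).toScheme :=
    IsOpenImmersion.lift (h ⁻¹ᵁ V).ι (Spec.map (CommRingCat.ofHom φ)) (by
      rw [Scheme.Opens.range_ι]
      rintro _ ⟨w, rfl⟩
      have : (Spec.map (CommRingCat.ofHom φ) ≫ h) w ∈ V := by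
        rw [hl]
        have : hV.fromSpec w ∈ Set.range hV.fromSpec := ⟨_, rfl⟩
        rwa [hV.range_fromSpec] at this
      exact this)
  have hr : r ≫ (h ⁻¹ᵁ V).ι = Spec.map (CommRingCat.ofHom φ) := IsOpenImmersion.lift_fac _ _ _
  have h1 : r ≫ s = 𝟙 _ := by
    rw [← cancel_mono hV.fromSpec, Category.assoc, hs1, ← Category.assoc, hr, hl,
      Category.id_comp]
  have h2 : s ≫ r = 𝟙 _ := by
    rw [← cancel_mono (h ⁻¹ᵁ V).ι, Category.assoc, hr, hs2, Category.id_comp]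
  have : IsIso r := ⟨s, h1, h2⟩
  rw [← hr]
  infer_instance

include H hb hh hV hφ in
theorem smooth_ringHom : φ.Smooth := by
  have := isOpenImmersion_SpecMap H hb hh hV e φ hφ
  have h2 : Smooth (Spec.map (CommRingCat.ofHom φ)) := inferInstance
  rwa [HasRingHomProperty.Spec_iff (P := @Smooth)] at h2

end Lift

end IsBlowupPair

end BlowupPair

end SemistableProduct

namespace SemistableProduct

/-! ### Points of the blow-up with values in local rings. -/

section BlowupProper

variable {X : Scheme.{u}}

namespace IsBlowupPair

variable {I : X.IdealSheafData} {U : X.Opens} {hU : IsAffineOpen U} {u v p q : Γ(X, U)}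
  {X' : Scheme.{u}} {b : X' ⟶ X}

theorem comp_apply_of_comp_eq (hh : h ≫ b = blowupChart hU u v p q) {B : Type u} [CommRing B]
    {l : Spec (.of B) ⟶ X'} {a : Γ(X, U) →+* B}
    (hl : l ≫ b = Spec.map (CommRingCat.ofHom a) ≫ hU.fromSpec)
    {m : BlowupRing u v p q →+* B} (hm : Spec.map (CommRingCat.ofHom m) ≫ h = l) (x : Γ(X, U)) :
    m (BlowupRing.of u v p q x) = a x := by
  refine comp_of_eq (hU := hU) (B := B) ?_ x
  rw [← hl, ← hm, Category.assoc, hh]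

/-- The spectrum of a local ring maps into any neighbourhood of the image of its closed point, and
small neighbourhoods map to one of the two charts. -/
theorem exists_factor (H : IsBlowupPair I hU u v p q) (hb : IsBlowup b I)
    {h₁ : Spec (.of (BlowupRing u v p q)) ⟶ X'} (hh₁ : h₁ ≫ b = blowupChart hU u v p q)
    {h₂ : Spec (.of (BlowupRing v u q p)) ⟶ X'} (hh₂ : h₂ ≫ b = blowupChart hU v u q p)
    {B : Type u} [CommRing B] [IsLocalRing B] (l : Spec (.of B) ⟶ X') (a : Γ(X, U) →+* B)
    (hl : l ≫ b = Spec.map (CommRingCat.ofHom a) ≫ hU.fromSpec) :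
    (∃ m : BlowupRing u v p q →+* B, Spec.map (CommRingCat.ofHom m) ≫ h₁ = l) ∨
    (∃ m : BlowupRing v u q p →+* B, Spec.map (CommRingCat.ofHom m) ≫ h₂ = l) := by
  have hx : b (l (IsLocalRing.closedPoint B)) ∈ U := by
    have h1 : (l ≫ b) (IsLocalRing.closedPoint B) ∈ Set.range hU.fromSpec := by
      rw [hl]
      exact ⟨_, rfl⟩
    rwa [hU.range_fromSpec] at h1
  obtain ⟨V, hV, e, hxV, hφ⟩ := H.exists_ringHom hb _ hx
  obtain ⟨n, hn⟩ := exists_eq_SpecMap_fromSpec hV l (range_subset_of_closedPoint_mem V l hxV)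
  rcases hφ with ⟨φ, hφ⟩ | ⟨φ, hφ⟩
  · refine Or.inl ⟨n.comp φ, ?_⟩
    rw [CommRingCat.ofHom_comp, Spec.map_comp, Category.assoc, hn]
    exact congr_arg _ (SpecMap_comp_lift hb hh₁ hV e φ hφ)
  · refine Or.inr ⟨n.comp φ, ?_⟩
    rw [CommRingCat.ofHom_comp, Spec.map_comp, Category.assoc, hn]
    exact congr_arg _ (SpecMap_comp_lift hb hh₂ hV e φ hφ)

/-- Inverting the ratio gives a flat algebra over the chart, on which the inverse image ideal is
still invertible. Uniqueness of lifts identifies the two charts there, and `m` factors through it.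
-/
theorem exists_swap_of_isUnit (H : IsBlowupPair I hU u v p q) (hb : IsBlowup b I)
    {h₁ : Spec (.of (BlowupRing u v p q)) ⟶ X'} (hh₁ : h₁ ≫ b = blowupChart hU u v p q)
    {h₂ : Spec (.of (BlowupRing v u q p)) ⟶ X'} (hh₂ : h₂ ≫ b = blowupChart hU v u q p)
    {B : Type u} [CommRing B] (m : BlowupRing u v p q →+* B) {r : B}
    (hr : m (BlowupRing.ratio u v p q) * r = 1) :
    ∃ m' : BlowupRing v u q p →+* B, m' (BlowupRing.ratio v u q p) = r ∧
      Spec.map (CommRingCat.ofHom m') ≫ h₂ = Spec.map (CommRingCat.ofHom m) ≫ h₁ := by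
  let L := Localization.Away (BlowupRing.ratio u v p q)
  let κ : BlowupRing u v p q →+* L := algebraMap _ _
  have hκ : κ.Flat := by
    have : Module.Flat (BlowupRing u v p q) L := IsLocalization.flat _ (.powers (BlowupRing.ratio u v p q))
    exact RingHom.flat_algebraMap_iff.mpr this
  let i : L := IsLocalization.Away.invSelf (BlowupRing.ratio u v p q)
  have hi : κ (BlowupRing.ratio u v p q) * i = 1 := IsLocalization.Away.mul_invSelf _
  have h1 : κ (BlowupRing.of u v p q u) * κ (BlowupRing.ratio u v p q) =
      κ (BlowupRing.of u v p q v) := by rw [← map_mul, BlowupRing.of_mul_ratio]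
  have h2 : κ (BlowupRing.of u v p q p) = κ (BlowupRing.ratio u v p q) *
      κ (BlowupRing.of u v p q q) := by rw [← map_mul, BlowupRing.of_eq_ratio_mul]
  obtain ⟨φ, hφ, hφ'⟩ := BlowupRing.exists_lift (u := v) (v := u) (p := q) (q := p)
    (κ.comp (BlowupRing.of u v p q)) i
    (by
      simp only [RingHom.comp_apply]
      linear_combination (κ (BlowupRing.of u v p q u)) * hi - i * h1)
    (by
      simp only [RingHom.comp_apply]
      linear_combination (- κ (BlowupRing.of u v p q q)) * hi - i * h2)
  have hφκ : φ.comp (BlowupRing.of v u q p) = κ.comp (BlowupRing.of u v p q) := RingHom.ext hφ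
  have key : Spec.map (CommRingCat.ofHom φ) ≫ h₂ = Spec.map (CommRingCat.ofHom κ) ≫ h₁ := by
    refine (hb.existsUnique_lift (Spec.map (CommRingCat.ofHom (κ.comp (BlowupRing.of u v p q))) ≫
      hU.fromSpec) (H.isInvertibleIdeal_comap κ
        (map_mem_nonZeroDivisors_of_flat hκ H.left))).unique ?_ ?_
    · rw [Category.assoc, hh₂, SpecMap_comp_blowupChart, hφκ]
    · rw [Category.assoc, hh₁, SpecMap_comp_blowupChart]
  let μ : L →+* B := IsLocalization.Away.lift (BlowupRing.ratio u v p q) (g := m)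
    (IsUnit.of_mul_eq_one _ hr)
  have hμ : μ.comp κ = m := IsLocalization.Away.lift_comp _ _
  refine ⟨μ.comp φ, ?_, ?_⟩
  · rw [RingHom.comp_apply, hφ']
    have h3 := congr_arg μ hi
    rw [map_mul, map_one, ← RingHom.comp_apply, hμ] at h3
    calc μ i = (m (BlowupRing.ratio u v p q) * r) * μ i := by rw [hr, one_mul]
      _ = (m (BlowupRing.ratio u v p q) * μ i) * r := by ring
      _ = r := by rw [h3, one_mul]
  · rw [CommRingCat.ofHom_comp, Spec.map_comp, Category.assoc, key, ← Category.assoc,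
      ← Spec.map_comp, ← CommRingCat.ofHom_comp, hμ]

/-- Combining u r = v and v r' = u gives u r r' = u, where u may be cancelled if it is a
non-zero-divisor. -/
theorem ratio_mul_ratio_of_comp_eq {Y : Scheme.{u}} {y : Y ⟶ Spec (.of (BlowupRing u v p q))}
    {k : Y ⟶ X'} (hy : y ≫ blowupChart hU u v p q = k ≫ b)
    {V : X'.Opens} (e : V ≤ b ⁻¹ᵁ U)
    (φ : BlowupRing v u q p →+* Γ(X', V))
    (hφ : ∀ a, φ (BlowupRing.of v u q p a) = (b.appLE U V e).hom a)
    {W : Y.Opens} (hW : IsAffineOpen W) (hWV : W ≤ k ⁻¹ᵁ V) :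
    ∃ ψ : BlowupRing u v p q →+* Γ(Y, W),
      hW.fromSpec ≫ y = Spec.map (CommRingCat.ofHom ψ) ∧
      (ψ (BlowupRing.of u v p q u) ∈ nonZeroDivisors Γ(Y, W) →
        ψ (BlowupRing.ratio u v p q) * (k.appLE V W hWV).hom (φ (BlowupRing.ratio v u q p)) = 1) := by
  have eW : W ≤ (k ≫ b) ⁻¹ᵁ U := fun x hx ↦ e (hWV hx)
  obtain ⟨ψ, hψ, hψof⟩ := exists_ringHom_of_comp_eq hy hW eW
  refine ⟨ψ, hψ, fun hnz ↦ ?_⟩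
  have hof : ∀ x, (k.appLE V W hWV).hom (φ (BlowupRing.of v u q p x)) =
      ψ (BlowupRing.of u v p q x) := by
    intro x
    rw [hφ, hψof, ← Scheme.Hom.appLE_comp_appLE k b U V W e hWV]
    rfl
  have h1 := congr_arg ψ (BlowupRing.of_mul_ratio u v p q)
  have h2 := congr_arg (fun x ↦ (k.appLE V W hWV).hom (φ x)) (BlowupRing.of_mul_ratio v u q p)
  simp only [map_mul, hof] at h1 h2
  refine (mul_cancel_left_mem_nonZeroDivisors hnz).mp ?_
  linear_combination ((k.appLE V W hWV).hom (φ (BlowupRing.ratio v u q p))) * h1 + h2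

theorem exists_comp_of_factor {Y : Scheme.{u}} {A : Type u} [CommRing A] {y : Y ⟶ Spec (.of A)}
    {k : Y ⟶ X'} {V : X'.Opens} (hV : IsAffineOpen V)
    {W : Y.Opens} (hW : IsAffineOpen W) (hWV : W ≤ k ⁻¹ᵁ V) {ψ : A →+* Γ(Y, W)}
    (hψ : hW.fromSpec ≫ y = Spec.map (CommRingCat.ofHom ψ))
    {B : Type u} [CommRing B] {l : Spec (.of B) ⟶ Y} (hl : Set.range l ⊆ W) {m : A →+* B}
    {n : Γ(X', V) →+* B} (hm : l ≫ y = Spec.map (CommRingCat.ofHom m))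
    (hn : l ≫ k = Spec.map (CommRingCat.ofHom n) ≫ hV.fromSpec) :
    ∃ β : Γ(Y, W) →+* B, m = β.comp ψ ∧ n = β.comp (k.appLE V W hWV).hom := by
  obtain ⟨β, hβ⟩ := exists_eq_SpecMap_fromSpec hW l hl
  refine ⟨β, ?_, ?_⟩
  · rw [hβ, Category.assoc, hψ, ← Spec.map_comp, ← CommRingCat.ofHom_comp] at hm
    exact (congr_arg CommRingCat.Hom.hom (Spec.map_injective hm)).symm
  · have hχ : Spec.map (k.appLE V W hWV) ≫ hV.fromSpec = hW.fromSpec ≫ k :=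
      IsAffineOpen.SpecMap_appLE_fromSpec k hV hW hWV
    rw [hβ, Category.assoc, ← hχ, ← Category.assoc, ← Spec.map_comp, cancel_mono] at hn
    exact (congr_arg CommRingCat.Hom.hom (Spec.map_injective hn)).symm

theorem flat_of_fromSpec_comp_eq {Y : Scheme.{u}} {A : Type u} [CommRing A] {y : Y ⟶ Spec (.of A)}
    [Flat y] {W : Y.Opens} (hW : IsAffineOpen W) {ψ : A →+* Γ(Y, W)}
    (hψ : hW.fromSpec ≫ y = Spec.map (CommRingCat.ofHom ψ)) : ψ.Flat := by
  have : Flat (Spec.map (CommRingCat.ofHom ψ)) := by rw [← hψ]; infer_instance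
  rwa [HasRingHomProperty.Spec_iff (P := @Flat)] at this

/-- The ratios in the two charts are inverse to each other. -/
theorem ratio_mul_ratio_of_chart (H : IsBlowupPair I hU u v p q)
    {h : Spec (.of (BlowupRing u v p q)) ⟶ X'} (hh : h ≫ b = blowupChart hU u v p q)
    {V : X'.Opens} (hV : IsAffineOpen V) (e : V ≤ b ⁻¹ᵁ U)
    (φ : BlowupRing v u q p →+* Γ(X', V))
    (hφ : ∀ a, φ (BlowupRing.of v u q p a) = (b.appLE U V e).hom a)
    {B : Type u} [CommRing B] [IsLocalRing B] (m : BlowupRing u v p q →+* B)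
    (n : Γ(X', V) →+* B) (hmn : Spec.map (CommRingCat.ofHom m) ≫ h =
      Spec.map (CommRingCat.ofHom n) ≫ hV.fromSpec) :
    m (BlowupRing.ratio u v p q) * n (φ (BlowupRing.ratio v u q p)) = 1 := by
  have hw : h ((Spec.map (CommRingCat.ofHom m)) (IsLocalRing.closedPoint B)) ∈ V := by
    have h1 : (Spec.map (CommRingCat.ofHom m) ≫ h) (IsLocalRing.closedPoint B) ∈
        Set.range hV.fromSpec := by
      rw [hmn]
      exact ⟨_, rfl⟩
    rwa [hV.range_fromSpec] at h1
  -- The element u may become a zero-divisor in `B`, so the identity is proved on an affine open of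
  -- the chart, which is flat over the chart, and then pushed to `B`.
  obtain ⟨W, hW, hwW, hWV⟩ := exists_isAffineOpen_mem_and_subset (U := h ⁻¹ᵁ V) hw
  obtain ⟨ψ, hψ, h3⟩ := ratio_mul_ratio_of_comp_eq ((Category.id_comp _).trans hh.symm) e φ hφ
    hW hWV
  obtain ⟨β, rfl, rfl⟩ := exists_comp_of_factor hV hW hWV hψ
    (range_subset_of_closedPoint_mem W _ hwW) (Category.comp_id _) hmn
  have h4 := h3 (map_mem_nonZeroDivisors_of_flat (flat_of_fromSpec_comp_eq hW hψ) H.left)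
  rw [RingHom.comp_apply, RingHom.comp_apply, ← map_mul, h4, map_one]

theorem eq_comp_of_chart (H : IsBlowupPair I hU u v p q) (hb : IsBlowup b I)
    {h : Spec (.of (BlowupRing u v p q)) ⟶ X'} (hh : h ≫ b = blowupChart hU u v p q)
    {V : X'.Opens} (hV : IsAffineOpen V) (e : V ≤ b ⁻¹ᵁ U)
    (φ : BlowupRing u v p q →+* Γ(X', V))
    (hφ : ∀ a, φ (BlowupRing.of u v p q a) = (b.appLE U V e).hom a)
    {B : Type u} [CommRing B] (m : BlowupRing u v p q →+* B)
    (n : Γ(X', V) →+* B) (hmn : Spec.map (CommRingCat.ofHom m) ≫ h =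
      Spec.map (CommRingCat.ofHom n) ≫ hV.fromSpec) : m = n.comp φ := by
  have h1 := comp_SpecMap_eq H hb hh hV e φ hφ (Spec.map (CommRingCat.ofHom m))
    (Spec.map (CommRingCat.ofHom n)) hmn
  have h2 : Spec.map (CommRingCat.ofHom (n.comp φ)) = Spec.map (CommRingCat.ofHom m) := by
    rw [← h1, CommRingCat.ofHom_comp, Spec.map_comp]
  exact (congr_arg CommRingCat.Hom.hom (Spec.map_injective h2)).symm

theorem ratio_mul_ratio (H : IsBlowupPair I hU u v p q) (hb : IsBlowup b I)
    {h₁ : Spec (.of (BlowupRing u v p q)) ⟶ X'} (hh₁ : h₁ ≫ b = blowupChart hU u v p q)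
    {h₂ : Spec (.of (BlowupRing v u q p)) ⟶ X'} (hh₂ : h₂ ≫ b = blowupChart hU v u q p)
    {B : Type u} [CommRing B] [IsLocalRing B] (m₁ : BlowupRing u v p q →+* B)
    (m₂ : BlowupRing v u q p →+* B)
    (h : Spec.map (CommRingCat.ofHom m₁) ≫ h₁ = Spec.map (CommRingCat.ofHom m₂) ≫ h₂) :
    m₁ (BlowupRing.ratio u v p q) * m₂ (BlowupRing.ratio v u q p) = 1 := by
  have hl : (Spec.map (CommRingCat.ofHom m₁) ≫ h₁) ≫ b =
      Spec.map (CommRingCat.ofHom (m₁.comp (BlowupRing.of u v p q))) ≫ hU.fromSpec := by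
    rw [Category.assoc, hh₁, SpecMap_comp_blowupChart]
  have hx : b ((Spec.map (CommRingCat.ofHom m₁) ≫ h₁) (IsLocalRing.closedPoint B)) ∈ U := by
    have h1 : ((Spec.map (CommRingCat.ofHom m₁) ≫ h₁) ≫ b) (IsLocalRing.closedPoint B) ∈
        Set.range hU.fromSpec := by
      rw [hl]
      exact ⟨_, rfl⟩
    rwa [hU.range_fromSpec] at h1
  obtain ⟨V, hV, e, hxV, hφ⟩ := H.exists_ringHom hb _ hx
  obtain ⟨n, hn⟩ := exists_eq_SpecMap_fromSpec hV _ (range_subset_of_closedPoint_mem V _ hxV)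
  rcases hφ with ⟨φ, hφ⟩ | ⟨φ, hφ⟩
  · rw [eq_comp_of_chart H hb hh₁ hV e φ hφ m₁ n hn, mul_comm]
    exact H.swap.ratio_mul_ratio_of_chart hh₂ hV e φ hφ m₂ n (h.symm.trans hn)
  · rw [eq_comp_of_chart H.swap hb hh₂ hV e φ hφ m₂ n (h.symm.trans hn)]
    exact H.ratio_mul_ratio_of_chart hh₁ hV e φ hφ m₁ n hn

/-- Near the point the blow-up maps to the same chart, through which both homomorphisms factor, or
to the other one, where both ratios are inverse to the same element. -/
theorem ringHom_eq (H : IsBlowupPair I hU u v p q) (hb : IsBlowup b I)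
    {h₁ : Spec (.of (BlowupRing u v p q)) ⟶ X'} (hh₁ : h₁ ≫ b = blowupChart hU u v p q)
    {B : Type u} [CommRing B] [IsLocalRing B] (m m' : BlowupRing u v p q →+* B)
    (h : Spec.map (CommRingCat.ofHom m) ≫ h₁ = Spec.map (CommRingCat.ofHom m') ≫ h₁) :
    m = m' := by
  have hl : (Spec.map (CommRingCat.ofHom m) ≫ h₁) ≫ b =
      Spec.map (CommRingCat.ofHom (m.comp (BlowupRing.of u v p q))) ≫ hU.fromSpec := by
    rw [Category.assoc, hh₁, SpecMap_comp_blowupChart]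
  have hof : ∀ x, m (BlowupRing.of u v p q x) = m' (BlowupRing.of u v p q x) :=
    fun x ↦ (comp_apply_of_comp_eq hh₁ hl h.symm x).symm
  obtain ⟨h₂, hh₂, -⟩ := H.swap.existsUnique_lift hb
  rcases H.exists_factor hb hh₁ hh₂ _ _ hl with ⟨n, hn⟩ | ⟨n, hn⟩
  · have hx : b ((Spec.map (CommRingCat.ofHom m) ≫ h₁) (IsLocalRing.closedPoint B)) ∈ U := by
      have h1 : ((Spec.map (CommRingCat.ofHom m) ≫ h₁) ≫ b) (IsLocalRing.closedPoint B) ∈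
          Set.range hU.fromSpec := by
        rw [hl]
        exact ⟨_, rfl⟩
      rwa [hU.range_fromSpec] at h1
    obtain ⟨V, hV, e, hxV, hφ⟩ := H.exists_ringHom hb _ hx
    obtain ⟨n, hn⟩ := exists_eq_SpecMap_fromSpec hV _ (range_subset_of_closedPoint_mem V _ hxV)
    rcases hφ with ⟨φ, hφ⟩ | ⟨φ, hφ⟩
    · rw [eq_comp_of_chart H hb hh₁ hV e φ hφ m n hn,
        eq_comp_of_chart H hb hh₁ hV e φ hφ m' n (h.symm.trans hn)]
    · have e1 := H.ratio_mul_ratio_of_chart hh₁ hV e φ hφ m n hn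
      have e2 := H.ratio_mul_ratio_of_chart hh₁ hV e φ hφ m' n (h.symm.trans hn)
      exact BlowupRing.hom_ext hof (left_inv_eq_right_inv e1 ((mul_comm _ _).trans e2))
  · have e1 := H.ratio_mul_ratio hb hh₁ hh₂ m n hn.symm
    have e2 := H.ratio_mul_ratio hb hh₁ hh₂ m' n (hn.trans h).symm
    exact BlowupRing.hom_ext hof (left_inv_eq_right_inv e1 ((mul_comm _ _).trans e2))

end IsBlowupPair

end BlowupProper

end SemistableProduct

namespace SemistableProduct

/-- A property of morphisms that is local on the source can be tested on affine opens
around each point of the source. -/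
theorem of_forall_exists_appLE (P : MorphismProperty Scheme.{u})
    {Q : ∀ {R S : Type u} [CommRing R] [CommRing S], (R →+* S) → Prop} [HasRingHomProperty P Q]
    [P.IsStableUnderComposition] (hP : ∀ {X Y : Scheme.{u}} (f : X ⟶ Y) [IsOpenImmersion f], P f)
    {X Y : Scheme.{u}} (f : X ⟶ Y)
    (H : ∀ x : X, ∃ (U : Y.Opens) (_ : IsAffineOpen U) (V : X.Opens) (_ : IsAffineOpen V)
      (e : V ≤ f ⁻¹ᵁ U), x ∈ V ∧ Q (f.appLE U V e).hom) : P f := by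
  choose U hU V hV e hx hQ using H
  have htop : ⨆ x, V x = ⊤ := top_le_iff.mp fun x _ ↦ Opens.mem_iSup.mpr ⟨x, hx x⟩
  rw [IsZariskiLocalAtSource.iff_of_iSup_eq_top (P := P) V htop]
  intro x
  have h6 : (hV x).isoSpec.hom ≫ (hV x).fromSpec = (V x).ι := (hV x).isoSpec_hom_fromSpec
  rw [← h6, Category.assoc, ← IsAffineOpen.SpecMap_appLE_fromSpec f (hU x) (hV x) (e x)]
  exact P.comp_mem _ _ (hP _) (P.comp_mem _ _ (HasRingHomProperty.Spec_iff.mpr (hQ x)) (hP _))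

/-! ### Properness of the blow-up. -/

section BlowupProper

variable {X : Scheme.{u}}

/-- Locally `I` is generated by two sections, and the charts of its blow-up have the expected
coordinate rings. -/
def HasBlowupPairs (I : X.IdealSheafData) : Prop :=
  ∀ x : X, ∃ (U : X.Opens) (hU : IsAffineOpen U) (u v p q : Γ(X, U)), x ∈ U ∧
    IsBlowupPair I hU u v p q

variable {I : X.IdealSheafData} {X' : Scheme.{u}} {b : X' ⟶ X}

namespace IsBlowupPair

variable {U : X.Opens} {hU : IsAffineOpen U} {u v p q : Γ(X, U)}

theorem appLE_finitePresentation (H : IsBlowupPair I hU u v p q) (hb : IsBlowup b I) (x : X')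
    (hx : b x ∈ U) : ∃ (V : X'.Opens) (_ : IsAffineOpen V) (e : V ≤ b ⁻¹ᵁ U), x ∈ V ∧
      (b.appLE U V e).hom.FinitePresentation := by
  obtain ⟨V, hV, e, hxV, hφ⟩ := H.exists_ringHom hb x hx
  refine ⟨V, hV, e, hxV, ?_⟩
  have key : ∀ {u v p q : Γ(X, U)} (_ : IsBlowupPair I hU u v p q)
      (φ : BlowupRing u v p q →+* Γ(X', V)),
      (∀ a, φ (BlowupRing.of u v p q a) = (b.appLE U V e).hom a) →
      (b.appLE U V e).hom.FinitePresentation := by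
    intro u v p q H φ hφ
    obtain ⟨h, hh, -⟩ := H.existsUnique_lift hb
    have h1 := (finitePresentation_of_smooth (smooth_ringHom H hb hh hV e φ hφ)).comp
      (BlowupRing.finitePresentation_of (u := u) (v := v) (p := p) (q := q))
    rwa [show φ.comp (BlowupRing.of u v p q) = (b.appLE U V e).hom from RingHom.ext hφ] at h1
  rcases hφ with ⟨φ, hφ⟩ | ⟨φ, hφ⟩
  · exact key H φ hφ
  · exact key H.swap φ hφ

/-- The preimage is the union of the images of the two affine charts. -/
theorem isCompact_preimage (H : IsBlowupPair I hU u v p q) (hb : IsBlowup b I) :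
    IsCompact (b ⁻¹ᵁ U : Set X') := by
  obtain ⟨h₁, hh₁, -⟩ := H.existsUnique_lift hb
  obtain ⟨h₂, hh₂, -⟩ := H.swap.existsUnique_lift hb
  have h1 : IsCompact (Set.range h₁) := isCompact_range h₁.continuous
  have h2 : IsCompact (Set.range h₂) := isCompact_range h₂.continuous
  convert! h1.union h2
  apply Set.Subset.antisymm
  · intro x hx
    obtain ⟨V, hV, e, hxV, hφ⟩ := H.exists_ringHom hb x hx
    have hx' : x ∈ Set.range hV.fromSpec := by rwa [hV.range_fromSpec]
    obtain ⟨y, hy⟩ := hx'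
    rcases hφ with ⟨φ, hφ⟩ | ⟨φ, hφ⟩
    · rw [← SpecMap_comp_lift hb hh₁ hV e φ hφ] at hy
      exact Or.inl ⟨_, hy⟩
    · rw [← SpecMap_comp_lift hb hh₂ hV e φ hφ] at hy
      exact Or.inr ⟨_, hy⟩
  · have key : ∀ {A : Type u} [CommRing A] (h : Spec (.of A) ⟶ X'),
        Set.range (h ≫ b) ⊆ U → Set.range h ⊆ (b ⁻¹ᵁ U : Set X') := by
      rintro A _ h hr _ ⟨x, rfl⟩
      exact hr ⟨x, rfl⟩
    exact Set.union_subset (key h₁ (hh₁ ▸ range_blowupChart_subset))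
      (key h₂ (hh₂ ▸ range_blowupChart_subset))

/-- The ratio or its inverse lies in the valuation ring; in the second case the point is moved to
the other chart. -/
theorem exists_valuative_lift (H : IsBlowupPair I hU u v p q) (hb : IsBlowup b I)
    {h₁ : Spec (.of (BlowupRing u v p q)) ⟶ X'} (hh₁ : h₁ ≫ b = blowupChart hU u v p q)
    {h₂ : Spec (.of (BlowupRing v u q p)) ⟶ X'} (hh₂ : h₂ ≫ b = blowupChart hU v u q p)
    {O K : Type u} [CommRing O] [IsDomain O] [ValuationRing O] [Field K] [Algebra O K]
    [IsFractionRing O K] (a : Γ(X, U) →+* O) (m : BlowupRing u v p q →+* K)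
    (hm : ∀ x, m (BlowupRing.of u v p q x) = algebraMap O K (a x)) :
    ∃ l : Spec (.of O) ⟶ X', Spec.map (CommRingCat.ofHom (algebraMap O K)) ≫ l =
      Spec.map (CommRingCat.ofHom m) ≫ h₁ ∧
      l ≫ b = Spec.map (CommRingCat.ofHom a) ≫ hU.fromSpec := by
  have hinj := IsFractionRing.injective O K
  have key : ∀ {u v p q : Γ(X, U)} {h : Spec (.of (BlowupRing u v p q)) ⟶ X'}
      (_ : h ≫ b = blowupChart hU u v p q) (m : BlowupRing u v p q →+* K)
      (_ : ∀ x, m (BlowupRing.of u v p q x) = algebraMap O K (a x)) (r : O)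
      (_ : algebraMap O K r = m (BlowupRing.ratio u v p q)),
      ∃ l : Spec (.of O) ⟶ X', Spec.map (CommRingCat.ofHom (algebraMap O K)) ≫ l =
        Spec.map (CommRingCat.ofHom m) ≫ h ∧
        l ≫ b = Spec.map (CommRingCat.ofHom a) ≫ hU.fromSpec := by
    intro u v p q h hh m hm r hr
    obtain ⟨φ, hφ, hφ'⟩ := BlowupRing.exists_lift (u := u) (v := v) (p := p) (q := q) a r
      (hinj (by rw [map_mul, hr, ← hm, ← hm, ← map_mul, BlowupRing.of_mul_ratio]))
      (hinj (by rw [map_mul, hr, ← hm, ← hm, ← map_mul, BlowupRing.of_eq_ratio_mul]))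
    have h1 : (algebraMap O K).comp φ = m :=
      BlowupRing.hom_ext (fun x ↦ by rw [RingHom.comp_apply, hφ, hm])
        (by rw [RingHom.comp_apply, hφ', hr])
    refine ⟨Spec.map (CommRingCat.ofHom φ) ≫ h, ?_, ?_⟩
    · rw [← Category.assoc, ← Spec.map_comp, ← CommRingCat.ofHom_comp, h1]
    · rw [Category.assoc, hh, SpecMap_comp_blowupChart,
        show φ.comp (BlowupRing.of u v p q) = a from RingHom.ext hφ]
  rcases ValuationRing.isInteger_or_isInteger O (m (BlowupRing.ratio u v p q)) with
    ⟨r, hr⟩ | ⟨r, hr⟩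
  · exact key hh₁ m hm r hr
  -- A zero ratio has inverse 0 by convention, and no change of chart is possible; but then the
  -- ratio is integral anyway.
  · by_cases h0 : m (BlowupRing.ratio u v p q) = 0
    · exact key hh₁ m hm 0 (by rw [h0, map_zero])
    · obtain ⟨m', h1, h2⟩ := H.exists_swap_of_isUnit hb hh₁ hh₂ m (mul_inv_cancel₀ h0)
      rw [← h2]
      refine key hh₂ m' (fun x ↦ ?_) r (hr.trans h1.symm)
      rw [← hm]
      have hl : (Spec.map (CommRingCat.ofHom m) ≫ h₁) ≫ b =
          Spec.map (CommRingCat.ofHom (m.comp (BlowupRing.of u v p q))) ≫ hU.fromSpec := by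
        rw [Category.assoc, hh₁, SpecMap_comp_blowupChart]
      exact comp_apply_of_comp_eq hh₂ hl h2 x

/-- Two lifts in one chart agree because they agree in `K`. For lifts in different charts the ratios
are inverse to each other in `K`, hence in `O`, so one of them can be moved to the chart of the
other. -/
theorem eq_of_valuative (H : IsBlowupPair I hU u v p q) (hb : IsBlowup b I)
    {O K : Type u} [CommRing O] [IsDomain O] [IsLocalRing O] [Field K] [Algebra O K]
    [IsFractionRing O K] (a : Γ(X, U) →+* O) {l l' : Spec (.of O) ⟶ X'}
    (hl : l ≫ b = Spec.map (CommRingCat.ofHom a) ≫ hU.fromSpec)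
    (hl' : l' ≫ b = Spec.map (CommRingCat.ofHom a) ≫ hU.fromSpec)
    (h : Spec.map (CommRingCat.ofHom (algebraMap O K)) ≫ l =
      Spec.map (CommRingCat.ofHom (algebraMap O K)) ≫ l') : l = l' := by
  have hinj := IsFractionRing.injective O K
  obtain ⟨h₁, hh₁, -⟩ := H.existsUnique_lift hb
  obtain ⟨h₂, hh₂, -⟩ := H.swap.existsUnique_lift hb
  have same : ∀ {u v p q : Γ(X, U)} (_ : IsBlowupPair I hU u v p q)
      {h₁ : Spec (.of (BlowupRing u v p q)) ⟶ X'} (_ : h₁ ≫ b = blowupChart hU u v p q)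
      (m m' : BlowupRing u v p q →+* O) (_ : Spec.map (CommRingCat.ofHom m) ≫ h₁ = l)
      (_ : Spec.map (CommRingCat.ofHom m') ≫ h₁ = l'), l = l' := by
    rintro u v p q H h₁ hh₁ m m' rfl rfl
    have h3 := H.ringHom_eq hb hh₁ ((algebraMap O K).comp m) ((algebraMap O K).comp m') (by
      rw [CommRingCat.ofHom_comp, CommRingCat.ofHom_comp, Spec.map_comp, Spec.map_comp,
        Category.assoc, Category.assoc, h])
    rw [RingHom.ext fun x ↦ hinj (RingHom.congr_fun h3 x)]
  have mixed : ∀ {u v p q : Γ(X, U)} (_ : IsBlowupPair I hU u v p q)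
      {h₁ : Spec (.of (BlowupRing u v p q)) ⟶ X'} (_ : h₁ ≫ b = blowupChart hU u v p q)
      {h₂ : Spec (.of (BlowupRing v u q p)) ⟶ X'} (_ : h₂ ≫ b = blowupChart hU v u q p)
      {l l' : Spec (.of O) ⟶ X'}
      (_ : l' ≫ b = Spec.map (CommRingCat.ofHom a) ≫ hU.fromSpec)
      (_ : l ≫ b = Spec.map (CommRingCat.ofHom a) ≫ hU.fromSpec)
      (_ : Spec.map (CommRingCat.ofHom (algebraMap O K)) ≫ l =
        Spec.map (CommRingCat.ofHom (algebraMap O K)) ≫ l')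
      (m : BlowupRing u v p q →+* O) (m' : BlowupRing v u q p →+* O)
      (_ : Spec.map (CommRingCat.ofHom m) ≫ h₁ = l)
      (_ : Spec.map (CommRingCat.ofHom m') ≫ h₂ = l'), l = l' := by
    intro u v p q H h₁ hh₁ h₂ hh₂ l l' hl' hl h m m' hm hm'
    have h3 := H.ratio_mul_ratio hb hh₁ hh₂ ((algebraMap O K).comp m)
      ((algebraMap O K).comp m') (by
        rw [CommRingCat.ofHom_comp, CommRingCat.ofHom_comp, Spec.map_comp, Spec.map_comp,
          Category.assoc, Category.assoc, hm, hm', h])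
    rw [RingHom.comp_apply, RingHom.comp_apply, ← map_mul, ← map_one (algebraMap O K)] at h3
    obtain ⟨n, hn, hn'⟩ := H.exists_swap_of_isUnit hb hh₁ hh₂ m (hinj h3)
    have h4 : n = m' := BlowupRing.hom_ext (fun x ↦ by
      rw [comp_apply_of_comp_eq hh₂ hl' hm' x, comp_apply_of_comp_eq hh₂ hl (hn'.trans hm) x]) hn
    rw [← hm, ← hm', ← hn', h4]
  rcases H.exists_factor hb hh₁ hh₂ l a hl with ⟨m, hm⟩ | ⟨m, hm⟩ <;>
  rcases H.exists_factor hb hh₁ hh₂ l' a hl' with ⟨m', hm'⟩ | ⟨m', hm'⟩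
  · exact same H hh₁ m m' hm hm'
  · exact mixed H hh₁ hh₂ hl' hl h m m' hm hm'
  · exact (mixed H hh₁ hh₂ hl hl' h.symm m' m hm' hm).symm
  · exact same H.swap hh₂ m m' hm hm'

end IsBlowupPair

namespace HasBlowupPairs

theorem locallyOfFiniteType (H : HasBlowupPairs I) (hb : IsBlowup b I) :
    LocallyOfFiniteType b := by
  refine of_forall_exists_appLE @LocallyOfFiniteType (fun f _ ↦ inferInstance) b fun x ↦ ?_
  obtain ⟨U, hU, u, v, p, q, hx, H'⟩ := H (b x)
  obtain ⟨V, hV, e, hxV, h⟩ := H'.appLE_finitePresentation hb x hx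
  exact ⟨U, hU, V, hV, e, hxV, RingHom.FiniteType.of_finitePresentation h⟩

theorem compactSpace [CompactSpace X] (H : HasBlowupPairs I) (hb : IsBlowup b I) :
    CompactSpace X' := by
  choose U hU u v p q hx H' using H
  obtain ⟨s, hs⟩ := CompactSpace.elim_nhds_subcover (fun x ↦ (U x : Set X))
    fun x ↦ (U x).2.mem_nhds (hx x)
  refine ⟨?_⟩
  have h1 : (Set.univ : Set X') = ⋃ x ∈ s, (b ⁻¹ᵁ (U x) : Set X') := by
    refine (Set.eq_univ_of_forall fun y ↦ ?_).symm
    have : b y ∈ ⋃ x ∈ s, (U x : Set X) := hs ▸ trivial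
    simpa using this
  rw [h1]
  exact s.isCompact_biUnion fun x _ ↦ (H' x).isCompact_preimage hb

theorem valuativeCriterion (H : HasBlowupPairs I) (hb : IsBlowup b I) :
    ValuativeCriterion b := by
  rw [ValuativeCriterion.iff]
  have key : ∀ {O : Type u} [CommRing O] [IsLocalRing O] (i : Spec (.of O) ⟶ X),
      ∃ (U : X.Opens) (hU : IsAffineOpen U) (u v p q : Γ(X, U)) (a : Γ(X, U) →+* O),
        IsBlowupPair I hU u v p q ∧ i = Spec.map (CommRingCat.ofHom a) ≫ hU.fromSpec := by
    intro O _ _ i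
    obtain ⟨U, hU, u, v, p, q, hx, H'⟩ := H (i (IsLocalRing.closedPoint O))
    obtain ⟨a, ha⟩ := exists_eq_SpecMap_fromSpec hU i (range_subset_of_closedPoint_mem U i hx)
    exact ⟨U, hU, u, v, p, q, a, H', ha⟩
  refine ⟨fun S ↦ ?_, fun S ↦ ⟨fun l l' ↦ ?_⟩⟩
  · obtain ⟨U, hU, u, v, p, q, a, H', ha⟩ := key S.i₂
    have hw := S.commSq.w
    rw [ha, ← Category.assoc, ← Spec.map_comp, ← CommRingCat.ofHom_comp] at hw
    obtain ⟨h₁, hh₁, -⟩ := H'.existsUnique_lift hb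
    obtain ⟨h₂, hh₂, -⟩ := H'.swap.existsUnique_lift hb
    rcases H'.exists_factor hb hh₁ hh₂ S.i₁ _ hw with ⟨m, hm⟩ | ⟨m, hm⟩
    · obtain ⟨l, hl, hl'⟩ := H'.exists_valuative_lift hb hh₁ hh₂ a m
        (IsBlowupPair.comp_apply_of_comp_eq hh₁ hw hm)
      exact ⟨⟨l, hl.trans hm, hl'.trans ha.symm⟩⟩
    · obtain ⟨l, hl, hl'⟩ := H'.swap.exists_valuative_lift hb hh₂ hh₁ a m
        (IsBlowupPair.comp_apply_of_comp_eq hh₂ hw hm)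
      exact ⟨⟨l, hl.trans hm, hl'.trans ha.symm⟩⟩
  · obtain ⟨U, hU, u, v, p, q, a, H', ha⟩ := key S.i₂
    ext1
    exact H'.eq_of_valuative (K := S.K) hb a (l.fac_right.trans ha) (l'.fac_right.trans ha)
      (l.fac_left.trans l'.fac_left.symm)

theorem isProper [CompactSpace X] [IsLocallyNoetherian X] (H : HasBlowupPairs I)
    (hb : IsBlowup b I) : IsProper b := by
  have := H.locallyOfFiniteType hb
  have := H.compactSpace hb
  have : IsLocallyNoetherian X' := LocallyOfFiniteType.isLocallyNoetherian b
  have : QuasiSeparatedSpace X' := inferInstance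
  have : QuasiSeparatedSpace X := inferInstance
  exact IsProper.of_valuativeCriterion b (H.valuativeCriterion hb)

end HasBlowupPairs

end BlowupProper

end SemistableProduct

namespace SemistableProduct

open IsLocalRing

/-! ### Structure maps on sections. -/

section SectionMap

variable {R : Type u} [CommRing R]

theorem le_preimage_top {X Y : Scheme.{u}} (f : X ⟶ Y) (U : X.Opens) : U ≤ f ⁻¹ᵁ ⊤ :=
  fun _ _ ↦ trivial

/-- The structure map `R → Γ(X, U)` of an `R`-scheme. -/
noncomputable def sectionMap {X : Scheme.{u}} (f : X ⟶ Spec (.of R)) (U : X.Opens) :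
    R →+* Γ(X, U) :=
  ((Scheme.ΓSpecIso (.of R)).inv ≫ f.appLE ⊤ U (le_preimage_top f U)).hom

theorem appLE_comp_sectionMap {X X' : Scheme.{u}} (f : X ⟶ Spec (.of R)) (b : X' ⟶ X)
    {U : X.Opens} {V : X'.Opens} (e : V ≤ b ⁻¹ᵁ U) :
    (b.appLE U V e).hom.comp (sectionMap f U) = sectionMap (b ≫ f) V := by
  rw [sectionMap, sectionMap, ← CommRingCat.hom_comp, Category.assoc,
    Scheme.Hom.appLE_comp_appLE]

theorem map_comp_sectionMap {X : Scheme.{u}} (f : X ⟶ Spec (.of R)) {U V : X.Opens} (h : V ≤ U) :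
    (X.presheaf.map (homOfLE h).op).hom.comp (sectionMap f U) = sectionMap f V := by
  rw [sectionMap, sectionMap, ← CommRingCat.hom_comp, Category.assoc, Scheme.Hom.appLE_map]

theorem toStalk_eq_germ {X : Scheme.{u}} (f : X ⟶ Spec (.of R)) {U : X.Opens} (x : X)
    (hx : x ∈ U) (r : R) : toStalk f x r = X.presheaf.germ U x hx (sectionMap f U r) := by
  have h : (Scheme.ΓSpecIso (.of R)).inv ≫ f.appTop ≫ X.presheaf.germ ⊤ x trivial =
      ((Scheme.ΓSpecIso (.of R)).inv ≫ f.appLE ⊤ U (le_preimage_top f U)) ≫ X.presheaf.germ U x hx := by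
    rw [Category.assoc]
    congr 1
    rw [Scheme.Hom.appLE, Category.assoc, TopCat.Presheaf.germ_res]
    rfl
  exact congr_arg (fun φ ↦ φ.hom r) h

theorem SpecMap_sectionMap {X : Scheme.{u}} (f : X ⟶ Spec (.of R)) {U : X.Opens}
    (hU : IsAffineOpen U) :
    Spec.map (CommRingCat.ofHom (sectionMap f U)) = hU.fromSpec ≫ f := by
  have h1 := IsAffineOpen.SpecMap_appLE_fromSpec f (isAffineOpen_top (Spec (.of R))) hU (le_preimage_top f U)
  rw [← h1, sectionMap, CommRingCat.ofHom_hom, Spec.map_comp]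
  congr 1
  rw [IsAffineOpen.fromSpec_top, Scheme.isoSpec_Spec_inv]

end SectionMap

/-! ### Zero loci and vanishing ideals. -/

section ZeroLocus

variable {X : Scheme.{u}}

theorem mem_zeroLocus_pair {U : X.Opens} {a b : Γ(X, U)} {x : X} :
    x ∈ X.zeroLocus {a, b} ↔ x ∉ X.basicOpen a ∧ x ∉ X.basicOpen b := by
  simp [Scheme.mem_zeroLocus_iff]

theorem mem_basicOpen_appLE {X' : Scheme.{u}} (b : X' ⟶ X) {U : X.Opens} {V : X'.Opens}
    (e : V ≤ b ⁻¹ᵁ U) (a : Γ(X, U)) {x : X'} (hx : x ∈ V) :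
    x ∈ X'.basicOpen ((b.appLE U V e).hom a) ↔ b x ∈ X.basicOpen a := by
  have := Scheme.basicOpen_appLE b V U e a
  rw [this]
  exact ⟨fun h ↦ h.2, fun h ↦ ⟨hx, h⟩⟩

theorem vanishingIdeal_ideal_eq {Z : Closeds X} {U : X.Opens} (hU : IsAffineOpen U)
    {J : Ideal Γ(X, U)} (hJ : J.IsRadical)
    (h : (Z : Set X) ∩ U = X.zeroLocus (U := U) (J : Set Γ(X, U)) ∩ U) :
    (Scheme.IdealSheafData.vanishingIdeal Z).ideal ⟨U, hU⟩ = J := by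
  rw [Scheme.IdealSheafData.vanishingIdeal_ideal]
  have h1 : hU.fromSpec ⁻¹' (Z : Set X) = PrimeSpectrum.zeroLocus (J : Set Γ(X, U)) := by
    rw [← hU.fromSpec_preimage_zeroLocus]
    have h2 : ∀ s : Set X, hU.fromSpec ⁻¹' s = hU.fromSpec ⁻¹' (s ∩ U) := by
      intro s
      rw [← hU.range_fromSpec, Set.preimage_inter_range]
    rw [h2 Z, h2 (X.zeroLocus _), h]
  refine (congr_arg PrimeSpectrum.vanishingIdeal h1).trans ?_
  rw [PrimeSpectrum.vanishingIdeal_zeroLocus_eq_radical, hJ.radical]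

theorem vanishingIdeal_ideal_eq_top {Z : Closeds X} {U : X.Opens} (hU : IsAffineOpen U)
    (h : (Z : Set X) ∩ U = ∅) :
    (Scheme.IdealSheafData.vanishingIdeal Z).ideal ⟨U, hU⟩ = ⊤ := by
  refine vanishingIdeal_ideal_eq hU (fun _ _ ↦ trivial) ?_
  rw [h]
  refine (Set.eq_empty_of_forall_notMem fun x hx ↦ ?_).symm
  have := (X.mem_zeroLocus_iff _ _).mp hx.1 1 trivial
  rw [Scheme.basicOpen_of_isUnit _ isUnit_one] at this
  exact this hx.2

/-- Minimal primes of A/J consist of zero-divisors, so `w` avoids them and the generic points of the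
zero locus lie in the open set where `w` is invertible. -/
theorem zeroLocus_subset_closure {A : Type u} [CommRing A] {J : Ideal A} {w : A}
    (hw : Ideal.Quotient.mk J w ∈ nonZeroDivisors (A ⧸ J)) :
    PrimeSpectrum.zeroLocus (J : Set A) ⊆
      closure (PrimeSpectrum.zeroLocus (J : Set A) ∩ PrimeSpectrum.basicOpen w) := by
  intro x hx
  obtain ⟨q, hq, hqx⟩ := Ideal.exists_minimalPrimes_le (I := J) (J := x.asIdeal) hx
  have hqp : q.IsPrime := hq.1.1
  have hwq : w ∉ q := by
    intro hwq
    have h1 : q.map (Ideal.Quotient.mk J) ∈ minimalPrimes (A ⧸ J) := by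
      rw [Ideal.minimalPrimes_eq_comap] at hq
      obtain ⟨q', hq', rfl⟩ := hq
      rwa [Ideal.map_comap_of_surjective _ Ideal.Quotient.mk_surjective]
    exact notMem_nonZeroDivisors_of_mem_mem_minimalPrimes (Ideal.mem_map_of_mem _ hwq) h1 hw
  have h1 : (⟨q, hqp⟩ : PrimeSpectrum A) ∈ PrimeSpectrum.zeroLocus (J : Set A) ∩
      PrimeSpectrum.basicOpen w := ⟨hq.1.2, hwq⟩
  have h2 : (⟨q, hqp⟩ : PrimeSpectrum A) ⤳ x := by
    rw [← PrimeSpectrum.le_iff_specializes]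
    exact hqx
  exact h2.mem_closed isClosed_closure (subset_closure h1)

/-- If `w` is a non-zero-divisor modulo `J`, then the complement of `w = 0` is dense in the
zero locus of `J`. -/
theorem zeroLocus_inter_subset_closure {U : X.Opens} (hU : IsAffineOpen U) {J : Ideal Γ(X, U)}
    {w : Γ(X, U)} (hw : Ideal.Quotient.mk J w ∈ nonZeroDivisors (Γ(X, U) ⧸ J)) :
    X.zeroLocus (U := U) (J : Set Γ(X, U)) ∩ U ⊆
      closure (X.zeroLocus (U := U) (J : Set Γ(X, U)) ∩ X.basicOpen w) := by
  have h1 : hU.fromSpec '' (PrimeSpectrum.zeroLocus (J : Set Γ(X, U)) ∩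
      (PrimeSpectrum.basicOpen w : Set (PrimeSpectrum Γ(X, U)))) ⊆
      X.zeroLocus (U := U) (J : Set Γ(X, U)) ∩ X.basicOpen w := by
    rintro _ ⟨y, ⟨hy1, hy2⟩, rfl⟩
    refine ⟨?_, ?_⟩
    · have : hU.fromSpec y ∈ X.zeroLocus (U := U) (J : Set Γ(X, U)) ∩ U := by
        rw [← hU.fromSpec_image_zeroLocus]
        exact ⟨y, hy1, rfl⟩
      exact this.1
    · have := hU.fromSpec_preimage_basicOpen w
      have h3 : y ∈ hU.fromSpec ⁻¹ᵁ X.basicOpen w := by rw [this]; exact hy2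
      exact h3
  rw [← hU.fromSpec_image_zeroLocus]
  refine (Set.image_mono (zeroLocus_subset_closure hw)).trans ?_
  exact (image_closure_subset_closure_image hU.fromSpec.continuous).trans (closure_mono h1)

end ZeroLocus

/-! ### Strict transforms on open subsets. -/

section StrictTransform

variable {X X' : Scheme.{u}} {b : X' ⟶ X} {Z₀ Z : Closeds X} {V : X'.Opens}

theorem coe_strictTransform : (strictTransform b Z₀ Z : Set X') =
    closure (b ⁻¹' ((Z : Set X) \ (Z₀ : Set X))) := rfl

theorem strictTransform_inter_eq_empty (h : ∀ x ∈ V, b x ∈ Z → b x ∈ Z₀) :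
    (strictTransform b Z₀ Z : Set X') ∩ V = ∅ := by
  rw [coe_strictTransform, Set.inter_comm]
  refine Set.eq_empty_of_subset_empty ?_
  refine (V.2.inter_closure).trans ?_
  rw [show (V.1 : Set X') ∩ b ⁻¹' ((Z : Set X) \ (Z₀ : Set X)) = ∅ from ?_, closure_empty]
  exact Set.eq_empty_of_forall_notMem fun x hx ↦ hx.2.2 (h x hx.1 hx.2.1)

theorem strictTransform_inter_eq {E : Set X'} (hE : IsClosed E)
    (h : ∀ x ∈ V, b x ∈ Z → b x ∉ Z₀ → x ∈ E)
    (h' : E ∩ V ⊆ closure (b ⁻¹' ((Z : Set X) \ (Z₀ : Set X)))) :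
    (strictTransform b Z₀ Z : Set X') ∩ V = E ∩ V := by
  rw [coe_strictTransform]
  refine Set.Subset.antisymm (fun x hx ↦ ⟨?_, hx.2⟩) (fun x hx ↦ ⟨h' hx, hx.2⟩)
  have h1 := V.2.inter_closure ⟨hx.2, hx.1⟩
  refine closure_minimal ?_ hE h1
  rintro y ⟨hy1, hy2⟩
  exact h y hy1 hy2.1 hy2.2

end StrictTransform

end SemistableProduct

namespace SemistableProduct

open IsLocalRing

/-! ### Adapted charts and their blow-ups. -/

section RingLemmas

variable {R : Type u} [CommRing R] {ϖ : R} {A : Type u} [CommRing A] {ρ : R →+* A}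
  {α β γ : Type} [Fintype α] [Fintype β] [Fintype γ] {u : α → A} {v : β → A} {w : γ → A}

theorem IsChart.isRadical_span_pair [IsLocalRing R] [PerfectField (ResidueField R)]
    (H : IsChart ϖ ρ u v w) (hϖ : maximalIdeal R = Ideal.span {ϖ}) (a : α) (b : β) :
    (Ideal.span {u a, v b}).IsRadical := by
  obtain ⟨κ, hκ, -⟩ := H.exists_smooth_quotient_pair hϖ a b
    (δ := Ideal.Quotient.mk (Ideal.span {u a, v b})) Ideal.Quotient.mk_surjective (Ideal.mk_ker)
  exact isRadical_of_smooth_quotient hκ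

theorem smooth_id (A : Type u) [CommRing A] : (RingHom.id A).Smooth := by
  have : Smooth (Spec.map (CommRingCat.ofHom (RingHom.id A))) := by
    rw [show CommRingCat.ofHom (RingHom.id A) = 𝟙 (CommRingCat.of A) from rfl, Spec.map_id]
    infer_instance
  rwa [HasRingHomProperty.Spec_iff (P := @Smooth)] at this

/-- The blow-up ring carries a chart of its own, in which u_a is one of the w and thus divides `ϖ`.
-/
theorem IsChart.left_mem_nonZeroDivisors_blowup [IsDomain R] [IsDiscreteValuationRing R]
    [DecidableEq α] [DecidableEq β]
    (H : IsChart ϖ ρ u v w) (hϖ : Irreducible ϖ) (a : α) (b : β) :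
    BlowupRing.of (u a) (v b) (∏ x : {x // x ≠ a}, u x) (∏ y : {y // y ≠ b}, v y) (u a) ∈
      nonZeroDivisors _ :=
  (H.blowup a b (BlowupRing.of _ _ _ _) (BlowupRing.ratio _ _ _ _) (RingHom.id _) (smooth_id _)
    (fun _ ↦ rfl) rfl).right_mem_nonZeroDivisors hϖ.ne_zero hϖ.maximalIdeal_eq none

end RingLemmas

variable {R : Type u} [CommRing R]

/-- An affine open `U` with coordinates such that the closed subsets in `𝒵` are, on `U`, empty or
loci `u a = v b = 0`, and all such loci that are not empty arise in this way. -/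
structure IsAdaptedChart (ϖ : R) {X : Scheme.{u}} (f : X ⟶ Spec (.of R)) (𝒵 : Set (Closeds X))
    (U : X.Opens) {α β γ : Type} [Fintype α] [Fintype β] [Fintype γ] (u : α → Γ(X, U))
    (v : β → Γ(X, U)) (w : γ → Γ(X, U)) : Prop where
  isAffine : IsAffineOpen U
  -- Keeps a variable that can be eliminated at the end. A blow-up chart loses an index in one
  -- family and none in the other, where it has the index of the centre.
  nonempty : Nonempty α ∨ Nonempty β
  isChart : IsChart ϖ (sectionMap f U) u v w
  inter : ∀ Z ∈ 𝒵, (Z : Set X) ∩ U = ∅ ∨ ∃ a b, (Z : Set X) ∩ U = X.zeroLocus {u a, v b} ∩ U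
  exists_inter : ∀ a b, X.zeroLocus {u a, v b} ∩ U = ∅ ∨
    ∃ Z ∈ 𝒵, (Z : Set X) ∩ U = X.zeroLocus {u a, v b} ∩ U

namespace IsAdaptedChart

variable {ϖ : R} {X : Scheme.{u}} {f : X ⟶ Spec (.of R)} {𝒵 : Set (Closeds X)}
  {U : X.Opens} {α β γ : Type} [Fintype α] [Fintype β] [Fintype γ] {u : α → Γ(X, U)}
  {v : β → Γ(X, U)} {w : γ → Γ(X, U)}

theorem swap (H : IsAdaptedChart ϖ f 𝒵 U u v w) : IsAdaptedChart ϖ f 𝒵 U v u w := by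
  refine ⟨H.isAffine, H.nonempty.symm, H.isChart.swap, fun Z hZ ↦ ?_, fun b a ↦ ?_⟩
  · rcases H.inter Z hZ with h | ⟨a, b, h⟩
    · exact Or.inl h
    · exact Or.inr ⟨b, a, by rw [h, Set.pair_comm]⟩
  · rw [Set.pair_comm]
    exact H.exists_inter a b

section AdaptedChart

variable {X' : Scheme.{u}} {b : X' ⟶ X} {Z₀ : Closeds X} {𝒴 : Set (Closeds X)}

theorem isBlowupPair [IsDomain R] [IsDiscreteValuationRing R] [PerfectField (ResidueField R)]
    [DecidableEq α] [DecidableEq β] (H : IsAdaptedChart ϖ f 𝒵 U u v w) (hϖ : Irreducible ϖ)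
    {a : α} {c : β} (hZ₀ : (Z₀ : Set X) ∩ U = X.zeroLocus {u a, v c} ∩ U) :
    IsBlowupPair (Scheme.IdealSheafData.vanishingIdeal Z₀) H.isAffine (u a) (v c)
      (∏ x : {x // x ≠ a}, u x) (∏ y : {y // y ≠ c}, v y) where
  ideal_eq := vanishingIdeal_ideal_eq _ (H.isChart.isRadical_span_pair hϖ.maximalIdeal_eq a c) (by
    rw [hZ₀, Scheme.zeroLocus_span])
  rel := H.isChart.blowup_relation a c
  left := H.isChart.left_mem_nonZeroDivisors_blowup hϖ a c
  right := H.isChart.swap.left_mem_nonZeroDivisors_blowup hϖ c a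

/-- Away from the centre the ideal is (1, 0): the first chart is the ring itself and the second is
the zero ring. -/
theorem isBlowupPair_of_inter_eq_empty (hU : IsAffineOpen U) (hZ₀ : (Z₀ : Set X) ∩ U = ∅) :
    IsBlowupPair (Scheme.IdealSheafData.vanishingIdeal Z₀) hU 1 0 0 0 where
  ideal_eq := by
    rw [vanishingIdeal_ideal_eq_top hU hZ₀, eq_comm, Ideal.eq_top_iff_one]
    exact Ideal.subset_span (Or.inl rfl)
  rel := by ring
  left := (isUnit_one.map (BlowupRing.of (1 : Γ(X, U)) 0 0 0)).mem_nonZeroDivisors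
  right := by
    have h : (1 : BlowupRing (0 : Γ(X, U)) 1 0 0) = 0 := by
      have h0 := map_zero (BlowupRing.of (0 : Γ(X, U)) 1 0 0)
      have h1 := map_one (BlowupRing.of (0 : Γ(X, U)) 1 0 0)
      exact h1.symm.trans ((BlowupRing.of_mul_ratio (0 : Γ(X, U)) 1 0 0).symm.trans
        ((congrArg (· * BlowupRing.ratio (0 : Γ(X, U)) 1 0 0) h0).trans (zero_mul _)))
    have := subsingleton_of_zero_eq_one h.symm
    rw [mem_nonZeroDivisors_iff_right]
    exact fun _ _ ↦ Subsingleton.elim _ _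

section Chart

variable {V : X'.Opens} (e : V ≤ b ⁻¹ᵁ U)

/-- In this chart v_c = u_a r, so u_a = 0 implies v_c = 0, and everything over u_a = 0 lies over the
centre. -/
theorem strictTransform_inter_eq_empty_of_left {a : α} {c d : β} {Z : Closeds X} {r : Γ(X', V)}
    (hr : (b.appLE U V e).hom (u a) * r = (b.appLE U V e).hom (v c))
    (hZ₀ : (Z₀ : Set X) ∩ U = X.zeroLocus {u a, v c} ∩ U)
    (hZ : (Z : Set X) ∩ U = X.zeroLocus {u a, v d} ∩ U) :
    (strictTransform b Z₀ Z : Set X') ∩ V = ∅ := by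
  refine strictTransform_inter_eq_empty fun x hx hxZ ↦ ?_
  have hxU : b x ∈ U := e hx
  have h1 : b x ∈ X.zeroLocus {u a, v d} ∩ U := hZ ▸ ⟨hxZ, hxU⟩
  have h2 : b x ∈ (Z₀ : Set X) ∩ U := by
    rw [hZ₀]
    refine ⟨mem_zeroLocus_pair.mpr ⟨(mem_zeroLocus_pair.mp h1.1).1, fun h ↦ ?_⟩, hxU⟩
    rw [← mem_basicOpen_appLE b e _ hx, ← hr, Scheme.basicOpen_mul] at h
    exact (mem_zeroLocus_pair.mp h1.1).1 ((mem_basicOpen_appLE b e _ hx).mp h.1)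
  exact h2.1

/-- Where u_a is invertible the new locus is the preimage of the old one and does not meet the
centre, and that part is dense because u_a is a non-zero-divisor modulo the ideal of the new locus.
The new coordinate `v'` is v_d, or the ratio when d is the index of the centre. -/
theorem strictTransform_inter_eq_of_ne {a c : α} {d d' : β} {Z : Closeds X} {v' : Γ(X', V)}
    (hV : IsAffineOpen V) (hv' : v' = (b.appLE U V e).hom (v d) ∨
      d = d' ∧ (b.appLE U V e).hom (u a) * v' = (b.appLE U V e).hom (v d))
    (hnz : Ideal.Quotient.mk (Ideal.span {(b.appLE U V e).hom (u c), v'})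
      ((b.appLE U V e).hom (u a)) ∈ nonZeroDivisors _)
    (hZ₀ : (Z₀ : Set X) ∩ U = X.zeroLocus {u a, v d'} ∩ U)
    (hZ : (Z : Set X) ∩ U = X.zeroLocus {u c, v d} ∩ U) :
    (strictTransform b Z₀ Z : Set X') ∩ V =
      X'.zeroLocus {(b.appLE U V e).hom (u c), v'} ∩ V := by
  have hZ' : ∀ x ∈ V, (b x ∈ (Z : Set X) ↔ b x ∉ X.basicOpen (u c) ∧ b x ∉ X.basicOpen (v d)) := by
    intro x hx
    have h1 : b x ∈ (Z : Set X) ∩ U ↔ b x ∈ X.zeroLocus {u c, v d} ∩ U := by rw [hZ]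
    have hxU : b x ∈ (U : Set X) := e hx
    rw [Set.mem_inter_iff, Set.mem_inter_iff, and_iff_left hxU, and_iff_left hxU,
      mem_zeroLocus_pair] at h1
    exact h1
  have hZ₀' : ∀ x ∈ V, (b x ∈ (Z₀ : Set X) ↔
      b x ∉ X.basicOpen (u a) ∧ b x ∉ X.basicOpen (v d')) := by
    intro x hx
    have h1 : b x ∈ (Z₀ : Set X) ∩ U ↔ b x ∈ X.zeroLocus {u a, v d'} ∩ U := by rw [hZ₀]
    have hxU : b x ∈ (U : Set X) := e hx
    rw [Set.mem_inter_iff, Set.mem_inter_iff, and_iff_left hxU, and_iff_left hxU,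
      mem_zeroLocus_pair] at h1
    exact h1
  refine strictTransform_inter_eq (X'.zeroLocus_isClosed _) (fun x hx hxZ hxZ₀ ↦ ?_) ?_
  · obtain ⟨h1, h2⟩ := (hZ' x hx).mp hxZ
    refine mem_zeroLocus_pair.mpr ⟨fun h ↦ h1 ((mem_basicOpen_appLE b e _ hx).mp h), fun h ↦ ?_⟩
    rcases hv' with rfl | ⟨rfl, hv'⟩
    · exact h2 ((mem_basicOpen_appLE b e _ hx).mp h)
    · have h3 : b x ∈ X.basicOpen (u a) := by
        by_contra h3
        exact hxZ₀ ((hZ₀' x hx).mpr ⟨h3, h2⟩)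
      refine h2 ((mem_basicOpen_appLE b e _ hx).mp ?_)
      rw [← hv', Scheme.basicOpen_mul]
      exact ⟨(mem_basicOpen_appLE b e _ hx).mpr h3, h⟩
  · rw [← Scheme.zeroLocus_span]
    refine (zeroLocus_inter_subset_closure hV hnz).trans (closure_mono ?_)
    rintro x ⟨h1, h2⟩
    have hx : x ∈ V := X'.basicOpen_le _ h2
    rw [Scheme.zeroLocus_span, mem_zeroLocus_pair] at h1
    have h3 := (mem_basicOpen_appLE b e _ hx).mp h2
    refine ⟨(hZ' x hx).mpr ⟨fun h ↦ h1.1 ((mem_basicOpen_appLE b e _ hx).mpr h), fun h ↦ ?_⟩,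
      fun h ↦ ((hZ₀' x hx).mp h).1 h3⟩
    have h4 := (mem_basicOpen_appLE b e _ hx).mpr h
    rcases hv' with rfl | ⟨rfl, hv'⟩
    · exact h1.2 h4
    · rw [← hv', Scheme.basicOpen_mul] at h4
      exact h1.2 h4.2

theorem zeroLocus_inter_eq_empty_of {a c : α} {d : β} {v' : Γ(X', V)}
    (hv' : v' = (b.appLE U V e).hom (v d) ∨
      (b.appLE U V e).hom (u a) * v' = (b.appLE U V e).hom (v d))
    (hZ : X.zeroLocus {u c, v d} ∩ (U : Set X) = ∅) :
    X'.zeroLocus {(b.appLE U V e).hom (u c), v'} ∩ (V : Set X') = ∅ := by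
  refine Set.eq_empty_of_forall_notMem fun x hx ↦ ?_
  have h1 := mem_zeroLocus_pair.mp hx.1
  refine Set.eq_empty_iff_forall_notMem.mp hZ (b x) ⟨mem_zeroLocus_pair.mpr
    ⟨fun h ↦ h1.1 ((mem_basicOpen_appLE b e _ hx.2).mpr h), fun h ↦ h1.2 ?_⟩, e hx.2⟩
  have h2 := (mem_basicOpen_appLE b e _ hx.2).mpr h
  rcases hv' with rfl | hv'
  · exact h2
  · rw [← hv', Scheme.basicOpen_mul] at h2
    exact h2.2

/-- A chart of the blow-up over an adapted chart. -/
theorem blowup [IsDomain R] [IsDiscreteValuationRing R] [PerfectField (ResidueField R)]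
    [DecidableEq α] [DecidableEq β] (H : IsAdaptedChart ϖ f (insert Z₀ 𝒴) U u v w)
    (hϖ : Irreducible ϖ) {a : α} {c : β}
    (hZ₀ : (Z₀ : Set X) ∩ U = X.zeroLocus {u a, v c} ∩ U) (hb : IsBlowupAlong b Z₀)
    (hV : IsAffineOpen V)
    (φ : BlowupRing (u a) (v c) (∏ x : {x // x ≠ a}, u x) (∏ y : {y // y ≠ c}, v y) →+* Γ(X', V))
    (hφ : ∀ x, φ (BlowupRing.of _ _ _ _ x) = (b.appLE U V e).hom x) :
    IsAdaptedChart ϖ (b ≫ f) (strictTransform b Z₀ '' 𝒴) V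
      (fun x : {x // x ≠ a} ↦ (b.appLE U V e).hom (u x))
      (Function.update ((b.appLE U V e).hom ∘ v) c (φ (BlowupRing.ratio _ _ _ _)))
      (fun x : Option γ ↦ x.elim ((b.appLE U V e).hom (u a)) ((b.appLE U V e).hom ∘ w)) := by
  have hpair := H.isBlowupPair hϖ hZ₀
  obtain ⟨l, hl, -⟩ := hpair.existsUnique_lift hb
  have hsmooth := IsBlowupPair.smooth_ringHom hpair hb hl hV e φ hφ
  have hchart := H.isChart.blowup a c (b.appLE U V e).hom (φ (BlowupRing.ratio _ _ _ _)) φ hsmooth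
    hφ rfl
  rw [appLE_comp_sectionMap] at hchart
  have hr : (b.appLE U V e).hom (u a) * φ (BlowupRing.ratio _ _ _ _) =
      (b.appLE U V e).hom (v c) := by
    rw [← hφ, ← hφ, ← map_mul, BlowupRing.of_mul_ratio]
  let v' := Function.update ((b.appLE U V e).hom ∘ v) c (φ (BlowupRing.ratio _ _ _ _))
  have hv' : ∀ d, v' d = (b.appLE U V e).hom (v d) ∨
      d = c ∧ (b.appLE U V e).hom (u a) * v' d = (b.appLE U V e).hom (v d) := by
    intro d
    by_cases hd : d = c
    · subst hd
      refine Or.inr ⟨rfl, ?_⟩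
      simp only [v', Function.update_self]
      exact hr
    · exact Or.inl (Function.update_of_ne hd _ _)
  -- In the new chart u_a is the w of index `none`.
  have hnz : ∀ (x : {x // x ≠ a}) (d : β),
      Ideal.Quotient.mk (Ideal.span {(b.appLE U V e).hom (u x), v' d})
        ((b.appLE U V e).hom (u a)) ∈ nonZeroDivisors _ := by
    intro x d
    obtain ⟨-, -, -, -, -, h1⟩ := hchart.exists_smooth_quotient_pair hϖ.maximalIdeal_eq x d
      (δ := Ideal.Quotient.mk _) Ideal.Quotient.mk_surjective Ideal.mk_ker
    exact h1 none
  have hmain : ∀ (x : {x // x ≠ a}) (d : β) (Z : Closeds X),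
      (Z : Set X) ∩ U = X.zeroLocus {u x, v d} ∩ U →
      (strictTransform b Z₀ Z : Set X') ∩ V =
        X'.zeroLocus {(b.appLE U V e).hom (u x), v' d} ∩ V :=
    fun x d Z hZ ↦ strictTransform_inter_eq_of_ne e hV (hv' d) (hnz x d) hZ₀ hZ
  refine ⟨hV, Or.inr ⟨c⟩, hchart, ?_, ?_⟩
  · rintro _ ⟨Z, hZ, rfl⟩
    rcases H.inter Z (Or.inr hZ) with h | ⟨x, d, h⟩
    · refine Or.inl (strictTransform_inter_eq_empty fun x hx hxZ ↦ ?_)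
      exact (Set.eq_empty_iff_forall_notMem.mp h (b x) ⟨hxZ, e hx⟩).elim
    · by_cases hx : x = a
      · subst hx
        exact Or.inl (strictTransform_inter_eq_empty_of_left e hr hZ₀ h)
      · exact Or.inr ⟨⟨x, hx⟩, d, hmain ⟨x, hx⟩ d Z h⟩
  · intro x d
    rcases H.exists_inter x d with h | ⟨Z, hZ, h⟩
    · exact Or.inl (zeroLocus_inter_eq_empty_of e ((hv' d).imp_right And.right) h)
    -- If the old locus coincides with the centre, its strict transform is empty, and hence so is
    -- the new locus.
    · rcases hZ with rfl | hZ
      · left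
        have h1 := hmain x d Z h
        rw [strictTransform_inter_eq_empty fun _ _ h ↦ h] at h1
        exact h1.symm
      · exact Or.inr ⟨_, ⟨Z, hZ, rfl⟩, hmain x d Z h⟩

/-- A chart of the blow-up over an adapted chart that does not meet the centre. -/
theorem map_of_inter_eq_empty (H : IsAdaptedChart ϖ f (insert Z₀ 𝒴) U u v w)
    (hZ₀ : (Z₀ : Set X) ∩ U = ∅) (hV : IsAffineOpen V) (hs : (b.appLE U V e).hom.Smooth) :
    IsAdaptedChart ϖ (b ≫ f) (strictTransform b Z₀ '' 𝒴) V
      ((b.appLE U V e).hom ∘ u) ((b.appLE U V e).hom ∘ v) ((b.appLE U V e).hom ∘ w) := by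
  have hchart := H.isChart.map hs
  rw [appLE_comp_sectionMap] at hchart
  have hmem : ∀ x ∈ V, b x ∉ (Z₀ : Set X) := fun x hx h ↦
    Set.eq_empty_iff_forall_notMem.mp hZ₀ (b x) ⟨h, e hx⟩
  have hmain : ∀ (x : α) (d : β) (Z : Closeds X),
      (Z : Set X) ∩ U = X.zeroLocus {u x, v d} ∩ U →
      (strictTransform b Z₀ Z : Set X') ∩ V =
        X'.zeroLocus {(b.appLE U V e).hom (u x), (b.appLE U V e).hom (v d)} ∩ V := by
    intro a d Z hZ
    have hZ' : ∀ x ∈ V, (b x ∈ (Z : Set X) ↔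
        b x ∉ X.basicOpen (u a) ∧ b x ∉ X.basicOpen (v d)) := by
      intro x hx
      have h1 : b x ∈ (Z : Set X) ∩ U ↔ b x ∈ X.zeroLocus {u a, v d} ∩ U := by rw [hZ]
      have hxU : b x ∈ (U : Set X) := e hx
      rw [Set.mem_inter_iff, Set.mem_inter_iff, and_iff_left hxU, and_iff_left hxU,
        mem_zeroLocus_pair] at h1
      exact h1
    refine strictTransform_inter_eq (X'.zeroLocus_isClosed _) (fun x hx hxZ _ ↦ ?_) fun x hx ↦ ?_
    · obtain ⟨h1, h2⟩ := (hZ' x hx).mp hxZ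
      exact mem_zeroLocus_pair.mpr ⟨fun h ↦ h1 ((mem_basicOpen_appLE b e _ hx).mp h),
        fun h ↦ h2 ((mem_basicOpen_appLE b e _ hx).mp h)⟩
    · obtain ⟨h1, h2⟩ := mem_zeroLocus_pair.mp hx.1
      exact subset_closure ⟨(hZ' x hx.2).mpr
        ⟨fun h ↦ h1 ((mem_basicOpen_appLE b e _ hx.2).mpr h),
        fun h ↦ h2 ((mem_basicOpen_appLE b e _ hx.2).mpr h)⟩, hmem x hx.2⟩
  refine ⟨hV, H.nonempty, hchart, ?_, fun x d ↦ ?_⟩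
  · rintro _ ⟨Z, hZ, rfl⟩
    rcases H.inter Z (Or.inr hZ) with h | ⟨x, d, h⟩
    · refine Or.inl (strictTransform_inter_eq_empty fun x hx hxZ ↦ ?_)
      exact (Set.eq_empty_iff_forall_notMem.mp h (b x) ⟨hxZ, e hx⟩).elim
    · exact Or.inr ⟨x, d, hmain x d Z h⟩
  · rcases H.exists_inter x d with h | ⟨Z, hZ, h⟩
    · exact Or.inl (zeroLocus_inter_eq_empty_of (a := x) e (Or.inl rfl) h)
    · rcases hZ with rfl | hZ
      · left
        have h1 := hmain x d Z h
        rw [strictTransform_inter_eq_empty fun _ _ h ↦ h] at h1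
        exact h1.symm
      · exact Or.inr ⟨_, ⟨Z, hZ, rfl⟩, hmain x d Z h⟩

end Chart

end AdaptedChart

end IsAdaptedChart

end SemistableProduct

namespace SemistableProduct

open IsLocalRing

theorem smooth_of_bijective {A B : Type u} [CommRing A] [CommRing B] {φ : A →+* B}
    (hφ : Function.Bijective φ) : φ.Smooth := by
  have : IsIso (CommRingCat.ofHom φ) := (ConcreteCategory.isIso_iff_bijective _).mpr hφ
  have : Smooth (Spec.map (CommRingCat.ofHom φ)) := inferInstance
  rwa [HasRingHomProperty.Spec_iff (P := @Smooth)] at this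

theorem smooth_presheaf_map {Y : Scheme.{u}} {U V : Y.Opens} (hU : IsAffineOpen U)
    (hV : IsAffineOpen V) (h : V ≤ U) : (Y.presheaf.map (homOfLE h).op).hom.Smooth := by
  have e : V ≤ (𝟙 Y : Y ⟶ Y) ⁻¹ᵁ U := h
  have h1 := HasRingHomProperty.appLE @Smooth (𝟙 Y) inferInstance ⟨U, hU⟩ ⟨V, hV⟩ e
  have h2 : (𝟙 Y : Y ⟶ Y).appLE U V e = Y.presheaf.map (homOfLE h).op := by
    change (𝟙 Y : Y ⟶ Y).app U ≫ Y.presheaf.map _ = _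
    rw [Scheme.Hom.id_app]
    exact Category.id_comp _
  rwa [h2] at h1

theorem BlowupRing.bijective_of_one (A : Type u) [CommRing A] :
    Function.Bijective (BlowupRing.of (1 : A) 0 0 0) := by
  obtain ⟨ψ, h1, h2⟩ := BlowupRing.exists_lift (u := (1 : A)) (v := 0) (p := 0) (q := 0)
    (RingHom.id A) 0 (by simp) (by simp)
  have h3 := BlowupRing.of_mul_ratio (1 : A) 0 0 0
  have h4 : (BlowupRing.of (1 : A) 0 0 0).comp ψ = RingHom.id _ := by
    refine BlowupRing.hom_ext (fun a ↦ ?_) ?_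
    · rw [RingHom.comp_apply, h1]
      rfl
    · rw [RingHom.comp_apply, h2, h3.symm]
      exact (congrArg (· * BlowupRing.ratio (1 : A) 0 0 0)
        (map_one (BlowupRing.of (1 : A) 0 0 0))).trans (one_mul _)
  exact ⟨Function.LeftInverse.injective h1, fun y ↦ ⟨ψ y, RingHom.congr_fun h4 y⟩⟩

theorem BlowupRing.one_eq_zero_of_zero_one (A : Type u) [CommRing A] :
    (1 : BlowupRing (0 : A) 1 0 0) = 0 := by
  have h0 := map_zero (BlowupRing.of (0 : A) 1 0 0)
  have h1 := map_one (BlowupRing.of (0 : A) 1 0 0)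
  exact h1.symm.trans ((BlowupRing.of_mul_ratio (0 : A) 1 0 0).symm.trans
    ((congrArg (· * BlowupRing.ratio (0 : A) 1 0 0) h0).trans (zero_mul _)))

/-! ### Covers by adapted charts and by standard charts. -/

variable {R : Type u} [CommRing R] {ϖ : R} {X : Scheme.{u}}

/-- There are adapted charts around every point. -/
def IsAdapted (ϖ : R) (f : X ⟶ Spec (.of R)) (𝒵 : Set (Closeds X)) : Prop :=
  ∀ x : X, ∃ (U : X.Opens) (α β γ : Type) (_ : Fintype α) (_ : Fintype β) (_ : Fintype γ)
    (u : α → Γ(X, U)) (v : β → Γ(X, U)) (w : γ → Γ(X, U)), x ∈ U ∧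
    IsAdaptedChart ϖ f 𝒵 U u v w

/-- There are standard charts around every point. -/
def HasStdCharts (ϖ : R) (f : X ⟶ Spec (.of R)) : Prop :=
  ∀ x : X, ∃ (U : X.Opens) (γ : Type) (_ : Fintype γ) (w : γ → Γ(X, U)), IsAffineOpen U ∧ x ∈ U ∧
    IsStdChart ϖ (sectionMap f U) w

theorem nontrivial_of_mem {U : X.Opens} {x : X} (hx : x ∈ U) : Nontrivial Γ(X, U) := by
  refine ⟨0, 1, fun h ↦ ?_⟩
  have h1 := congr_arg (X.presheaf.germ U x hx).hom h
  rw [map_zero, map_one] at h1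
  exact zero_ne_one h1

namespace IsAdapted

variable {f : X ⟶ Spec (.of R)} {Z₀ : Closeds X} {𝒴 : Set (Closeds X)}

theorem hasBlowupPairs [IsDomain R] [IsDiscreteValuationRing R] (hϖ : Irreducible ϖ)
    (hk : Nonempty X → PerfectField (ResidueField R)) (H : IsAdapted ϖ f (insert Z₀ 𝒴)) :
    HasBlowupPairs (Scheme.IdealSheafData.vanishingIdeal Z₀) := by
  classical
  intro x
  have := hk ⟨x⟩
  obtain ⟨U, α, β, γ, _, _, _, u, v, w, hx, H⟩ := H x
  rcases H.inter Z₀ (Or.inl rfl) with h | ⟨a, c, h⟩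
  · exact ⟨U, H.isAffine, 1, 0, 0, 0, hx, IsAdaptedChart.isBlowupPair_of_inter_eq_empty _ h⟩
  · exact ⟨U, H.isAffine, _, _, _, _, hx, H.isBlowupPair hϖ h⟩

theorem blowup [IsDomain R] [IsDiscreteValuationRing R] (hϖ : Irreducible ϖ)
    (hk : Nonempty X → PerfectField (ResidueField R)) (H : IsAdapted ϖ f (insert Z₀ 𝒴))
    {X' : Scheme.{u}} {b : X' ⟶ X} (hb : IsBlowupAlong b Z₀) :
    IsAdapted ϖ (b ≫ f) (strictTransform b Z₀ '' 𝒴) := by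
  classical
  intro x
  have := hk ⟨b x⟩
  obtain ⟨U, α, β, γ, _, _, _, u, v, w, hx, H⟩ := H (b x)
  rcases H.inter Z₀ (Or.inl rfl) with h | ⟨a, c, h⟩
  · have hpair := IsAdaptedChart.isBlowupPair_of_inter_eq_empty H.isAffine h
    obtain ⟨V, hV, e, hxV, ⟨φ, hφ⟩ | ⟨φ, hφ⟩⟩ := hpair.exists_ringHom hb x hx
    · obtain ⟨l, hl, -⟩ := hpair.existsUnique_lift hb
      have h1 := (smooth_of_bijective (BlowupRing.bijective_of_one Γ(X, U))).comp
        (hpair.smooth_ringHom hb hl hV e φ hφ)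
      rw [show φ.comp (BlowupRing.of _ _ _ _) = (b.appLE U V e).hom from RingHom.ext hφ] at h1
      exact ⟨V, α, β, γ, ‹_›, ‹_›, ‹_›, _, _, _, hxV, H.map_of_inter_eq_empty e h hV h1⟩
    · have h1 := congr_arg φ (BlowupRing.one_eq_zero_of_zero_one Γ(X, U))
      rw [map_one, map_zero] at h1
      have := nontrivial_of_mem hxV
      exact (one_ne_zero h1).elim
  · obtain ⟨V, hV, e, hxV, ⟨φ, hφ⟩ | ⟨φ, hφ⟩⟩ := (H.isBlowupPair hϖ h).exists_ringHom hb x hx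
    · exact ⟨V, _, _, _, inferInstance, inferInstance, inferInstance, _, _, _, hxV,
        H.blowup e hϖ h hb hV φ hφ⟩
    · rw [Set.pair_comm] at h
      exact ⟨V, _, _, _, inferInstance, inferInstance, inferInstance, _, _, _, hxV,
        H.swap.blowup e hϖ h hb hV φ hφ⟩

/-- The members of `𝒴` lie in the special fibre: locally u_a vanishes on them, and u_a divides `ϖ`.
-/
theorem disjoint_basicOpen (H : IsAdapted ϖ f 𝒴) {Z : Closeds X} (hZ : Z ∈ 𝒴) {x : X}
    (hx : x ∈ (Z : Set X)) : ∃ U : X.Opens, x ∈ U ∧ IsAffineOpen U ∧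
      x ∉ X.basicOpen (sectionMap f U ϖ) := by
  classical
  obtain ⟨U, α, β, γ, _, _, _, u, v, w, hxU, H⟩ := H x
  refine ⟨U, hxU, H.isAffine, fun h ↦ ?_⟩
  rcases H.inter Z hZ with h' | ⟨a, c, h'⟩
  · exact Set.eq_empty_iff_forall_notMem.mp h' x ⟨hx, hxU⟩
  · have h1 : x ∈ X.zeroLocus {u a, v c} ∩ (U : Set X) := h' ▸ ⟨hx, hxU⟩
    rw [← H.isChart.prod_mul, ← Finset.mul_prod_erase _ _ (Finset.mem_univ a), mul_assoc,
      Scheme.basicOpen_mul] at h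
    exact (mem_zeroLocus_pair.mp h1.1).1 h.1

end IsAdapted

theorem mem_basicOpen_prod {ι : Type*} (s : Finset ι) {U : X.Opens} (u : ι → Γ(X, U)) {x : X}
    (hx : x ∈ U) : x ∈ X.basicOpen (∏ i ∈ s, u i) ↔ ∀ i ∈ s, x ∈ X.basicOpen (u i) := by
  classical
  induction s using Finset.induction_on with
  | empty => simpa [Scheme.basicOpen_of_isUnit] using hx
  | insert i s hi ih =>
    rw [Finset.prod_insert hi, Scheme.basicOpen_mul, Finset.forall_mem_insert, ← ih]
    rfl

theorem IsChart.exists_isStdChart {f : X ⟶ Spec (.of R)} {U : X.Opens} (hU : IsAffineOpen U)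
    {α β γ : Type} [Fintype α] [Fintype β] [Fintype γ] {u : α → Γ(X, U)} {v : β → Γ(X, U)}
    {w : γ → Γ(X, U)} (H : IsChart ϖ (sectionMap f U) u v w) {x : X} (hx : x ∈ U) (a : α)
    (ha : ∀ a', a' ≠ a → x ∈ X.basicOpen (u a')) :
    ∃ (U : X.Opens) (γ : Type) (_ : Fintype γ) (w : γ → Γ(X, U)), IsAffineOpen U ∧ x ∈ U ∧
      IsStdChart ϖ (sectionMap f U) w := by
  classical
  let s := ∏ a' ∈ Finset.univ.erase a, u a'
  have h1 := H.map (smooth_presheaf_map hU (hU.basicOpen s) (X.basicOpen_le s))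
  rw [map_comp_sectionMap] at h1
  refine ⟨X.basicOpen s, β ⊕ γ, inferInstance, _, hU.basicOpen s, ?_, h1.of_isUnit_left a ?_⟩
  · exact (mem_basicOpen_prod _ u hx).mpr fun a' h ↦ ha a' (Finset.ne_of_mem_erase h)
  · intro a' h
    have h2 : IsUnit ((X.presheaf.map (homOfLE (X.basicOpen_le s)).op).hom s) :=
      RingedSpace.isUnit_res_basicOpen _ s
    rw [map_prod, IsUnit.prod_iff] at h2
    exact h2 a' (Finset.mem_erase.mpr ⟨h, Finset.mem_univ _⟩)

/-- If u_a and u_{a'} both vanish at x, so does some v_c, and the loci (u_a, v_c) and (u_{a'}, v_c)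
are both the trace of the only member of `𝒵`. But u_{a'} is a non-zero-divisor modulo (u_a, v_c), so
it cannot vanish on the whole first locus. -/
theorem IsAdaptedChart.mem_basicOpen_of_subsingleton [IsLocalRing R]
    (hϖ : maximalIdeal R = Ideal.span {ϖ}) {f : X ⟶ Spec (.of R)} {𝒵 : Set (Closeds X)}
    (h𝒵 : 𝒵.Subsingleton) {U : X.Opens} {α β γ : Type} [Fintype α] [Fintype β] [Fintype γ] {u : α → Γ(X, U)} {v : β → Γ(X, U)}
    {w : γ → Γ(X, U)} (H : IsAdaptedChart ϖ f 𝒵 U u v w) {x : X} (hx : x ∈ U) {a : α}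
    (hxa : x ∉ X.basicOpen (u a)) {a' : α} (ha' : a' ≠ a) : x ∈ X.basicOpen (u a') := by
  by_contra hxa'
  have hc : ∃ c, x ∉ X.basicOpen (v c) := by
    by_contra! hc
    have h1 := (mem_basicOpen_prod Finset.univ v hx).mpr fun c _ ↦ hc c
    rw [← H.isChart.prod_eq, mem_basicOpen_prod _ _ hx] at h1
    exact hxa (h1 a (Finset.mem_univ a))
  obtain ⟨c, hc⟩ := hc
  have key : ∀ a, x ∉ X.basicOpen (u a) →
      ∃ Z ∈ 𝒵, (Z : Set X) ∩ U = X.zeroLocus {u a, v c} ∩ U := fun a hxa ↦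
    (H.exists_inter a c).resolve_left fun h ↦
      Set.eq_empty_iff_forall_notMem.mp h x ⟨mem_zeroLocus_pair.mpr ⟨hxa, hc⟩, hx⟩
  obtain ⟨Z, hZ, h₁⟩ := key a hxa
  obtain ⟨Z', hZ', h₂⟩ := key a' hxa'
  rw [h𝒵 hZ' hZ] at h₂
  obtain ⟨-, -, -, h1, -⟩ := H.isChart.exists_smooth_quotient_pair hϖ a c
    (δ := Ideal.Quotient.mk _) Ideal.Quotient.mk_surjective Ideal.mk_ker
  have h2 := zeroLocus_inter_subset_closure H.isAffine (h1 a' ha')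
  rw [Scheme.zeroLocus_span] at h2
  have h3 : X.zeroLocus {u a, v c} ∩ (X.basicOpen (u a') : Set X) = ∅ := by
    refine Set.eq_empty_of_forall_notMem fun y hy ↦ ?_
    have hyU : y ∈ (U : Set X) := X.basicOpen_le _ hy.2
    have h4 : y ∈ X.zeroLocus {u a', v c} ∩ (U : Set X) := by
      rw [← h₂, h₁]
      exact ⟨hy.1, hyU⟩
    exact (mem_zeroLocus_pair.mp h4.1).1 hy.2
  rw [h3, closure_empty] at h2
  exact h2 ⟨mem_zeroLocus_pair.mpr ⟨hxa, hc⟩, hx⟩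

/-- Once at most one component is left, all charts are standard. -/
theorem IsAdapted.hasStdCharts [IsLocalRing R] (hϖ : maximalIdeal R = Ideal.span {ϖ})
    {f : X ⟶ Spec (.of R)} {𝒵 : Set (Closeds X)} (h𝒵 : 𝒵.Subsingleton) (H : IsAdapted ϖ f 𝒵) :
    HasStdCharts ϖ f := by
  have key : ∀ (x : X) (U : X.Opens) (α β γ : Type) (_ : Fintype α) (_ : Fintype β) (_ : Fintype γ)
      (u : α → Γ(X, U)) (v : β → Γ(X, U)) (w : γ → Γ(X, U)) (_ : x ∈ U)
      (_ : IsAdaptedChart ϖ f 𝒵 U u v w) (_ : Nonempty α),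
      ∃ (U : X.Opens) (γ : Type) (_ : Fintype γ) (w : γ → Γ(X, U)), IsAffineOpen U ∧ x ∈ U ∧
        IsStdChart ϖ (sectionMap f U) w := by
    intro x U α β γ _ _ _ u v w hx H ⟨a⟩
    by_cases h : ∃ a, x ∉ X.basicOpen (u a)
    · obtain ⟨a, ha⟩ := h
      exact H.isChart.exists_isStdChart H.isAffine hx a
        fun a' h ↦ H.mem_basicOpen_of_subsingleton hϖ h𝒵 hx ha h
    · push Not at h
      exact H.isChart.exists_isStdChart H.isAffine hx a fun a' _ ↦ h a'
  intro x
  obtain ⟨U, α, β, γ, _, _, _, u, v, w, hx, H⟩ := H x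
  rcases H.nonempty with h | h
  · exact key x U α β γ _ _ _ u v w hx H h
  · exact key x U β α γ _ _ _ v u w hx H.swap h

end SemistableProduct

namespace SemistableProduct

open IsLocalRing

/-! ### Local properties of morphisms and the special fibre. -/

section SectionMap

variable {R : Type u} [CommRing R] {X : Scheme.{u}}

theorem of_forall_exists_sectionMap (P : MorphismProperty Scheme.{u})
    {Q : ∀ {R S : Type u} [CommRing R] [CommRing S], (R →+* S) → Prop} [HasRingHomProperty P Q]
    [P.IsStableUnderComposition] (hP : ∀ {X Y : Scheme.{u}} (f : X ⟶ Y) [IsOpenImmersion f], P f)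
    (f : X ⟶ Spec (.of R)) (H : ∀ x : X, ∃ V : X.Opens, IsAffineOpen V ∧ x ∈ V ∧
      Q (sectionMap f V)) : P f := by
  choose V hV hx hQ using H
  have htop : ⨆ x, V x = ⊤ := top_le_iff.mp fun x _ ↦ Opens.mem_iSup.mpr ⟨x, hx x⟩
  rw [IsZariskiLocalAtSource.iff_of_iSup_eq_top (P := P) V htop]
  intro x
  have h6 : (hV x).isoSpec.hom ≫ (hV x).fromSpec = (V x).ι := (hV x).isoSpec_hom_fromSpec
  rw [← h6, Category.assoc, ← SpecMap_sectionMap f (hV x)]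
  exact P.comp_mem _ _ (hP _) (HasRingHomProperty.Spec_iff.mpr (hQ x))

theorem sectionMap_comp_SpecMap {S : Type u} [CommRing S] (φ : R →+* S) (g : X ⟶ Spec (.of S))
    (U : X.Opens) : (sectionMap g U).comp φ =
      sectionMap (g ≫ Spec.map (CommRingCat.ofHom φ)) U := by
  have h1 := Scheme.ΓSpecIso_inv_naturality (CommRingCat.ofHom φ)
  have h2 := Scheme.Hom.appLE_comp_appLE g (Spec.map (CommRingCat.ofHom φ)) ⊤ ⊤ U
    (le_preimage_top _ _) (le_preimage_top _ _)
  rw [sectionMap, sectionMap, ← h2]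
  have h3 : (Spec.map (CommRingCat.ofHom φ)).appLE ⊤ ⊤ (le_preimage_top _ _) =
      (Spec.map (CommRingCat.ofHom φ)).appTop := by
    rw [Scheme.Hom.appTop, Scheme.Hom.app_eq_appLE]
    rfl
  rw [h3, ← Category.assoc, ← h1, Category.assoc]
  rfl

theorem toSpecΓ_SpecMap_sectionMap (f : X ⟶ Spec (.of R)) :
    X.toSpecΓ ≫ Spec.map (CommRingCat.ofHom (sectionMap f ⊤)) = f := by
  have h2 : CommRingCat.ofHom (sectionMap f ⊤) = (Scheme.ΓSpecIso (.of R)).inv ≫ f.appTop := by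
    rw [sectionMap, CommRingCat.ofHom_hom, Scheme.Hom.appTop, Scheme.Hom.app_eq_appLE]
    rfl
  rw [h2, Spec.map_comp, ← Category.assoc, ← Scheme.toSpecΓ_naturality, Category.assoc,
    toSpecΓ_SpecMap_ΓSpecIso_inv, Category.comp_id]

theorem mem_specialFiber_iff [IsLocalRing R] {ϖ : R} (hϖ : maximalIdeal R = Ideal.span {ϖ})
    (f : X ⟶ Spec (.of R)) {U : X.Opens} {x : X} (hx : x ∈ U) :
    x ∈ specialFiber f ↔ x ∉ X.basicOpen (sectionMap f U ϖ) := by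
  have h1 : x ∈ X.basicOpen (sectionMap f U ϖ) ↔ f x ∈ PrimeSpectrum.basicOpen ϖ := by
    have h2 := mem_basicOpen_appLE f (le_preimage_top f U) ((Scheme.ΓSpecIso (.of R)).inv.hom ϖ) hx
    refine h2.trans ?_
    have h3 := basicOpen_eq_of_affine' ((Scheme.ΓSpecIso (.of R)).inv.hom ϖ)
    have h4 : (Scheme.ΓSpecIso (.of R)).hom.hom ((Scheme.ΓSpecIso (.of R)).inv.hom ϖ) = ϖ :=
      Iso.inv_hom_id_apply (C := CommRingCat) (Scheme.ΓSpecIso (.of R)) ϖ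
    have h5 : (Spec (.of R)).basicOpen ((Scheme.ΓSpecIso (.of R)).inv.hom ϖ) =
        PrimeSpectrum.basicOpen ϖ := h3.trans (congr_arg PrimeSpectrum.basicOpen h4)
    exact Iff.of_eq (congr_arg (fun s : (Spec (.of R)).Opens ↦ f x ∈ s) h5)
  rw [h1]
  change f x = closedPoint R ↔ ¬ (ϖ ∉ (f x).asIdeal)
  rw [not_not]
  refine ⟨fun h ↦ ?_, fun h ↦ PrimeSpectrum.ext ?_⟩
  · rw [h]
    change ϖ ∈ maximalIdeal R
    rw [hϖ]
    exact Ideal.mem_span_singleton_self ϖ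
  · refine ((IsLocalRing.maximalIdeal.isMaximal R).eq_of_le (f x).2.ne_top ?_).symm
    rw [hϖ, Ideal.span_singleton_le_iff_mem]
    exact h

theorem isClosed_specialFiber [IsLocalRing R] (f : X ⟶ Spec (.of R)) :
    IsClosed (specialFiber f) :=
  (PrimeSpectrum.isClosed_singleton_iff_isMaximal _ |>.mpr
    (IsLocalRing.maximalIdeal.isMaximal R)).preimage f.continuous

theorem mem_primeIdealOf_iff {U : X.Opens} (hU : IsAffineOpen U) (x : U) (w : Γ(X, U)) :
    w ∈ (hU.primeIdealOf x).asIdeal ↔ x.1 ∉ X.basicOpen w := by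
  have h1 := hU.fromSpec_preimage_basicOpen w
  have h2 : hU.primeIdealOf x ∈ hU.fromSpec ⁻¹ᵁ X.basicOpen w ↔ x.1 ∈ X.basicOpen w := by
    change hU.fromSpec (hU.primeIdealOf x) ∈ X.basicOpen w ↔ _
    rw [hU.fromSpec_primeIdealOf]
  rw [← h2, h1]
  exact not_not.symm

end SectionMap

/-! ### Components of the special fibre on an affine open. -/

section Components

variable {R : Type u} [CommRing R] [IsLocalRing R] {X : Scheme.{u}} {f : X ⟶ Spec (.of R)}
  {U : X.Opens}

theorem isIrreducible_zeroLocus_inter (hU : IsAffineOpen U) {J : Ideal Γ(X, U)} (hJ : J.IsPrime) :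
    IsIrreducible (X.zeroLocus (U := U) (J : Set Γ(X, U)) ∩ U) := by
  rw [← hU.fromSpec_image_zeroLocus]
  refine IsIrreducible.image ?_ _ hU.fromSpec.continuous.continuousOn
  exact (PrimeSpectrum.isIrreducible_zeroLocus_iff_of_radical _ hJ.isRadical).mpr hJ

theorem zeroLocus_inter_eq_empty_of_eq_top {J : Ideal Γ(X, U)} (hJ : J = ⊤) :
    X.zeroLocus (U := U) (J : Set Γ(X, U)) ∩ U = ∅ := by
  refine Set.eq_empty_of_forall_notMem fun x hx ↦ ?_
  have := (X.mem_zeroLocus_iff _ _).mp hx.1 1 (hJ ▸ trivial)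
  rw [Scheme.basicOpen_of_isUnit _ isUnit_one] at this
  exact this hx.2

/-- The generic point of `Z` lies in one of the loci, so `Z` is inside that locus; the locus is
irreducible, and maximality of `Z` gives equality on `U`. -/
theorem specialComponents_inter (hU : IsAffineOpen U) {ι : Type*} (J : ι → Ideal Γ(X, U))
    (hJ : ∀ i, (J i).IsPrime ∨ J i = ⊤)
    (hs : specialFiber f ∩ U = ⋃ i, X.zeroLocus (U := U) (J i : Set Γ(X, U)) ∩ U)
    {Z : Closeds X} (hZ : Z ∈ specialComponents f) (hne : ((Z : Set X) ∩ U).Nonempty) :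
    ∃ i, (Z : Set X) ∩ U = X.zeroLocus (U := U) (J i : Set Γ(X, U)) ∩ U := by
  obtain ⟨z, hz⟩ := QuasiSober.sober hZ.1.1 Z.isClosed
  have hzU : z ∈ (U : Set X) := (hz.mem_open_set_iff U.2).mpr hne
  have hzZ : z ∈ (Z : Set X) := hz.mem
  have h1 : z ∈ ⋃ i, X.zeroLocus (U := U) (J i : Set Γ(X, U)) ∩ U := by
    rw [← hs]
    exact ⟨hZ.1.2 hzZ, hzU⟩
  obtain ⟨i, hi⟩ := Set.mem_iUnion.mp h1
  have h2 : (Z : Set X) ⊆ X.zeroLocus (U := U) (J i : Set Γ(X, U)) := by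
    rw [← hz.def]
    exact closure_minimal (by simpa using hi.1) (X.zeroLocus_isClosed _)
  have hJi : (J i).IsPrime := by
    rcases hJ i with h | h
    · exact h
    · rw [zeroLocus_inter_eq_empty_of_eq_top h] at hi
      exact hi.elim
  refine ⟨i, Set.Subset.antisymm (fun x hx ↦ ⟨h2 hx.1, hx.2⟩) fun x hx ↦ ⟨?_, hx.2⟩⟩
  have h3 : X.zeroLocus (U := U) (J i : Set Γ(X, U)) ∩ U ⊆ specialFiber f := by
    intro y hy
    have : y ∈ specialFiber f ∩ U := by
      rw [hs]
      exact Set.mem_iUnion.mpr ⟨i, hy⟩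
    exact this.1
  refine hZ.2 (y := closure (X.zeroLocus (U := U) (J i : Set Γ(X, U)) ∩ U))
    ⟨(isIrreducible_zeroLocus_inter hU hJi).closure,
      closure_minimal h3 (isClosed_specialFiber f)⟩ ?_ (subset_closure hx)
  rw [← hz.def]
  exact closure_minimal (Set.singleton_subset_iff.mpr (subset_closure hi)) isClosed_closure

/-- Zorn's lemma. A maximal set is closed because its closure stays irreducible and inside the
closed special fibre. -/
theorem exists_specialComponents_of_isIrreducible {s : Set X} (hs : IsIrreducible s)
    (hs' : s ⊆ specialFiber f) : ∃ Z ∈ specialComponents f, s ⊆ (Z : Set X) := by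
  have hchain : ∀ c ⊆ {t : Set X | IsPreirreducible t ∧ t ⊆ specialFiber f},
      IsChain (· ⊆ ·) c → c.Nonempty →
      ∃ ub ∈ {t : Set X | IsPreirreducible t ∧ t ⊆ specialFiber f}, ∀ s ∈ c, s ⊆ ub := by
    intro c hc hcc _
    refine ⟨⋃₀ c, ⟨?_, Set.sUnion_subset fun t ht ↦ (hc ht).2⟩,
      fun t ht ↦ Set.subset_sUnion_of_mem ht⟩
    rintro u v hu hv ⟨y, ⟨p, hpc, hyp⟩, hyu⟩ ⟨x, ⟨q, hqc, hxq⟩, hxv⟩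
    rcases hcc.total hpc hqc with hpq | hqp
    · obtain ⟨x, hxp, hxuv⟩ := (hc hqc).1 u v hu hv ⟨y, hpq hyp, hyu⟩ ⟨x, hxq, hxv⟩
      exact ⟨x, ⟨q, hqc, hxp⟩, hxuv⟩
    · obtain ⟨x, hxp, hxuv⟩ := (hc hpc).1 u v hu hv ⟨y, hyp, hyu⟩ ⟨x, hqp hxq, hxv⟩
      exact ⟨x, ⟨p, hpc, hxp⟩, hxuv⟩
  obtain ⟨m, hsm, hm⟩ := zorn_subset_nonempty _ hchain s ⟨hs.isPreirreducible, hs'⟩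
  have hirr : IsIrreducible m := ⟨hs.nonempty.mono hsm, hm.prop.1⟩
  have hcl : closure m ⊆ m := hm.2 ⟨hirr.closure.isPreirreducible,
    closure_minimal hm.prop.2 (isClosed_specialFiber f)⟩ subset_closure
  refine ⟨⟨m, closure_subset_iff_isClosed.mp hcl⟩, ⟨⟨hirr, hm.prop.2⟩, fun t ht hmt ↦ ?_⟩, hsm⟩
  exact hm.2 ⟨ht.1.isPreirreducible, ht.2⟩ hmt

theorem exists_specialComponents_inter (hU : IsAffineOpen U) {ι : Type*} (J : ι → Ideal Γ(X, U))
    (hJ : ∀ i, (J i).IsPrime ∨ J i = ⊤)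
    (hs : specialFiber f ∩ U = ⋃ i, X.zeroLocus (U := U) (J i : Set Γ(X, U)) ∩ U)
    (i : ι) (hne : (X.zeroLocus (U := U) (J i : Set Γ(X, U)) ∩ U).Nonempty)
    (hi : ∀ j, j ≠ i → ¬ X.zeroLocus (U := U) (J i : Set Γ(X, U)) ∩ U ⊆
      X.zeroLocus (U := U) (J j : Set Γ(X, U))) :
    ∃ Z ∈ specialComponents f,
      (Z : Set X) ∩ U = X.zeroLocus (U := U) (J i : Set Γ(X, U)) ∩ U := by
  have hJi : (J i).IsPrime := by
    rcases hJ i with h | h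
    · exact h
    · rw [zeroLocus_inter_eq_empty_of_eq_top h] at hne
      exact (Set.not_nonempty_empty hne).elim
  obtain ⟨Z, hZ, hZi⟩ := exists_specialComponents_of_isIrreducible (f := f)
    (isIrreducible_zeroLocus_inter hU hJi) fun y hy ↦ by
      have : y ∈ specialFiber f ∩ U := by
        rw [hs]
        exact Set.mem_iUnion.mpr ⟨i, hy⟩
      exact this.1
  obtain ⟨j, hj⟩ := specialComponents_inter hU J hJ hs hZ
    (hne.mono fun y hy ↦ ⟨hZi hy, hy.2⟩)
  refine ⟨Z, hZ, ?_⟩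
  by_cases hji : j = i
  · rw [hj, hji]
  · refine (hi j hji fun y hy ↦ ?_).elim
    have : y ∈ (Z : Set X) ∩ U := ⟨hZi hy, hy.2⟩
    rw [hj] at this
    exact this.1

end Components

/-! ### Flatness and semistability from standard charts. -/

namespace HasStdCharts

variable {R : Type u} [CommRing R] {ϖ : R} {X : Scheme.{u}} {f : X ⟶ Spec (.of R)}

theorem flat [IsDomain R] [IsDiscreteValuationRing R] (hϖ : Irreducible ϖ)
    (H : HasStdCharts ϖ f) : Flat f := by
  refine of_forall_exists_sectionMap @Flat (fun f _ ↦ inferInstance) f fun x ↦ ?_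
  obtain ⟨U, γ, _, w, hU, hx, h⟩ := H x
  exact ⟨U, hU, hx, IsChart.flat h hϖ⟩

/-- On the special fibre some w vanishes at the point; the w that do not vanish there become units
after shrinking and are absorbed into it. -/
theorem exists_isStdChart_forall_notMem [IsLocalRing R] (hϖ : maximalIdeal R = Ideal.span {ϖ})
    (H : HasStdCharts ϖ f) {x : X} (hx : x ∈ specialFiber f) :
    ∃ (U : X.Opens) (γ : Type) (_ : Fintype γ) (_ : Nonempty γ) (w : γ → Γ(X, U)),
      IsAffineOpen U ∧ x ∈ U ∧ IsStdChart ϖ (sectionMap f U) w ∧ ∀ c, x ∉ X.basicOpen (w c) := by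
  classical
  obtain ⟨U, γ, _, w, hU, hxU, h⟩ := H x
  have h0 := (mem_specialFiber_iff hϖ f hxU).mp hx
  rw [← IsStdChart.prod_eq h, mem_basicOpen_prod _ _ hxU] at h0
  push Not at h0
  obtain ⟨c₀, -, hc₀⟩ := h0
  let s := ∏ c ∈ Finset.univ.filter (fun c ↦ x ∈ X.basicOpen (w c)), w c
  let r := (X.presheaf.map (homOfLE (X.basicOpen_le s)).op).hom
  have hs : x ∈ X.basicOpen s := (mem_basicOpen_prod _ w hxU).mpr fun c hc ↦
    (Finset.mem_filter.mp hc).2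
  have h1 : IsStdChart ϖ (sectionMap f (X.basicOpen s)) (r ∘ w) := by
    have := IsChart.map h (smooth_presheaf_map hU (hU.basicOpen s) (X.basicOpen_le s))
    rw [map_comp_sectionMap] at this
    convert this using 1
  have hrw : ∀ c, x ∈ X.basicOpen (r (w c)) ↔ x ∈ X.basicOpen (w c) := by
    intro c
    have := Scheme.basicOpen_res X (w c) (homOfLE (X.basicOpen_le s)).op
    refine ⟨fun h ↦ (this.le h).2, fun h ↦ this.ge ⟨hs, h⟩⟩
  have h2 := h1.of_isUnit (fun c ↦ x ∉ X.basicOpen (w c)) ⟨c₀, hc₀⟩ (fun c hc ↦ by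
    have h3 : IsUnit (r s) := RingedSpace.isUnit_res_basicOpen _ s
    rw [map_prod, IsUnit.prod_iff] at h3
    exact h3 c (Finset.mem_filter.mpr ⟨Finset.mem_univ _, not_not.mp hc⟩))
  refine ⟨X.basicOpen s, _, inferInstance, ⟨⟨c₀, hc₀⟩⟩, _, hU.basicOpen s, hs, h2, fun c hc ↦ ?_⟩
  refine c.2 ((hrw c).mp ?_)
  split_ifs at hc with hcc
  · rw [Scheme.basicOpen_mul] at hc
    exact hc.1
  · exact hc

theorem isSemistableAt [IsLocalRing R] [IsNoetherianRing R]
    (hk : Nonempty X → PerfectField (ResidueField R))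
    (hϖ : maximalIdeal R = Ideal.span {ϖ}) (H : HasStdCharts ϖ f) {P : X} (hP : IsClosed {P})
    (hP' : P ∈ specialFiber f) : IsSemistableAt ϖ f P := by
  have := hk ⟨P⟩
  obtain ⟨U, γ, _, _, w, hU, hPU, h, hw⟩ := H.exists_isStdChart_forall_notMem hϖ hP'
  letI := X.presheaf.algebra_section_stalk ⟨P, hPU⟩
  have := hU.isLocalization_stalk ⟨P, hPU⟩
  have := hU.primeIdealOf_isMaximal_of_isClosed ⟨P, hPU⟩ hP
  have hnoeth : IsNoetherianRing Γ(X, U) := by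
    letI := (sectionMap f U).toAlgebra
    have : Algebra.FinitePresentation R Γ(X, U) := IsChart.finitePresentation h
    exact Algebra.FiniteType.isNoetherianRing R Γ(X, U)
  have hnoeth' : IsNoetherianRing (X.presheaf.stalk P) :=
    IsLocalization.isNoetherianRing (hU.primeIdealOf ⟨P, hPU⟩).asIdeal.primeCompl _ hnoeth
  obtain ⟨n, t, φ, h1, h2, h3, h4, h5⟩ := IsStdChart.exists_finite_etale_stdRing hϖ h
    (hU.primeIdealOf ⟨P, hPU⟩).asIdeal
    (fun c ↦ (mem_primeIdealOf_iff hU ⟨P, hPU⟩ _).mpr (hw c)) (B := X.presheaf.stalk P)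
    (IsCompletion.adicCompletion (maximalIdeal (X.presheaf.stalk P))
      (IsNoetherian.noetherian _))
  refine ⟨n, t, φ, h1, h2, h3, h4, fun r ↦ ?_⟩
  rw [h5, toStalk_eq_germ f P hPU]
  rfl

end HasStdCharts

end SemistableProduct

namespace SemistableProduct

open IsLocalRing

section Shrink

variable {X : Scheme.{u}} {U : X.Opens}

theorem exists_basicOpen_isPrime_map (hU : IsAffineOpen U) [IsNoetherianRing Γ(X, U)] {ι : Type*}
    [Finite ι] (J : ι → Ideal Γ(X, U)) {x : X} (hx : x ∈ U)
    (H : ∀ i (P : Ideal Γ(X, U)), P.IsPrime → J i ≤ P →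
      ∀ x y, x * y ∈ J i → ∃ s ∉ P, s * x ∈ J i ∨ s * y ∈ J i) :
    ∃ g : Γ(X, U), x ∈ X.basicOpen g ∧ ∀ i,
      ((J i).map (X.presheaf.map (homOfLE (X.basicOpen_le g)).op).hom).IsPrime ∨
      (J i).map (X.presheaf.map (homOfLE (X.basicOpen_le g)).op).hom = ⊤ := by
  obtain ⟨g, hg, h⟩ := exists_forall_isPrime_map_or_eq_top J (hU.primeIdealOf ⟨x, hx⟩).asIdeal
    fun i hi ↦ H i _ inferInstance hi
  refine ⟨g, not_not.mp fun h' ↦ hg ((mem_primeIdealOf_iff hU ⟨x, hx⟩ g).mpr h'), fun i ↦ ?_⟩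
  letI := (X.presheaf.map (homOfLE (X.basicOpen_le g)).op).hom.toAlgebra
  have : IsLocalization.Away g Γ(X, X.basicOpen g) := hU.isLocalization_basicOpen g
  exact h g dvd_rfl hg Γ(X, X.basicOpen g) i

theorem isNoetherianRing_of_isChart {R : Type u} [CommRing R] [IsNoetherianRing R] {ϖ : R}
    {A : Type u} [CommRing A] {ρ : R →+* A} {α β γ : Type} [Fintype α] [Fintype β] [Fintype γ]
    {u : α → A} {v : β → A} {w : γ → A} (H : IsChart ϖ ρ u v w) : IsNoetherianRing A := by
  letI := ρ.toAlgebra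
  have : Algebra.FinitePresentation R A := H.finitePresentation
  exact Algebra.FiniteType.isNoetherianRing R A

end Shrink

/-! ### Smoothness of the components. -/

section Smooth

variable {R : Type u} [CommRing R] [IsLocalRing R]

/-- The maximal ideal of `R` dies locally on `Y`, hence globally, so `Y` is a scheme over the
residue field; smoothness is then local. -/
theorem exists_smooth_of_forall_exists_smooth {Y : Scheme.{u}} (h : Y ⟶ Spec (.of R))
    (H : ∀ y : Y, ∃ V : Y.Opens, IsAffineOpen V ∧ y ∈ V ∧ ∃ κ : ResidueField R →+* Γ(Y, V),
      κ.Smooth ∧ ∀ r, κ (residue R r) = sectionMap h V r) :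
    ∃ g : Y ⟶ Spec (.of (ResidueField R)),
      g ≫ Spec.map (CommRingCat.ofHom (residue R)) = h ∧ Smooth g := by
  have h0 : ∀ r ∈ maximalIdeal R, sectionMap h ⊤ r = 0 := by
    intro r hr
    refine TopCat.Presheaf.section_ext Y.sheaf ⊤ _ _ fun y _ ↦ ?_
    obtain ⟨V, -, hyV, κ, -, hκ⟩ := H y
    have h1 := (toStalk_eq_germ h (U := ⊤) y trivial r).symm.trans (toStalk_eq_germ h y hyV r)
    rw [← hκ, residue_eq_zero_iff r |>.mpr hr, map_zero, map_zero] at h1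
    exact h1.trans (map_zero (Y.presheaf.germ ⊤ y trivial).hom).symm
  let κ₀ : ResidueField R →+* Γ(Y, ⊤) := Ideal.Quotient.lift _ (sectionMap h ⊤) h0
  have hκ₀ : κ₀.comp (residue R) = sectionMap h ⊤ := RingHom.ext fun r ↦ rfl
  have hg : (Y.toSpecΓ ≫ Spec.map (CommRingCat.ofHom κ₀)) ≫
      Spec.map (CommRingCat.ofHom (residue R)) = h := by
    rw [Category.assoc, ← Spec.map_comp, ← CommRingCat.ofHom_comp, hκ₀,
      toSpecΓ_SpecMap_sectionMap]
  refine ⟨Y.toSpecΓ ≫ Spec.map (CommRingCat.ofHom κ₀), hg, ?_⟩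
  refine of_forall_exists_sectionMap @Smooth (fun f _ ↦ inferInstance) _ fun y ↦ ?_
  obtain ⟨V, hV, hyV, κ, hκs, hκ⟩ := H y
  refine ⟨V, hV, hyV, ?_⟩
  convert hκs
  refine RingHom.ext fun x ↦ ?_
  obtain ⟨r, rfl⟩ := residue_surjective x
  rw [hκ, ← RingHom.comp_apply, sectionMap_comp_SpecMap, hg]

theorem isSmoothOverResidueField_of_forall {X : Scheme.{u}} {f : X ⟶ Spec (.of R)}
    {Z : Closeds X} (H : ∀ x ∈ (Z : Set X), ∃ (U : X.Opens) (hU : IsAffineOpen U), x ∈ U ∧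
      ∀ (D : Type u) [CommRing D] (δ : Γ(X, U) →+* D), Function.Surjective δ →
        RingHom.ker δ = (Scheme.IdealSheafData.vanishingIdeal Z).ideal ⟨U, hU⟩ →
        ∃ κ : ResidueField R →+* D, κ.Smooth ∧ ∀ r, κ (residue R r) = δ (sectionMap f U r)) :
    IsSmoothOverResidueField f Z := by
  refine exists_smooth_of_forall_exists_smooth _ fun y ↦ ?_
  let ι := (Scheme.IdealSheafData.vanishingIdeal Z).subschemeι
  have hy : ι y ∈ (Z : Set X) := by
    have h1 : ι y ∈ Set.range ι := ⟨y, rfl⟩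
    rw [Scheme.IdealSheafData.range_subschemeι] at h1
    simpa using h1
  obtain ⟨U, hU, hyU, h⟩ := H _ hy
  obtain ⟨κ, hκ, hκ'⟩ := h _ (ι.app U).hom
    (Scheme.IdealSheafData.subschemeι_app_surjective _ ⟨U, hU⟩)
    (Scheme.IdealSheafData.ker_subschemeι_app _ ⟨U, hU⟩)
  refine ⟨ι ⁻¹ᵁ U, hU.preimage ι, hyU, κ, hκ, fun r ↦ ?_⟩
  rw [hκ', ← appLE_comp_sectionMap f ι (le_refl (ι ⁻¹ᵁ U)), ← Scheme.Hom.app_eq_appLE]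
  rfl

end Smooth

namespace HasStdCharts

variable {R : Type u} [CommRing R] {ϖ : R} {X : Scheme.{u}} {f : X ⟶ Spec (.of R)}

/-- The loci w_c = 0 are smooth over a perfect field, so their local rings are domains, and
shrinking makes each locus irreducible or empty. -/
theorem exists_isStdChart_isPrime [IsLocalRing R] [IsNoetherianRing R]
    (hk : Nonempty X → PerfectField (ResidueField R)) (hϖ : maximalIdeal R = Ideal.span {ϖ})
    (H : HasStdCharts ϖ f) (x : X) :
    ∃ (U : X.Opens) (γ : Type) (_ : Fintype γ) (w : γ → Γ(X, U)), IsAffineOpen U ∧ x ∈ U ∧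
      IsStdChart ϖ (sectionMap f U) w ∧
      ∀ c, (Ideal.span {w c}).IsPrime ∨ Ideal.span {w c} = ⊤ := by
  have := hk ⟨x⟩
  obtain ⟨U, γ, _, w, hU, hx, h⟩ := H x
  have := isNoetherianRing_of_isChart h
  obtain ⟨g, hg, hJ⟩ := exists_basicOpen_isPrime_map hU (fun c ↦ Ideal.span {w c}) hx (by
    intro c P _ hP x y hxy
    obtain ⟨κ, hκ, -⟩ := IsStdChart.exists_smooth_quotient_single h hϖ c
      (δ := Ideal.Quotient.mk (Ideal.span {w c})) Ideal.Quotient.mk_surjective Ideal.mk_ker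
    exact exists_mul_mem_of_smooth_quotient hκ P hP x y hxy)
  let r := (X.presheaf.map (homOfLE (X.basicOpen_le g)).op).hom
  refine ⟨X.basicOpen g, γ, inferInstance, r ∘ w, hU.basicOpen g, hg, ?_, fun c ↦ ?_⟩
  · have := IsChart.map h (smooth_presheaf_map hU (hU.basicOpen g) (X.basicOpen_le g))
    rw [map_comp_sectionMap] at this
    convert this using 1
  · have := hJ c
    rwa [Ideal.map_span, Set.image_singleton] at this

theorem isSmooth_component [IsLocalRing R] [IsNoetherianRing R]
    (hk : Nonempty X → PerfectField (ResidueField R)) (hϖ : maximalIdeal R = Ideal.span {ϖ})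
    (H : HasStdCharts ϖ f) {Z : Closeds X} (hZ : Z ∈ specialComponents f) :
    IsSmoothOverResidueField f Z := by
  refine isSmoothOverResidueField_of_forall fun x hxZ ↦ ?_
  have := hk ⟨x⟩
  obtain ⟨U, γ, _, w, hU, hx, h, hw⟩ := H.exists_isStdChart_isPrime hk hϖ x
  have hs : specialFiber f ∩ U = ⋃ c, X.zeroLocus (U := U) (Ideal.span {w c} : Set Γ(X, U)) ∩ U := by
    ext y
    simp only [Set.mem_inter_iff, Set.mem_iUnion, exists_and_right]
    refine and_congr_left fun hy ↦ ?_
    rw [mem_specialFiber_iff hϖ f hy, ← IsStdChart.prod_eq h, mem_basicOpen_prod _ _ hy]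
    simp [Scheme.zeroLocus_span]
  obtain ⟨c, hc⟩ := specialComponents_inter hU (fun c ↦ Ideal.span {w c}) hw hs hZ ⟨x, hxZ, hx⟩
  obtain ⟨κ, hκ, -⟩ := IsStdChart.exists_smooth_quotient_single h hϖ c
    (δ := Ideal.Quotient.mk (Ideal.span {w c})) Ideal.Quotient.mk_surjective Ideal.mk_ker
  have hI := vanishingIdeal_ideal_eq hU (isRadical_of_smooth_quotient hκ) hc
  refine ⟨U, hU, hx, fun D _ δ hδ hker ↦ ?_⟩
  obtain ⟨κ, hκ, hκ', -⟩ := IsStdChart.exists_smooth_quotient_single h hϖ c hδ (hker.trans hI)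
  exact ⟨κ, hκ, hκ'⟩

theorem isStrictlySemistable [IsLocalRing R] [IsNoetherianRing R]
    (hk : Nonempty X → PerfectField (ResidueField R)) (hϖ : maximalIdeal R = Ideal.span {ϖ})
    (H : HasStdCharts ϖ f) : IsStrictlySemistable ϖ f where
  isSemistableAt _ hP hP' := H.isSemistableAt hk hϖ hP hP'
  isSmooth_component _ hZ := H.isSmooth_component hk hϖ hZ

end HasStdCharts

end SemistableProduct

namespace SemistableProduct

open IsLocalRing

/-! ### The generic fibre and the induction along the blow-ups. -/

section GenericFibre

theorem isInvertibleIdeal_top (X : Scheme.{u}) : IsInvertibleIdeal (⊤ : X.IdealSheafData) := by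
  intro x
  obtain ⟨U, hU, hx, -⟩ := exists_isAffineOpen_mem_and_subset (U := ⊤) (x := x) trivial
  exact ⟨⟨U, hU⟩, hx, 1, one_mem _, by rw [Ideal.span_singleton_one]; rfl⟩

theorem comap_eq_top_of_disjoint {X Y : Scheme.{u}} {I : X.IdealSheafData} (j : Y ⟶ X)
    (h : ∀ y, j y ∉ I.support) : I.comap j = ⊤ := by
  rw [← Scheme.IdealSheafData.support_eq_bot_iff, Scheme.IdealSheafData.support_comap]
  exact Closeds.ext (Set.eq_empty_of_forall_notMem h)

/-- A blow-up is an isomorphism over a scheme that does not meet the centre. -/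
theorem IsBlowup.exists_isPullback {X X' Y : Scheme.{u}} {b : X' ⟶ X} {I : X.IdealSheafData}
    (hb : IsBlowup b I) (j : Y ⟶ X) (h : ∀ y, j y ∉ I.support) :
    ∃ j' : Y ⟶ X', IsPullback j' (𝟙 Y) b j := by
  -- The centre pulls back to the unit ideal, so the universal property applies to every scheme over
  -- `Y`.
  have hinv : ∀ {T : Scheme.{u}} (β : T ⟶ Y), IsInvertibleIdeal (I.comap (β ≫ j)) := by
    intro T β
    rw [comap_eq_top_of_disjoint (β ≫ j) fun t ↦ h (β t)]
    exact isInvertibleIdeal_top T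
  obtain ⟨j', hj', -⟩ := hb.existsUnique_lift j (Category.id_comp j ▸ hinv (𝟙 Y))
  refine ⟨j', ⟨⟨by rw [hj', Category.id_comp]⟩, ⟨PullbackCone.IsLimit.mk _ (fun s ↦ s.snd)
    (fun s ↦ ?_) (fun s ↦ Category.comp_id _) fun s m _ hm ↦ ?_⟩⟩⟩
  · refine (hb.existsUnique_lift (s.snd ≫ j) (hinv s.snd)).unique ?_ s.condition
    rw [Category.assoc, hj']
  · rwa [Category.comp_id] at hm

theorem notMem_specialFiber_of_isPullback {R K : Type u} [CommRing R] [IsLocalRing R] [Field K]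
    [Algebra R K] {ϖ : R} (hϖ : algebraMap R K ϖ ≠ 0) (hϖ' : ϖ ∈ maximalIdeal R)
    {X Y : Scheme.{u}} {f : X ⟶ Spec (.of R)} {c : Y ⟶ Spec (.of K)} {j : Y ⟶ X}
    (h : j ≫ f = c ≫ Spec.map (CommRingCat.ofHom (algebraMap R K))) (y : Y) :
    j y ∉ specialFiber f := by
  intro hy
  have h1 : (j ≫ f) y = closedPoint R := hy
  rw [h] at h1
  have h2 : ϖ ∈ ((Spec.map (CommRingCat.ofHom (algebraMap R K))) (c y)).asIdeal := by
    have h3 : (Spec.map (CommRingCat.ofHom (algebraMap R K))) (c y) = closedPoint R := h1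
    rw [h3]
    exact hϖ'
  have h4 : algebraMap R K ϖ ∈ (c y).asIdeal := h2
  exact (c y).2.ne_top (Ideal.eq_top_of_isUnit_mem _ h4 (isUnit_iff_ne_zero.mpr hϖ))

end GenericFibre

namespace BlowupSequence

variable {R K : Type u} [CommRing R] [IsDomain R] [IsDiscreteValuationRing R]
  [Field K] [Algebra R K] [IsFractionRing R K] {ϖ : R}

/-- The strict transforms in `X i` of the components that have not been blown up yet. -/
def remaining {t : ℕ} (T : BlowupSequence.{u} t) (i : ℕ) : Set (Closeds (T.X i)) :=
  {Z | ∃ j : Fin t, i ≤ j ∧ T.comp i j = Z}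

theorem remaining_eq_insert {t : ℕ} (T : BlowupSequence.{u} t) (i : ℕ) (hi : i + 1 < t) :
    T.remaining i = insert (T.comp i ⟨i, Nat.lt_of_succ_lt hi⟩)
      {Z | ∃ j : Fin t, i < j ∧ T.comp i j = Z} := by
  ext Z
  constructor
  · rintro ⟨j, hj, rfl⟩
    rcases hj.eq_or_lt with h | h
    · left
      congr 1
      exact Fin.ext h.symm
    · exact Or.inr ⟨j, h, rfl⟩
  · rintro (rfl | ⟨j, hj, rfl⟩)
    · exact ⟨_, le_rfl, rfl⟩
    · exact ⟨j, hj.le, rfl⟩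

theorem remaining_succ {t : ℕ} (T : BlowupSequence.{u} t) (i : ℕ) (hi : i + 1 < t) :
    T.remaining (i + 1) = strictTransform (T.b i) (T.comp i ⟨i, Nat.lt_of_succ_lt hi⟩) ''
      {Z | ∃ j : Fin t, i < j ∧ T.comp i j = Z} := by
  ext Z
  constructor
  · rintro ⟨j, hj, rfl⟩
    exact ⟨_, ⟨j, hj, rfl⟩, (T.comp_succ i hi j hj).symm⟩
  · rintro ⟨_, ⟨j, hj, rfl⟩, rfl⟩
    exact ⟨j, hj, T.comp_succ i hi j hj⟩

theorem isAdapted_and_isProper (hϖ : Irreducible ϖ) {t : ℕ} (T : BlowupSequence.{u} t)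
    (f : T.X 0 ⟶ Spec (.of R)) [IsProper f] {Y : Scheme.{u}} {c : Y ⟶ Spec (.of K)}
    (hj : ∃ j, IsPullback j c f (Spec.map (CommRingCat.ofHom (algebraMap R K))))
    (hk : Nonempty (T.X 0) → PerfectField (ResidueField R))
    (H : IsAdapted ϖ f (Set.range (T.comp 0))) (i : ℕ) (hi : i ≤ t - 1) :
    IsAdapted ϖ (T.toBottom i ≫ f) (T.remaining i) ∧ IsProper (T.toBottom i ≫ f) ∧
      ∃ j, IsPullback j c (T.toBottom i ≫ f) (Spec.map (CommRingCat.ofHom (algebraMap R K))) := by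
  induction i with
  | zero =>
    rw [toBottom, Category.id_comp]
    refine ⟨?_, inferInstance, hj⟩
    convert H
    ext Z
    simp [remaining]
  | succ i ih =>
    obtain ⟨h1, h2, j, hj⟩ := ih (by omega)
    have hi' : i + 1 < t := by omega
    have hki : Nonempty (T.X i) → PerfectField (ResidueField R) := fun ⟨x⟩ ↦ hk ⟨T.toBottom i x⟩
    have hb := T.isBlowupAlong i hi'
    have hspec : ∀ x ∈ (T.comp i ⟨i, Nat.lt_of_succ_lt hi'⟩ : Set (T.X i)),
        x ∈ specialFiber (T.toBottom i ≫ f) := by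
      intro x hx
      obtain ⟨U, hxU, -, h⟩ := h1.disjoint_basicOpen (Z := T.comp i ⟨i, Nat.lt_of_succ_lt hi'⟩)
        ⟨_, le_rfl, rfl⟩ hx
      exact (mem_specialFiber_iff hϖ.maximalIdeal_eq _ hxU).mpr h
    rw [T.remaining_eq_insert i hi'] at h1
    have : CompactSpace (T.X i) := QuasiCompact.compactSpace_of_compactSpace (T.toBottom i ≫ f)
    have : IsLocallyNoetherian (T.X i) :=
      LocallyOfFiniteType.isLocallyNoetherian (T.toBottom i ≫ f)
    have hproper : IsProper (T.b i) := (h1.hasBlowupPairs hϖ hki).isProper hb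
    rw [toBottom, Category.assoc, T.remaining_succ i hi']
    refine ⟨h1.blowup hϖ hki hb, inferInstance, ?_⟩
    obtain ⟨j', hj'⟩ := hb.exists_isPullback j fun y hy ↦ by
      rw [← SetLike.mem_coe, Scheme.IdealSheafData.coe_support_vanishingIdeal] at hy
      exact notMem_specialFiber_of_isPullback
        ((IsFractionRing.injective R K).ne_iff' (map_zero _) |>.mpr hϖ.ne_zero)
        (hϖ.maximalIdeal_eq ▸ Ideal.mem_span_singleton_self ϖ) hj.w y
        (hspec _ hy)
    have h3 := hj'.paste_vert hj
    rw [Category.id_comp] at h3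
    exact ⟨j', h3⟩

theorem isModel_and_isStrictlySemistable (hϖ : Irreducible ϖ) {t : ℕ} (T : BlowupSequence.{u} t)
    (f : T.X 0 ⟶ Spec (.of R)) [IsProper f] {Y : Scheme.{u}} {c : Y ⟶ Spec (.of K)}
    (hj : ∃ j, IsPullback j c f (Spec.map (CommRingCat.ofHom (algebraMap R K))))
    (hk : Nonempty (T.X 0) → PerfectField (ResidueField R))
    (H : IsAdapted ϖ f (Set.range (T.comp 0))) :
    IsModel (T.toBottom (t - 1) ≫ f) c ∧ IsStrictlySemistable ϖ (T.toBottom (t - 1) ≫ f) := by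
  obtain ⟨h1, h2, h3⟩ := T.isAdapted_and_isProper hϖ f hj hk H (t - 1) le_rfl
  -- After t - 1 blow-ups the only index left is t - 1, and none is left if t = 0.
  have hs : (T.remaining (t - 1)).Subsingleton := by
    rintro _ ⟨j, hj, rfl⟩ _ ⟨j', hj', rfl⟩
    congr 1
    exact Fin.ext (by omega)
  have h4 := h1.hasStdCharts hϖ.maximalIdeal_eq hs
  exact ⟨⟨h2, h4.flat hϖ, h3⟩,
    h4.isStrictlySemistable (fun ⟨x⟩ ↦ hk ⟨T.toBottom (t - 1) x⟩) hϖ.maximalIdeal_eq⟩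

end BlowupSequence

end SemistableProduct

namespace SemistableProduct

open IsLocalRing

/-! ### Étale charts at closed points of a strictly semistable scheme. -/

section ChartAtPoint

/-- B/J is the local ring of the smooth algebra `D` at a closed point with separable residue field,
and S/JS is its completion, a domain by `isDomain_of_smooth_of_isCompletion`. -/
theorem isPrime_map_of_smooth_quotient {R A B S D : Type u} [CommRing R] [IsLocalRing R]
    [CommRing A] [CommRing B] [IsLocalRing B] [CommRing S] [IsNoetherianRing S] [CommRing D]
    [Algebra A B] [Algebra B S] [Algebra R B] {ρ : R →+* A}
    (hρ : ∀ r, algebraMap A B (ρ r) = algebraMap R B r) (P : Ideal A) [P.IsMaximal]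
    [IsLocalization.AtPrime B P] (hS : IsCompletion (maximalIdeal B) S)
    (hsep : HasSimpleRoots R (ResidueField B)) (hfin : Module.Finite R (ResidueField B))
    {δ : A →+* D} (hδ : Function.Surjective δ) (hker : RingHom.ker δ ≤ P)
    {κ : ResidueField R →+* D} (hκ : κ.Smooth) (hκδ : ∀ r, κ (residue R r) = δ (ρ r)) :
    (((RingHom.ker δ).map (algebraMap A B)).map (algebraMap B S)).IsPrime := by
  let J := (RingHom.ker δ).map (algebraMap A B)
  have hJ : J ≤ maximalIdeal B := (Ideal.map_mono hker).trans
    (IsLocalization.AtPrime.map_eq_maximalIdeal P B).le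
  have hJt : J ≠ ⊤ := fun h ↦ Ideal.IsPrime.ne_top' (top_le_iff.mp (h ▸ hJ))
  have : Nontrivial (B ⧸ J) := Ideal.Quotient.nontrivial_iff.mpr hJt
  have : IsLocalRing (B ⧸ J) := IsLocalRing.of_surjective' _ Ideal.Quotient.mk_surjective
  have h1 := hS.quotient J
  rw [map_maximalIdeal_of_surjective _ Ideal.Quotient.mk_surjective] at h1
  have : (P.map δ).IsMaximal := Ideal.IsMaximal.map_of_surjective_of_ker_le hδ hker
  have hcomap : (P.map δ).comap δ = P := by
    rw [Ideal.comap_map_of_surjective' _ hδ, sup_eq_left.mpr hker]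
  let g : D →+* B ⧸ J := RingHom.liftOfSurjective δ hδ
    ⟨(Ideal.Quotient.mk J).comp (algebraMap A B), fun a ha ↦ by
      rw [RingHom.mem_ker, RingHom.comp_apply, Ideal.Quotient.eq_zero_iff_mem]
      exact Ideal.mem_map_of_mem _ ha⟩
  have hg : ∀ a, g (δ a) = Ideal.Quotient.mk J (algebraMap A B a) :=
    fun a ↦ RingHom.liftOfSurjective_comp_apply ..
  letI := g.toAlgebra
  letI := κ.toAlgebra
  have : Algebra.Smooth (ResidueField R) D := hκ
  have hM : P.primeCompl.map (δ : A →* D) = (P.map δ).primeCompl := by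
    ext d
    constructor
    · rintro ⟨a, ha, rfl⟩ h
      exact ha (hcomap.le h)
    · intro hd
      obtain ⟨a, rfl⟩ := hδ d
      exact ⟨a, fun ha ↦ hd (Ideal.mem_map_of_mem _ ha), rfl⟩
  have hloc : IsLocalization.AtPrime (B ⧸ J) (P.map δ) := by
    have := IsLocalization.of_surjective (M := P.primeCompl) (S := B) δ hδ (Ideal.Quotient.mk J)
      Ideal.Quotient.mk_surjective (RingHom.ext fun a ↦ (hg a).symm) (Ideal.mk_ker.le)
    rw [IsLocalization.AtPrime, ← hM]
    exact this
  obtain ⟨b, hb, hb'⟩ := residueField_quotient_bijective (B := B) P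
  let b' : A ⧸ P →+* D ⧸ P.map δ := Ideal.quotientMap _ δ Ideal.le_comap_map
  have hb'' : Function.Bijective b' := ⟨Ideal.quotientMap_injective' hcomap.le,
    Ideal.quotientMap_surjective hδ⟩
  let e : ResidueField B ≃+* D ⧸ P.map δ :=
    (RingEquiv.ofBijective b hb).symm.trans (RingEquiv.ofBijective b' hb'')
  have he : ∀ r, e (algebraMap R (ResidueField B) r) =
      algebraMap (ResidueField R) (D ⧸ P.map δ) (residue R r) := by
    intro r
    have : algebraMap R (ResidueField B) r = b (Ideal.Quotient.mk P (ρ r)) := by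
      rw [hb', hρ]
      rfl
    rw [this]
    change b' ((RingEquiv.ofBijective b hb).symm (RingEquiv.ofBijective b hb _)) = _
    rw [RingEquiv.symm_apply_apply]
    change Ideal.Quotient.mk (P.map δ) (δ (ρ r)) = Ideal.Quotient.mk (P.map δ) (κ (residue R r))
    rw [hκδ]
  have hfin' : Module.Finite (ResidueField R) (D ⧸ P.map δ) := by
    have h2 : (algebraMap (ResidueField R) (D ⧸ P.map δ)).Finite := by
      refine RingHom.Finite.of_comp_finite (f := residue R) ?_
      have h3 : (algebraMap (ResidueField R) (D ⧸ P.map δ)).comp (residue R) =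
          (e : ResidueField B →+* D ⧸ P.map δ).comp (algebraMap R (ResidueField B)) :=
        RingHom.ext fun r ↦ (he r).symm
      rw [h3]
      exact (RingHom.Finite.of_surjective _ e.surjective).comp (RingHom.finite_algebraMap.mpr hfin)
    exact RingHom.finite_algebraMap.mp h2
  have := isDomain_of_smooth_of_isCompletion (k := ResidueField R) (B := B ⧸ J) (P.map δ)
    (hsep.of_ringHom (residue R) (e : ResidueField B →+* D ⧸ P.map δ) e.bijective he) h1
  exact Ideal.Quotient.isDomain_iff_prime _ |>.mp this

/-- One element clears the denominators of the finitely many coordinates, and a second one makes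
their relation hold. -/
theorem StdPoly.exists_lift_away {R A B : Type u} [CommRing R] [CommRing A] [CommRing B]
    [Algebra R A] [Algebra A B] [Algebra R B] [IsScalarTower R A B] (P : Ideal A) [P.IsPrime]
    [IsLocalization.AtPrime B P] {ϖ : R} {n t : ℕ} (h : StdPoly ϖ n t →ₐ[R] B) :
    ∃ g ∉ P, ∀ (A' : Type u) [CommRing A'] [Algebra A A'] [IsLocalization.Away g A']
      [Algebra A' B] [IsScalarTower A A' B], ∃ h' : StdPoly ϖ n t →+* A',
      (algebraMap A' B).comp h' = h.toRingHom ∧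
        ∀ r, h' (algebraMap R _ r) = algebraMap A A' (algebraMap R A r) := by
  obtain ⟨⟨s, hs⟩, hsz⟩ := IsLocalization.exist_integer_multiples_of_finite P.primeCompl
    fun i ↦ h (StdPoly.x ϖ n t i)
  choose a ha using hsz
  have ha' : ∀ i, algebraMap A B (a i) = algebraMap A B s * h (StdPoly.x ϖ n t i) := fun i ↦ by
    rw [ha, Algebra.smul_def]
  let T := Finset.univ.filter (fun i : Fin n ↦ (i : ℕ) < t)
  have hE : algebraMap A B (∏ i ∈ T, a i) =
      algebraMap A B ((∏ _i ∈ T, s) * algebraMap R A ϖ) := by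
    have h1 : ∏ i ∈ T, h (StdPoly.x ϖ n t i) = algebraMap R B ϖ := by
      rw [← map_prod, StdPoly.prod_x, AlgHom.commutes]
    rw [map_prod, map_mul, map_prod, ← IsScalarTower.algebraMap_apply,
      Finset.prod_congr rfl fun i _ ↦ ha' i, Finset.prod_mul_distrib, h1]
  obtain ⟨⟨s', hs'⟩, hss⟩ := (IsLocalization.eq_iff_exists P.primeCompl B).mp hE
  refine ⟨s * s', fun hmem ↦ (Ideal.IsPrime.mem_or_mem ‹_› hmem).elim hs hs', ?_⟩
  intro A' _ _ _ _ _
  have hu := IsLocalization.Away.algebraMap_isUnit (S := A') (s * s')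
  rw [map_mul, IsUnit.mul_iff] at hu
  obtain ⟨⟨w, hw⟩, hu'⟩ := hu
  letI := ((algebraMap A A').comp (algebraMap R A)).toAlgebra
  have hR : ∀ r, algebraMap R A' r = algebraMap A A' (algebraMap R A r) := fun _ ↦ rfl
  let z : Fin n → A' := fun i ↦ algebraMap A A' (a i) * ↑w⁻¹
  have hz : ∏ i ∈ T, z i = algebraMap R A' ϖ := by
    have h2 := congr_arg (algebraMap A A') hss
    simp only [map_mul] at h2
    have h3 := hu'.mul_left_cancel h2
    rw [Finset.prod_mul_distrib, ← map_prod, h3, map_prod, ← hw, mul_right_comm,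
      ← Finset.prod_mul_distrib]
    simp [hR]
  refine ⟨(StdPoly.lift z hz).toRingHom, ?_, fun r ↦ (StdPoly.lift z hz).commutes r⟩
  refine Ideal.Quotient.ringHom_ext (MvPolynomial.ringHom_ext (fun r ↦ ?_) fun i ↦ ?_)
  · change algebraMap A' B (StdPoly.lift z hz (algebraMap R _ r)) = h (algebraMap R _ r)
    rw [AlgHom.commutes, AlgHom.commutes, hR, ← IsScalarTower.algebraMap_apply,
      ← IsScalarTower.algebraMap_apply]
  · change algebraMap A' B (StdPoly.lift z hz (StdPoly.x ϖ n t i)) = h (StdPoly.x ϖ n t i)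
    rw [StdPoly.lift_x, map_mul, ← IsScalarTower.algebraMap_apply, ha',
      IsScalarTower.algebraMap_apply A A' B s, ← hw, mul_right_comm, ← map_mul, Units.mul_inv,
      map_one, one_mul]

theorem StdPoly.exists_etale_away {R A B : Type u} [CommRing R] [IsLocalRing R]
    [IsNoetherianRing R] [CommRing A] [CommRing B] [IsLocalRing B]
    [Algebra R A] [Algebra.FiniteType R A] [Algebra A B] [Algebra R B] [IsScalarTower R A B]
    (q : Ideal A) [q.IsPrime] [IsLocalization.AtPrime B q] {ϖ : R} {n t : ℕ}
    (hϖ : maximalIdeal R = Ideal.span {ϖ}) (ht : 1 ≤ t) (htn : t ≤ n)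
    (hsep : HasSimpleRoots R (ResidueField B)) (h : StdPoly ϖ n t →ₐ[R] A)
    (hflat : ((algebraMap A B).comp h.toRingHom).Flat)
    (hmap : (StdPoly.origin ϖ n t).map ((algebraMap A B).comp h.toRingHom) = maximalIdeal B) :
    ∃ g ∉ q, ∀ (A' : Type u) [CommRing A'] [Algebra A A'] [IsLocalization.Away g A'],
      ((algebraMap A A').comp h.toRingHom).Etale := by
  have hmax := StdPoly.isMaximal_origin ϖ n t hϖ ht htn
  let e : B ≃ₐ[A] Localization.AtPrime q := IsLocalization.algEquiv q.primeCompl _ _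
  letI := h.toRingHom.toAlgebra
  have hA : Algebra.FinitePresentation R A := Algebra.FinitePresentation.of_finiteType.mp ‹_›
  have : Algebra.FinitePresentation (StdPoly ϖ n t) A := by
    refine RingHom.FinitePresentation.of_comp_finiteType (algebraMap R (StdPoly ϖ n t))
      (g := h.toRingHom) ?_ ?_
    · rw [AlgHom.toRingHom_eq_coe, AlgHom.comp_algebraMap]
      exact RingHom.finitePresentation_algebraMap.mpr hA
    · exact RingHom.finiteType_algebraMap.mpr inferInstance
  have halg : algebraMap (StdPoly ϖ n t) (Localization.AtPrime q) =
      (e : B →+* Localization.AtPrime q).comp ((algebraMap A B).comp h.toRingHom) := by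
    rw [IsScalarTower.algebraMap_eq (StdPoly ϖ n t) A]
    exact RingHom.ext fun x ↦ (e.commutes _).symm
  have hfl : Module.Flat (StdPoly ϖ n t) (Localization.AtPrime q) := by
    rw [← RingHom.flat_algebraMap_iff, halg]
    exact hflat.comp (RingHom.Flat.of_bijective e.bijective)
  have hmap' : (StdPoly.origin ϖ n t).map
      (algebraMap (StdPoly ϖ n t) (Localization.AtPrime q)) = maximalIdeal _ := by
    rw [halg, ← Ideal.map_map, hmap]
    exact map_maximalIdeal_of_surjective _ e.surjective
  have hlies : q.LiesOver (StdPoly.origin ϖ n t) := by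
    refine ⟨hmax.eq_of_le Ideal.IsPrime.ne_top' fun x hx ↦ ?_⟩
    have h1 := Ideal.mem_map_of_mem
      (algebraMap (StdPoly ϖ n t) (Localization.AtPrime q)) hx
    rw [hmap', IsScalarTower.algebraMap_apply (StdPoly ϖ n t) A,
      IsLocalization.AtPrime.to_map_mem_maximal_iff _ q] at h1
    exact h1
  have hE := isEtaleAt_of_flat q (StdPoly.origin ϖ n t) hmap'
    (hsep.of_ringHom (algebraMap R _) (ResidueField.map (e : B →+* Localization.AtPrime q))
      ((ResidueField.mapEquiv e.toRingEquiv).bijective) fun r ↦ by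
        change residue _ (e (algebraMap R B r)) =
          residue _ (algebraMap (StdPoly ϖ n t) _ (algebraMap R _ r))
        congr 1
        rw [IsScalarTower.algebraMap_apply R A B, AlgEquiv.commutes,
          IsScalarTower.algebraMap_apply (StdPoly ϖ n t) A]
        exact congr_arg _ (h.commutes r).symm)
  obtain ⟨g, hg, hgE⟩ := Algebra.exists_etale_of_isEtaleAt (R := StdPoly ϖ n t) q
  refine ⟨g, hg, fun A' _ _ _ ↦ ?_⟩
  let e' : Localization.Away g ≃ₐ[A] A' := IsLocalization.algEquiv (Submonoid.powers g) _ _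
  have h3 : (algebraMap (StdPoly ϖ n t) (Localization.Away g)).Etale :=
    RingHom.etale_algebraMap.mpr hgE
  have h4 := RingHom.Etale.stableUnderComposition _ (e' : Localization.Away g →+* A') h3
    (RingHom.Etale.of_bijective e'.bijective)
  convert h4 using 1
  rw [IsScalarTower.algebraMap_eq (StdPoly ϖ n t) A]
  exact RingHom.ext fun x ↦ (e'.commutes _).symm

end ChartAtPoint

end SemistableProduct

namespace SemistableProduct

open IsLocalRing

section ChartAtPoint

variable {R : Type u} [CommRing R] {X : Scheme.{u}} {f : X ⟶ Spec (.of R)} {U : X.Opens}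

theorem sectionMap_of_hasRingHomProperty (P : MorphismProperty Scheme.{u})
    {Q : ∀ {R S : Type u} [CommRing R] [CommRing S], (R →+* S) → Prop} [HasRingHomProperty P Q]
    [P.IsStableUnderComposition] (hP : ∀ {X Y : Scheme.{u}} (f : X ⟶ Y) [IsOpenImmersion f], P f)
    (hU : IsAffineOpen U) (hf : P f) : Q (sectionMap f U) := by
  have h1 : P (Spec.map (CommRingCat.ofHom (sectionMap f U))) := by
    rw [SpecMap_sectionMap f hU]
    exact P.comp_mem _ _ (hP _) hf
  exact HasRingHomProperty.Spec_iff.mp h1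

theorem fromSpec_specializes_iff (hU : IsAffineOpen U) (y z : Spec Γ(X, U)) :
    hU.fromSpec y ⤳ hU.fromSpec z ↔ y.asIdeal ≤ z.asIdeal := by
  rw [hU.fromSpec.isOpenEmbedding.isInducing.specializes_iff]
  exact (PrimeSpectrum.le_iff_specializes _ _).symm

theorem specializes_iff_primeIdealOf_le (hU : IsAffineOpen U) (y z : U) :
    y.1 ⤳ z.1 ↔ (hU.primeIdealOf y).asIdeal ≤ (hU.primeIdealOf z).asIdeal :=
  (Iff.of_eq (congr_arg₂ (· ⤳ ·) (hU.fromSpec_primeIdealOf y)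
    (hU.fromSpec_primeIdealOf z))).symm.trans (fromSpec_specializes_iff hU _ _)

theorem closure_singleton_inter (hU : IsAffineOpen U) (y : U) :
    closure {y.1} ∩ (U : Set X) =
      X.zeroLocus (U := U) ((hU.primeIdealOf y).asIdeal : Set Γ(X, U)) ∩ U := by
  ext z
  refine and_congr_left fun hz ↦ ?_
  rw [← specializes_iff_mem_closure, specializes_iff_primeIdealOf_le hU y ⟨z, hz⟩,
    Scheme.mem_zeroLocus_iff]
  exact forall₂_congr fun a _ ↦ mem_primeIdealOf_iff hU ⟨z, hz⟩ a

theorem primeIdealOf_fromSpec (hU : IsAffineOpen U) (y : Spec Γ(X, U)) (h : hU.fromSpec y ∈ U) :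
    hU.primeIdealOf ⟨hU.fromSpec y, h⟩ = y :=
  hU.fromSpec.isOpenEmbedding.injective (hU.fromSpec_primeIdealOf _)

/-- The point of `p` lies on some component, whose generic point is a prime contained in `p` and
containing `ϖ`; minimality makes them equal. -/
theorem exists_specialComponents_ideal_eq [IsLocalRing R]
    {ϖ : R} (hϖ : maximalIdeal R = Ideal.span {ϖ}) (hU : IsAffineOpen U) (p : Ideal Γ(X, U))
    (hp : p ∈ (Ideal.span {sectionMap f U ϖ}).minimalPrimes) :
    ∃ Z ∈ specialComponents f,
      (Scheme.IdealSheafData.vanishingIdeal Z).ideal ⟨U, hU⟩ = p := by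
  have hprime : p.IsPrime := hp.1.1
  have hmem : ∀ y : Spec Γ(X, U), hU.fromSpec y ∈ specialFiber f ↔ sectionMap f U ϖ ∈ y.asIdeal := by
    intro y
    have hy : hU.fromSpec y ∈ U := hU.range_fromSpec.le ⟨y, rfl⟩
    rw [mem_specialFiber_iff hϖ f hy, ← mem_primeIdealOf_iff hU ⟨_, hy⟩, primeIdealOf_fromSpec]
  let ξ : Spec Γ(X, U) := ⟨p, hprime⟩
  have hξ : hU.fromSpec ξ ∈ specialFiber f :=
    (hmem ξ).mpr ((Ideal.span_singleton_le_iff_mem _).mp hp.1.2)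
  have hξU : hU.fromSpec ξ ∈ U := hU.range_fromSpec.le ⟨ξ, rfl⟩
  obtain ⟨Z, hZ, hξZ⟩ := exists_specialComponents_of_isIrreducible (f := f)
    (isIrreducible_singleton (x := hU.fromSpec ξ)) (Set.singleton_subset_iff.mpr hξ)
  have hξZ' : hU.fromSpec ξ ∈ (Z : Set X) := hξZ rfl
  obtain ⟨z, hz⟩ := QuasiSober.sober hZ.1.1 Z.isClosed
  have hzU : z ∈ (U : Set X) := (hz.mem_open_set_iff U.2).mpr ⟨_, hξZ', hξU⟩
  have h1 := closure_singleton_inter hU ⟨z, hzU⟩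
  rw [show closure {z} = (Z : Set X) from hz.def] at h1
  have hle : (hU.primeIdealOf ⟨z, hzU⟩).asIdeal ≤ p := by
    have h2 := (specializes_iff_primeIdealOf_le hU ⟨z, hzU⟩ ⟨_, hξU⟩).mp
      (specializes_iff_mem_closure.mpr (hz.def.ge hξZ'))
    rwa [primeIdealOf_fromSpec] at h2
  have hϖz : sectionMap f U ϖ ∈ (hU.primeIdealOf ⟨z, hzU⟩).asIdeal :=
    (mem_primeIdealOf_iff hU ⟨z, hzU⟩ _).mpr
      ((mem_specialFiber_iff hϖ f hzU).mp (hZ.1.2 hz.mem))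
  have heq : (hU.primeIdealOf ⟨z, hzU⟩).asIdeal = p := le_antisymm hle
    (hp.2 ⟨inferInstance, (Ideal.span_singleton_le_iff_mem _).mpr hϖz⟩ hle)
  rw [heq] at h1
  exact ⟨Z, hZ, vanishingIdeal_ideal_eq hU hprime.isRadical h1⟩

theorem exists_smooth_quotient_of_isSmoothOverResidueField [IsLocalRing R] (hU : IsAffineOpen U)
    {Z : Closeds X} (hZ : IsSmoothOverResidueField f Z) :
    ∃ (D : Type u) (_ : CommRing D) (δ : Γ(X, U) →+* D) (κ : ResidueField R →+* D),
      Function.Surjective δ ∧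
      RingHom.ker δ = (Scheme.IdealSheafData.vanishingIdeal Z).ideal ⟨U, hU⟩ ∧ κ.Smooth ∧
      ∀ r, κ (residue R r) = δ (sectionMap f U r) := by
  obtain ⟨g, hg, hs⟩ := hZ
  let ι := (Scheme.IdealSheafData.vanishingIdeal Z).subschemeι
  refine ⟨_, inferInstance, (ι.app U).hom, sectionMap g (ι ⁻¹ᵁ U),
    Scheme.IdealSheafData.subschemeι_app_surjective _ ⟨U, hU⟩,
    Scheme.IdealSheafData.ker_subschemeι_app _ ⟨U, hU⟩,
    sectionMap_of_hasRingHomProperty @Smooth (fun f _ ↦ inferInstance) (hU.preimage ι) hs,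
    fun r ↦ ?_⟩
  rw [← RingHom.comp_apply, sectionMap_comp_SpecMap, hg,
    ← appLE_comp_sectionMap f ι (le_refl (ι ⁻¹ᵁ U)), ← Scheme.Hom.app_eq_appLE]
  rfl

/-- Verifies the hypothesis `H` of `exists_flat_chart`: smoothness of the components keeps them
irreducible in the completion. -/
theorem isPrime_map_of_mem_minimalPrimes [IsLocalRing R] {ϖ : R}
    (hϖ : maximalIdeal R = Ideal.span {ϖ}) (hU : IsAffineOpen U)
    (hsm : ∀ Z ∈ specialComponents f, IsSmoothOverResidueField f Z)
    {B S : Type u} [CommRing B] [IsLocalRing B] [CommRing S] [IsNoetherianRing S]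
    [Algebra Γ(X, U) B] [Algebra B S] [Algebra R B]
    (hρ : ∀ r, algebraMap Γ(X, U) B (sectionMap f U r) = algebraMap R B r) (P : Ideal Γ(X, U))
    [P.IsMaximal] [IsLocalization.AtPrime B P] (hS : IsCompletion (maximalIdeal B) S)
    (hsep : HasSimpleRoots R (ResidueField B)) (hfin : Module.Finite R (ResidueField B))
    (p : Ideal B) (hp : p ∈ (Ideal.span {algebraMap R B ϖ}).minimalPrimes) :
    (p.map (algebraMap B S)).IsPrime := by
  have hprime : p.IsPrime := hp.1.1
  have hspan : Ideal.span {algebraMap R B ϖ} =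
      (Ideal.span {sectionMap f U ϖ}).map (algebraMap Γ(X, U) B) := by
    rw [Ideal.map_span, Set.image_singleton, hρ]
  have hp' : p.comap (algebraMap Γ(X, U) B) ∈ (Ideal.span {sectionMap f U ϖ}).minimalPrimes := by
    rw [hspan, IsLocalization.minimalPrimes_map P.primeCompl] at hp
    exact hp
  obtain ⟨Z, hZ, hI⟩ := exists_specialComponents_ideal_eq hϖ hU _ hp'
  obtain ⟨D, _, δ, κ, hδ, hker, hκ, hκδ⟩ :=
    exists_smooth_quotient_of_isSmoothOverResidueField hU (hsm Z hZ)
  rw [hI] at hker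
  have h1 := isPrime_map_of_smooth_quotient hρ P hS hsep hfin hδ (hker.le.trans fun a ha ↦
    (IsLocalization.AtPrime.to_map_mem_maximal_iff B P a).mp
      (le_maximalIdeal hprime.ne_top ha)) hκ hκδ
  rw [hker] at h1
  have h2 : (p.comap (algebraMap Γ(X, U) B)).map (algebraMap Γ(X, U) B) = p :=
    IsLocalization.map_under P.primeCompl B p
  rwa [h2] at h1

theorem IsSemistableAt.residueField [IsLocalRing R] [IsNoetherianRing R] {ϖ : R}
    (hϖ : maximalIdeal R = Ideal.span {ϖ}) [LocallyOfFiniteType f] {x : X}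
    (h : IsSemistableAt ϖ f x) [Algebra R (X.presheaf.stalk x)]
    (hR : algebraMap R (X.presheaf.stalk x) = toStalk f x) :
    HasSimpleRoots R (ResidueField (X.presheaf.stalk x)) ∧
      Module.Finite R (ResidueField (X.presheaf.stalk x)) := by
  have : IsLocallyNoetherian X := LocallyOfFiniteType.isLocallyNoetherian f
  obtain ⟨n, t, φ, ht, htn, hfin, het, hφ⟩ := h
  letI := φ.toAlgebra
  have : Module.Finite (StdRing ϖ n t) (CompletedStalk x) := hfin
  have : Algebra.Etale (StdRing ϖ n t) (CompletedStalk x) := het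
  exact residueField_of_formalChart (S := CompletedStalk x) hϖ ht htn
    (IsCompletion.adicCompletion _ (IsNoetherian.noetherian _)) fun r ↦ by
      rw [hR]
      exact hφ r

/-- The map of `exists_flat_chart` into the local ring is spread out twice: over D(g) its
coordinates become sections, and over a smaller D(g') it becomes étale. -/
theorem IsSemistableAt.exists_etale_chart [IsLocalRing R] [IsNoetherianRing R] {ϖ : R}
    (hϖ : maximalIdeal R = Ideal.span {ϖ}) [LocallyOfFiniteType f] {x : X} (hx : IsClosed {x})
    (h : IsSemistableAt ϖ f x)
    (hsm : ∀ Z ∈ specialComponents f, IsSmoothOverResidueField f Z) :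
    ∃ (n t : ℕ) (V : X.Opens) (h : StdPoly ϖ n t →+* Γ(X, V)), 1 ≤ t ∧ t ≤ n ∧
      IsAffineOpen V ∧ x ∈ V ∧ h.Etale ∧ h.comp (algebraMap R _) = sectionMap f V := by
  have : IsLocallyNoetherian X := LocallyOfFiniteType.isLocallyNoetherian f
  let B := X.presheaf.stalk x
  letI : Algebra R B := (toStalk f x).toAlgebra
  obtain ⟨hsep, hfinκ⟩ := h.residueField hϖ (x := x) rfl
  obtain ⟨n, t, φ, ht, htn, hfin, het, hφ⟩ := h
  letI := φ.toAlgebra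
  have : Module.Finite (StdRing ϖ n t) (CompletedStalk x) := hfin
  have : Algebra.Etale (StdRing ϖ n t) (CompletedStalk x) := het
  have : IsNoetherianRing (StdRing ϖ n t) := inferInstance
  have : IsNoetherianRing (CompletedStalk x) := IsNoetherianRing.of_finite (StdRing ϖ n t) _
  have hS : IsCompletion (maximalIdeal B) (CompletedStalk x) :=
    IsCompletion.adicCompletion _ (IsNoetherian.noetherian _)
  obtain ⟨U, hU, hxU, -⟩ := exists_isAffineOpen_mem_and_subset (U := ⊤) (x := x) trivial
  letI : Algebra R Γ(X, U) := (sectionMap f U).toAlgebra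
  letI : Algebra Γ(X, U) B := X.presheaf.algebra_section_stalk ⟨x, hxU⟩
  have : IsScalarTower R Γ(X, U) B := IsScalarTower.of_algebraMap_eq (toStalk_eq_germ f x hxU)
  have : IsLocalization.AtPrime B (hU.primeIdealOf ⟨x, hxU⟩).asIdeal :=
    hU.isLocalization_stalk ⟨x, hxU⟩
  have := hU.primeIdealOf_isMaximal_of_isClosed ⟨x, hxU⟩ hx
  have hC : ∀ r, algebraMap (StdPoly ϖ n t) (StdRing ϖ n t) (algebraMap R _ r) =
      Ideal.Quotient.mk _ (MvPowerSeries.C r) := fun r ↦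
    (StdPoly.algebraMap_mk ϖ n t (MvPolynomial.C r)).trans (by rw [MvPolynomial.coe_C])
  obtain ⟨h, hflat, hmap⟩ := exists_flat_chart (R := R) (B := B) (D := StdRing ϖ n t)
    hϖ ht htn (isCompletion_stdRing ϖ n t) hS
    (fun r ↦ (congr_arg φ (hC r)).trans (hφ r)) fun p hp ↦
      isPrime_map_of_mem_minimalPrimes hϖ hU hsm
        (fun r ↦ (IsScalarTower.algebraMap_apply R Γ(X, U) B r).symm)
        (hU.primeIdealOf ⟨x, hxU⟩).asIdeal hS hsep hfinκ p hp
  obtain ⟨g, hg, H⟩ := StdPoly.exists_lift_away (hU.primeIdealOf ⟨x, hxU⟩).asIdeal h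
  have hxV : x ∈ X.basicOpen g :=
    not_not.mp fun h' ↦ hg ((mem_primeIdealOf_iff hU ⟨x, hxU⟩ g).mpr h')
  have hV : IsAffineOpen (X.basicOpen g) := hU.basicOpen g
  letI : Algebra R Γ(X, X.basicOpen g) := (sectionMap f (X.basicOpen g)).toAlgebra
  letI : Algebra Γ(X, X.basicOpen g) B := X.presheaf.algebra_section_stalk ⟨x, hxV⟩
  letI : Algebra Γ(X, U) Γ(X, X.basicOpen g) :=
    (X.presheaf.map (homOfLE (X.basicOpen_le g)).op).hom.toAlgebra
  have : IsScalarTower R Γ(X, X.basicOpen g) B :=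
    IsScalarTower.of_algebraMap_eq (toStalk_eq_germ f x hxV)
  have : IsScalarTower Γ(X, U) Γ(X, X.basicOpen g) B := IsScalarTower.of_algebraMap_eq fun a ↦
    (X.presheaf.germ_res_apply (homOfLE (X.basicOpen_le g)) x hxV a).symm
  have : IsLocalization.Away g Γ(X, X.basicOpen g) := hU.isLocalization_basicOpen g
  have : IsLocalization.AtPrime B (hV.primeIdealOf ⟨x, hxV⟩).asIdeal :=
    hV.isLocalization_stalk ⟨x, hxV⟩
  obtain ⟨h', hh', hR'⟩ := H Γ(X, X.basicOpen g)
  have : Algebra.FiniteType R Γ(X, X.basicOpen g) := sectionMap_of_hasRingHomProperty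
    @LocallyOfFiniteType (fun f _ ↦ inferInstance) hV ‹_›
  have hres : ∀ r, algebraMap Γ(X, U) Γ(X, X.basicOpen g) (sectionMap f U r) =
      sectionMap f (X.basicOpen g) r :=
    fun r ↦ congr_arg (fun ψ : R →+* Γ(X, X.basicOpen g) ↦ ψ r)
      (map_comp_sectionMap f (X.basicOpen_le g))
  let h'' : StdPoly ϖ n t →ₐ[R] Γ(X, X.basicOpen g) :=
    { h' with commutes' := fun r ↦ (hR' r).trans (hres r) }
  have hh'' : (algebraMap Γ(X, X.basicOpen g) B).comp h''.toRingHom = h.toRingHom := hh'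
  obtain ⟨g', hg', H'⟩ := StdPoly.exists_etale_away (B := B) (hV.primeIdealOf ⟨x, hxV⟩).asIdeal
    hϖ ht htn hsep h'' (hh'' ▸ hflat) (hh'' ▸ hmap)
  letI : Algebra Γ(X, X.basicOpen g) Γ(X, X.basicOpen g') :=
    (X.presheaf.map (homOfLE (X.basicOpen_le g')).op).hom.toAlgebra
  have : IsLocalization.Away g' Γ(X, X.basicOpen g') := hV.isLocalization_basicOpen g'
  refine ⟨n, t, X.basicOpen g', _, ht, htn, hV.basicOpen g',
    not_not.mp fun h' ↦ hg' ((mem_primeIdealOf_iff hV ⟨x, hxV⟩ g').mpr h'),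
    H' Γ(X, X.basicOpen g'), ?_⟩
  rw [RingHom.comp_assoc, ← map_comp_sectionMap f (X.basicOpen_le g')]
  congr 1
  exact RingHom.ext fun r ↦ h''.commutes r

end ChartAtPoint

end SemistableProduct

namespace SemistableProduct

open IsLocalRing

/-! ### Points of an étale chart with prescribed p-th roots. -/

section Perfect

theorem isMaximal_ker_of_isIntegral_comp {R A κ : Type*} [CommRing R] [CommRing A] [CommRing κ]
    [IsDomain κ] [IsLocalRing R] (ρ : R →+* A) (φ : A →+* κ)
    (hρ : ∀ r ∈ maximalIdeal R, φ (ρ r) = 0) (hint : (φ.comp ρ).IsIntegral) :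
    (RingHom.ker φ).IsMaximal ∧ ((Ideal.Quotient.mk (RingHom.ker φ)).comp ρ).IsIntegral := by
  have h1 : ((Ideal.Quotient.mk (RingHom.ker φ)).comp ρ).IsIntegral := by
    intro a
    obtain ⟨a, rfl⟩ := Ideal.Quotient.mk_surjective a
    obtain ⟨F, hF, hF'⟩ := hint (φ a)
    refine ⟨F, hF, ?_⟩
    rw [← Polynomial.hom_eval₂] at hF' ⊢
    exact Ideal.Quotient.eq_zero_iff_mem.mpr hF'
  have hprime : (RingHom.ker φ).IsPrime := RingHom.ker_isPrime φ
  refine ⟨?_, h1⟩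
  letI := ((Ideal.Quotient.mk (RingHom.ker φ)).comp ρ).toAlgebra
  have : Algebra.IsIntegral R (A ⧸ RingHom.ker φ) := ⟨h1⟩
  rw [Ideal.Quotient.maximal_ideal_iff_isField_quotient, Ring.isField_iff_maximal_bot]
  refine Ideal.isMaximal_of_isIntegral_of_isMaximal_comap (R := R) _ ?_
  have h2 : maximalIdeal R ≤ (⊥ : Ideal (A ⧸ RingHom.ker φ)).comap (algebraMap R _) :=
    fun r hr ↦ Ideal.Quotient.eq_zero_iff_mem.mpr (hρ r hr)
  rw [← (maximalIdeal.isMaximal R).eq_of_le (Ideal.IsPrime.ne_top inferInstance) h2]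
  exact maximalIdeal.isMaximal R

variable {R : Type u} [CommRing R] [IsLocalRing R] {ϖ : R} {n t : ℕ}

/-- The special fibre of the model contains the affine space x_i = 0, of dimension n - 1 ≥ 1, and
the étale chart covers a non-empty open part of it. As k is infinite, this part has a point at which
another coordinate x_j differs from a p-th root of r by an element of k; the point lifts to the
chart. -/
theorem exists_isMaximal_pow_sub_mem_of_etale (hϖ : maximalIdeal R = Ideal.span {ϖ})
    (hn : 2 ≤ n) {A : Type u} [CommRing A]
    (h : StdPoly ϖ n t →+* A) (hE : h.Etale) (P : Ideal A) [hP : P.IsPrime]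
    (hϖP : h (algebraMap R _ ϖ) ∈ P) [Infinite (ResidueField R)] (p : ℕ) (hp : 0 < p) (r : R) :
    ∃ Q : Ideal A, Q.IsMaximal ∧ h (algebraMap R _ ϖ) ∈ Q ∧
      ((Ideal.Quotient.mk Q).comp (h.comp (algebraMap R _))).IsIntegral ∧
      ∃ β : A, β ^ p - h (algebraMap R _ r) ∈ Q := by
  classical
  let k := ResidueField R
  let L := AlgebraicClosure k
  let F := StdPoly ϖ n t
  let χ : R →+* L := (algebraMap k L).comp (residue R)
  have hχ : ∀ a ∈ maximalIdeal R, χ a = 0 := fun a ha ↦ by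
    change algebraMap k L (residue R a) = 0
    rw [(residue_eq_zero_iff a).mpr ha, map_zero]
  have hϖm : ϖ ∈ maximalIdeal R := hϖ ▸ Ideal.mem_span_singleton_self ϖ
  obtain ⟨i, hit, hi⟩ : ∃ i : Fin n, (i : ℕ) < t ∧ h (StdPoly.x ϖ n t i) ∈ P := by
    rw [← StdPoly.prod_x, map_prod, hP.prod_mem_iff] at hϖP
    obtain ⟨i, hi, hi'⟩ := hϖP
    exact ⟨i, (Finset.mem_filter.mp hi).2, hi'⟩
  have : Nontrivial (Fin n) := Fin.nontrivial_iff_two_le.mpr hn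
  obtain ⟨j, hji⟩ := exists_ne i
  letI := h.toAlgebra
  have : Algebra.Etale F A := hE
  have : Algebra.HasGoingDown F A := Algebra.HasGoingDown.of_flat
  have hopen : IsOpen (Set.range (PrimeSpectrum.comap h)) :=
    (PrimeSpectrum.isOpenMap_comap_of_hasGoingDown_of_finitePresentation
      (R := F) (S := A)).isOpen_range
  obtain ⟨_, ⟨s, rfl⟩, hs, hsub⟩ := PrimeSpectrum.isTopologicalBasis_basic_opens.exists_subset_of_mem_open
    (⟨⟨P, hP⟩, rfl⟩ : PrimeSpectrum.comap h ⟨P, hP⟩ ∈ Set.range (PrimeSpectrum.comap h)) hopen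
  have hsP : h s ∉ P := hs
  obtain ⟨s, rfl⟩ := Ideal.Quotient.mk_surjective s
  let X' : Fin n → MvPolynomial (Fin n) k := Function.update MvPolynomial.X i 0
  let sk : MvPolynomial (Fin n) k :=
    MvPolynomial.eval₂Hom (MvPolynomial.C.comp (residue R)) X' s
  -- The reduction of s to the affine space x_i = 0 over k is not zero, because s does not lie in
  -- the contraction of `P`, whereas `ϖ` and x_i do.
  have hsk : sk ≠ 0 := by
    intro h0
    let κ : k →+* A ⧸ P := Ideal.Quotient.lift (maximalIdeal R)
      ((Ideal.Quotient.mk P).comp (h.comp (algebraMap R F))) fun a ha ↦ by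
        rw [hϖ, Ideal.mem_span_singleton] at ha
        obtain ⟨a, rfl⟩ := ha
        rw [RingHom.comp_apply, Ideal.Quotient.eq_zero_iff_mem, RingHom.comp_apply, map_mul,
          map_mul]
        exact P.mul_mem_right _ hϖP
    let θ : MvPolynomial (Fin n) k →+* A ⧸ P :=
      MvPolynomial.eval₂Hom κ fun l ↦ Ideal.Quotient.mk P (h (StdPoly.x ϖ n t l))
    have hθ : θ.comp (MvPolynomial.eval₂Hom (MvPolynomial.C.comp (residue R)) X') =
        (Ideal.Quotient.mk P).comp (h.comp (Ideal.Quotient.mk _)) := by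
      refine MvPolynomial.ringHom_ext (fun a ↦ ?_) fun l ↦ ?_
      · simp only [RingHom.comp_apply, MvPolynomial.coe_eval₂Hom, MvPolynomial.eval₂_C, θ]
        rfl
      · have h1 : θ.comp (MvPolynomial.eval₂Hom (MvPolynomial.C.comp (residue R)) X')
            (MvPolynomial.X l) = θ (X' l) := congr_arg θ (MvPolynomial.eval₂_X _ _ _)
        refine h1.trans ?_
        by_cases hl : l = i
        · subst hl
          simp only [X', Function.update_self, map_zero]
          exact (Ideal.Quotient.eq_zero_iff_mem.mpr hi).symm
        · simp only [X', Function.update_of_ne hl, θ, MvPolynomial.coe_eval₂Hom,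
            MvPolynomial.eval₂_X]
          rfl
    refine hsP (Ideal.Quotient.eq_zero_iff_mem.mp ?_)
    have := congr_arg (fun ψ : MvPolynomial (Fin n) R →+* A ⧸ P ↦ ψ s) hθ
    refine this.symm.trans ?_
    change θ sk = 0
    rw [h0, map_zero]
  obtain ⟨α, hα⟩ := IsAlgClosed.exists_pow_nat_eq (χ r) hp
  -- A non-zero polynomial does not vanish on a product of infinite sets, here α + k in the
  -- direction j and k in the others.
  obtain ⟨a, haS, ha⟩ : ∃ a : Fin n → L, (∃ e : R, a j = α + χ e) ∧
      (∀ l, l ≠ j → ∃ e : R, a l = χ e) ∧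
      MvPolynomial.eval a (MvPolynomial.map (algebraMap k L) sk) ≠ 0 := by
    by_contra! hcon
    refine hsk (MvPolynomial.map_injective _ (algebraMap k L).injective ?_)
    rw [map_zero]
    have hinf : (Set.range (algebraMap k L)).Infinite :=
      Set.infinite_range_of_injective (algebraMap k L).injective
    refine MvPolynomial.funext_set (fun l ↦ if l = j then (fun y ↦ α + y) '' Set.range (algebraMap k L)
      else Set.range (algebraMap k L)) (fun l ↦ ?_) fun a ha ↦ ?_
    · split_ifs
      · exact hinf.image (add_right_injective α).injOn
      · exact hinf
    · rw [map_zero]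
      refine hcon a ?_ fun l hl ↦ ?_
      · have := ha j trivial
        simp only [if_true] at this
        obtain ⟨_, ⟨e, rfl⟩, he⟩ := this
        obtain ⟨e, rfl⟩ := residue_surjective e
        exact ⟨e, he.symm⟩
      · have := ha l trivial
        simp only [if_neg hl] at this
        obtain ⟨e, he⟩ := this
        obtain ⟨e, rfl⟩ := residue_surjective e
        exact ⟨e, he.symm⟩
  obtain ⟨e, he⟩ := haS
  let a' : Fin n → L := Function.update a i 0
  letI := χ.toAlgebra
  have hprod : ∏ i ∈ Finset.univ.filter (fun i : Fin n ↦ (i : ℕ) < t), a' i =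
      algebraMap R L ϖ := by
    rw [Finset.prod_eq_zero (i := i) (by simpa using hit) (by simp [a'])]
    exact (hχ ϖ hϖm).symm
  let ev : F →ₐ[R] L := StdPoly.lift a' hprod
  have hevs : ev (Ideal.Quotient.mk _ s) ≠ 0 := by
    have h1 : (ev.toRingHom.comp (Ideal.Quotient.mk _)) =
        ((MvPolynomial.eval a).comp (MvPolynomial.map (algebraMap k L))).comp
          (MvPolynomial.eval₂Hom (MvPolynomial.C.comp (residue R)) X') := by
      refine MvPolynomial.ringHom_ext (fun b ↦ ?_) fun l ↦ ?_
      · simp only [RingHom.comp_apply, MvPolynomial.coe_eval₂Hom, MvPolynomial.eval₂_C,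
          MvPolynomial.map_C, MvPolynomial.eval_C]
        exact ev.commutes b
      · simp only [RingHom.comp_apply, MvPolynomial.coe_eval₂Hom, MvPolynomial.eval₂_X]
        refine (StdPoly.lift_x a' hprod l).trans ?_
        by_cases hl : l = i
        · subst hl
          simp [a', X']
        · simp [a', X', Function.update_of_ne hl]
    have h2 := congr_arg (fun ψ : MvPolynomial (Fin n) R →+* L ↦ ψ s) h1
    exact fun h3 ↦ ha.2 (h2.symm.trans h3)
  have hχint : (ev.toRingHom.comp (algebraMap R F)).IsIntegral := by
    have h1 : ev.toRingHom.comp (algebraMap R F) = χ := RingHom.ext ev.commutes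
    rw [h1]
    exact (RingHom.isIntegral_of_surjective _ residue_surjective).trans _ _
      (algebraMap_isIntegral_iff.mpr inferInstance)
  obtain ⟨hmax, hint⟩ := isMaximal_ker_of_isIntegral_comp (algebraMap R F) ev.toRingHom
    (fun b hb ↦ (ev.commutes b).trans (hχ b hb)) hχint
  obtain ⟨Q₀, hQ₀⟩ := hsub
    (a := (⟨RingHom.ker ev.toRingHom, hmax.isPrime⟩ : PrimeSpectrum F)) hevs
  obtain ⟨Q, hQ, hQQ⟩ := Q₀.asIdeal.exists_le_maximal Q₀.2.ne_top
  have hker : RingHom.ker ev.toRingHom ≤ Q.comap h := fun b hb ↦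
    hQQ ((congr_arg PrimeSpectrum.asIdeal hQ₀).ge hb)
  -- At this point x_j equals α + e, so x_j - e is a p-th root of r.
  refine ⟨Q, hQ, hker ((ev.commutes ϖ).trans (hχ ϖ hϖm)), ?_,
    h (StdPoly.x ϖ n t j - algebraMap R F e), ?_⟩
  · letI := hmax.isPrime
    letI : Field (F ⧸ RingHom.ker ev.toRingHom) := Ideal.Quotient.field _
    letI : Field (A ⧸ Q) := Ideal.Quotient.field _
    let ψ : F ⧸ RingHom.ker ev.toRingHom →+* A ⧸ Q := Ideal.quotientMap Q h hker
    have hψ : (Ideal.Quotient.mk Q).comp (h.comp (algebraMap R F)) =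
        ψ.comp ((Ideal.Quotient.mk _).comp (algebraMap R F)) := rfl
    have hft : ψ.FiniteType := by
      refine RingHom.FiniteType.of_comp_finiteType (f := Ideal.Quotient.mk _) ?_
      have h2 : ψ.comp (Ideal.Quotient.mk _) = (Ideal.Quotient.mk Q).comp h := rfl
      rw [h2]
      exact (RingHom.FiniteType.of_surjective _ Ideal.Quotient.mk_surjective).comp
        (RingHom.finiteType_algebraMap.mpr (inferInstanceAs (Algebra.FiniteType F A)))
    have hfin : ψ.Finite := by
      letI := ψ.toAlgebra
      have : Algebra.FiniteType (F ⧸ RingHom.ker ev.toRingHom) (A ⧸ Q) := hft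
      exact finite_of_finite_type_of_isJacobsonRing (F ⧸ RingHom.ker ev.toRingHom) (A ⧸ Q)
    rw [hψ]
    exact hint.trans _ _ hfin.to_isIntegral
  · have h1 : (StdPoly.x ϖ n t j - algebraMap R F e) ^ p - algebraMap R F r ∈
        RingHom.ker ev.toRingHom := by
      change ev ((StdPoly.x ϖ n t j - algebraMap R F e) ^ p - algebraMap R F r) = 0
      have h2 : ev (StdPoly.x ϖ n t j) = α + χ e := by
        rw [← he]
        refine (StdPoly.lift_x a' hprod j).trans ?_
        simp [a', Function.update_of_ne hji]
      rw [map_sub, map_pow, map_sub, h2, AlgHom.commutes, AlgHom.commutes]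
      change (α + χ e - χ e) ^ p - χ r = 0
      rw [add_sub_cancel_right, hα, sub_self]
    have := hker h1
    rwa [Ideal.mem_comap, map_sub, map_pow] at this

theorem exists_pow_eq_of_isSeparable {k K : Type*} [Field k] [Field K] [Algebra k K]
    [Algebra.IsSeparable k K] (p : ℕ) [ExpChar k p] (c : k) (β : K)
    (h : β ^ p = algebraMap k K c) : ∃ b, b ^ p = c := by
  have h1 : β ∈ perfectClosure k K := (mem_perfectClosure_iff_pow_mem p).mpr
    ⟨1, by rw [pow_one, h]; exact ⟨c, rfl⟩⟩
  rw [perfectClosure.eq_bot_of_isSeparable] at h1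
  obtain ⟨b, rfl⟩ := IntermediateField.mem_bot.mp h1
  exact ⟨b, (algebraMap k K).injective (by rw [map_pow, h])⟩

theorem perfectField_of_forall_exists_pow_eq {k : Type*} [Field k]
    (H : Infinite k → ∀ (p : ℕ) [ExpChar k p] (c : k), ∃ b, b ^ p = c) : PerfectField k := by
  cases finite_or_infinite k with
  | inl h => exact PerfectField.ofFinite
  | inr h =>
    obtain ⟨p, hp⟩ := ExpChar.exists k
    have : PerfectRing k p := PerfectRing.ofSurjective k p (H h p)
    exact PerfectRing.toPerfectField k p

end Perfect

end SemistableProduct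

namespace SemistableProduct

open IsLocalRing

/-! ### Closed points and the perfectness of the residue field. -/

section ClosedPoints

variable {R : Type u} [CommRing R] [IsLocalRing R] {ϖ : R} {X : Scheme.{u}} {f : X ⟶ Spec (.of R)}

/-- The closure of y contains a closed point by quasi-compactness, and a proper map sends it to the
closed point of the base. -/
theorem exists_isClosed_specializes [IsProper f] (y : X) :
    ∃ x, y ⤳ x ∧ IsClosed {x} ∧ x ∈ specialFiber f := by
  have : CompactSpace X := QuasiCompact.compactSpace_of_compactSpace f
  obtain ⟨x, hx, hxc⟩ := IsClosed.exists_closed_singleton (S := closure {y}) isClosed_closure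
    ⟨y, subset_closure rfl⟩
  refine ⟨x, specializes_iff_mem_closure.mpr hx, hxc, ?_⟩
  have h1 : IsClosed ({f x} : Set (Spec (.of R))) := by
    rw [← Set.image_singleton]
    exact f.isClosedMap _ hxc
  have h2 := (PrimeSpectrum.isClosed_singleton_iff_isMaximal _).mp h1
  exact PrimeSpectrum.ext (eq_maximalIdeal h2)

theorem residue_germ_eq_zero_iff {U : X.Opens} (hU : IsAffineOpen U) (y : U) (a : Γ(X, U)) :
    residue _ (X.presheaf.germ U y.1 y.2 a) = 0 ↔ a ∈ (hU.primeIdealOf y).asIdeal := by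
  rw [residue_eq_zero_iff, mem_maximalIdeal, mem_nonunits_iff, mem_primeIdealOf_iff hU,
    X.mem_basicOpen a y.1 y.2]

theorem toStalk_mem_maximalIdeal (hϖ : maximalIdeal R = Ideal.span {ϖ}) {x : X}
    (hx : x ∈ specialFiber f) {r : R} (hr : r ∈ maximalIdeal R) :
    toStalk f x r ∈ maximalIdeal (X.presheaf.stalk x) := by
  have h0 := (mem_specialFiber_iff hϖ f (U := ⊤) (x := x) trivial).mp hx
  rw [X.mem_basicOpen (U := ⊤) _ x trivial] at h0
  have h1 : toStalk f x ϖ ∈ maximalIdeal (X.presheaf.stalk x) := by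
    rw [toStalk_eq_germ f (U := ⊤) x trivial]
    exact h0
  rw [hϖ, Ideal.mem_span_singleton] at hr
  obtain ⟨r, rfl⟩ := hr
  rw [map_mul]
  exact Ideal.mul_mem_right _ _ h1

theorem isClosed_singleton_of_isIntegral (hϖ : maximalIdeal R = Ideal.span {ϖ}) {y : X}
    (hy : y ∈ specialFiber f)
    (hint : ((residue (X.presheaf.stalk y)).comp (toStalk f y)).IsIntegral) : IsClosed {y} := by
  refine isClosed_of_closure_subset fun z hz ↦ ?_
  obtain ⟨U, hU, hzU, -⟩ := exists_isAffineOpen_mem_and_subset (U := ⊤) (x := z) trivial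
  have hyz : y ⤳ z := specializes_iff_mem_closure.mpr hz
  have hyU : y ∈ U := hyz.mem_open U.2 hzU
  let φ : Γ(X, U) →+* ResidueField (X.presheaf.stalk y) :=
    (residue _).comp (X.presheaf.germ U y hyU).hom
  have hφ : RingHom.ker φ = (hU.primeIdealOf ⟨y, hyU⟩).asIdeal :=
    Ideal.ext fun a ↦ residue_germ_eq_zero_iff hU ⟨y, hyU⟩ a
  have hcomp : φ.comp (sectionMap f U) = (residue _).comp (toStalk f y) := by
    ext r
    exact congr_arg (residue _) (toStalk_eq_germ f y hyU r).symm
  have hmax := (isMaximal_ker_of_isIntegral_comp (sectionMap f U) φ (fun r hr ↦ by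
    rw [← RingHom.comp_apply, hcomp]
    exact (residue_eq_zero_iff _).mpr (toStalk_mem_maximalIdeal hϖ hy hr)) (hcomp ▸ hint)).1
  rw [hφ] at hmax
  have hle := (specializes_iff_primeIdealOf_le hU ⟨y, hyU⟩ ⟨z, hzU⟩).mp hyz
  have heq := hmax.eq_of_le Ideal.IsPrime.ne_top' hle
  have h3 : z ⤳ y := (specializes_iff_primeIdealOf_le hU ⟨z, hzU⟩ ⟨y, hyU⟩).mpr heq.ge
  exact (h3.antisymm hyz).eq

/-- Closed points of the special fibre have residue fields separable over k by semistability. The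
closed point constructed above contains a p-th root of a given element of k, which by separability
already lies in k. -/
theorem perfectField_of_etale_chart [IsNoetherianRing R] (hϖ : maximalIdeal R = Ideal.span {ϖ})
    [LocallyOfFiniteType f]
    (H : ∀ x : X, IsClosed {x} → x ∈ specialFiber f → IsSemistableAt ϖ f x) {n t : ℕ}
    (hn : 2 ≤ n) {V : X.Opens} (hV : IsAffineOpen V) {x : X} (hxV : x ∈ V)
    (hx : x ∈ specialFiber f) (h : StdPoly ϖ n t →+* Γ(X, V)) (hE : h.Etale)
    (hR : h.comp (algebraMap R _) = sectionMap f V) : PerfectField (ResidueField R) := by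
  have hϖm : ϖ ∈ maximalIdeal R := hϖ ▸ Ideal.mem_span_singleton_self ϖ
  have hR' : ∀ r, h (algebraMap R _ r) = sectionMap f V r := fun r ↦ RingHom.congr_fun hR r
  refine perfectField_of_forall_exists_pow_eq fun _ p _ c ↦ ?_
  obtain ⟨r, rfl⟩ := residue_surjective c
  obtain ⟨Q, hQ, hϖQ, hint, β, hβ⟩ := exists_isMaximal_pow_sub_mem_of_etale hϖ hn h hE
    (hV.primeIdealOf ⟨x, hxV⟩).asIdeal (by
      rw [hR', mem_primeIdealOf_iff]
      exact (mem_specialFiber_iff hϖ f hxV).mp hx) p (expChar_pos (ResidueField R) p) r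
  obtain ⟨y, hyV, rfl⟩ : ∃ (y : X) (hyV : y ∈ V), (hV.primeIdealOf ⟨y, hyV⟩).asIdeal = Q :=
    ⟨hV.fromSpec ⟨Q, hQ.isPrime⟩, hV.range_fromSpec.le ⟨_, rfl⟩,
      congr_arg PrimeSpectrum.asIdeal (primeIdealOf_fromSpec hV ⟨Q, hQ.isPrime⟩ _)⟩
  let Q := (hV.primeIdealOf ⟨y, hyV⟩).asIdeal
  have hy : y ∈ specialFiber f := by
    rwa [mem_specialFiber_iff hϖ f hyV, ← mem_primeIdealOf_iff hV ⟨y, hyV⟩, ← hR']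
  letI : Algebra Γ(X, V) (X.presheaf.stalk y) := X.presheaf.algebra_section_stalk ⟨y, hyV⟩
  have : IsLocalization.AtPrime (X.presheaf.stalk y) Q := hV.isLocalization_stalk ⟨y, hyV⟩
  obtain ⟨b, hb, hb'⟩ := residueField_quotient_bijective (B := X.presheaf.stalk y) Q
  have hbR : b.comp ((Ideal.Quotient.mk Q).comp (h.comp (algebraMap R _))) =
      (residue _).comp (toStalk f y) := by
    ext r
    refine (hb' _).trans ?_
    rw [RingHom.comp_apply, RingHom.comp_apply, hR', toStalk_eq_germ f y hyV]
    rfl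
  have hclosed : IsClosed {y} := isClosed_singleton_of_isIntegral hϖ hy
    (hbR ▸ hint.trans _ _ (RingHom.isIntegral_of_surjective _ hb.2))
  letI := (toStalk f y).toAlgebra
  have hsep := ((H y hclosed hy).residueField hϖ rfl).1
  let κ : ResidueField R →+* ResidueField (X.presheaf.stalk y) :=
    Ideal.Quotient.lift (maximalIdeal R) ((residue _).comp (toStalk f y)) fun r hr ↦
      (residue_eq_zero_iff _).mpr (toStalk_mem_maximalIdeal hϖ hy hr)
  letI := κ.toAlgebra
  have hsep' : HasSimpleRoots (ResidueField R) (ResidueField (X.presheaf.stalk y)) :=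
    hsep.of_ringHom (residue R) (RingHom.id _) Function.bijective_id fun r ↦ rfl
  have := hsep'.isSeparable
  refine exists_pow_eq_of_isSeparable p (residue R r) (b (Ideal.Quotient.mk Q β)) ?_
  rw [← map_pow, ← map_pow, ← sub_eq_zero]
  have h1 : algebraMap (ResidueField R) (ResidueField (X.presheaf.stalk y)) (residue R r) =
      b (Ideal.Quotient.mk Q (h (algebraMap R _ r))) :=
    (RingHom.congr_fun hbR r).symm
  rw [h1, ← map_sub, ← map_sub, Ideal.Quotient.eq_zero_iff_mem.mpr hβ, map_zero]

/-- Every point specializes to a closed point of the special fibre, and a neighbourhood of the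
latter contains it. -/
theorem IsStrictlySemistable.exists_isStdChart [IsNoetherianRing R]
    (hϖ : maximalIdeal R = Ideal.span {ϖ}) [IsProper f] (H : IsStrictlySemistable ϖ f) (y : X) :
    ∃ (U : X.Opens) (γ : Type) (_ : Fintype γ) (_ : Nonempty γ) (w : γ → Γ(X, U)),
      IsAffineOpen U ∧ y ∈ U ∧ IsStdChart ϖ (sectionMap f U) w := by
  obtain ⟨x, hyx, hx, hxs⟩ := exists_isClosed_specializes (f := f) y
  obtain ⟨n, t, V, h, ht, htn, hV, hxV, hE, hR⟩ :=
    (H.isSemistableAt x hx hxs).exists_etale_chart hϖ hx H.isSmooth_component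
  have : Nonempty (Fin t) := ⟨⟨0, ht⟩⟩
  have h1 := IsStdChart.of_etale htn h hE
  rw [hR] at h1
  exact ⟨V, Fin t, inferInstance, this, _, hV, hyx.mem_open V.2 hxV, h1⟩

end ClosedPoints

end SemistableProduct

namespace SemistableProduct

open IsLocalRing

/-! ### A chart of a curve has at least two coordinates. -/

section Dimension

theorem subsingleton_of_etale_of_isStandardSmooth {A B : Type u} [CommRing A] [CommRing B]
    {φ : A →+* B} (hE : φ.Etale) (hφ : φ.IsStandardSmoothOfRelativeDimension 1) :
    Subsingleton B := by
  letI := φ.toAlgebra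
  have : Algebra.Etale A B := hE
  have : Algebra.IsStandardSmoothOfRelativeDimension 1 A B := hφ
  by_contra hB
  have : Nontrivial B := not_subsingleton_iff_nontrivial.mp hB
  have h1 := Algebra.IsStandardSmoothOfRelativeDimension.rank_kaehlerDifferential (R := A) (S := B) 1
  rw [rank_subsingleton' ] at h1
  simp at h1

theorem isEmpty_of_etale {X Y : Scheme.{u}} (f : X ⟶ Y) [Etale f] [SmoothOfRelativeDimension 1 f] :
    IsEmpty X := by
  refine ⟨fun x ↦ ?_⟩
  obtain ⟨U, hU, V, hV, hx, e, h⟩ :=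
    SmoothOfRelativeDimension.exists_isStandardSmoothOfRelativeDimension (n := 1) (f := f) x
  have h1 : (f.appLE U V e).hom.Etale :=
    HasRingHomProperty.appLE @Etale f inferInstance ⟨U, hU⟩ ⟨V, hV⟩ e
  have := nontrivial_of_mem hx
  exact not_subsingleton _ (subsingleton_of_etale_of_isStandardSmooth h1 h)

theorem StdPoly.etale_algebraMap_one {R : Type u} [CommRing R] (ϖ : R) :
    (algebraMap R (StdPoly ϖ 1 1)).Etale := by
  refine RingHom.Etale.of_bijective ⟨?_, ?_⟩
  · let e : StdPoly ϖ 1 1 →ₐ[R] R := StdPoly.lift (fun _ ↦ ϖ) (by simp)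
    exact Function.LeftInverse.injective (g := e) e.commutes
  · have h0 : StdPoly.x ϖ 1 1 0 = algebraMap R _ ϖ := by
      rw [← StdPoly.prod_x]
      simp
    have h1 : (algebraMap R (StdPoly ϖ 1 1)).range = ⊤ := by
      rw [eq_top_iff]
      rintro y -
      obtain ⟨y, rfl⟩ := Ideal.Quotient.mk_surjective y
      induction y using MvPolynomial.induction_on with
      | C a => exact ⟨a, rfl⟩
      | add p q hp hq => rw [map_add]; exact add_mem hp hq
      | mul_X p i hp =>
        rw [map_mul]
        refine mul_mem hp ⟨ϖ, ?_⟩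
        rw [← h0, Subsingleton.elim i 0]
        rfl
    exact RingHom.range_eq_top.mp h1

/-- With n = 1 the model is `R` itself, so `V` is étale over `R`. Its generic fibre is then étale
and smooth of relative dimension 1, hence empty; but `V` is not empty and its open image in Spec R
contains the generic point. -/
theorem two_le_of_etale_chart {R K : Type u} [CommRing R] [IsDomain R] [IsLocalRing R]
    [Field K] [Algebra R K] [IsFractionRing R K] {ϖ : R} {X C : Scheme.{u}} {f : X ⟶ Spec (.of R)}
    {c : C ⟶ Spec (.of K)} [SmoothOfRelativeDimension 1 c] {j : C ⟶ X}
    (hj : IsPullback j c f (Spec.map (CommRingCat.ofHom (algebraMap R K)))) {n t : ℕ}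
    (ht : 1 ≤ t) (htn : t ≤ n) {V : X.Opens} (hV : IsAffineOpen V) {x : X} (hxV : x ∈ V)
    (h : StdPoly ϖ n t →+* Γ(X, V)) (hE : h.Etale)
    (hR : h.comp (algebraMap R _) = sectionMap f V) : 2 ≤ n := by
  by_contra hn
  obtain rfl : n = 1 := by omega
  obtain rfl : t = 1 := by omega
  have h1 : (sectionMap f V).Etale := by
    rw [← hR]
    exact RingHom.Etale.stableUnderComposition _ _ (StdPoly.etale_algebraMap_one ϖ) hE
  have h2 : Etale (V.ι ≫ f) := by
    rw [← hV.isoSpec_hom_fromSpec, Category.assoc, ← SpecMap_sectionMap f hV]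
    have : Etale (Spec.map (CommRingCat.ofHom (sectionMap f V))) :=
      HasRingHomProperty.Spec_iff.mpr h1
    infer_instance
  have hpb := (isPullback_morphismRestrict j V).paste_vert hj
  have h3 : Etale ((j ⁻¹ᵁ V).ι ≫ c) := MorphismProperty.of_isPullback hpb h2
  -- Relative dimensions add: 0 for the open immersion and 1 for the curve.
  have h4 : SmoothOfRelativeDimension 1 ((j ⁻¹ᵁ V).ι ≫ c) :=
    inferInstanceAs (SmoothOfRelativeDimension (0 + 1) _)
  have h5 := isEmpty_of_etale ((j ⁻¹ᵁ V).ι ≫ c)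
  let η : Spec (.of R) := ⟨⊥, Ideal.isPrime_bot⟩
  have hη : η ∈ Set.range (V.ι ≫ f) := by
    have h6 : IsOpen (Set.range (V.ι ≫ f)) := (V.ι ≫ f).isOpenMap.isOpen_range
    have h7 : η ⤳ (V.ι ≫ f) ⟨x, hxV⟩ := (PrimeSpectrum.le_iff_specializes _ _).mp bot_le
    exact h7.mem_open h6 ⟨_, rfl⟩
  obtain ⟨v, hv⟩ := hη
  let ζ : Spec (.of K) := ⟨⊥, Ideal.isPrime_bot⟩
  have hζ : Spec.map (CommRingCat.ofHom (algebraMap R K)) ζ = η := by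
    refine PrimeSpectrum.ext ?_
    change (⊥ : Ideal K).comap (algebraMap R K) = ⊥
    exact (RingHom.injective_iff_ker_eq_bot _).mp (IsFractionRing.injective R K)
  obtain ⟨z, hz, -⟩ := Scheme.Pullback.exists_preimage_pullback v ζ (hv.trans hζ.symm)
  exact h5.false (hpb.isoPullback.inv z)

end Dimension

end SemistableProduct

namespace SemistableProduct

open IsLocalRing

/-! ### The product of the two models. -/

section Product

theorem exists_isPullback_product {𝒞 𝒮 X C S Y Z : Scheme.{u}} {f : 𝒞 ⟶ Y} {g : 𝒮 ⟶ Y}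
    {p : X ⟶ 𝒞} {q : X ⟶ 𝒮} (hpq : IsPullback p q f g) {c : C ⟶ Z} {s : S ⟶ Z} {a : Z ⟶ Y}
    {j : C ⟶ 𝒞} (hj : IsPullback j c f a) {j' : S ⟶ 𝒮} (hj' : IsPullback j' s g a) :
    ∃ i, IsPullback i (pullback.fst c s ≫ c) (p ≫ f) a := by
  have hw : (pullback.fst c s ≫ j) ≫ f = (pullback.snd c s ≫ j') ≫ g := by
    rw [Category.assoc, hj.w, Category.assoc, hj'.w, pullback.condition_assoc]
  refine ⟨hpq.lift _ _ hw, ⟨⟨?_⟩, ⟨PullbackCone.IsLimit.mk _ (fun t ↦ ?_) (fun t ↦ ?_)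
    (fun t ↦ ?_) fun t m h1 h2 ↦ ?_⟩⟩⟩
  · rw [hpq.lift_fst_assoc, Category.assoc, Category.assoc, hj.w]
  · refine pullback.lift (hj.lift (t.fst ≫ p) t.snd ?_) (hj'.lift (t.fst ≫ q) t.snd ?_) ?_
    · rw [Category.assoc, t.condition]
    · rw [Category.assoc, ← hpq.w, t.condition]
    · rw [hj.lift_snd, hj'.lift_snd]
  · refine hpq.hom_ext ?_ ?_
    · rw [Category.assoc, hpq.lift_fst, pullback.lift_fst_assoc, hj.lift_fst]
    · rw [Category.assoc, hpq.lift_snd, pullback.lift_snd_assoc, hj'.lift_fst]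
  · rw [pullback.lift_fst_assoc, hj.lift_snd]
  · refine pullback.hom_ext ?_ ?_
    · rw [pullback.lift_fst]
      refine hj.hom_ext ?_ ?_
      · rw [hj.lift_fst, ← h1, Category.assoc, Category.assoc, hpq.lift_fst]
      · rw [hj.lift_snd, ← h2, Category.assoc]
    · rw [pullback.lift_snd]
      refine hj'.hom_ext ?_ ?_
      · rw [hj'.lift_fst, ← h1, Category.assoc, Category.assoc, hpq.lift_snd]
      · rw [hj'.lift_snd, ← h2, Category.assoc, pullback.condition]

variable {R : Type u} [CommRing R] {ϖ : R} {𝒞 𝒮 X : Scheme.{u}} {f : 𝒞 ⟶ Spec (.of R)}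
  {g : 𝒮 ⟶ Spec (.of R)} {p : X ⟶ 𝒞} {q : X ⟶ 𝒮}

theorem isAffineOpen_preimage_inf_preimage (hpq : IsPullback p q f g) {U : 𝒞.Opens}
    (hU : IsAffineOpen U) {V : 𝒮.Opens} (hV : IsAffineOpen V) :
    IsAffineOpen (p ⁻¹ᵁ U ⊓ q ⁻¹ᵁ V) := by
  have : IsAffine U := hU
  have h1 := (isPullback_morphismRestrict p U).paste_vert hpq
  have : IsAffineHom (U.ι ≫ f) := inferInstance
  have : IsAffineHom ((p ⁻¹ᵁ U).ι ≫ q) := MorphismProperty.of_isPullback h1 this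
  have h2 := (hV.preimage ((p ⁻¹ᵁ U).ι ≫ q)).image_of_isOpenImmersion (p ⁻¹ᵁ U).ι
  rwa [Scheme.Hom.comp_preimage, Scheme.Hom.image_preimage_eq_opensRange_inf,
    Scheme.Opens.opensRange_ι] at h2

theorem isChart_of_isPullback [IsNoetherianRing R] (hpq : IsPullback p q f g)
    [LocallyOfFiniteType (p ≫ f)] {U : 𝒞.Opens}
    (hU : IsAffineOpen U) {V : 𝒮.Opens} (hV : IsAffineOpen V) {W : X.Opens} (hW : IsAffineOpen W)
    (hWeq : W = p ⁻¹ᵁ U ⊓ q ⁻¹ᵁ V) (e₁ : W ≤ p ⁻¹ᵁ U) (e₂ : W ≤ q ⁻¹ᵁ V) {α β : Type} [Fintype α]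
    [Fintype β] {u : α → Γ(𝒞, U)} {v : β → Γ(𝒮, V)} (H₁ : IsStdChart ϖ (sectionMap f U) u)
    (H₂ : IsStdChart ϖ (sectionMap g V) v) :
    IsChart ϖ (sectionMap (p ≫ f) W) ((p.appLE U W e₁).hom ∘ u) ((q.appLE V W e₂).hom ∘ v)
      (Empty.elim : Empty → Γ(X, W)) := by
  have hft : (sectionMap (p ≫ f) W).FiniteType := sectionMap_of_hasRingHomProperty
    @LocallyOfFiniteType (fun f _ ↦ inferInstance) hW ‹_›
  have hp := appLE_comp_sectionMap f p e₁
  have hq := appLE_comp_sectionMap g q e₂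
  rw [← hpq.w] at hq
  have hfac₁ : ∀ (B : Type u) [CommRing B] (φ : Γ(X, W) →+* B),
      (Spec.map (CommRingCat.ofHom φ) ≫ hW.fromSpec) ≫ p =
        Spec.map (CommRingCat.ofHom (φ.comp (p.appLE U W e₁).hom)) ≫ hU.fromSpec := by
    intro B _ φ
    rw [Category.assoc, ← IsAffineOpen.SpecMap_appLE_fromSpec p hU hW e₁, ← Spec.map_comp_assoc]
    rfl
  have hfac₂ : ∀ (B : Type u) [CommRing B] (φ : Γ(X, W) →+* B),
      (Spec.map (CommRingCat.ofHom φ) ≫ hW.fromSpec) ≫ q =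
        Spec.map (CommRingCat.ofHom (φ.comp (q.appLE V W e₂).hom)) ≫ hV.fromSpec := by
    intro B _ φ
    rw [Category.assoc, ← IsAffineOpen.SpecMap_appLE_fromSpec q hV hW e₂, ← Spec.map_comp_assoc]
    rfl
  have hinj : ∀ {Y : Scheme.{u}} {U : Y.Opens} (hU : IsAffineOpen U) (B : Type u) [CommRing B]
      (φ ψ : Γ(Y, U) →+* B), Spec.map (CommRingCat.ofHom φ) ≫ hU.fromSpec =
        Spec.map (CommRingCat.ofHom ψ) ≫ hU.fromSpec → φ = ψ := by
    intro Y U hU B _ φ ψ h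
    rw [cancel_mono] at h
    exact congr_arg CommRingCat.Hom.hom (Spec.map_injective h)
  refine IsStdChart.prod H₁ H₂ _ _
    (RingHom.FinitePresentation.of_finiteType.mp hft) (RingHom.congr_fun hp)
    (RingHom.congr_fun hq) (fun B _ φ ψ h₁ h₂ ↦ ?_) fun B _ φ ψ h ↦ ?_
  · refine hinj hW B φ ψ (hpq.hom_ext ?_ ?_)
    · rw [hfac₁, hfac₁, h₁]
    · rw [hfac₂, hfac₂, h₂]
  · have hw : (Spec.map (CommRingCat.ofHom φ) ≫ hU.fromSpec) ≫ f =
        (Spec.map (CommRingCat.ofHom ψ) ≫ hV.fromSpec) ≫ g := by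
      rw [Category.assoc, Category.assoc, ← SpecMap_sectionMap f hU, ← SpecMap_sectionMap g hV,
        ← Spec.map_comp, ← Spec.map_comp, ← CommRingCat.ofHom_comp, h, CommRingCat.ofHom_comp]
    obtain ⟨θ, hθ⟩ := exists_eq_SpecMap_fromSpec hW (hpq.lift _ _ hw) (by
      rintro _ ⟨y, rfl⟩
      rw [hWeq]
      constructor
      · change p (hpq.lift _ _ hw y) ∈ U
        rw [← Scheme.Hom.comp_apply, hpq.lift_fst]
        exact hU.range_fromSpec.le ⟨_, rfl⟩
      · change q (hpq.lift _ _ hw y) ∈ V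
        rw [← Scheme.Hom.comp_apply, hpq.lift_snd]
        exact hV.range_fromSpec.le ⟨_, rfl⟩)
    refine ⟨θ, hinj hU B _ _ ?_, hinj hV B _ _ ?_⟩
    · rw [← hfac₁, ← hθ, hpq.lift_fst]
    · rw [← hfac₂, ← hθ, hpq.lift_snd]

theorem mem_of_zeroLocus_inter_subset {U : X.Opens} (hU : IsAffineOpen U) {J : Ideal Γ(X, U)}
    (hJ : J.IsPrime) {s : Set Γ(X, U)}
    (h : X.zeroLocus (U := U) (J : Set Γ(X, U)) ∩ U ⊆ X.zeroLocus s) : s ⊆ J := by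
  intro a ha
  let ξ : Spec Γ(X, U) := ⟨J, hJ⟩
  have hξU : hU.fromSpec ξ ∈ U := hU.range_fromSpec.le ⟨ξ, rfl⟩
  have hmem : ∀ b, hU.fromSpec ξ ∉ X.basicOpen b ↔ b ∈ J := by
    intro b
    rw [← mem_primeIdealOf_iff hU ⟨_, hξU⟩, primeIdealOf_fromSpec]
  have h1 : hU.fromSpec ξ ∈ X.zeroLocus s :=
    h ⟨(X.mem_zeroLocus_iff _ _).mpr fun b hb ↦ (hmem b).mpr hb, hξU⟩
  exact (hmem a).mp ((X.mem_zeroLocus_iff _ _).mp h1 a ha)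

variable [IsLocalRing R] {f : X ⟶ Spec (.of R)}

theorem specialFiber_inter_eq {γ : Type} [Fintype γ] [IsEmpty γ] (hϖ : maximalIdeal R = Ideal.span {ϖ})
    {U : X.Opens} {α β : Type} [Fintype α] [Fintype β] {u : α → Γ(X, U)} {v : β → Γ(X, U)}
    {w : γ → Γ(X, U)} (H : IsChart ϖ (sectionMap f U) u v w) :
    specialFiber f ∩ U =
      ⋃ i : α × β, X.zeroLocus (U := U) (Ideal.span {u i.1, v i.2} : Set Γ(X, U)) ∩ U := by
  have h1 : ∏ a, u a = sectionMap f U ϖ := by simpa using H.prod_mul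
  have h2 : ∏ b, v b = sectionMap f U ϖ := by rw [← H.prod_eq, h1]
  ext y
  simp only [Set.mem_iUnion, Set.mem_inter_iff, Scheme.zeroLocus_span, exists_and_right,
    mem_zeroLocus_pair, Prod.exists]
  refine and_congr_left fun hy ↦ ?_
  have h3 := mem_specialFiber_iff hϖ f hy
  have h4 : y ∈ specialFiber f ↔ ∃ a, y ∉ X.basicOpen (u a) := by
    rw [h3, ← h1, mem_basicOpen_prod _ _ hy]
    simp
  have h5 : y ∈ specialFiber f ↔ ∃ b, y ∉ X.basicOpen (v b) := by
    rw [h3, ← h2, mem_basicOpen_prod _ _ hy]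
    simp
  constructor
  · intro h
    obtain ⟨⟨a, ha⟩, b, hb⟩ := And.intro (h4.mp h) (h5.mp h)
    exact ⟨a, b, ha, hb⟩
  · rintro ⟨a, -, ha, -⟩
    exact h4.mpr ⟨a, ha⟩

/-- Modulo (u_a, v_b) every other coordinate is a non-zero-divisor, so a non-empty locus is
contained in no other one and is the trace of a whole component. -/
theorem isAdaptedChart_of_isPrime {γ : Type} [Fintype γ] [IsEmpty γ]
    (hϖ : maximalIdeal R = Ideal.span {ϖ})
    {U : X.Opens} (hU : IsAffineOpen U) {α β : Type} [Fintype α] [Fintype β] [Nonempty α]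
    {u : α → Γ(X, U)} {v : β → Γ(X, U)} {w : γ → Γ(X, U)} (H : IsChart ϖ (sectionMap f U) u v w)
    (hJ : ∀ i : α × β, (Ideal.span {u i.1, v i.2}).IsPrime ∨ Ideal.span {u i.1, v i.2} = ⊤) :
    IsAdaptedChart ϖ f (specialComponents f) U u v w := by
  have hs := specialFiber_inter_eq hϖ H
  refine ⟨hU, Or.inl ‹_›, H, fun Z hZ ↦ ?_, fun a b ↦ ?_⟩
  · rcases Set.eq_empty_or_nonempty ((Z : Set X) ∩ U) with h | h
    · exact Or.inl h
    · obtain ⟨i, hi⟩ := specialComponents_inter hU (fun i : α × β ↦ Ideal.span {u i.1, v i.2})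
        hJ hs hZ h
      rw [Scheme.zeroLocus_span] at hi
      exact Or.inr ⟨i.1, i.2, hi⟩
  · rw [← Scheme.zeroLocus_span]
    rcases Set.eq_empty_or_nonempty
      (X.zeroLocus (U := U) (Ideal.span {u a, v b} : Set Γ(X, U)) ∩ U) with h | h
    · exact Or.inl h
    · have hprime : (Ideal.span {u a, v b}).IsPrime := by
        rcases hJ (a, b) with h' | h'
        · exact h'
        · rw [zeroLocus_inter_eq_empty_of_eq_top h'] at h
          exact (Set.not_nonempty_empty h).elim
      obtain ⟨κ, -, -, ha, hb, -⟩ := H.exists_smooth_quotient_pair hϖ a b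
        (δ := Ideal.Quotient.mk (Ideal.span {u a, v b})) Ideal.Quotient.mk_surjective Ideal.mk_ker
      have := Ideal.Quotient.nontrivial_iff.mpr hprime.ne_top
      have hnot : ∀ z, Ideal.Quotient.mk (Ideal.span {u a, v b}) z ∈ nonZeroDivisors _ →
          z ∉ Ideal.span {u a, v b} := fun z hz hz' ↦
        nonZeroDivisors.ne_zero hz (Ideal.Quotient.eq_zero_iff_mem.mpr hz')
      refine Or.inr (exists_specialComponents_inter hU
        (fun i : α × β ↦ Ideal.span {u i.1, v i.2}) hJ hs (a, b) h fun j hj hsub ↦ ?_)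
      have hle := mem_of_zeroLocus_inter_subset hU hprime hsub
      by_cases hja : j.1 = a
      · have hjb : j.2 ≠ b := fun hjb ↦ hj (Prod.ext hja hjb)
        exact hnot _ (hb _ hjb) (hle (Ideal.subset_span (Or.inr rfl)))
      · exact hnot _ (ha _ hja) (hle (Ideal.subset_span (Or.inl rfl)))

end Product

section Product

variable {R : Type u} [CommRing R] [IsLocalRing R] [IsNoetherianRing R] {ϖ : R} {𝒞 𝒮 X : Scheme.{u}}
  {f : 𝒞 ⟶ Spec (.of R)} {g : 𝒮 ⟶ Spec (.of R)} {p : X ⟶ 𝒞} {q : X ⟶ 𝒮}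

/-- Two standard charts multiply to a chart without w. Modulo (u_a, v_b) it is smooth over a perfect
field, so after shrinking each of these ideals is prime or trivial. -/
theorem isAdapted_of_isPullback (hϖ : maximalIdeal R = Ideal.span {ϖ})
    (hk : Nonempty X → PerfectField (ResidueField R)) [IsProper f] [IsProper g]
    (hpq : IsPullback p q f g) [LocallyOfFiniteType (p ≫ f)]
    (hf : IsStrictlySemistable ϖ f) (hg : IsStrictlySemistable ϖ g) :
    IsAdapted ϖ (p ≫ f) (specialComponents (p ≫ f)) := by
  intro x
  have := hk ⟨x⟩
  obtain ⟨U, α, _, _, u, hU, hxU, Hu⟩ := hf.exists_isStdChart hϖ (p x)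
  obtain ⟨V, β, _, _, v, hV, hxV, Hv⟩ := hg.exists_isStdChart hϖ (q x)
  have hW := isAffineOpen_preimage_inf_preimage hpq hU hV
  obtain ⟨W, hWeq⟩ : ∃ W, W = p ⁻¹ᵁ U ⊓ q ⁻¹ᵁ V := ⟨_, rfl⟩
  have hxW : x ∈ W := hWeq ▸ ⟨hxU, hxV⟩
  rw [← hWeq] at hW
  have H := isChart_of_isPullback hpq hU hV hW hWeq (hWeq.trans_le inf_le_left)
    (hWeq.trans_le inf_le_right) Hu Hv
  generalize (p.appLE U W _).hom ∘ u = u' at H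
  generalize (q.appLE V W _).hom ∘ v = v' at H
  have := isNoetherianRing_of_isChart H
  obtain ⟨s, hs, hJ⟩ := exists_basicOpen_isPrime_map hW
    (fun i : α × β ↦ Ideal.span {u' i.1, v' i.2}) hxW (by
      intro i P _ hP x y hxy
      obtain ⟨κ, hκ, -⟩ := H.exists_smooth_quotient_pair hϖ i.1 i.2
        (δ := Ideal.Quotient.mk (Ideal.span {u' i.1, v' i.2})) Ideal.Quotient.mk_surjective
        Ideal.mk_ker
      exact exists_mul_mem_of_smooth_quotient hκ P hP x y hxy)
  have H' := H.map (smooth_presheaf_map hW (hW.basicOpen s) (X.basicOpen_le s))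
  rw [map_comp_sectionMap] at H'
  refine ⟨X.basicOpen s, α, β, Empty, inferInstance, inferInstance, inferInstance, _, _, _, hs,
    isAdaptedChart_of_isPrime hϖ (hW.basicOpen s) H' fun i ↦ ?_⟩
  have := hJ i
  rwa [Ideal.map_span, Set.image_pair] at this

end Product

end SemistableProduct

namespace SemistableProduct

open IsLocalRing

/-- A strictly semistable model of a smooth curve is non-empty only if the residue field is
perfect. -/
theorem IsStrictlySemistable.perfectField {R K : Type u} [CommRing R] [IsDomain R]
    [IsDiscreteValuationRing R] [Field K] [Algebra R K] [IsFractionRing R K] {ϖ : R}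
    (hϖ : Irreducible ϖ) {C 𝒞 : Scheme.{u}} {c : C ⟶ Spec (.of K)} [SmoothOfRelativeDimension 1 c]
    {f : 𝒞 ⟶ Spec (.of R)} [IsProper f] {j : C ⟶ 𝒞}
    (hj : IsPullback j c f (Spec.map (CommRingCat.ofHom (algebraMap R K))))
    (hf : IsStrictlySemistable ϖ f) (y : 𝒞) : PerfectField (ResidueField R) := by
  obtain ⟨x, -, hx, hxs⟩ := exists_isClosed_specializes (f := f) y
  obtain ⟨n, t, V, h, ht, htn, hV, hxV, hE, hR⟩ :=
    (hf.isSemistableAt x hx hxs).exists_etale_chart hϖ.maximalIdeal_eq hx hf.isSmooth_component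
  exact perfectField_of_etale_chart hϖ.maximalIdeal_eq hf.isSemistableAt
    (two_le_of_etale_chart hj ht htn hV hxV h hE hR) hV hxV hxs h hE hR

end SemistableProduct

theorem proposition4p1
    {R K : Type u} [CommRing R] [IsDomain R] [IsDiscreteValuationRing R]
    [Field K] [Algebra R K] [IsFractionRing R K]
    (ϖ : R) (hϖ : Irreducible ϖ)
    -- a smooth proper curve and a smooth proper surface over `K`
    {C S : Scheme.{u}} (c : C ⟶ Spec (.of K)) (s : S ⟶ Spec (.of K))
    [IsProper c] [SmoothOfRelativeDimension 1 c]
    [IsProper s] [SmoothOfRelativeDimension 2 s]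
    -- strictly semistable models of them over `R`
    {𝒞 𝒮 : Scheme.{u}} (f : 𝒞 ⟶ Spec (.of R)) (g : 𝒮 ⟶ Spec (.of R))
    (hf : SemistableProduct.IsModel f c) (hg : SemistableProduct.IsModel g s)
    (hf' : SemistableProduct.IsStrictlySemistable ϖ f)
    (hg' : SemistableProduct.IsStrictlySemistable ϖ g)
    -- the successive blow-up of `T.X 0 = 𝒞 ×_R 𝒮` along its special components
    {t : ℕ} (T : SemistableProduct.BlowupSequence.{u} t)
    (p : T.X 0 ⟶ 𝒞) (q : T.X 0 ⟶ 𝒮) (hpq : IsPullback p q f g)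
    (hinj : Function.Injective (T.comp 0))
    (hrange : Set.range (T.comp 0) = SemistableProduct.specialComponents (p ≫ f)) :
    SemistableProduct.IsModel (T.toBottom (t - 1) ≫ p ≫ f) (pullback.fst c s ≫ c) ∧
    SemistableProduct.IsStrictlySemistable ϖ (T.toBottom (t - 1) ≫ p ≫ f) := by
  have := hf.isProper
  have hgp := hg.isProper
  have : IsProper p := MorphismProperty.of_isPullback hpq.flip hgp
  obtain ⟨j, hj⟩ := hf.exists_isPullback
  obtain ⟨j', hj'⟩ := hg.exists_isPullback
  -- A point of the product lies over a point of the model of the curve, whose existence forces the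
  -- residue field to be perfect.
  have hk : Nonempty (T.X 0) → PerfectField (IsLocalRing.ResidueField R) :=
    fun ⟨x⟩ ↦ hf'.perfectField hϖ hj (p x)
  refine T.isModel_and_isStrictlySemistable hϖ (p ≫ f)
    (SemistableProduct.exists_isPullback_product hpq hj hj') hk ?_
  rw [hrange]
  exact SemistableProduct.isAdapted_of_isPullback hϖ.maximalIdeal_eq hk hpq hf' hg'
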